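/- **Definitions.** A *polygon* in $\mathbb{E}^3$ is either a finite $n$-gon ($n\ge 3$) with distinct vertices $v_1,\dots,v_n$ and edges the line segments $(v_i,v_{i+1})$, $(v_n,v_1)$, or an infinite polygon with distinct vertices $v_i$ and edges $(v_i,v_{i+1})$, $i\in\mathbb{Z}$, such that each compact set meets only finitely many edges. A *zigzag* is an infinite polygon with vertices $v_i=c+ia+(-1)^i b$, $i\in\mathbb Z$, where $a,b\neq 0$ are orthogonal vectors. A *polygonal complex* $\mathcal K$ in $\mathbb{E}^3$ consists of a set of points (vertices), a set of line segments between vertices (edges) and a set of polygons (faces) whose vertices and edges are vertices and edges of $\mathcal K$, such that (a) the edge graph is connected; (b) for each vertex $v$ the vertex-figure, that is, the graph on the neighbours of $v$ in which $u,w$ are joined whenever $(u,v)$ and $(v,w)$ are edges of a common face, is connected; (c) each edge lies in exactly $r$ faces, for a fixed number $r\ge 2$; (d) each compact set meets only finitely many faces. Its symmetry group $G(\mathcal K)$ consists of the isometries of the affine hull of $\mathcal K$ that map $\mathcal K$ to itself. A flag is a set of mutually incident vertex, edge and face, and $\mathcal K$ is *regular* if $G(\mathcal K)$ is transitive on the flags.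 A *regular $4$-apeirotope* in $\mathbb{E}^3$ is a discrete, faithfully realized, infinite abstract polytope of rank $4$ in $\mathbb{E}^3$ (its edges are pairs of vertices, its $2$-faces polygons, its facets sets of $2$-faces) whose flags are permuted transitively by the isometries of $\mathbb{E}^3$ that preserve it; its *$2$-skeleton* consists of its vertices, edges and $2$-faces. For a finite regular polyhedron $\mathcal Q$ in $\mathbb{E}^3$ with centroid $o$, a base flag with vertex $w$, and the distinguished generators $R_1,R_2,R_3$ of its symmetry group (mapping the base flag to the flags that differ from it precisely in the vertex, the edge and the face, respectively), let $R_0$ be the reflection in the point $\frac12(o+w)$. Then $\operatorname{apeir}\mathcal Q$ is the structure obtained by Wythoff's construction from $R_0,R_1,R_2,R_3$ with initial vertex $o$: the base edge joins $o$ and its image under $R_0$; the base $2$-face consists of the images of $o$ and of the base edge under $\langle R_0,R_1\rangle$; the base facet consists of the images of the base $2$-face under $\langle R_0,R_1,R_2\rangle$; and the faces of each rank are the images of the base face of that rank under $\langle R_0,R_1,R_2,R_3\rangle$. **Theorem.** Let $\mathcal K$ be a regular polygonal complex in $\mathbb{E}^3$ such that the stabilizer of a flag in $G(\mathcal K)$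 is non-trivial. Then $\mathcal K$ is the $2$-skeleton of a regular $4$-apeirotope $\mathcal P$ in $\mathbb{E}^3$. More precisely, either all faces of $\mathcal K$ are finite and $\mathcal P$ can be taken to be a tessellation $\{4,3,4\}$ of $\mathbb{E}^3$ by cubes, or all faces of $\mathcal K$ are zigzags and $\mathcal P$ can be taken to be $\operatorname{apeir}\mathcal Q$ with $\mathcal Q$ a regular tetrahedron $\{3,3\}$, a regular octahedron $\{3,4\}$ or a cube $\{4,3\}$. -/

import Mathlib

noncomputable section

/-- Euclidean 3-space. -/
abbrev E3 : Type := EuclideanSpace ℝ (Fin 3)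

/-- A figure made of points and line segments. A segment is recorded by the unordered pair of
its end points. -/
@[ext]
structure Figure where
  verts : Set E3
  edges : Set (Sym2 E3)

namespace Figure

/-- The figure with vertices `v i` and edges `(v i, v (i + 1))`. With `ι = ZMod n` or `Fin n` it is
closed up cyclically, with `ι = ℤ` it is a two-sided infinite path. -/
def ofSeq {ι : Type} [Add ι] [One ι] (v : ι → E3) : Figure where
  verts := Set.range v
  edges := Set.range fun i => s(v i, v (i + 1))

/-- The image of a figure under a map (used for isometries and similarities only). -/
def map (f : E3 → E3) (F : Figure) : Figure where
  verts := f '' F.verts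
  edges := Sym2.map f '' F.edges

/-- The points of `E3` that lie on some edge of the figure. -/
def carrier (F : Figure) : Set E3 :=
  {x | ∃ a b : E3, s(a, b) ∈ F.edges ∧ x ∈ segment ℝ a b}

/-- A finite polygon: an `n`-gon with distinct vertices, `n ≥ 3`. -/
def IsFinitePolygon (F : Figure) : Prop :=
  ∃ n : ℕ, 3 ≤ n ∧ ∃ v : ZMod n → E3, Function.Injective v ∧ F = ofSeq v

/-- An infinite polygon: distinct vertices `v i`, `i ∈ ℤ`, such that each compact set meets only
finitely many edges. -/
def IsInfinitePolygon (F : Figure) : Prop :=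
  ∃ v : ℤ → E3, Function.Injective v ∧ F = ofSeq v ∧
    ∀ C : Set E3, IsCompact C → {i : ℤ | (segment ℝ (v i) (v (i + 1)) ∩ C).Nonempty}.Finite

def IsPolygon (F : Figure) : Prop :=
  F.IsFinitePolygon ∨ F.IsInfinitePolygon

/-- A (regular, planar, non-linear) zigzag: the vertices advance by equal steps `a` along an axis
and lie alternately on its two sides, displaced by `± b` with `b` orthogonal to `a`. -/
def IsZigzag (F : Figure) : Prop :=
  ∃ c a b : E3, a ≠ 0 ∧ b ≠ 0 ∧ inner ℝ a b = 0 ∧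
    F = ofSeq fun i : ℤ => c + (i : ℝ) • a + ((-1 : ℝ) ^ i) • b

theorem map_id (F : Figure) : F.map id = F := by
  ext <;> simp [map]

theorem map_map (f g : E3 → E3) (F : Figure) : (F.map g).map f = F.map (f ∘ g) := by
  ext x
  · simp [map]
  · simp [map, Sym2.map_map]

end Figure

/-- The data of vertices, edges and polygonal faces. -/
@[ext]
structure Complex2 where
  verts : Set E3
  edges : Set (Sym2 E3)
  faces : Set Figure

namespace Complex2

def map (f : E3 → E3) (K : Complex2) : Complex2 where
  verts := f '' K.verts
  edges := Sym2.map f '' K.edges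
  faces := Figure.map f '' K.faces

theorem map_id (K : Complex2) : K.map id = K := by
  have h : Figure.map id = id := funext Figure.map_id
  ext <;> simp [map, h]

theorem map_map (f g : E3 → E3) (K : Complex2) : (K.map g).map f = K.map (f ∘ g) := by
  ext x
  · simp [map]
  · simp [map, Sym2.map_map]
  · simp [map, Figure.map_map]

def edgeGraph (K : Complex2) : SimpleGraph K.verts where
  Adj u w := u ≠ w ∧ s((u : E3), (w : E3)) ∈ K.edges
  symm := ⟨fun u w h => ⟨h.1.symm, by rw [Sym2.eq_swap]; exact h.2⟩⟩
  loopless := ⟨fun _ h => h.1 rfl⟩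

/-- The vertex-figure at `v`: its vertices are the neighbours of `v`, and `u`, `w` are joined if
`(u, v)` and `(v, w)` are edges of a common face. Multiplicities of edges are not recorded; they
do not affect connectedness. -/
def vertexFigure (K : Complex2) (v : E3) : SimpleGraph {u : E3 | s(v, u) ∈ K.edges} where
  Adj u w := u ≠ w ∧ ∃ F ∈ K.faces, s(v, (u : E3)) ∈ F.edges ∧ s(v, (w : E3)) ∈ F.edges
  symm := ⟨fun _ _ h => ⟨h.1.symm, h.2.imp fun _ hF => ⟨hF.1, hF.2.2, hF.2.1⟩⟩⟩
  loopless := ⟨fun _ h => h.1 rfl⟩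

/-- Polygonal complexes in `E3`. -/
structure IsPolygonalComplex (K : Complex2) : Prop where
  edge_nondegenerate : ∀ e ∈ K.edges, ¬ e.IsDiag
  edge_verts : ∀ e ∈ K.edges, ∀ v ∈ e, v ∈ K.verts
  face_polygon : ∀ F ∈ K.faces, F.IsPolygon
  face_verts : ∀ F ∈ K.faces, F.verts ⊆ K.verts
  face_edges : ∀ F ∈ K.faces, F.edges ⊆ K.edges
  edgeGraph_connected : K.edgeGraph.Connected
  vertexFigure_connected : ∀ v ∈ K.verts, (K.vertexFigure v).Connected
  faces_around_edge :
    ∃ r : ℕ, 2 ≤ r ∧ ∀ e ∈ K.edges, {F ∈ K.faces | e ∈ F.edges}.encard = r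
  discrete : ∀ C : Set E3, IsCompact C → {F ∈ K.faces | (F.carrier ∩ C).Nonempty}.Finite

/-- The isometries of `E3` that map `K` to itself. The symmetry group proper consists of the
restrictions of these maps to the affine hull of `K` (every isometry of the affine hull extends
to `E3`); this matters only for planar `K`, and is taken care of in
`FlagStabilizerNontrivial`. -/
def symmetryGroup (K : Complex2) : Subgroup (E3 ≃ᵢ E3) where
  carrier := {g | K.map g = K}
  one_mem' := K.map_id
  mul_mem' := by
    intro g h hg hh
    change K.map (g ∘ h) = K
    rw [← map_map, hh, hg]
  inv_mem' := by
    intro g hg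
    change K.map g = K at hg
    change K.map g.symm = K
    conv_lhs => rw [← hg]
    rw [map_map]
    convert K.map_id using 2
    funext x
    simp

/-- Flags: mutually incident triples of a vertex, an edge and a face. -/
def IsFlag (K : Complex2) (v : E3) (e : Sym2 E3) (F : Figure) : Prop :=
  v ∈ K.verts ∧ e ∈ K.edges ∧ F ∈ K.faces ∧ v ∈ e ∧ v ∈ F.verts ∧ e ∈ F.edges

/-- Geometric regularity: the symmetry group is transitive on the flags. -/
def IsRegular (K : Complex2) : Prop :=
  ∀ v e F v' e' F', K.IsFlag v e F → K.IsFlag v' e' F' →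
    ∃ g ∈ K.symmetryGroup, g v = v' ∧ Sym2.map g e = e' ∧ F.map g = F'

/-- The stabilizer of the flag `(v, e, F)` in the symmetry group is non-trivial: some symmetry
fixes the flag and is not the identity on the affine hull of `K`. -/
def FlagStabilizerNontrivial (K : Complex2) (v : E3) (e : Sym2 E3) (F : Figure) : Prop :=
  ∃ g ∈ K.symmetryGroup, (g v = v ∧ Sym2.map g e = e ∧ F.map g = F) ∧
    ∃ x ∈ affineSpan ℝ K.verts, g x ≠ x

end Complex2

/-- Abstract polytopes of rank `n`: partially ordered sets with a least and a greatest face, such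
that each flag (maximal chain) has `n + 2` faces, each section is connected (a condition only on
sections of rank at least `2`), and the diamond condition holds. -/
structure IsAbstractPolytope (n : ℕ) (P : Type) [PartialOrder P] [BoundedOrder P] : Prop where
  flag_card : ∀ Φ : Flag P, (Φ : Set P).encard = n + 2
  section_connected : ∀ F G : P, (∃ x y, F < x ∧ x < y ∧ y < G) →
    ∀ a ∈ Set.Ioo F G, ∀ b ∈ Set.Ioo F G,
      Relation.ReflTransGen (fun x y => (x ≤ y ∨ y ≤ x) ∧ y ∈ Set.Ioo F G) a b
  diamond : ∀ F G : P, (∃ x, F ⋖ x ∧ x ⋖ G) → (Set.Ioo F G).encard = 2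

/-- The data of a structure of rank 4 in `E3`: vertices, edges, 2-faces, and facets, each facet
being given by the set of its 2-faces. -/
@[ext]
structure Complex3 where
  verts : Set E3
  edges : Set (Sym2 E3)
  faces : Set Figure
  facets : Set (Set Figure)

namespace Complex3

def map (f : E3 → E3) (P : Complex3) : Complex3 where
  verts := f '' P.verts
  edges := Sym2.map f '' P.edges
  faces := Figure.map f '' P.faces
  facets := Set.image (Figure.map f) '' P.facets

def twoSkeleton (P : Complex3) : Complex2 where
  verts := P.verts
  edges := P.edges
  faces := P.faces

/-- The faces of all ranks `-1, 0, 1, 2, 3, 4`. -/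
inductive Face (P : Complex3) : Type
  | bot : Face P
  | vert (v : P.verts) : Face P
  | edge (e : P.edges) : Face P
  | face (F : P.faces) : Face P
  | facet (C : P.facets) : Face P
  | top : Face P

/-- Incidence of faces: membership for consecutive ranks, and a chain of memberships in
general. -/
def Face.Le {P : Complex3} : Face P → Face P → Prop
  | .bot, _ => True
  | .vert _, .bot => False
  | .vert v, .vert w => v = w
  | .vert v, .edge e => (v : E3) ∈ (e : Sym2 E3)
  | .vert v, .face F => ∃ e : P.edges, (v : E3) ∈ (e : Sym2 E3) ∧ (e : Sym2 E3) ∈ F.1.edges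
  | .vert v, .facet C => ∃ e : P.edges, ∃ F : P.faces,
      (v : E3) ∈ (e : Sym2 E3) ∧ (e : Sym2 E3) ∈ F.1.edges ∧ F.1 ∈ C.1
  | .vert _, .top => True
  | .edge e, .edge e' => e = e'
  | .edge e, .face F => (e : Sym2 E3) ∈ F.1.edges
  | .edge e, .facet C => ∃ F : P.faces, (e : Sym2 E3) ∈ F.1.edges ∧ F.1 ∈ C.1
  | .edge _, .top => True
  | .edge _, _ => False
  | .face F, .face F' => F = F'
  | .face F, .facet C => F.1 ∈ C.1
  | .face _, .top => True
  | .face _, _ => False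
  | .facet C, .facet C' => C = C'
  | .facet _, .top => True
  | .facet _, _ => False
  | .top, .top => True
  | .top, _ => False

instance (P : Complex3) : PartialOrder (Face P) where
  le := Face.Le
  le_refl a := by cases a <;> simp [Face.Le]
  le_trans a b c hab hbc := by
    cases a <;> cases b <;> cases c <;> simp only [Face.Le] at hab hbc ⊢ <;> aesop
  le_antisymm a b hab hba := by
    cases a <;> cases b <;> simp_all [Face.Le]

instance (P : Complex3) : BoundedOrder (Face P) where
  bot := .bot
  bot_le a := by cases a <;> trivial
  top := .top
  le_top a := by cases a <;> trivial

/-- Flags, without the two improper faces. -/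
def IsFlag (P : Complex3) (v : E3) (e : Sym2 E3) (F : Figure) (C : Set Figure) : Prop :=
  v ∈ P.verts ∧ e ∈ P.edges ∧ F ∈ P.faces ∧ C ∈ P.facets ∧ v ∈ e ∧ e ∈ F.edges ∧ F ∈ C

/-- Regular 4-apeirotopes in `E3`: discrete, faithfully realized infinite abstract polytopes of
rank 4 whose flags are permuted transitively by the isometries of `E3` that preserve the
structure. Faithfulness is built in: edges are pairs of vertices, 2-faces are polygons, and
facets are sets of 2-faces. -/
structure IsRegularApeirotope (P : Complex3) : Prop where
  edge_nondegenerate : ∀ e ∈ P.edges, ¬ e.IsDiag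
  edge_verts : ∀ e ∈ P.edges, ∀ v ∈ e, v ∈ P.verts
  face_polygon : ∀ F ∈ P.faces, F.IsPolygon
  face_verts : ∀ F ∈ P.faces, F.verts ⊆ P.verts
  face_edges : ∀ F ∈ P.faces, F.edges ⊆ P.edges
  facet_faces : ∀ C ∈ P.facets, C ⊆ P.faces
  polytope : IsAbstractPolytope 4 (Face P)
  infinite : P.verts.Infinite
  discrete : ∀ C : Set E3, IsCompact C → {F ∈ P.faces | (F.carrier ∩ C).Nonempty}.Finite
  flag_transitive : ∀ v e F C v' e' F' C', P.IsFlag v e F C → P.IsFlag v' e' F' C' →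
    ∃ g : E3 ≃ᵢ E3, P.map g = P ∧
      g v = v' ∧ Sym2.map g e = e' ∧ F.map g = F' ∧ Figure.map g '' C = C'

/-- Wythoff's construction of rank 4 with generators `R₀, R₁, R₂, R₃` and initial vertex `o`: the
base edge joins `o` and `R₀ o`, the base 2-face consists of the images of `o` and the base edge under
`⟨R₀, R₁⟩`, the base facet of the images of the base 2-face under `⟨R₀, R₁, R₂⟩`, and the faces of
each rank are the images of the base face of that rank under `⟨R₀, R₁, R₂, R₃⟩`. -/
def wythoff (R₀ R₁ R₂ R₃ : E3 ≃ᵢ E3) (o : E3) : Complex3 :=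
  let G : Subgroup (E3 ≃ᵢ E3) := Subgroup.closure {R₀, R₁, R₂, R₃}
  let baseEdge : Sym2 E3 := s(o, R₀ o)
  let baseFace : Figure :=
    { verts := {x | ∃ g ∈ Subgroup.closure {R₀, R₁}, x = g o}
      edges := {e | ∃ g ∈ Subgroup.closure {R₀, R₁}, e = Sym2.map g baseEdge} }
  let baseFacet : Set Figure := {F | ∃ g ∈ Subgroup.closure {R₀, R₁, R₂}, F = baseFace.map g}
  { verts := {x | ∃ g ∈ G, x = g o}
    edges := {e | ∃ g ∈ G, e = Sym2.map g baseEdge}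
    faces := {F | ∃ g ∈ G, F = baseFace.map g}
    facets := {C | ∃ g ∈ G, C = Figure.map g '' baseFacet} }

end Complex3

/-- The centroid of the (finite) vertex set. -/
def Complex2.centroid (Q : Complex2) : E3 :=
  (Q.verts.ncard : ℝ)⁻¹ • ∑ᶠ v ∈ Q.verts, v

/-- `P` is the apeirotope `apeir Q` of the finite regular polyhedron `Q`. Here `R₁, R₂, R₃` are the
distinguished generators of the symmetry group of `Q` with respect to a base flag `(w, e, F)`, that
is, the symmetries that map the base flag to the flags that differ from it precisely in the vertex,
the edge and the face, respectively; `R₀` is the reflection in the midpoint of `w` and the centroid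
`o` of `Q`, and `o` is the initial vertex. -/
def Complex2.IsApeir (Q : Complex2) (P : Complex3) : Prop :=
  ∃ (w : E3) (e : Sym2 E3) (F : Figure) (R₁ R₂ R₃ : E3 ≃ᵢ E3),
    Q.IsFlag w e F ∧
    R₁ ∈ Q.symmetryGroup ∧ R₂ ∈ Q.symmetryGroup ∧ R₃ ∈ Q.symmetryGroup ∧
    (R₁ w ≠ w ∧ Sym2.map R₁ e = e ∧ F.map R₁ = F) ∧
    (R₂ w = w ∧ Sym2.map R₂ e ≠ e ∧ F.map R₂ = F) ∧
    (R₃ w = w ∧ Sym2.map R₃ e = e ∧ F.map R₃ ≠ F) ∧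
    P = Complex3.wythoff
      (AffineIsometryEquiv.pointReflection ℝ (midpoint ℝ Q.centroid w)).toIsometryEquiv
      R₁ R₂ R₃ Q.centroid

/-- The point of `E3` with given integral coordinates. -/
def intPoint (c : Fin 3 → ℤ) : E3 := WithLp.toLp 2 fun i => (c i : ℝ)

/-- The polyhedron with vertex set `V` whose edges join the vertices at distance `d` and whose faces
are all the circuits of length `p` in the edge graph. -/
def polyhedronOf (p : ℕ) (V : Set E3) (d : ℝ) : Complex2 where
  verts := V
  edges := {e | ∃ a ∈ V, ∃ b ∈ V, dist a b = d ∧ e = s(a, b)}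
  faces := {F | ∃ v : ZMod p → E3, Function.Injective v ∧ (∀ i, v i ∈ V) ∧
    (∀ i, dist (v i) (v (i + 1)) = d) ∧ F = Figure.ofSeq v}

/-- A regular tetrahedron `{3,3}`. -/
def tetrahedron : Complex2 :=
  polyhedronOf 3
    {intPoint ![1, 1, 1], intPoint ![1, -1, -1], intPoint ![-1, 1, -1], intPoint ![-1, -1, 1]}
    (2 * √2)

/-- A regular octahedron `{3,4}`. -/
def octahedron : Complex2 :=
  polyhedronOf 3 {x | ∃ i, x = intPoint (Pi.single i 1) ∨ x = intPoint (Pi.single i (-1))} (√2)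

/-- A cube `{4,3}`; the circuits of length 4 in its edge graph are its six square faces. -/
def cube : Complex2 :=
  polyhedronOf 4 {x | ∃ c : Fin 3 → ℤ, (∀ i, c i = 1 ∨ c i = -1) ∧ x = intPoint c} 2

/-- The unit square with corner `c` spanned by the coordinate directions `i` and `j`. -/
def unitSquare (c : Fin 3 → ℤ) (i j : Fin 3) : Figure :=
  Figure.ofSeq (ι := Fin 4)
    ![intPoint c, intPoint (c + Pi.single i 1), intPoint (c + Pi.single i 1 + Pi.single j 1),
      intPoint (c + Pi.single j 1)]

/-- The 2-faces of the unit cube with smallest corner `c`. -/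
def unitCubeFaces (c : Fin 3 → ℤ) : Set Figure :=
  {F | (∃ a i j, i ≠ j ∧ F = unitSquare a i j) ∧
    F.verts ⊆ {x | ∃ b : Fin 3 → ℤ, (∀ k, b k = c k ∨ b k = c k + 1) ∧ x = intPoint b}}

/-- The standard tessellation `{4,3,4}` of `E3` by unit cubes with integral vertices. -/
def cubicalTessellation : Complex3 where
  verts := Set.range intPoint
  edges := {e | ∃ c i, e = s(intPoint c, intPoint (c + Pi.single i 1))}
  faces := {F | ∃ c i j, i ≠ j ∧ F = unitSquare c i j}
  facets := Set.range unitCubeFaces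

/-- `P` is a cubical tessellation `{4,3,4}`, of any position and size. -/
def Complex3.IsCubicalTessellation (P : Complex3) : Prop :=
  ∃ f : E3 ≃ᵈ E3, P = cubicalTessellation.map f

/-- `P` is `apeir Q'` for some polyhedron `Q'` similar to `Q`. -/
def Complex3.IsApeirOfSimilar (P : Complex3) (Q : Complex2) : Prop :=
  ∃ f : E3 ≃ᵈ E3, (Q.map f).IsApeir P

end

/-! A polygon is determined by two consecutive vertices, so a symmetry that fixes a flag fixes every
vertex of its face. Regularity together with `2 ≤ r` excludes faces that go straight on, so two
consecutive edges span a plane on which such a symmetry is the identity; if it is non-trivial, it is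
the reflection in that plane. By conjugation every face plane is a mirror of the complex, and all
faces are planar (`hasMirrors`). The complex itself is not planar, since the reflection would then
be trivial on its affine hull (`arc_nonplanar`).

Consider the edge vectors at a vertex, two of them forming an arc if they belong to a common face.
The vertex stabilizer is transitive on arcs, and composition with a mirror corrects orientations.
Hence the neighbours of an edge vector `u` form a regular `r`-gon around `u` with `r ≥ 3`, and the
rotation by `2π/r` about `u` belongs to the special group (`exists_rotation`). So `r` and the cosine
`c` of the face angle determine all arcs up to similarity. Products of such rotations about the two
ends of an arc have traces that are polynomials in `cos (2π/r)` and `c` (`exists_traces`), and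
arithmetic of these traces restricts `r` and `c`.

Some symmetry reverses the base edge of a face. Modulo the mirror it is either the reflection in the
midpoint of the edge or the reflection in its perpendicular bisector
(`pointReflection_or_bisectorReflection`).

With point reflections, products of two of them are translations by differences of edge vectors.
These generate a lattice invariant under the special group, so the traces are integers, and `(r, c)`
is `(4, 0)`, `(3, 1/3)` or `(3, -1/3)`: the edge vectors point to the vertices of an octahedron, a
cube or a tetrahedron, and the faces are zigzags.

With bisector reflections, the edge vectors of a face turn by a constant angle; the face is bounded,
closes up by discreteness, and `-c` is the real part of a root of unity. The elements of the special
group have finite order, so traces are algebraic integers; an extremal argument gives `r < 6`, and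
integrality leaves `(4, 0)`: square faces and octahedral vertex-figures.

The arcs at one vertex then determine the complex, because the reflections carry them along the
edges (`twoSkeleton_apeirotope_eq`, `twoSkeleton_cubeComplex_eq`). The target structures are built
in integral coordinates over a polyhedron `D` whose finitely many incidence properties are
decidable. The polytope axioms follow since all vertex-figures are copies of `D`
(`isAbstractPolytope`). Flag transitivity follows from explicit affine maps of integral points,
which also identify the zigzag structures with Wythoff's construction (`apeirotope_eq_wythoff`). -/

noncomputable section

/-! ### Polygons as two-sided sequences of vertices, and flags in these terms. -/

namespace Figure

/-- `q : ℤ → E3` runs through the vertices of the polygon `F` in cyclic, respectively linear,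
order; for an `n`-gon it has period `n`. -/
structure IsParam (F : Figure) (q : ℤ → E3) : Prop where
  eq : F = ofSeq q
  nbr : ∀ i x, s(q i, x) ∈ F.edges ↔ x = q (i - 1) ∨ x = q (i + 1)
  ne : ∀ i, q (i - 1) ≠ q (i + 1)

/-- The map `π` unrolls a cyclic polygon into a periodic sequence, so that finite and infinite
polygons can be treated alike. For `ZMod n` the condition `1 + 1 ≠ 0` excludes `n = 1, 2`; it keeps
predecessor and successor distinct. -/
theorem isParam_of_injective {ι : Type} [AddCommGroup ι] [One ι] (π : ℤ → ι)
    (hπ : Function.Surjective π) (hadd : ∀ i, π (i + 1) = π i + 1) (h2 : (1 + 1 : ι) ≠ 0)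
    {v : ι → E3} (hv : Function.Injective v) : IsParam (ofSeq v) (v ∘ π) := by
  have hsub : ∀ i, π (i - 1) = π i - 1 := fun i => by
    have := hadd (i - 1)
    rw [sub_add_cancel] at this
    rw [this, add_sub_cancel_right]
  refine ⟨?_, ?_, ?_⟩
  · ext x
    · simp only [ofSeq, Set.mem_range]
      constructor
      · rintro ⟨i, rfl⟩
        obtain ⟨j, rfl⟩ := hπ i
        exact ⟨j, rfl⟩
      · rintro ⟨j, rfl⟩
        exact ⟨π j, rfl⟩
    · simp only [ofSeq, Set.mem_range]
      constructor
      · rintro ⟨i, rfl⟩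
        obtain ⟨j, rfl⟩ := hπ i
        exact ⟨j, by simp [hadd]⟩
      · rintro ⟨j, rfl⟩
        exact ⟨π j, by simp [hadd]⟩
  · intro i x
    simp only [ofSeq, Set.mem_range, Function.comp, hadd, hsub, Sym2.eq_iff]
    constructor
    · rintro ⟨j, ⟨h, rfl⟩ | ⟨rfl, h⟩⟩
      · right
        rw [hv h]
      · left
        rw [← hv h, add_sub_cancel_right]
    · rintro (rfl | rfl)
      · exact ⟨π i - 1, Or.inr ⟨rfl, by rw [sub_add_cancel]⟩⟩
      · exact ⟨π i, Or.inl ⟨rfl, rfl⟩⟩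
  · intro i h
    simp only [Function.comp, hadd, hsub] at h
    have := hv h
    apply h2
    have h' : π i - 1 + (1 + 1) = π i - 1 := by
      conv_rhs => rw [this]
      abel
    exact add_eq_left.1 h'

theorem IsPolygon.exists_isParam {F : Figure} (hF : F.IsPolygon) : ∃ q, F.IsParam q := by
  rcases hF with ⟨n, hn, v, hv, rfl⟩ | ⟨v, hv, rfl, -⟩
  · refine ⟨_, isParam_of_injective (fun i : ℤ => (i : ZMod n)) ZMod.intCast_surjective
      (fun i => by push_cast; rfl) ?_ hv⟩
    intro h
    have h2 : ((2 : ℕ) : ZMod n) = 0 := by push_cast; rw [← h]; norm_num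
    rw [ZMod.natCast_eq_zero_iff] at h2
    have := Nat.le_of_dvd (by norm_num) h2
    omega
  · exact ⟨_, isParam_of_injective (fun i : ℤ => i) (fun i => ⟨i, rfl⟩) (fun i => rfl)
      (by norm_num) hv⟩

namespace IsParam

variable {F : Figure} {q : ℤ → E3}

theorem mem_verts (h : F.IsParam q) (i : ℤ) : q i ∈ F.verts := by
  rw [h.eq]; exact ⟨i, rfl⟩

theorem mem_edges (h : F.IsParam q) (i : ℤ) : s(q i, q (i + 1)) ∈ F.edges := by
  rw [h.eq]; exact ⟨i, rfl⟩

theorem shift (h : F.IsParam q) (k : ℤ) : F.IsParam fun i => q (i + k) := by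
  refine ⟨?_, ?_, ?_⟩
  · rw [h.eq]
    ext x
    · simp only [ofSeq, Set.mem_range]
      constructor
      · rintro ⟨i, rfl⟩; exact ⟨i - k, by simp⟩
      · rintro ⟨i, rfl⟩; exact ⟨i + k, rfl⟩
    · simp only [ofSeq, Set.mem_range]
      constructor
      · rintro ⟨i, rfl⟩; exact ⟨i - k, by rw [sub_add_cancel, sub_add_eq_add_sub, sub_add_cancel]⟩
      · rintro ⟨i, rfl⟩; exact ⟨i + k, by rw [add_right_comm]⟩
  · intro i x
    rw [h.nbr, show i - 1 + k = i + k - 1 by ring, show i + 1 + k = i + k + 1 by ring]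
  · intro i
    rw [show i - 1 + k = i + k - 1 by ring, show i + 1 + k = i + k + 1 by ring]
    exact h.ne _

theorem neg (h : F.IsParam q) : F.IsParam fun i => q (-i) := by
  refine ⟨?_, ?_, ?_⟩
  · rw [h.eq]
    ext x
    · simp only [ofSeq, Set.mem_range]
      constructor
      · rintro ⟨i, rfl⟩; exact ⟨-i, by simp⟩
      · rintro ⟨i, rfl⟩; exact ⟨-i, rfl⟩
    · simp only [ofSeq, Set.mem_range]
      constructor
      · rintro ⟨i, rfl⟩
        refine ⟨-i - 1, ?_⟩
        rw [Sym2.eq_swap]; congr 2 <;> ring_nf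
      · rintro ⟨i, rfl⟩
        refine ⟨-i - 1, ?_⟩
        rw [Sym2.eq_swap]; congr 2 <;> ring_nf
  · intro i x
    rw [h.nbr, show -(i - 1) = -i + 1 by ring, show -(i + 1) = -i - 1 by ring, or_comm]
  · intro i
    rw [show -(i - 1) = -i + 1 by ring, show -(i + 1) = -i - 1 by ring]
    exact (h.ne _).symm

/-- Each vertex has exactly two distinct neighbours, so a vertex and one neighbour determine the
other one; agreement at two consecutive indices spreads in both directions. This is the rigidity of
a flag on its face. -/
theorem unique {q' : ℤ → E3} (h : F.IsParam q) (h' : F.IsParam q') (h0 : q 0 = q' 0)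
    (h1 : q 1 = q' 1) : q = q' := by
  have step : ∀ i, q i = q' i → q (i + 1) = q' (i + 1) → q (i + 2) = q' (i + 2) := by
    intro i e0 e1
    have a := (h.nbr (i + 1) (q (i + 2))).2 (Or.inr (by congr 1; ring))
    rw [e1, h'.nbr] at a
    rcases a with a | a
    · exfalso
      have := h.ne (i + 1)
      simp only [add_sub_cancel_right] at a this
      rw [show i + 1 + 1 = i + 2 by ring, a] at this
      exact this e0
    · rw [a]; congr 1; ring
  have back : ∀ i, q i = q' i → q (i + 1) = q' (i + 1) → q (i - 1) = q' (i - 1) := by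
    intro i e0 e1
    have a := (h.nbr i (q (i - 1))).2 (Or.inl rfl)
    rw [e0, h'.nbr] at a
    rcases a with a | a
    · exact a
    · exact absurd (a.trans e1.symm) (h.ne i)
  have key : ∀ i : ℤ, q i = q' i ∧ q (i + 1) = q' (i + 1) := by
    intro i
    induction i using Int.induction_on with
    | zero => exact ⟨h0, by simpa using h1⟩
    | succ i ih => exact ⟨ih.2, by rw [add_assoc]; exact step _ ih.1 ih.2⟩
    | pred i ih => exact ⟨back _ ih.1 ih.2, by simpa using ih.1⟩
  exact funext fun i => (key i).1

theorem map (h : F.IsParam q) (g : E3 ≃ᵢ E3) : (F.map g).IsParam (g ∘ q) := by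
  refine ⟨?_, ?_, ?_⟩
  · rw [h.eq]
    ext x
    · simp [Figure.map, ofSeq]
    · simp [Figure.map, ofSeq]
  · intro i x
    have : s((g ∘ q) i, x) ∈ (F.map g).edges ↔ s(q i, g.symm x) ∈ F.edges := by
      constructor
      · rintro ⟨e, he, hx⟩
        have : e = s(q i, g.symm x) := by
          apply Sym2.map.injective g.injective
          rw [hx]; simp
        rwa [← this]
      · intro he
        exact ⟨_, he, by simp⟩
    rw [this, h.nbr]
    simp [IsometryEquiv.symm_apply_eq]
  · intro i
    simpa using fun e => h.ne i (g.injective e)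

end IsParam

/-- Shifts and reversal are both available, so any incident vertex and edge can be brought to the
indices `0` and `0, 1`. -/
theorem exists_param_of_incident {F : Figure} {q : ℤ → E3} (h : F.IsParam q) {v : E3}
    {e : Sym2 E3} (he : e ∈ F.edges) (hve : v ∈ e) :
    ∃ q', F.IsParam q' ∧ q' 0 = v ∧ e = s(v, q' 1) := by
  obtain ⟨x, rfl⟩ := Sym2.mem_iff_exists.1 hve
  have hv : ∃ i, q i = v := by
    have := he
    rw [h.eq] at this
    obtain ⟨i, hi⟩ := this
    rcases Sym2.eq_iff.1 hi with ⟨a, -⟩ | ⟨-, a⟩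
    · exact ⟨_, a⟩
    · exact ⟨_, a⟩
  obtain ⟨i, rfl⟩ := hv
  rcases (h.nbr _ _).1 he with rfl | rfl
  · exact ⟨_, (h.shift i).neg, by simp, by simp [neg_add_eq_sub]⟩
  · exact ⟨_, h.shift i, by simp, by simp [add_comm]⟩

end Figure

namespace Complex2

variable {K : Complex2}

/-- `q` runs through the vertices of a face of `K`. -/
def IsFaceParam (K : Complex2) (q : ℤ → E3) : Prop := ∃ F ∈ K.faces, F.IsParam q

theorem IsFaceParam.shift {q : ℤ → E3} (h : K.IsFaceParam q) (k : ℤ) :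
    K.IsFaceParam fun i => q (i + k) :=
  let ⟨F, hF, hq⟩ := h; ⟨F, hF, hq.shift k⟩

theorem IsFaceParam.neg {q : ℤ → E3} (h : K.IsFaceParam q) : K.IsFaceParam fun i => q (-i) :=
  let ⟨F, hF, hq⟩ := h; ⟨F, hF, hq.neg⟩

theorem IsFaceParam.mem_faces {q : ℤ → E3} (h : K.IsFaceParam q) : Figure.ofSeq q ∈ K.faces := by
  obtain ⟨F, hF, hq⟩ := h
  rwa [← hq.eq]

theorem IsFaceParam.isParam {q : ℤ → E3} (h : K.IsFaceParam q) :
    (Figure.ofSeq q).IsParam q := by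
  obtain ⟨F, hF, hq⟩ := h
  rwa [← hq.eq]

theorem mem_symmetryGroup {g : E3 ≃ᵢ E3} : g ∈ K.symmetryGroup ↔ K.map g = K := Iff.rfl

theorem map_mem_faces {g : E3 ≃ᵢ E3} (hg : g ∈ K.symmetryGroup) {F : Figure} (hF : F ∈ K.faces) :
    F.map g ∈ K.faces := by
  rw [mem_symmetryGroup] at hg
  rw [← hg]
  exact ⟨F, hF, rfl⟩

theorem map_mem_verts {g : E3 ≃ᵢ E3} (hg : g ∈ K.symmetryGroup) {v : E3}
    (hv : v ∈ K.verts) : g v ∈ K.verts := by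
  rw [mem_symmetryGroup] at hg
  rw [← hg]
  exact ⟨v, hv, rfl⟩

theorem IsFaceParam.map {q : ℤ → E3} (h : K.IsFaceParam q) {g : E3 ≃ᵢ E3}
    (hg : g ∈ K.symmetryGroup) : K.IsFaceParam (g ∘ q) :=
  let ⟨F, hF, hq⟩ := h; ⟨F.map g, map_mem_faces hg hF, hq.map g⟩

theorem IsFaceParam.mem_edges (hK : K.IsPolygonalComplex) {q : ℤ → E3} (h : K.IsFaceParam q)
    (i : ℤ) : s(q i, q (i + 1)) ∈ K.edges :=
  let ⟨F, hF, hq⟩ := h; hK.face_edges F hF (hq.mem_edges i)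

theorem IsFaceParam.mem_verts (hK : K.IsPolygonalComplex) {q : ℤ → E3} (h : K.IsFaceParam q)
    (i : ℤ) : q i ∈ K.verts :=
  let ⟨F, hF, hq⟩ := h; hK.face_verts F hF (hq.mem_verts i)

theorem IsFaceParam.isFlag (hK : K.IsPolygonalComplex) {q : ℤ → E3} (h : K.IsFaceParam q) :
    K.IsFlag (q 0) s(q 0, q 1) (Figure.ofSeq q) :=
  ⟨h.mem_verts hK 0, by simpa using h.mem_edges hK 0, h.mem_faces, by simp, ⟨0, rfl⟩,
    by simpa using h.isParam.mem_edges 0⟩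

theorem IsFaceParam.succ_ne (hK : K.IsPolygonalComplex) {q : ℤ → E3} (h : K.IsFaceParam q)
    (i : ℤ) : q (i + 1) ≠ q i := fun e => by
  apply hK.edge_nondegenerate _ (h.mem_edges hK i)
  simp [e]

theorem exists_isFaceParam_of_flag (hK : K.IsPolygonalComplex) {v : E3} {e : Sym2 E3} {F : Figure}
    (h : K.IsFlag v e F) : ∃ q, K.IsFaceParam q ∧ F = Figure.ofSeq q ∧ q 0 = v ∧ e = s(v, q 1) := by
  obtain ⟨-, -, hF, hve, -, heF⟩ := h
  obtain ⟨q, hq⟩ := (hK.face_polygon F hF).exists_isParam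
  obtain ⟨q', hq', h0, h1⟩ := Figure.exists_param_of_incident hq heF hve
  exact ⟨q', ⟨F, hF, hq'⟩, hq'.eq, h0, h1⟩

/-- A symmetry that maps a face parametrization to another one at two consecutive vertices and
on the face does so everywhere. -/
theorem comp_eq_of_flag {q q' : ℤ → E3} (h : K.IsFaceParam q) (h' : K.IsFaceParam q')
    {g : E3 ≃ᵢ E3} (h0 : g (q 0) = q' 0) (h1 : g (q 1) = q' 1)
    (hF : (Figure.ofSeq q).map g = Figure.ofSeq q') (i : ℤ) : g (q i) = q' i := by
  have a := h.isParam.map g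
  rw [hF] at a
  exact congrFun (a.unique h'.isParam h0 h1) i

/-- A flag is the same as a parametrization of its face starting with its vertex and its edge.
Transitivity on flags thus becomes transitivity on parametrizations, the form in which regularity is
used. -/
theorem IsRegular.exists_map_param (hK : K.IsPolygonalComplex) (hreg : K.IsRegular)
    {q q' : ℤ → E3} (h : K.IsFaceParam q) (h' : K.IsFaceParam q') :
    ∃ g ∈ K.symmetryGroup, ∀ i, g (q i) = q' i := by
  obtain ⟨g, hg, h0, h1, h2⟩ := hreg _ _ _ _ _ _ (h.isFlag hK) (h'.isFlag hK)
  refine ⟨g, hg, comp_eq_of_flag h h' h0 ?_ h2⟩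
  rw [Sym2.map_mk, h0] at h1
  exact Sym2.congr_right.1 h1

/-- The faces that contain a given edge are parametrized starting with this edge. -/
theorem exists_isFaceParam_of_edge (hK : K.IsPolygonalComplex) {v x : E3}
    (he : s(v, x) ∈ K.edges) : ∃ q, K.IsFaceParam q ∧ q 0 = v ∧ q 1 = x := by
  obtain ⟨r, hr, h⟩ := hK.faces_around_edge
  have h1 := h _ he
  have : {F ∈ K.faces | s(v, x) ∈ F.edges}.Nonempty := by
    rw [Set.nonempty_iff_ne_empty]
    intro h0
    rw [h0, Set.encard_empty] at h1
    have : r = 0 := by exact_mod_cast h1.symm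
    omega
  obtain ⟨F, hF, heF⟩ := this
  obtain ⟨q, hq⟩ := (hK.face_polygon F hF).exists_isParam
  obtain ⟨q', hq', h0, h1⟩ := Figure.exists_param_of_incident hq heF (v := v) (by simp)
  exact ⟨q', ⟨F, hF, hq'⟩, h0, (Sym2.congr_right.1 h1).symm⟩

theorem exists_edge_of_vert (hK : K.IsPolygonalComplex) {v : E3} (hv : v ∈ K.verts) :
    ∃ x, s(v, x) ∈ K.edges :=
  let ⟨x⟩ := (hK.vertexFigure_connected v hv).nonempty
  ⟨x.1, x.2⟩

end Complex2

end


/-! ### Adapted bases, and the regular polygon of neighbours around an edge vector. -/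

noncomputable section

open scoped ComplexConjugate

theorem linearIsometryEquiv_mul_apply (f g : E3 ≃ₗᵢ[ℝ] E3) (x : E3) : (f * g) x = f (g x) := rfl

theorem linearIsometryEquiv_inv_apply_self (f : E3 ≃ₗᵢ[ℝ] E3) (x : E3) : f⁻¹ (f x) = x :=
  f.symm_apply_apply x

/-- A pair of vectors of equal length, put into standard position by an orthonormal basis. -/
theorem exists_adapted_basis {a b : E3} {ℓ c : ℝ} (hℓ : 0 < ℓ) (hc : c ^ 2 < 1) (ha : ‖a‖ = ℓ)
    (hb : ‖b‖ = ℓ) (hab : inner ℝ a b = ℓ ^ 2 * c) :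
    ∃ o : OrthonormalBasis (Fin 3) ℝ E3,
      a = ℓ • o 0 ∧ b = ℓ • (c • o 0 + √(1 - c ^ 2) • o 1) := by
  set s := √(1 - c ^ 2) with hs
  have hs0 : 0 < s := Real.sqrt_pos.2 (by linarith)
  have hs2 : s ^ 2 = 1 - c ^ 2 := Real.sq_sqrt (by linarith)
  have haa : inner ℝ a a = ℓ ^ 2 := by rw [real_inner_self_eq_norm_sq, ha]
  have hbb : inner ℝ b b = ℓ ^ 2 := by rw [real_inner_self_eq_norm_sq, hb]
  have hba : inner ℝ b a = ℓ ^ 2 * c := by rw [real_inner_comm, hab]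
  let e0 : E3 := ℓ⁻¹ • a
  let e1 : E3 := s⁻¹ • (ℓ⁻¹ • b - c • e0)
  have h00 : inner ℝ e0 e0 = 1 := by
    simp only [e0, inner_smul_left, inner_smul_right, haa, conj_trivial]; field_simp
  have h01 : inner ℝ e0 e1 = 0 := by
    simp only [e1, e0, inner_smul_left, inner_smul_right, inner_sub_right, haa, hab, conj_trivial]
    field_simp; ring
  have h11 : inner ℝ e1 e1 = 1 := by
    simp only [e1, e0, inner_smul_left, inner_smul_right, inner_sub_right, inner_sub_left, haa, hab,
      hba, hbb, conj_trivial]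
    field_simp; rw [hs2]; ring
  have hon : Orthonormal ℝ (({0, 1} : Set (Fin 3)).domRestrict ![e0, e1, 0]) := by
    rw [orthonormal_iff_ite]
    rintro ⟨i, hi⟩ ⟨j, hj⟩
    have hi' : i = 0 ∨ i = 1 := by simpa using hi
    have hj' : j = 0 ∨ j = 1 := by simpa using hj
    have h10 : inner ℝ e1 e0 = 0 := by rw [real_inner_comm, h01]
    change inner ℝ (![e0, e1, 0] i) (![e0, e1, 0] j) = _
    rcases hi' with rfl | rfl <;> rcases hj' with rfl | rfl
    · rw [if_pos rfl]; exact h00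
    · rw [if_neg (by simp)]; exact h01
    · rw [if_neg (by simp)]; exact h10
    · rw [if_pos rfl]; exact h11
  obtain ⟨o, ho⟩ := hon.exists_orthonormalBasis_extension_of_card_eq (by simp)
  have o0 : o 0 = e0 := ho 0 (by simp)
  have o1 : o 1 = e1 := ho 1 (by simp)
  refine ⟨o, ?_, ?_⟩
  · rw [o0]; simp [e0, hℓ.ne']
  · rw [o0, o1]
    simp only [e1, smul_smul, mul_inv_cancel₀ hs0.ne', one_smul, add_sub_cancel,
      mul_inv_cancel₀ hℓ.ne']

namespace OrthonormalBasis

variable (o : OrthonormalBasis (Fin 3) ℝ E3)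

theorem eq_sum_three (x : E3) :
    x = inner ℝ (o 0) x • o 0 + inner ℝ (o 1) x • o 1 + inner ℝ (o 2) x • o 2 := by
  conv_lhs => rw [← o.sum_repr' x]
  rw [Fin.sum_univ_three]

theorem inner_eq_three (x y : E3) : inner ℝ x y = inner ℝ (o 0) x * inner ℝ (o 0) y +
    inner ℝ (o 1) x * inner ℝ (o 1) y + inner ℝ (o 2) x * inner ℝ (o 2) y := by
  rw [← o.sum_inner_mul_inner x y, Fin.sum_univ_three]
  simp only [real_inner_comm]

theorem ext_three {x y : E3} (h0 : inner ℝ (o 0) x = inner ℝ (o 0) y)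
    (h1 : inner ℝ (o 1) x = inner ℝ (o 1) y) (h2 : inner ℝ (o 2) x = inner ℝ (o 2) y) : x = y := by
  rw [o.eq_sum_three x, o.eq_sum_three y, h0, h1, h2]

theorem inner_self_one (i : Fin 3) : inner ℝ (o i) (o i) = 1 := by
  rw [real_inner_self_eq_norm_sq, o.orthonormal.1]; norm_num

theorem inner_zero {i j : Fin 3} (h : i ≠ j) : inner ℝ (o i) (o j) = 0 := o.orthonormal.2 h

theorem inner_zero_comb (x y z : ℝ) : inner ℝ (o 0) (x • o 0 + y • o 1 + z • o 2) = x := by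
  simp [inner_add_right, inner_smul_right, o.inner_zero, o.inner_self_one, -inner_self_eq_norm_sq_to_K]

theorem inner_one_comb (x y z : ℝ) : inner ℝ (o 1) (x • o 0 + y • o 1 + z • o 2) = y := by
  simp [inner_add_right, inner_smul_right, o.inner_zero, o.inner_self_one, -inner_self_eq_norm_sq_to_K]

theorem inner_two_comb (x y z : ℝ) : inner ℝ (o 2) (x • o 0 + y • o 1 + z • o 2) = z := by
  simp [inner_add_right, inner_smul_right, o.inner_zero, o.inner_self_one, -inner_self_eq_norm_sq_to_K]

/-- The complex coordinate in the plane perpendicular to the first basis vector. -/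
def planeCoord (x : E3) : ℂ := ⟨inner ℝ (o 1) x, inner ℝ (o 2) x⟩

/-- An isometry that fixes the axis acts on the perpendicular plane by an orthogonal 2×2 matrix. Its
determinant decides between a rotation (multiplication by a complex number) and a reflection
(multiplication after conjugation). -/
theorem planeCoord_map_of_fix (L : E3 ≃ₗᵢ[ℝ] E3) (h0 : L (o 0) = o 0) :
    (∀ x, o.planeCoord (L x) = o.planeCoord (L (o 1)) * o.planeCoord x) ∨
      ∀ x, o.planeCoord (L x) = o.planeCoord (L (o 1)) * conj (o.planeCoord x) := by
  have hα0 : inner ℝ (o 0) (L (o 1)) = 0 := by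
    rw [← h0, L.inner_map_map]; exact o.inner_zero (by decide)
  have hγ0 : inner ℝ (o 0) (L (o 2)) = 0 := by
    rw [← h0, L.inner_map_map]; exact o.inner_zero (by decide)
  have e1 : inner ℝ (L (o 1)) (L (o 1)) = 1 := by rw [L.inner_map_map, o.inner_self_one]
  have e2 : inner ℝ (L (o 2)) (L (o 2)) = 1 := by rw [L.inner_map_map, o.inner_self_one]
  have e3 : inner ℝ (L (o 1)) (L (o 2)) = 0 := by
    rw [L.inner_map_map]; exact o.inner_zero (by decide)
  rw [o.inner_eq_three] at e1 e2 e3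
  rw [hα0] at e1 e3
  rw [hγ0] at e2
  have hL : ∀ x, L x = inner ℝ (o 0) x • o 0 + inner ℝ (o 1) x • L (o 1) +
      inner ℝ (o 2) x • L (o 2) := by
    intro x
    conv_lhs => rw [o.eq_sum_three x]
    simp [h0]
  have w1 : ∀ x, inner ℝ (o 1) (L x) = inner ℝ (o 1) x * inner ℝ (o 1) (L (o 1)) +
      inner ℝ (o 2) x * inner ℝ (o 1) (L (o 2)) := by
    intro x
    conv_lhs => rw [hL x]
    simp [inner_add_right, inner_smul_right, o.inner_zero]
  have w2 : ∀ x, inner ℝ (o 2) (L x) = inner ℝ (o 1) x * inner ℝ (o 2) (L (o 1)) +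
      inner ℝ (o 2) x * inner ℝ (o 2) (L (o 2)) := by
    intro x
    conv_lhs => rw [hL x]
    simp [inner_add_right, inner_smul_right, o.inner_zero]
  generalize inner ℝ (o 1) (L (o 1)) = α at *
  generalize inner ℝ (o 2) (L (o 1)) = β at *
  generalize inner ℝ (o 1) (L (o 2)) = γ at *
  generalize inner ℝ (o 2) (L (o 2)) = δ at *
  -- The squared determinant is the Gram determinant of the two columns.
  have hε : (α * δ - β * γ) ^ 2 = 1 := by
    linear_combination (-α * γ - β * δ) * e3 + (α * α + β * β) * e2 + e1
  have hγ : γ = -(α * δ - β * γ) * β := by linear_combination (-γ) * e1 + α * e3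
  have hδ : δ = (α * δ - β * γ) * α := by linear_combination (-δ) * e1 + β * e3
  have hw : ∀ x, o.planeCoord (L x) = ⟨inner ℝ (o 1) x * α + inner ℝ (o 2) x * γ,
      inner ℝ (o 1) x * β + inner ℝ (o 2) x * δ⟩ := by
    intro x; rw [planeCoord, w1, w2]
  have hw1 : o.planeCoord (L (o 1)) = ⟨α, β⟩ := by
    rw [hw]; simp [o.inner_zero]
  rcases sq_eq_one_iff.1 hε with h | h
  · left
    intro x
    rw [hw1, hw]
    rw [h] at hγ hδ
    apply Complex.ext <;> simp only [planeCoord, hγ, hδ, Complex.mul_re, Complex.mul_im] <;> ring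
  · right
    intro x
    rw [hw1, hw]
    rw [h] at hγ hδ
    apply Complex.ext <;> simp only [planeCoord, hγ, hδ, Complex.mul_re, Complex.mul_im,
      Complex.conj_re, Complex.conj_im] <;> ring

end OrthonormalBasis

/-- A finite set of nonzero complex numbers that contains `1` and is closed under multiplication
consists of all `r`-th roots of unity, for some `r`. -/
theorem exists_roots_of_unity_of_mul_closed {H : Set ℂ} (hfin : H.Finite) (h1 : (1 : ℂ) ∈ H)
    (h0 : (0 : ℂ) ∉ H) (hmul : ∀ x ∈ H, ∀ y ∈ H, x * y ∈ H) :
    ∃ r : ℕ, 0 < r ∧ ∀ x, x ∈ H ↔ x ^ r = 1 := by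
  classical
  set T := hfin.toFinset with hT
  have hmem : ∀ x, x ∈ T ↔ x ∈ H := fun x => hfin.mem_toFinset
  have hpos : 0 < T.card := Finset.card_pos.2 ⟨1, (hmem 1).2 h1⟩
  have hpow : ∀ x ∈ T, x ^ T.card = 1 := by
    intro x hx
    have hx0 : x ≠ 0 := fun h => h0 (h ▸ (hmem x).1 hx)
    have himg : T.image (x * ·) = T := by
      apply Finset.eq_of_subset_of_card_le
      · intro y hy
        obtain ⟨z, hz, rfl⟩ := Finset.mem_image.1 hy
        exact (hmem _).2 (hmul _ ((hmem _).1 hx) _ ((hmem _).1 hz))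
      · rw [Finset.card_image_of_injective _ (mul_right_injective₀ hx0)]
    have hprod : ∏ y ∈ T, y ≠ 0 :=
      Finset.prod_ne_zero_iff.2 fun y hy h => h0 (h ▸ (hmem y).1 hy)
    -- Multiplication by `x` permutes `T` and therefore leaves the product of its elements
    -- unchanged.
    have : x ^ T.card * ∏ y ∈ T, y = ∏ y ∈ T, y := by
      conv_rhs => rw [← himg, Finset.prod_image (fun a _ b _ h => mul_right_injective₀ hx0 h)]
      rw [Finset.prod_mul_distrib, Finset.prod_const]
    exact mul_right_cancel₀ hprod (this.trans (one_mul _).symm)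
  have hsub : T ⊆ Polynomial.nthRootsFinset T.card (1 : ℂ) := fun x hx =>
    (Polynomial.mem_nthRootsFinset hpos _).2 (hpow x hx)
  -- There are exactly `T.card` roots of unity of order dividing `T.card`, so the inclusion is an
  -- equality.
  have heq : T = Polynomial.nthRootsFinset T.card (1 : ℂ) := by
    apply Finset.eq_of_subset_of_card_le hsub
    rw [(Complex.isPrimitiveRoot_exp T.card hpos.ne').card_nthRootsFinset]
  refine ⟨T.card, hpos, fun x => ?_⟩
  rw [← hmem]
  refine ⟨hpow x, fun hx => ?_⟩
  rw [heq]
  exact (Polynomial.mem_nthRootsFinset hpos _).2 hx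

/-- The structure of the edges and faces at a vertex of a regular complex with face mirrors:
`A u u'` says that the edges in the directions `u` and `u'` belong to a common face, and `Γ` is the
special group of the vertex stabilizer. All edges have length `ℓ`, and `c` is the cosine of the
angle of a face. -/
structure LocalData (A : E3 → E3 → Prop) (Γ : Subgroup (E3 ≃ₗᵢ[ℝ] E3)) (ℓ c : ℝ) : Prop where
  pos : 0 < ℓ
  lt : c ^ 2 < 1
  exists_arc : ∃ u u', A u u'
  finite : {u | ∃ u', A u u'}.Finite
  symm : ∀ {u u'}, A u u' → A u' u
  map : ∀ {L}, L ∈ Γ → ∀ {u u'}, A u u' → A (L u) (L u')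
  trans : ∀ {u u' w w'}, A u u' → A w w' → ∃ L ∈ Γ, L u = w ∧ L u' = w'
  mirror : ∀ {u u'}, A u u' → ∃ L ∈ Γ, L u = u ∧ L u' = u' ∧
    ∀ n : E3, inner ℝ n u = 0 → inner ℝ n u' = 0 → L n = -n
  norm_eq : ∀ {u u'}, A u u' → ‖u‖ = ℓ
  inner_eq : ∀ {u u'}, A u u' → inner ℝ u u' = ℓ ^ 2 * c
  connected : ∀ {u u' w w'}, A u u' → A w w' → Relation.ReflTransGen A u w
  nonplanar : ∀ {n : E3}, n ≠ 0 → ∃ w w', A w w' ∧ inner ℝ n w ≠ 0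

namespace LocalData

variable {A : E3 → E3 → Prop} {Γ : Subgroup (E3 ≃ₗᵢ[ℝ] E3)} {ℓ c : ℝ} {u u' : E3}

theorem exists_basis (h : LocalData A Γ ℓ c) (hA : A u u') :
    ∃ o : OrthonormalBasis (Fin 3) ℝ E3,
      u = ℓ • o 0 ∧ u' = ℓ • (c • o 0 + √(1 - c ^ 2) • o 1) :=
  exists_adapted_basis h.pos h.lt (h.norm_eq hA) (h.norm_eq (h.symm hA)) (h.inner_eq hA)

theorem sin_pos (h : LocalData A Γ ℓ c) : 0 < √(1 - c ^ 2) :=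
  Real.sqrt_pos.2 (by linarith [h.lt])

theorem sin_sq (h : LocalData A Γ ℓ c) : √(1 - c ^ 2) ^ 2 = 1 - c ^ 2 :=
  Real.sq_sqrt (by linarith [h.lt])

theorem map_iff (h : LocalData A Γ ℓ c) {L : E3 ≃ₗᵢ[ℝ] E3} (hL : L ∈ Γ) {x y : E3} :
    A (L x) (L y) ↔ A x y := by
  refine ⟨fun hA => ?_, h.map hL⟩
  have := h.map (Γ.inv_mem hL) hA
  rwa [← linearIsometryEquiv_mul_apply, ← linearIsometryEquiv_mul_apply, inv_mul_cancel] at this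

theorem norm_planeCoord (h : LocalData A Γ ℓ c) {o : OrthonormalBasis (Fin 3) ℝ E3}
    (hu : u = ℓ • o 0) {x : E3} (hx : A u x) :
    inner ℝ (o 0) x = ℓ * c ∧ ‖o.planeCoord x‖ = ℓ * √(1 - c ^ 2) := by
  have hpos := h.pos
  have h0 : inner ℝ (o 0) x = ℓ * c := by
    have := h.inner_eq hx
    rw [hu, inner_smul_left, conj_trivial] at this
    have : ℓ * inner ℝ (o 0) x = ℓ * (ℓ * c) := by rw [this]; ring
    exact mul_left_cancel₀ hpos.ne' this
  refine ⟨h0, ?_⟩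
  have hn : inner ℝ x x = ℓ ^ 2 := by rw [real_inner_self_eq_norm_sq, h.norm_eq (h.symm hx)]
  rw [o.inner_eq_three, h0] at hn
  have : ‖o.planeCoord x‖ ^ 2 = (ℓ * √(1 - c ^ 2)) ^ 2 := by
    rw [← Complex.normSq_eq_norm_sq, Complex.normSq_apply, mul_pow, h.sin_sq]
    simp only [OrthonormalBasis.planeCoord]
    linarith
  exact (sq_eq_sq₀ (norm_nonneg _) (mul_pos hpos h.sin_pos).le).1 this

/-- The rotation about `u` that takes one neighbour of `u` to another. -/
theorem exists_rotation_between (h : LocalData A Γ ℓ c) {o : OrthonormalBasis (Fin 3) ℝ E3}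
    (hu : u = ℓ • o 0) {x y : E3} (hx : A u x) (hy : A u y) :
    ∃ L ∈ Γ, L (o 0) = o 0 ∧ L x = y ∧
      ∀ t, o.planeCoord (L t) = o.planeCoord y / o.planeCoord x * o.planeCoord t := by
  have hpos := h.pos
  have hspos := h.sin_pos
  have hne : ∀ {z}, A u z → o.planeCoord z ≠ 0 := fun hz => by
    rw [← norm_ne_zero_iff, (h.norm_planeCoord hu hz).2]; positivity
  have hfix : ∀ L : E3 ≃ₗᵢ[ℝ] E3, L u = u → L (o 0) = o 0 := fun L hL => by
    rw [hu, map_smul] at hL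
    exact smul_right_injective _ hpos.ne' hL
  obtain ⟨L, hL, hLu, hLx⟩ := h.trans hx hy
  rcases o.planeCoord_map_of_fix L (hfix L hLu) with hr | hr
  · refine ⟨L, hL, hfix L hLu, hLx, fun t => ?_⟩
    have := hr x
    rw [hLx] at this
    rw [hr t, this, mul_div_cancel_right₀ _ (hne hx)]
  -- If `L` acts on the plane as a reflection, it is composed with the mirror `R` of the arc `(u,
  -- y)`. This mirror is not a rotation about `u`: fixing `y` it would be trivial on the plane, but
  -- it reverses the normal of the arc.
  · obtain ⟨R, hR, hRu, hRy, hRn⟩ := h.mirror hy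
    rcases o.planeCoord_map_of_fix R (hfix R hRu) with hr' | hr'
    · exfalso
      have e1 := hr' y
      rw [hRy] at e1
      have e2 : o.planeCoord (R (o 1)) = 1 :=
        mul_right_cancel₀ (hne hy) (e1.symm.trans (one_mul _).symm)
      -- The normal of the arc: the plane component of `y` after a quarter-turn.
      obtain ⟨n, hn0, hn1, hn2⟩ : ∃ n : E3, o.planeCoord n ≠ 0 ∧ inner ℝ n u = 0 ∧
          inner ℝ n y = 0 := by
        have hcomb : (-(inner ℝ (o 2) y)) • o 1 + inner ℝ (o 1) y • o 2 =
          (0 : ℝ) • o 0 + (-(inner ℝ (o 2) y)) • o 1 + inner ℝ (o 1) y • o 2 := by simp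
        refine ⟨(-(inner ℝ (o 2) y)) • o 1 + inner ℝ (o 1) y • o 2, ?_, ?_, ?_⟩
        · intro hz
          apply hne hy
          rw [hcomb, OrthonormalBasis.planeCoord, o.inner_one_comb, o.inner_two_comb,
            Complex.ext_iff] at hz
          apply Complex.ext
          · exact hz.2
          · exact neg_eq_zero.1 hz.1
        · rw [hu, inner_smul_right, real_inner_comm, hcomb, o.inner_zero_comb, mul_zero]
        · rw [o.inner_eq_three, hcomb, o.inner_zero_comb, o.inner_one_comb, o.inner_two_comb]
          ring
      have := hr' n
      rw [e2, one_mul, hRn n hn1 hn2] at this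
      apply hn0
      have h2 : o.planeCoord (-n) = -o.planeCoord n := by
        apply Complex.ext <;> simp [OrthonormalBasis.planeCoord]
      rw [h2] at this
      exact self_eq_neg.1 this.symm
    · refine ⟨R * L, Γ.mul_mem hR hL, ?_, ?_, fun t => ?_⟩
      · rw [linearIsometryEquiv_mul_apply, hfix L hLu, hfix R hRu]
      · rw [linearIsometryEquiv_mul_apply, hLx, hRy]
      · rw [linearIsometryEquiv_mul_apply, hr' (L t), hr t]
        have e1 := hr x
        have e2 := hr' y
        rw [hLx] at e1
        rw [hRy] at e2
        have hcx : conj (o.planeCoord x) ≠ 0 := by simpa using hne hx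
        have hcy : conj (o.planeCoord y) ≠ 0 := by simpa using hne hy
        have e3 : o.planeCoord (L (o 1)) = o.planeCoord y / conj (o.planeCoord x) := by
          rw [eq_div_iff hcx, ← e1]
        have e4 : o.planeCoord (R (o 1)) = o.planeCoord y / conj (o.planeCoord y) := by
          rw [eq_div_iff hcy, ← e2]
        rw [e3, e4]
        simp only [map_mul, map_div₀, Complex.conj_conj]
        field_simp

theorem planeCoord_base {o : OrthonormalBasis (Fin 3) ℝ E3}
    (hu' : u' = ℓ • (c • o 0 + √(1 - c ^ 2) • o 1)) :
    o.planeCoord u' = ((ℓ * √(1 - c ^ 2) : ℝ) : ℂ) := by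
  have : u' = (ℓ * c) • o 0 + (ℓ * √(1 - c ^ 2)) • o 1 + (0 : ℝ) • o 2 := by
    rw [hu']; module
  rw [OrthonormalBasis.planeCoord, this, o.inner_one_comb, o.inner_two_comb]
  rfl

/-- The neighbours of `u` form a regular `r`-gon around `u`, and the rotation by `2π/r` about `u`
belongs to the group. -/
theorem exists_rotation (h : LocalData A Γ ℓ c) (hA : A u u')
    {o : OrthonormalBasis (Fin 3) ℝ E3} (hu : u = ℓ • o 0)
    (hu' : u' = ℓ • (c • o 0 + √(1 - c ^ 2) • o 1)) :
    ∃ r : ℕ, 3 ≤ r ∧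
      (∀ x, A u x ↔ ∃ ω : ℂ, ω ^ r = 1 ∧
        x = ℓ • (c • o 0 + √(1 - c ^ 2) • (ω.re • o 1 + ω.im • o 2))) ∧
      ∀ ω : ℂ, ω ^ r = 1 → ∃ S ∈ Γ, S (o 0) = o 0 ∧ S (o 1) = ω.re • o 1 + ω.im • o 2 ∧
        S (o 2) = (-ω.im) • o 1 + ω.re • o 2 := by
  have hpos := h.pos
  have hspos := h.sin_pos
  set s := √(1 - c ^ 2) with hs
  have hls : (((ℓ * s : ℝ)) : ℂ) ≠ 0 := by
    rw [Complex.ofReal_ne_zero]; positivity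
  have hbase := planeCoord_base hu'
  rw [← hs] at hbase
  have hform : ∀ x (ω : ℂ), inner ℝ (o 0) x = ℓ * c → o.planeCoord x = ω * ((ℓ * s : ℝ) : ℂ) →
      x = ℓ • (c • o 0 + s • (ω.re • o 1 + ω.im • o 2)) := by
    intro x ω h0 h1
    have e : ℓ • (c • o 0 + s • (ω.re • o 1 + ω.im • o 2)) =
      (ℓ * c) • o 0 + (ℓ * s * ω.re) • o 1 + (ℓ * s * ω.im) • o 2 := by module
    have h2 := congrArg Complex.re h1
    have h3 := congrArg Complex.im h1
    simp only [OrthonormalBasis.planeCoord, Complex.re_mul_ofReal, Complex.im_mul_ofReal] at h2 h3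
    rw [e]
    apply o.ext_three
    · rw [o.inner_zero_comb, h0]
    · rw [o.inner_one_comb, h2]; ring
    · rw [o.inner_two_comb, h3]; ring
  -- The positions of the neighbours on their circle, normalized so that `u'` is at `1`. The
  -- rotations between neighbours make this set closed under multiplication.
  let H : Set ℂ := {ω | ∃ x, A u x ∧ o.planeCoord x = ω * ((ℓ * s : ℝ) : ℂ)}
  have hrot : ∀ ω ∈ H, ∃ S ∈ Γ, S (o 0) = o 0 ∧ 
      ∀ t, o.planeCoord (S t) = ω * o.planeCoord t := by
    rintro ω ⟨x, hx, hxω⟩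
    obtain ⟨S, hS, hS0, -, hSt⟩ := h.exists_rotation_between hu hA hx
    refine ⟨S, hS, hS0, fun t => ?_⟩
    rw [hSt, hbase, hxω, mul_div_cancel_right₀ _ hls]
  have hH : ∃ r : ℕ, 0 < r ∧ ∀ x, x ∈ H ↔ x ^ r = 1 := by
    apply exists_roots_of_unity_of_mul_closed
    · have : H ⊆ (fun x => o.planeCoord x / ((ℓ * s : ℝ) : ℂ)) '' {u | ∃ u', A u u'} := by
        rintro ω ⟨x, hx, hxω⟩
        exact ⟨x, ⟨u, h.symm hx⟩, by simp only [hxω]; rw [mul_div_cancel_right₀ _ hls]⟩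
      exact (h.finite.image _).subset this
    · exact ⟨u', hA, by rw [hbase, one_mul]⟩
    · rintro ⟨x, hx, hxω⟩
      have := (h.norm_planeCoord hu hx).2
      rw [hxω, zero_mul, norm_zero] at this
      have : 0 < ℓ * s := by positivity
      linarith
    · rintro x hx y ⟨t, ht, hty⟩
      obtain ⟨S, hS, hS0, hSt⟩ := hrot x hx
      refine ⟨S t, ?_, by rw [hSt, hty, mul_assoc]⟩
      have := h.map hS ht
      rwa [hu, map_smul, hS0, ← hu] at this
  obtain ⟨r, hr, hHr⟩ := hH
  have hnbr : ∀ x, A u x ↔ ∃ ω : ℂ, ω ^ r = 1 ∧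
        x = ℓ • (c • o 0 + s • (ω.re • o 1 + ω.im • o 2)) := by
    intro x
    constructor
    · intro hx
      have hω : o.planeCoord x = o.planeCoord x / ((ℓ * s : ℝ) : ℂ) * ((ℓ * s : ℝ) : ℂ) := by
        rw [div_mul_cancel₀ _ hls]
      exact ⟨_, (hHr _).1 ⟨x, hx, hω⟩, hform x _ (h.norm_planeCoord hu hx).1 hω⟩
    · rintro ⟨ω, hω, rfl⟩
      obtain ⟨x, hx, hxω⟩ := (hHr ω).2 hω
      rwa [← hform x ω (h.norm_planeCoord hu hx).1 hxω]
  refine ⟨r, ?_, hnbr, fun ω hω => ?_⟩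
  -- For `r ≤ 2` all neighbours of a node lie in the plane of that node and one neighbour. By
  -- connectedness all nodes then lie in the plane of `u` and `u'`, against `nonplanar`.
  · by_contra! hlt
    have hnb : ∀ x, A u x → x = u' ∨ x = (2 * c) • u - u' := by
      intro x hx
      obtain ⟨ω, hω, rfl⟩ := (hnbr x).1 hx
      have : ω = 1 ∨ ω = -1 := by
        rw [← sq_eq_one_iff]
        interval_cases r
        · rw [pow_one] at hω; rw [hω, one_pow]
        · exact hω
      rcases this with rfl | rfl
      · left; rw [hu']; simp
      · right; rw [hu', hu]; simp; module
    have hnb' : ∀ {b a x}, A b a → A b x → x = a ∨ x = (2 * c) • b - a := by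
      intro b a x hba hbx
      obtain ⟨L, hL, rfl, rfl⟩ := h.trans hA hba
      obtain ⟨y, rfl⟩ := L.surjective x
      rcases hnb y ((h.map_iff hL).1 hbx) with rfl | rfl
      · exact Or.inl rfl
      · right; simp
    have ho2 : o 2 ≠ 0 := fun e => by simpa [e] using o.orthonormal.1 2
    obtain ⟨w, w', hw, hne⟩ := h.nonplanar ho2
    apply hne
    have hu2 : inner ℝ (o 2) u = 0 := by
      rw [hu, inner_smul_right, o.inner_zero (by decide), mul_zero]
    have hu2' : inner ℝ (o 2) u' = 0 := by
      rw [hu']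
      simp [inner_smul_right, inner_add_right, o.inner_zero]
    have key : ∀ a, Relation.ReflTransGen A u a →
        inner ℝ (o 2) a = 0 ∧ ∀ x, A a x → inner ℝ (o 2) x = 0 := by
      have base : ∀ {b a}, A b a → inner ℝ (o 2) b = 0 → inner ℝ (o 2) a = 0 →
          ∀ x, A b x → inner ℝ (o 2) x = 0 := by
        intro b a hba hb ha x hx
        rcases hnb' hba hx with rfl | rfl
        · exact ha
        · rw [inner_sub_right, inner_smul_right, ha, hb]; simp
      intro a ha
      induction ha with
      | refl => exact ⟨hu2, base hA hu2 hu2'⟩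
      | tail _ hab ih => exact ⟨ih.2 _ hab, base (h.symm hab) (ih.2 _ hab) ih.1⟩
    exact (key w (h.connected hA hw)).1
  · obtain ⟨S, hS, hS0, hSt⟩ := hrot ω ((hHr ω).2 hω)
    have hperp : ∀ i, i ≠ 0 → inner ℝ (o 0) (S (o i)) = 0 := fun i hi => by
      rw [← hS0, S.inner_map_map]; exact o.inner_zero hi.symm
    refine ⟨S, hS, hS0, ?_, ?_⟩
    · have e := hSt (o 1)
      have e2 := congrArg Complex.re e
      have e3 := congrArg Complex.im e
      simp [OrthonormalBasis.planeCoord, o.inner_zero] at e2 e3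
      have : ω.re • o 1 + ω.im • o 2 = (0 : ℝ) • o 0 + ω.re • o 1 + ω.im • o 2 := by simp
      rw [this]
      apply o.ext_three
      · rw [o.inner_zero_comb, hperp 1 (by decide)]
      · rw [o.inner_one_comb, e2]
      · rw [o.inner_two_comb, e3]
    · have e := hSt (o 2)
      have e2 := congrArg Complex.re e
      have e3 := congrArg Complex.im e
      simp [OrthonormalBasis.planeCoord, o.inner_zero] at e2 e3
      have : (-ω.im) • o 1 + ω.re • o 2 = (0 : ℝ) • o 0 + (-ω.im) • o 1 + ω.re • o 2 := by simp
      rw [this]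
      apply o.ext_three
      · rw [o.inner_zero_comb, hperp 2 (by decide)]
      · rw [o.inner_one_comb, e2]
      · rw [o.inner_two_comb, e3]

end LocalData

end


/-! ### Integrality of traces and cosines; traces of products of rotations. -/

noncomputable section

open scoped ComplexConjugate

/-! ### Integrality -/

/-- The complex eigenvalues are roots of unity, hence algebraic integers, and the trace is their
sum. -/
theorem isIntegral_trace_of_pow_eq_one {L : E3 →ₗ[ℝ] E3} {k : ℕ} (hk : 0 < k) (h : L ^ k = 1) :
    IsIntegral ℤ (LinearMap.trace ℝ E3 L) := by
  classical
  let b := (EuclideanSpace.basisFun (Fin 3) ℝ).toBasis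
  rw [LinearMap.trace_eq_matrix_trace ℝ b]
  set M := LinearMap.toMatrix b b L with hM
  have hMk : M ^ k = 1 := by
    rw [hM, LinearMap.toMatrix_pow, h]
    exact LinearMap.toMatrix_one b
  set N := (algebraMap ℝ ℂ).mapMatrix M with hN
  have hNk : N ^ k = 1 := by rw [hN, ← map_pow, hMk, map_one]
  have htr : algebraMap ℝ ℂ M.trace = N.trace := by simp [hN, Matrix.trace, RingHom.mapMatrix]
  rw [← isIntegral_algebraMap_iff (FaithfulSMul.algebraMap_injective ℝ ℂ), htr,
    Matrix.trace_eq_sum_roots_charpoly]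
  refine IsIntegral.multiset_sum fun μ hμ => ?_
  rw [Polynomial.mem_roots N.charpoly_monic.ne_zero] at hμ
  have := spectrum.pow_mem_pow N k (Matrix.mem_spectrum_of_isRoot_charpoly hμ)
  rw [hNk, spectrum.one_eq, Set.mem_singleton_iff] at this
  exact IsIntegral.of_pow hk (this ▸ isIntegral_one)

/-- An algebraic integer that is the real part of a root of unity is `0` or `±1`. -/
theorem eq_zero_of_isIntegral_of_re_root {x : ℝ} (hx : IsIntegral ℤ x) (hlt : |x| < 1) {l : ℂ}
    {n : ℕ} (hn : 0 < n) (hl : l ^ n = 1) (hre : l.re = x) : x = 0 := by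
  obtain ⟨θ, hθ⟩ : ∃ θ : ℝ, l = Complex.exp (θ * Complex.I) := by
    have : ‖l‖ = 1 := Complex.norm_eq_one_of_pow_eq_one hl hn.ne'
    exact ⟨l.arg, by rw [← one_mul (Complex.exp _), ← Complex.ofReal_one, ← this, Complex.norm_mul_exp_arg_mul_I]⟩
  have hxθ : x = Real.cos θ := by rw [← hre, hθ, Complex.exp_ofReal_mul_I_re]
  have hnθ : Real.cos (n * θ) = 1 := by
    have := congrArg Complex.re hl
    rw [hθ, ← Complex.exp_nat_mul, ← mul_assoc, ← Complex.ofReal_natCast, ← Complex.ofReal_mul, Complex.exp_ofReal_mul_I_re] at this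
    simpa using this
  -- Here `T_n (cos θ) = cos (n θ) = 1`, and every complex root of `T_n - 1` is the cosine of a real
  -- angle. So all conjugates of `x` have modulus at most one.
  let P : Polynomial ℤ := Polynomial.Chebyshev.T ℤ n - 1
  have hP : Polynomial.aeval x P = 0 := by
    simp only [P, map_sub, Polynomial.Chebyshev.aeval_T, map_one]
    rw [hxθ, Polynomial.Chebyshev.T_real_cos]
    simp [hnθ]
  have hroot : ∀ w : ℂ, Polynomial.aeval w P = 0 → ‖w‖ ≤ 1 := by
    intro w hw
    obtain ⟨z, rfl⟩ := Complex.cos_surjective w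
    simp only [P, map_sub, Polynomial.Chebyshev.aeval_T, map_one,
      Polynomial.Chebyshev.T_complex_cos, sub_eq_zero] at hw
    obtain ⟨k, hk⟩ := Complex.cos_eq_one_iff.1 hw
    have hz : z = ((k * (2 * Real.pi) / n : ℝ) : ℂ) := by
      have : (n : ℂ) ≠ 0 := by exact_mod_cast hn.ne'
      push_cast
      rw [eq_div_iff this, hk]
      push_cast; ring
    rw [hz, ← Complex.ofReal_cos, Complex.norm_real]
    exact Real.abs_cos_le_one _
  set p := minpoly ℤ x with hp
  have hdvd : p ∣ P := minpoly.isIntegrallyClosed_dvd hx hP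
  have hmonic : p.Monic := minpoly.monic hx
  set pc := p.map (algebraMap ℤ ℂ) with hpc
  have hpcm : pc.Monic := hmonic.map _
  have hroots : ∀ w ∈ pc.roots, ‖w‖ ≤ 1 := by
    intro w hw
    apply hroot
    rw [Polynomial.mem_roots hpcm.ne_zero, hpc, Polynomial.IsRoot, Polynomial.eval_map_algebraMap] at hw
    obtain ⟨q, hq⟩ := hdvd
    rw [hq, map_mul, hw, zero_mul]
  have hxroot : (x : ℂ) ∈ pc.roots := by
    rw [Polynomial.mem_roots hpcm.ne_zero, hpc, Polynomial.IsRoot, Polynomial.eval_map_algebraMap]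
    have := congrArg (algebraMap ℝ ℂ) (minpoly.aeval ℤ x)
    rw [← Polynomial.aeval_algebraMap_apply, map_zero] at this
    exact this
  -- Up to sign this integer is the product of the conjugates, one of which is `x` with `|x| < 1`.
  -- It therefore vanishes, and `X` divides the irreducible minimal polynomial.
  have hcoeff : ‖pc.coeff 0‖ < 1 := by
    rw [(IsAlgClosed.splits pc).coeff_zero_eq_prod_roots_of_monic hpcm, norm_mul, norm_pow, norm_neg, norm_one,
      one_pow, one_mul, ← Multiset.cons_erase hxroot, Multiset.prod_cons, norm_mul, Complex.norm_real]
    have : ‖(pc.roots.erase (x : ℂ)).prod‖ ≤ 1 := by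
      have hall : ∀ w ∈ pc.roots.erase (x : ℂ), ‖w‖ ≤ 1 := fun w hw =>
        hroots w (Multiset.mem_of_mem_erase hw)
      generalize pc.roots.erase (x : ℂ) = m at hall
      induction m using Multiset.induction_on with
      | empty => simp
      | cons a m ih =>
        rw [Multiset.prod_cons, norm_mul]
        exact mul_le_one₀ (hall a (by simp)) (norm_nonneg _)
          (ih fun w hw => hall w (Multiset.mem_cons_of_mem hw))
    calc ‖x‖ * _ ≤ ‖x‖ * 1 := by gcongr
      _ < 1 := by rw [mul_one]; exact hlt
  have h0 : p.coeff 0 = 0 := by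
    rw [hpc, Polynomial.coeff_map] at hcoeff
    simp only [algebraMap_int_eq, eq_intCast, Complex.norm_intCast] at hcoeff
    have : |p.coeff 0| < 1 := by exact_mod_cast hcoeff
    exact Int.abs_lt_one_iff.1 this
  obtain ⟨q, hq⟩ := Polynomial.X_dvd_iff.2 h0
  have hirr : Irreducible p := minpoly.irreducible hx
  have hax : Polynomial.aeval x p = 0 := minpoly.aeval ℤ x
  rcases hirr.isUnit_or_isUnit hq with hu | hu
  · exact absurd hu Polynomial.not_isUnit_X
  · rw [hq, map_mul, Polynomial.aeval_X] at hax
    exact (mul_eq_zero.1 hax).resolve_right ((hu.map (Polynomial.aeval x)).ne_zero)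

namespace LocalData

variable {A : E3 → E3 → Prop} {Γ : Subgroup (E3 ≃ₗᵢ[ℝ] E3)} {ℓ c : ℝ} {u u' : E3}

theorem fix_basis (h : LocalData A Γ ℓ c) {o : OrthonormalBasis (Fin 3) ℝ E3} (hu : u = ℓ • o 0)
    (hu' : u' = ℓ • (c • o 0 + √(1 - c ^ 2) • o 1)) {L M : E3 ≃ₗᵢ[ℝ] E3} (h0 : L u = M u)
    (h1 : L u' = M u') : L (o 0) = M (o 0) ∧ L (o 1) = M (o 1) := by
  have e0 : L (o 0) = M (o 0) := by
    rw [hu, map_smul, map_smul] at h0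
    exact smul_right_injective _ h.pos.ne' h0
  refine ⟨e0, ?_⟩
  rw [hu', map_smul, map_smul] at h1
  have := smul_right_injective _ h.pos.ne' h1
  simp only [map_add, map_smul, e0] at this
  exact smul_right_injective _ h.sin_pos.ne' (add_left_cancel this)

/-- A symmetry exchanging the ends of an arc acts on the plane of the arc as the reflection in the
bisector, and by a sign on the normal. The mirror of the arc corrects this sign to `+1`, so that a
plane reflection results. -/
theorem exists_swap (h : LocalData A Γ ℓ c) (hA : A u u')
    {o : OrthonormalBasis (Fin 3) ℝ E3} (hu : u = ℓ • o 0)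
    (hu' : u' = ℓ • (c • o 0 + √(1 - c ^ 2) • o 1)) :
    ∃ g ∈ Γ, g (o 0) = c • o 0 + √(1 - c ^ 2) • o 1 ∧
      g (o 1) = √(1 - c ^ 2) • o 0 - c • o 1 ∧ g (o 2) = o 2 := by
  have hspos := h.sin_pos
  have hs2 := h.sin_sq
  have hfix := @fix_basis A Γ ℓ c u u' h o hu hu'
  set s := √(1 - c ^ 2) with hs
  obtain ⟨L, hL, h0, h1⟩ := h.trans hA (h.symm hA)
  have e0 : L (o 0) = c • o 0 + s • o 1 := by
    rw [hu, hu', map_smul] at h0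
    exact smul_right_injective _ h.pos.ne' h0
  have e1 : L (o 1) = s • o 0 - c • o 1 := by
    rw [hu, hu', map_smul] at h1
    have := smul_right_injective _ h.pos.ne' h1
    simp only [map_add, map_smul, e0] at this
    apply smul_right_injective _ hspos.ne'
    change s • L (o 1) = s • (s • o 0 - c • o 1)
    have e : s • L (o 1) = o 0 - c • (c • o 0 + s • o 1) := eq_sub_of_add_eq' this
    rw [e]
    have : s • (s • o 0 - c • o 1) = (s ^ 2) • o 0 - (s * c) • o 1 := by module
    rw [this, hs2]; module
  have p0 : inner ℝ (L (o 0)) (L (o 2)) = 0 := by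
    rw [L.inner_map_map]; exact o.inner_zero (by decide)
  have p1 : inner ℝ (L (o 1)) (L (o 2)) = 0 := by
    rw [L.inner_map_map]; exact o.inner_zero (by decide)
  have p2 : inner ℝ (L (o 2)) (L (o 2)) = 1 := by rw [L.inner_map_map, o.inner_self_one]
  rw [e0, inner_add_left, inner_smul_left, inner_smul_left, conj_trivial, conj_trivial] at p0
  rw [e1, inner_sub_left, inner_smul_left, inner_smul_left, conj_trivial, conj_trivial] at p1
  have q0 : inner ℝ (o 0) (L (o 2)) = 0 := by
    have : (s ^ 2 + c ^ 2) * inner ℝ (o 0) (L (o 2)) = 0 := by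
      linear_combination c * p0 + s * p1
    rw [hs2] at this; simpa using this
  have q1 : inner ℝ (o 1) (L (o 2)) = 0 := by
    have : (s ^ 2 + c ^ 2) * inner ℝ (o 1) (L (o 2)) = 0 := by
      linear_combination s * p0 - c * p1
    rw [hs2] at this; simpa using this
  rw [o.inner_eq_three, q0, q1] at p2
  have e2 : L (o 2) = inner ℝ (o 2) (L (o 2)) • o 2 := by
    conv_lhs => rw [o.eq_sum_three (L (o 2)), q0, q1]
    simp
  have : inner ℝ (o 2) (L (o 2)) = 1 ∨ inner ℝ (o 2) (L (o 2)) = -1 := by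
    rw [← sq_eq_one_iff]; linarith
  rcases this with e | e
  · exact ⟨L, hL, e0, e1, by rw [e2, e, one_smul]⟩
  · obtain ⟨R, hR, hRu, hRu', hRn⟩ := h.mirror hA
    obtain ⟨r0, r1⟩ := hfix (L := R) (M := 1) hRu hRu'
    have r2 : R (o 2) = -(o 2) := by
      apply hRn
      · rw [hu, inner_smul_right, o.inner_zero (by decide), mul_zero]
      · rw [hu']; simp [inner_add_right, inner_smul_right, o.inner_zero]
    refine ⟨R * L, Γ.mul_mem hR hL, ?_, ?_, ?_⟩
    · rw [linearIsometryEquiv_mul_apply, e0, map_add, map_smul, map_smul, r0, r1]; rfl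
    · rw [linearIsometryEquiv_mul_apply, e1, map_sub, map_smul, map_smul, r0, r1]; rfl
    · rw [linearIsometryEquiv_mul_apply, e2, e, map_smul, r2]; simp

theorem trace_eq_three (o : OrthonormalBasis (Fin 3) ℝ E3) (L : E3 ≃ₗᵢ[ℝ] E3) :
    LinearMap.trace ℝ E3 (L : E3 →ₗ[ℝ] E3) =
      inner ℝ (o 0) (L (o 0)) + inner ℝ (o 1) (L (o 1)) + inner ℝ (o 2) (L (o 2)) := by
  rw [LinearMap.trace_eq_sum_inner _ o, Fin.sum_univ_three]; rfl

theorem trace_rotation {o : OrthonormalBasis (Fin 3) ℝ E3} {S : E3 ≃ₗᵢ[ℝ] E3} {ω : ℂ}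
    (S0 : S (o 0) = o 0) (S1 : S (o 1) = ω.re • o 1 + ω.im • o 2)
    (S2 : S (o 2) = (-ω.im) • o 1 + ω.re • o 2) :
    LinearMap.trace ℝ E3 (S : E3 →ₗ[ℝ] E3) = 1 + 2 * ω.re := by
  rw [trace_eq_three o, S0, S1, S2]
  simp [inner_add_right, inner_smul_right, o.inner_zero]
  ring

/-- With `g` from `exists_swap`, the product `g T g` is a rotation about the other end of the arc,
so this is the trace of a product of rotations about both ends. -/
theorem trace_rotation_swap {o : OrthonormalBasis (Fin 3) ℝ E3} {S T g : E3 ≃ₗᵢ[ℝ] E3} {ω υ : ℂ}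
    {s : ℝ}
    (S0 : S (o 0) = o 0) (S1 : S (o 1) = ω.re • o 1 + ω.im • o 2)
    (S2 : S (o 2) = (-ω.im) • o 1 + ω.re • o 2)
    (T0 : T (o 0) = o 0) (T1 : T (o 1) = υ.re • o 1 + υ.im • o 2)
    (T2 : T (o 2) = (-υ.im) • o 1 + υ.re • o 2)
    (g0 : g (o 0) = c • o 0 + s • o 1) (g1 : g (o 1) = s • o 0 - c • o 1) (g2 : g (o 2) = o 2) :
    LinearMap.trace ℝ E3 ((S * (g * (T * g)) : E3 ≃ₗᵢ[ℝ] E3) : E3 →ₗ[ℝ] E3) =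
      c ^ 2 + s ^ 2 * υ.re + ω.re * s ^ 2 + ω.re * υ.re * c ^ 2 + 2 * ω.im * υ.im * c
        + ω.re * υ.re := by
  rw [trace_eq_three o]
  simp only [linearIsometryEquiv_mul_apply, S0, S1, S2, T0, T1, T2, g0, g1, g2, map_add, map_sub,
    map_smul]
  simp [inner_add_right, inner_sub_right, inner_smul_right, o.inner_zero]
  ring

/-- The traces that decide the shape of the vertex-figure. -/
theorem exists_traces (h : LocalData A Γ ℓ c) (hA : A u u')
    {o : OrthonormalBasis (Fin 3) ℝ E3} (hu : u = ℓ • o 0)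
    (hu' : u' = ℓ • (c • o 0 + √(1 - c ^ 2) • o 1)) {ω : ℂ} (hω : ‖ω‖ = 1)
    (hS : ∃ S ∈ Γ, S (o 0) = o 0 ∧ S (o 1) = ω.re • o 1 + ω.im • o 2 ∧
        S (o 2) = (-ω.im) • o 1 + ω.re • o 2) :
    (∃ L ∈ Γ, LinearMap.trace ℝ E3 (L : E3 →ₗ[ℝ] E3) = 1 + 2 * ω.re) ∧
    (∃ L ∈ Γ, LinearMap.trace ℝ E3 (L : E3 →ₗ[ℝ] E3) = (1 + ω.re + (1 - ω.re) * c) ^ 2 - 1) ∧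
    ∃ L ∈ Γ, LinearMap.trace ℝ E3 (L : E3 →ₗ[ℝ] E3) = (1 + ω.re - (1 - ω.re) * c) ^ 2 - 1 := by
  obtain ⟨g, hg, g0, g1, g2⟩ := h.exists_swap hA hu hu'
  obtain ⟨S, hS, S0, S1, S2⟩ := hS
  have hs2 := h.sin_sq
  have hn : ω.re ^ 2 + ω.im ^ 2 = 1 := by
    have := Complex.normSq_eq_norm_sq ω
    rw [Complex.normSq_apply, hω] at this; linarith
  have hinv : ∀ x y, S x = y → S⁻¹ y = x := fun x y e => by
    rw [← e, ← linearIsometryEquiv_mul_apply, inv_mul_cancel]; rfl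
  have T0 : S⁻¹ (o 0) = o 0 := hinv _ _ S0
  have T1 : S⁻¹ (o 1) = (conj ω).re • o 1 + (conj ω).im • o 2 := by
    apply hinv
    simp only [Complex.conj_re, Complex.conj_im, map_add, map_smul, S1, S2]
    have : ω.re • (ω.re • o 1 + ω.im • o 2) + -ω.im • (-ω.im • o 1 + ω.re • o 2) =
      (ω.re ^ 2 + ω.im ^ 2) • o 1 := by module
    rw [this, hn, one_smul]
  have T2 : S⁻¹ (o 2) = (-(conj ω).im) • o 1 + (conj ω).re • o 2 := by
    apply hinv
    simp only [Complex.conj_re, Complex.conj_im, map_add, map_smul, S1, S2, neg_neg]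
    have : ω.im • (ω.re • o 1 + ω.im • o 2) + ω.re • (-ω.im • o 1 + ω.re • o 2) =
      (ω.re ^ 2 + ω.im ^ 2) • o 2 := by module
    rw [this, hn, one_smul]
  -- For `ω = exp (iα)`, the elements `S g S g` and `S g S⁻¹ g` are products of rotations by `±α`
  -- about the two ends of the arc. Half of their angle `θ` has cosine `cos² (α/2) ± c sin² (α/2)`,
  -- and a rotation by `θ` has trace `4 cos² (θ/2) - 1`.
  refine ⟨⟨S, hS, trace_rotation S0 S1 S2⟩,
    ⟨_, Γ.mul_mem hS (Γ.mul_mem hg (Γ.mul_mem hS hg)), ?_⟩,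
    ⟨_, Γ.mul_mem hS (Γ.mul_mem hg (Γ.mul_mem (Γ.inv_mem hS) hg)), ?_⟩⟩
  · rw [trace_rotation_swap S0 S1 S2 S0 S1 S2 g0 g1 g2, hs2]
    linear_combination 2 * c * hn
  · rw [trace_rotation_swap S0 S1 S2 T0 T1 T2 g0 g1 g2, hs2]
    simp only [Complex.conj_re, Complex.conj_im]
    linear_combination -2 * c * hn

/-- The neighbours of each node are described by the same order `r`. -/
theorem exists_order (h : LocalData A Γ ℓ c) :
    ∃ r : ℕ, 3 ≤ r ∧
      (∀ a b n, A a b → inner ℝ n a = 0 → inner ℝ n b = 0 → ‖n‖ ^ 2 = ℓ ^ 2 * (1 - c ^ 2) →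
        ∀ x, A a x ↔ ∃ ω : ℂ, ω ^ r = 1 ∧ x = c • a + (ω.re • (b - c • a) + ω.im • n)) ∧
      ∃ u u', A u u' ∧ ∃ o : OrthonormalBasis (Fin 3) ℝ E3, u = ℓ • o 0 ∧
        u' = ℓ • (c • o 0 + √(1 - c ^ 2) • o 1) ∧
        ∀ ω : ℂ, ω ^ r = 1 → ∃ S ∈ Γ, S (o 0) = o 0 ∧ S (o 1) = ω.re • o 1 + ω.im • o 2 ∧
        S (o 2) = (-ω.im) • o 1 + ω.re • o 2 := by
  obtain ⟨u, u', hA⟩ := h.exists_arc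
  obtain ⟨o, hu, hu'⟩ := h.exists_basis hA
  obtain ⟨r, hr, hnbr, hrot⟩ := h.exists_rotation hA hu hu'
  refine ⟨r, hr, ?_, u, u', hA, o, hu, hu', hrot⟩
  intro a b n hab hna hnb hn x
  have hs2 := h.sin_sq
  have hfix := @fix_basis A Γ ℓ c u u' h o hu hu'
  set s := √(1 - c ^ 2) with hs
  obtain ⟨L, hL, rfl, rfl⟩ := h.trans hA hab
  obtain ⟨m, rfl⟩ := L.surjective n
  rw [L.inner_map_map] at hna hnb
  rw [L.norm_map] at hn
  have hm0 : inner ℝ (o 0) m = 0 := by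
    rw [hu, inner_smul_right] at hna
    rw [real_inner_comm]
    exact (mul_eq_zero.1 hna).resolve_left h.pos.ne'
  have hm1 : inner ℝ (o 1) m = 0 := by
    rw [hu', inner_smul_right, inner_add_right, inner_smul_right, inner_smul_right,
      real_inner_comm, hm0] at hnb
    rw [real_inner_comm]
    have := (mul_eq_zero.1 hnb).resolve_left h.pos.ne'
    rw [mul_zero, zero_add] at this
    exact (mul_eq_zero.1 this).resolve_left h.sin_pos.ne'
  have hm : m = inner ℝ (o 2) m • o 2 := by
    conv_lhs => rw [o.eq_sum_three m, hm0, hm1]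
    simp
  -- The normal is determined up to sign. The other sign amounts to replacing `ω` by its conjugate,
  -- which is again an `r`-th root of unity.
  have hsgn : inner ℝ (o 2) m = ℓ * s ∨ inner ℝ (o 2) m = -(ℓ * s) := by
    rw [← sq_eq_sq_iff_eq_or_eq_neg, mul_pow, hs2, ← hn, ← real_inner_self_eq_norm_sq,
      o.inner_eq_three m m, hm0, hm1]
    ring
  obtain ⟨y, rfl⟩ := L.surjective x
  rw [h.map_iff hL, hnbr]
  have hform : ∀ (ω : ℂ) (σ : ℝ), inner ℝ (o 2) m = σ * (ℓ * s) →
      c • L u + (ω.re • (L u' - c • L u) + ω.im • L m) =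
      L (ℓ • (c • o 0 + s • (ω.re • o 1 + (σ * ω.im) • o 2))) := by
    intro ω σ hσ
    have e1 : u' - c • u = (ℓ * s) • o 1 := by rw [hu, hu']; module
    have e2 : c • L u + (ω.re • (L u' - c • L u) + ω.im • L m) =
      L (c • u + (ω.re • (u' - c • u) + ω.im • m)) := by simp
    rw [e2, e1, hm, hσ, hu]
    congr 1; module
  rcases hsgn with e | e
  · refine exists_congr fun ω => and_congr_right fun _ => ?_
    rw [hform ω 1 (by rw [e, one_mul]), one_mul, L.injective.eq_iff]
  · constructor
    · rintro ⟨ω, hω, rfl⟩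
      refine ⟨conj ω, by rw [← map_pow, hω, map_one], ?_⟩
      rw [hform _ (-1) (by rw [e, neg_one_mul])]
      simp
    · rintro ⟨ω, hω, hy⟩
      refine ⟨conj ω, by rw [← map_pow, hω, map_one], ?_⟩
      rw [hform _ (-1) (by rw [e, neg_one_mul]), L.injective.eq_iff] at hy
      rw [hy]
      simp

end LocalData

end


/-! ### The possible orders `r` and face angles. -/

noncomputable section

open scoped ComplexConjugate

theorem cos_two_pi_div_injective {r s : ℕ} (hr : 3 ≤ r) (hs : 3 ≤ s)
    (h : Real.cos (2 * Real.pi / r) = Real.cos (2 * Real.pi / s)) : r = s := by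
  have hπ := Real.pi_pos
  have key : ∀ {k : ℕ}, 3 ≤ k → 2 * Real.pi / k ∈ Set.Icc 0 Real.pi := fun {k} hk => by
    have : (3 : ℝ) ≤ k := by exact_mod_cast hk
    refine ⟨by positivity, ?_⟩
    rw [div_le_iff₀ (by positivity)]
    nlinarith
  have h1 := Real.injOn_cos (key hr) (key hs) h
  have hr0 : (r : ℝ) ≠ 0 := by positivity
  have hs0 : (s : ℝ) ≠ 0 := by positivity
  field_simp at h1
  exact_mod_cast h1.symm

theorem cos_two_pi_div_three : Real.cos (2 * Real.pi / (3 : ℕ)) = -1 / 2 := by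
  have : 2 * Real.pi / (3 : ℕ) = 2 * (Real.pi / 3) := by push_cast; ring
  rw [this, Real.cos_two_mul, Real.cos_pi_div_three]; norm_num

theorem cos_two_pi_div_four : Real.cos (2 * Real.pi / (4 : ℕ)) = 0 := by
  have : 2 * Real.pi / (4 : ℕ) = Real.pi / 2 := by push_cast; ring
  rw [this, Real.cos_pi_div_two]

theorem cos_two_pi_div_five : Real.cos (2 * Real.pi / (5 : ℕ)) = (√5 - 1) / 4 := by
  have : 2 * Real.pi / (5 : ℕ) = 2 * (Real.pi / 5) := by push_cast; ring
  rw [this, Real.cos_two_mul, Real.cos_pi_div_five]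
  have : √5 ^ 2 = 5 := Real.sq_sqrt (by norm_num)
  linear_combination this / 8

theorem cos_two_pi_div_six : Real.cos (2 * Real.pi / (6 : ℕ)) = 1 / 2 := by
  have : 2 * Real.pi / (6 : ℕ) = Real.pi / 3 := by push_cast; ring
  rw [this, Real.cos_pi_div_three]

/-- The vertex-figures compatible with a lattice. -/
theorem order_cases_of_int {r : ℕ} (hr : 3 ≤ r) {c z : ℝ} (hz : z = Real.cos (2 * Real.pi / r))
    (hc : c ^ 2 < 1) {k l m : ℤ} (h0 : 1 + 2 * z = k) (h1 : (1 + z + (1 - z) * c) ^ 2 - 1 = l)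
    (h2 : (1 + z - (1 - z) * c) ^ 2 - 1 = m) :
    (r = 4 ∧ c = 0) ∨ (r = 3 ∧ (c = 1 / 3 ∨ c = -1 / 3)) := by
  have hπ := Real.pi_pos
  have hr' : (3 : ℝ) ≤ r := by exact_mod_cast hr
  have hz1 : -1 / 2 ≤ z := by
    rw [hz, ← cos_two_pi_div_three]
    apply Real.cos_le_cos_of_nonneg_of_le_pi
    · positivity
    · push_cast; linarith
    · push_cast; gcongr
  have hz2 : z < 1 := by
    rw [hz, ← Real.cos_zero]
    apply Real.cos_lt_cos_of_nonneg_of_le_pi le_rfl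
    · rw [div_le_iff₀ (by positivity)]; nlinarith
    · positivity
  have hk0 : (-1 : ℝ) < k := by rw [← h0]; linarith
  have hk1 : (k : ℝ) < 3 := by rw [← h0]; linarith
  have hk0' : -1 < k := by exact_mod_cast hk0
  have hk1' : k < 3 := by exact_mod_cast hk1
  have habs : |c| < 1 := by rwa [← sq_lt_one_iff_abs_lt_one]
  obtain ⟨hc1, hc2⟩ := abs_lt.1 habs
  -- These values stand for `r = 3, 4, 6`. In each case the difference of `h1` and `h2` shows that a
  -- multiple of `c` is an integer in a short interval, and their sum gives a congruence for this
  -- integer.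
  have hkc : k = 0 ∨ k = 1 ∨ k = 2 := by omega
  rcases hkc with rfl | rfl | rfl
  · right
    have hz3 : z = -1 / 2 := by push_cast at h0; linarith
    refine ⟨cos_two_pi_div_injective hr le_rfl (by rw [cos_two_pi_div_three, ← hz, hz3]), ?_⟩
    rw [hz3] at h1 h2
    have e1 : 3 * c = ((l - m : ℤ) : ℝ) := by push_cast; linarith
    have e2 : 1 + (3 * c) ^ 2 = 2 * ((l + m + 2 : ℤ) : ℝ) := by push_cast; linarith
    have b1 : (-3 : ℝ) < ((l - m : ℤ) : ℝ) := by rw [← e1]; linarith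
    have b2 : ((l - m : ℤ) : ℝ) < 3 := by rw [← e1]; linarith
    rw [e1] at e2
    have e3 : 1 + (l - m) ^ 2 = 2 * (l + m + 2) := by exact_mod_cast e2
    have b1' : -3 < l - m := by exact_mod_cast b1
    have b2' : l - m < 3 := by exact_mod_cast b2
    generalize l - m = t at *
    have : t = -2 ∨ t = -1 ∨ t = 0 ∨ t = 1 ∨ t = 2 := by omega
    rcases this with rfl | rfl | rfl | rfl | rfl
    · omega
    · right; push_cast at e1; linarith
    · omega
    · left; push_cast at e1; linarith
    · omega
  · left
    have hz3 : z = 0 := by push_cast at h0; linarith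
    refine ⟨cos_two_pi_div_injective hr (by norm_num) (by rw [cos_two_pi_div_four, ← hz, hz3]), ?_⟩
    rw [hz3] at h1 h2
    have e1 : 4 * c = ((l - m : ℤ) : ℝ) := by push_cast; linarith
    have e2 : 16 + (4 * c) ^ 2 = 8 * ((l + m + 2 : ℤ) : ℝ) := by push_cast; linarith
    have b1 : (-4 : ℝ) < ((l - m : ℤ) : ℝ) := by rw [← e1]; linarith
    have b2 : ((l - m : ℤ) : ℝ) < 4 := by rw [← e1]; linarith
    rw [e1] at e2
    have e3 : 16 + (l - m) ^ 2 = 8 * (l + m + 2) := by exact_mod_cast e2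
    have b1' : -4 < l - m := by exact_mod_cast b1
    have b2' : l - m < 4 := by exact_mod_cast b2
    generalize l - m = t at *
    have : t = -3 ∨ t = -2 ∨ t = -1 ∨ t = 0 ∨ t = 1 ∨ t = 2 ∨ t = 3 := by omega
    rcases this with rfl | rfl | rfl | rfl | rfl | rfl | rfl
    · omega
    · omega
    · omega
    · push_cast at e1; linarith
    · omega
    · omega
    · omega
  -- Order six would require `81 + t ^ 2` to be divisible by `18` for an integer `t` with `|t| < 3`.
  · exfalso
    have hz3 : z = 1 / 2 := by push_cast at h0; linarith
    rw [hz3] at h1 h2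
    have e1 : 3 * c = ((l - m : ℤ) : ℝ) := by push_cast; linarith
    have e2 : 81 + (3 * c) ^ 2 = 18 * ((l + m + 2 : ℤ) : ℝ) := by push_cast; linarith
    have b1 : (-3 : ℝ) < ((l - m : ℤ) : ℝ) := by rw [← e1]; linarith
    have b2 : ((l - m : ℤ) : ℝ) < 3 := by rw [← e1]; linarith
    rw [e1] at e2
    have e3 : 81 + (l - m) ^ 2 = 18 * (l + m + 2) := by exact_mod_cast e2
    have b1' : -3 < l - m := by exact_mod_cast b1
    have b2' : l - m < 3 := by exact_mod_cast b2
    generalize l - m = t at *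
    have : t = -2 ∨ t = -1 ∨ t = 0 ∨ t = 1 ∨ t = 2 := by omega
    rcases this with rfl | rfl | rfl | rfl | rfl <;> omega

theorem not_isIntegral_half : ¬ IsIntegral ℤ (1 / 2 : ℝ) := by
  intro h
  obtain ⟨k, hk⟩ := (h.exists_int_iff_exists_rat).1 ⟨1 / 2, by norm_num⟩
  have : (1 : ℝ) = ((2 * k : ℤ) : ℝ) := by push_cast; rw [← hk]; norm_num
  have : 1 = 2 * k := by exact_mod_cast this
  omega

/-- The vertex-figures compatible with finite planar faces. -/
theorem order_cases_of_isIntegral {r : ℕ} (hr : 3 ≤ r) (hr6 : r < 6) {c z : ℝ}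
    (hz : z = Real.cos (2 * Real.pi / r)) (hc : c ^ 2 < 1)
    (h1 : IsIntegral ℤ ((1 + z - (1 - z) * c) ^ 2 - 1)) {l : ℂ} {n : ℕ} (hn : 0 < n)
    (hl : l ^ n = 1) (hre : l.re = -c) : r = 4 ∧ c = 0 := by
  have habs : |c| < 1 := by rwa [← sq_lt_one_iff_abs_lt_one]
  -- The square of this number is integral, hence so is the number.
  have hy : IsIntegral ℤ (1 + z - (1 - z) * c) := by
    refine IsIntegral.of_pow (n := 2) (by norm_num) ?_
    simpa using h1.add isIntegral_one
  -- Up to sign `2c` is the sum of the root of unity `l` and its conjugate.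
  have h2c : IsIntegral ℤ (2 * c) := by
    have hli : IsIntegral ℤ l := IsIntegral.of_pow hn (hl ▸ isIntegral_one)
    have hlc : IsIntegral ℤ (conj l) := by
      refine IsIntegral.of_pow hn ?_
      rw [← map_pow, hl, map_one]; exact isIntegral_one
    have := (hli.add hlc).neg
    rw [Complex.add_conj, hre] at this
    rw [← isIntegral_algebraMap_iff (FaithfulSMul.algebraMap_injective ℝ ℂ)]
    have e : algebraMap ℝ ℂ (2 * c) = -((2 * -c : ℝ) : ℂ) := by
      rw [Complex.coe_algebraMap]; push_cast; ring
    rw [e]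
    exact this
  have h2 : IsIntegral ℤ (2 : ℝ) := by simpa using isIntegral_algebraMap (R := ℤ) (A := ℝ) (x := 2)
  -- As soon as `c` itself is integral it vanishes. For each order it remains to express `c` as an
  -- integral combination of the known algebraic integers.
  have hzero : IsIntegral ℤ c → c = 0 := fun hi => by
    have := eq_zero_of_isIntegral_of_re_root hi.neg (by rwa [abs_neg]) hn hl hre
    simpa using this
  have hcases : r = 3 ∨ r = 4 ∨ r = 5 := by omega
  rcases hcases with rfl | rfl | rfl
  · exfalso
    rw [cos_two_pi_div_three] at hz
    have hci : IsIntegral ℤ c := by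
      have e : c = 1 - 2 * (1 + z - (1 - z) * c) - 2 * c := by rw [hz]; ring
      rw [e]; exact (isIntegral_one.sub (h2.mul hy)).sub h2c
    rw [hzero hci, hz] at hy
    apply not_isIntegral_half
    convert hy using 1; norm_num
  · rw [cos_two_pi_div_four] at hz
    refine ⟨rfl, hzero ?_⟩
    have e : c = 1 - (1 + z - (1 - z) * c) := by rw [hz]; ring
    rw [e]; exact isIntegral_one.sub hy
  · exfalso
    rw [cos_two_pi_div_five] at hz
    have h5 : √5 ^ 2 = 5 := Real.sq_sqrt (by norm_num)
    have hφ : IsIntegral ℤ ((1 + √5) / 2) := by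
      refine ⟨Polynomial.X ^ 2 - Polynomial.X - 1, by monicity!, ?_⟩
      simp
    have hci : IsIntegral ℤ c := by
      have e : c = ((1 + √5) / 2 + 1 - 2 * (1 + z - (1 - z) * c)) * ((1 + √5) / 2 + 2) -
          2 * (2 * c) := by
        rw [hz]; linear_combination (1 / 4 * c) * h5
      rw [e]
      exact ((((hφ.add isIntegral_one).sub (h2.mul hy)).mul (hφ.add h2))).sub (h2.mul h2c)
    rw [hzero hci, hz] at hy
    apply not_isIntegral_half
    -- For `c = 0` the integral number is `(3 + √5) / 4`; its product with `2 - φ = (3 - √5) / 2`,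
    -- where `φ` is the golden ratio, is `1 / 2`.
    have e : (1 / 2 : ℝ) = (1 + (√5 - 1) / 4 - (1 - (√5 - 1) / 4) * 0) *
        (1 + 1 - (1 + √5) / 2) := by
      linear_combination h5 / 8
    rw [e]
    exact hy.mul ((isIntegral_one.add isIntegral_one).sub hφ)

namespace LocalData

variable {A : E3 → E3 → Prop} {Γ : Subgroup (E3 ≃ₗᵢ[ℝ] E3)} {ℓ c : ℝ} {u u' : E3}

/-- The rotation about the base node, transported to `a`: it fixes the part of `x` along `a` and
turns the perpendicular part through an angle with cosine `ω.re`. The factor `ℓ ^ 2` avoids a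
division. -/
theorem exists_node_rotation (h : LocalData A Γ ℓ c) {o : OrthonormalBasis (Fin 3) ℝ E3}
    (hA : A u u') (hu : u = ℓ • o 0) {ω : ℂ} {S : E3 ≃ₗᵢ[ℝ] E3} (hS : S ∈ Γ) (S0 : S (o 0) = o 0)
    (S1 : S (o 1) = ω.re • o 1 + ω.im • o 2) (S2 : S (o 2) = (-ω.im) • o 1 + ω.re • o 2)
    {a a' : E3} (ha : A a a') :
    ∃ T ∈ Γ, ∀ x, ℓ ^ 2 * inner ℝ x (T x) =
      inner ℝ x a ^ 2 * (1 - ω.re) + ω.re * (ℓ ^ 2 * inner ℝ x x) := by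
  obtain ⟨L, hL, rfl, rfl⟩ := h.trans hA ha
  refine ⟨L * (S * L⁻¹), Γ.mul_mem hL (Γ.mul_mem hS (Γ.inv_mem hL)), fun x => ?_⟩
  obtain ⟨y, rfl⟩ := L.surjective x
  have : L⁻¹ (L y) = y := by
    rw [← linearIsometryEquiv_mul_apply, inv_mul_cancel]; rfl
  rw [linearIsometryEquiv_mul_apply, linearIsometryEquiv_mul_apply, this, L.inner_map_map,
    L.inner_map_map, L.inner_map_map, hu, inner_smul_right]
  have hSy : S y = inner ℝ (o 0) y • o 0 +
      (ω.re * inner ℝ (o 1) y - ω.im * inner ℝ (o 2) y) • o 1 +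
      (ω.im * inner ℝ (o 1) y + ω.re * inner ℝ (o 2) y) • o 2 := by
    conv_lhs => rw [o.eq_sum_three y]
    simp only [map_add, map_smul, S0, S1, S2]
    module
  rw [o.inner_eq_three y (S y), o.inner_eq_three y y, hSy, o.inner_zero_comb, o.inner_one_comb,
    o.inner_two_comb, real_inner_comm]
  ring

/-- The rotations about the nodes have order less than six. -/
theorem order_lt_six (h : LocalData A Γ ℓ c) {z : ℝ} (hz1 : -1 < z) (hz2 : z < 1)
    (hrot : ∀ a a', A a a' → ∃ T ∈ Γ, ∀ x, ℓ ^ 2 * inner ℝ x (T x) =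
      inner ℝ x a ^ 2 * (1 - z) + z * (ℓ ^ 2 * inner ℝ x x)) : z < 1 / 2 := by
  have hpos := h.pos
  -- Among the pairs of non-collinear nodes one is chosen for which the lines through them enclose
  -- the smallest angle, the cosine being `k`. If `T` rotates about `a`, the pair `(b, T b)` cannot
  -- enclose a smaller angle; this gives `z ≤ k / (1 + k) < 1 / 2`.
  let B : Set (E3 × E3) := {p | ((∃ a', A p.1 a') ∧ ∃ b', A p.2 b') ∧
    |inner ℝ p.1 p.2| < ℓ ^ 2}
  have hB : B.Finite := by
    refine ((h.finite.prod h.finite).subset ?_)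
    rintro ⟨a, b⟩ ⟨⟨ha, hb⟩, -⟩
    exact ⟨ha, hb⟩
  have hBne : B.Nonempty := by
    obtain ⟨u, u', hA⟩ := h.exists_arc
    refine ⟨(u, u'), ⟨⟨u', hA⟩, ⟨u, h.symm hA⟩⟩, ?_⟩
    change |inner ℝ u u'| < ℓ ^ 2
    rw [h.inner_eq hA, abs_mul, abs_of_nonneg (sq_nonneg ℓ)]
    have : |c| < 1 := by rw [← sq_lt_one_iff_abs_lt_one]; exact h.lt
    nlinarith [sq_pos_of_pos hpos]
  obtain ⟨⟨a, b⟩, ⟨⟨⟨a', ha⟩, ⟨b', hb⟩⟩, hlt⟩, hmax⟩ :=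
    Set.exists_max_image B (fun p => |inner ℝ p.1 p.2|) hB hBne
  simp only at hlt ha hb
  obtain ⟨T, hT, hTx⟩ := hrot a a' ha
  have e := hTx b
  have hbb : inner ℝ b b = ℓ ^ 2 := by rw [real_inner_self_eq_norm_sq, h.norm_eq hb]
  have hl2 : 0 < ℓ ^ 2 := by positivity
  rw [hbb, real_inner_comm a b] at e
  set k := |inner ℝ a b| / ℓ ^ 2 with hk
  have hk0 : 0 ≤ k := by positivity
  have hk1 : k < 1 := by rw [hk, div_lt_one hl2]; exact hlt
  have hab : inner ℝ a b ^ 2 = (ℓ ^ 2 * k) ^ 2 := by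
    rw [hk, mul_div_cancel₀ _ hl2.ne', sq_abs]
  have hkl : |inner ℝ a b| = ℓ ^ 2 * k := by rw [hk, mul_div_cancel₀ _ hl2.ne']
  rw [hab] at e
  have e' : inner ℝ b (T b) = ℓ ^ 2 * (k ^ 2 * (1 - z) + z) := by
    apply mul_left_cancel₀ hl2.ne'
    rw [e]; ring
  have hb1 : k ^ 2 * (1 - z) + z < 1 := by
    have hkk : k ^ 2 < 1 := by nlinarith
    nlinarith [mul_pos (sub_pos.2 hkk) (sub_pos.2 hz2)]
  have hb2 : -1 < k ^ 2 * (1 - z) + z := by nlinarith [sq_nonneg k]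
  have hmem : (b, T b) ∈ B := by
    refine ⟨⟨⟨b', hb⟩, ⟨T b', h.map hT hb⟩⟩, ?_⟩
    change |inner ℝ b (T b)| < ℓ ^ 2
    rw [e', abs_mul, abs_of_pos hl2]
    have : |k ^ 2 * (1 - z) + z| < 1 := abs_lt.2 ⟨hb2, hb1⟩
    nlinarith
  have hle := hmax _ hmem
  simp only at hle
  rw [e', hkl, abs_mul, abs_of_pos hl2] at hle
  have hle' : k ^ 2 * (1 - z) + z ≤ k := (le_abs_self _).trans (le_of_mul_le_mul_left hle hl2)
  by_contra! hge
  have : k ^ 2 * (1 - z) + z - k = (1 - k) * (z * (1 + k) - k) := by ring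
  have h3 : 0 < (1 - k) * (z * (1 + k) - k) := by
    apply mul_pos (by linarith)
    nlinarith
  linarith

theorem exp_root (r : ℕ) (hr : r ≠ 0) : ∃ ω : ℂ, ω ^ r = 1 ∧ ‖ω‖ = 1 ∧
    ω.re = Real.cos (2 * Real.pi / r) := by
  have hp := Complex.isPrimitiveRoot_exp r hr
  refine ⟨_, hp.pow_eq_one, Complex.norm_eq_one_of_pow_eq_one hp.pow_eq_one hr, ?_⟩
  have : 2 * (Real.pi : ℂ) * Complex.I / r = ((2 * Real.pi / r : ℝ) : ℂ) * Complex.I := by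
    push_cast; ring
  rw [this, Complex.exp_ofReal_mul_I_re]

/-- The neighbours of `a`, given one neighbour `b`. -/
def NeighbourRule (A : E3 → E3 → Prop) (ℓ c : ℝ) (r : ℕ) : Prop :=
  ∀ a b n, A a b → inner ℝ n a = 0 → inner ℝ n b = 0 → ‖n‖ ^ 2 = ℓ ^ 2 * (1 - c ^ 2) →
    ∀ x, A a x ↔ ∃ ω : ℂ, ω ^ r = 1 ∧ x = c • a + (ω.re • (b - c • a) + ω.im • n)

/-- For the case of point reflections, where the special group preserves a lattice. -/
theorem neighbourRule_of_int (h : LocalData A Γ ℓ c)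
    (hint : ∀ L ∈ Γ, ∃ k : ℤ, LinearMap.trace ℝ E3 (L : E3 →ₗ[ℝ] E3) = k) :
    (NeighbourRule A ℓ c 4 ∧ c = 0) ∨ (NeighbourRule A ℓ c 3 ∧ (c = 1 / 3 ∨ c = -1 / 3)) := by
  obtain ⟨r, hr, hnb, u, u', hA, o, hu, hu', hrot⟩ := h.exists_order
  obtain ⟨ω, hω, hn, hre⟩ := exp_root r (by omega)
  obtain ⟨⟨L0, hL0, h0⟩, ⟨L1, hL1, h1⟩, ⟨L2, hL2, h2⟩⟩ := h.exists_traces hA hu hu' hn (hrot ω hω)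
  obtain ⟨k0, e0⟩ := hint L0 hL0
  obtain ⟨k1, e1⟩ := hint L1 hL1
  obtain ⟨k2, e2⟩ := hint L2 hL2
  rcases order_cases_of_int hr hre h.lt (h0.symm.trans e0) (h1.symm.trans e1) (h2.symm.trans e2)
    with ⟨rfl, hc⟩ | ⟨rfl, hc⟩
  · exact Or.inl ⟨hnb, hc⟩
  · exact Or.inr ⟨hnb, hc⟩

/-- For the case of bisector reflections, where the traces are only known to be algebraic integers.
The root of unity comes from a closed planar face, whose exterior angle has cosine `-c`. -/
theorem neighbourRule_of_isIntegral (h : LocalData A Γ ℓ c)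
    (hint : ∀ L ∈ Γ, IsIntegral ℤ (LinearMap.trace ℝ E3 (L : E3 →ₗ[ℝ] E3)))
    {l : ℂ} {n : ℕ} (hn : 0 < n) (hl : l ^ n = 1) (hre : l.re = -c) :
    NeighbourRule A ℓ c 4 ∧ c = 0 := by
  obtain ⟨r, hr, hnb, u, u', hA, o, hu, hu', hrot⟩ := h.exists_order
  obtain ⟨ω, hω, hnω, hreω⟩ := exp_root r (by omega)
  obtain ⟨-, -, ⟨L2, hL2, h2⟩⟩ := h.exists_traces hA hu hu' hnω (hrot ω hω)
  obtain ⟨S, hS, S0, S1, S2⟩ := hrot ω hω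
  have hr' : (3 : ℝ) ≤ r := by exact_mod_cast hr
  have hπ := Real.pi_pos
  have hz1 : -1 < ω.re := by
    have : -1 / 2 ≤ ω.re := by
      rw [hreω, ← cos_two_pi_div_three]
      apply Real.cos_le_cos_of_nonneg_of_le_pi
      · positivity
      · push_cast; linarith
      · push_cast; gcongr
    linarith
  have hz2 : ω.re < 1 := by
    rw [hreω, ← Real.cos_zero]
    apply Real.cos_lt_cos_of_nonneg_of_le_pi le_rfl
    · rw [div_le_iff₀ (by positivity)]; nlinarith
    · positivity
  have hlt := h.order_lt_six hz1 hz2 fun a a' ha =>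
    h.exists_node_rotation hA hu hS S0 S1 S2 ha
  have hr6 : r < 6 := by
    by_contra! hge
    have hge' : (6 : ℝ) ≤ r := by exact_mod_cast hge
    have : 1 / 2 ≤ ω.re := by
      rw [hreω, ← cos_two_pi_div_six]
      apply Real.cos_le_cos_of_nonneg_of_le_pi
      · positivity
      · push_cast; linarith
      · push_cast; gcongr
    linarith
  have hi := hint L2 hL2
  rw [h2] at hi
  obtain ⟨rfl, hc⟩ := order_cases_of_isIntegral hr hr6 hreω h.lt hi hn hl hre
  exact ⟨hnb, hc⟩

/-- Every element of the special group has finite order. -/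
theorem isIntegral_trace (h : LocalData A Γ ℓ c) {L : E3 ≃ₗᵢ[ℝ] E3} (hL : L ∈ Γ) :
    IsIntegral ℤ (LinearMap.trace ℝ E3 (L : E3 →ₗ[ℝ] E3)) := by
  let N : Set E3 := {u | ∃ u', A u u'}
  have : Finite N := h.finite
  have hmaps : ∀ M ∈ Γ, ∀ x ∈ N, M x ∈ N := fun M hM x ⟨y, hxy⟩ => ⟨M y, h.map hM hxy⟩
  have hcancel : ∀ M : E3 ≃ₗᵢ[ℝ] E3, ∀ x, M⁻¹ (M x) = x := fun M x => by
    rw [← linearIsometryEquiv_mul_apply, inv_mul_cancel]; rfl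
  have hcancel' : ∀ M : E3 ≃ₗᵢ[ℝ] E3, ∀ x, M (M⁻¹ x) = x := fun M x => by
    rw [← linearIsometryEquiv_mul_apply, mul_inv_cancel]; rfl
  let e : Equiv.Perm N :=
    { toFun := fun x => ⟨L x, hmaps L hL x x.2⟩
      invFun := fun x => ⟨L⁻¹ (x : E3), hmaps _ (Γ.inv_mem hL) x x.2⟩
      left_inv := fun x => Subtype.ext (hcancel L x)
      right_inv := fun x => Subtype.ext (hcancel' L x) }
  obtain ⟨k, hk, hek⟩ := isOfFinOrder_iff_pow_eq_one.1 (isOfFinOrder_of_finite e)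
  have hpow : ∀ (j : ℕ) (x : N), (((L : E3 →ₗ[ℝ] E3) ^ j) x : E3) = ((e ^ j) x : N) := by
    intro j
    induction j with
    | zero => intro x; rfl
    | succ j ih =>
      intro x
      rw [pow_succ, pow_succ, Module.End.mul_apply, Equiv.Perm.mul_apply, ← ih]
      rfl
  refine isIntegral_trace_of_pow_eq_one hk ?_
  -- No plane contains all nodes, so they span the space, and a power of `L` that fixes each node is
  -- the identity.
  have hspan : Submodule.span ℝ N = ⊤ := by
    rw [← Submodule.orthogonal_eq_bot_iff, Submodule.eq_bot_iff]
    intro n hn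
    by_contra hne
    obtain ⟨w, w', hw, hnw⟩ := h.nonplanar hne
    exact hnw (Submodule.inner_left_of_mem_orthogonal (Submodule.subset_span (show w ∈ N from ⟨w', hw⟩)) hn)
  refine LinearMap.ext_on hspan fun x hx => ?_
  rw [hpow k ⟨x, hx⟩, hek]; rfl

end LocalData

end


/-! ### Linear parts of isometries, the common angle of the faces, and the face mirrors. -/

noncomputable section

/-- The linear part of an isometry. -/
def linearPart (g : E3 ≃ᵢ E3) : E3 ≃ₗᵢ[ℝ] E3 := g.toRealAffineIsometryEquiv.linearIsometryEquiv

theorem linearPart_sub (g : E3 ≃ᵢ E3) (x y : E3) : linearPart g (x - y) = g x - g y := by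
  have := g.toRealAffineIsometryEquiv.map_vsub x y
  rw [g.coeFn_toRealAffineIsometryEquiv] at this
  exact this

theorem linearPart_eq {g : E3 ≃ᵢ E3} {v x : E3} : g x = g v + linearPart g (x - v) := by
  rw [linearPart_sub]; abel

theorem linearPart_mul (g h : E3 ≃ᵢ E3) : linearPart (g * h) = linearPart g * linearPart h := by
  ext1 x
  have h1 := linearPart_sub (g * h) x 0
  have h2 := linearPart_sub h x 0
  rw [sub_zero] at h1 h2
  rw [h1, linearIsometryEquiv_mul_apply, h2, linearPart_sub]
  rfl

theorem linearPart_one : linearPart 1 = 1 := by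
  ext1 x
  have h1 := linearPart_sub 1 x 0
  rw [sub_zero] at h1
  rw [h1]; simp

theorem linearPart_inv (g : E3 ≃ᵢ E3) : linearPart g⁻¹ = (linearPart g)⁻¹ := by
  rw [eq_inv_iff_mul_eq_one, ← linearPart_mul, inv_mul_cancel, linearPart_one]

theorem isometryEquiv_mul_apply (g h : E3 ≃ᵢ E3) (x : E3) : (g * h) x = g (h x) := rfl

theorem isometryEquiv_inv_apply_self (g : E3 ≃ᵢ E3) (x : E3) : g⁻¹ (g x) = x := g.symm_apply_apply x

theorem isometryEquiv_apply_inv_self (g : E3 ≃ᵢ E3) (x : E3) : g (g⁻¹ x) = x := g.apply_symm_apply x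

/-- Two vectors of length `ℓ` that enclose an angle with cosine `c ≠ ±1`. -/
structure IsIsoscelesPair (ℓ c : ℝ) (a b : E3) : Prop where
  pos : 0 < ℓ
  lt : c ^ 2 < 1
  left : ‖a‖ = ℓ
  right : ‖b‖ = ℓ
  inner_eq : inner ℝ a b = ℓ ^ 2 * c

namespace IsIsoscelesPair

variable {ℓ c : ℝ} {a b : E3}

theorem exists_basis (h : IsIsoscelesPair ℓ c a b) : ∃ o : OrthonormalBasis (Fin 3) ℝ E3,
    a = ℓ • o 0 ∧ b = ℓ • (c • o 0 + √(1 - c ^ 2) • o 1) :=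
  exists_adapted_basis h.pos h.lt h.left h.right h.inner_eq

theorem sin_pos (h : IsIsoscelesPair ℓ c a b) : 0 < √(1 - c ^ 2) :=
  Real.sqrt_pos.2 (by linarith [h.lt])

theorem map (h : IsIsoscelesPair ℓ c a b) (L : E3 ≃ₗᵢ[ℝ] E3) :
    IsIsoscelesPair ℓ c (L a) (L b) :=
  ⟨h.pos, h.lt, by rw [L.norm_map, h.left], by rw [L.norm_map, h.right],
    by rw [L.inner_map_map, h.inner_eq]⟩

theorem perp_iff (h : IsIsoscelesPair ℓ c a b) {o : OrthonormalBasis (Fin 3) ℝ E3}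
    (ha : a = ℓ • o 0) (hb : b = ℓ • (c • o 0 + √(1 - c ^ 2) • o 1)) {n : E3}
    (hna : inner ℝ n a = 0) (hnb : inner ℝ n b = 0) : n = inner ℝ (o 2) n • o 2 := by
  have hm0 : inner ℝ (o 0) n = 0 := by
    rw [ha, inner_smul_right] at hna
    rw [real_inner_comm]
    exact (mul_eq_zero.1 hna).resolve_left h.pos.ne'
  have hm1 : inner ℝ (o 1) n = 0 := by
    rw [hb, inner_smul_right, inner_add_right, inner_smul_right, inner_smul_right,
      real_inner_comm, hm0] at hnb
    rw [real_inner_comm]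
    have := (mul_eq_zero.1 hnb).resolve_left h.pos.ne'
    rw [mul_zero, zero_add] at this
    exact (mul_eq_zero.1 this).resolve_left h.sin_pos.ne'
  conv_lhs => rw [o.eq_sum_three n, hm0, hm1]
  simp

theorem basis_two_perp {o : OrthonormalBasis (Fin 3) ℝ E3}
    (ha : a = ℓ • o 0) (hb : b = ℓ • (c • o 0 + √(1 - c ^ 2) • o 1)) :
    inner ℝ (o 2) a = 0 ∧ inner ℝ (o 2) b = 0 := by
  constructor
  · rw [ha, inner_smul_right, o.inner_zero (by decide), mul_zero]
  · rw [hb]; simp [inner_add_right, inner_smul_right, o.inner_zero]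

/-- The normals of a plane form a line, on which the length determines a vector up to sign. -/
theorem eq_or_eq_neg (h : IsIsoscelesPair ℓ c a b) {m n : E3} (hma : inner ℝ m a = 0)
    (hmb : inner ℝ m b = 0) (hna : inner ℝ n a = 0) (hnb : inner ℝ n b = 0) (hmn : ‖m‖ = ‖n‖) :
    m = n ∨ m = -n := by
  obtain ⟨o, ha, hb⟩ := h.exists_basis
  have em := h.perp_iff ha hb hma hmb
  have en := h.perp_iff ha hb hna hnb
  have : |inner ℝ (o 2) m| = |inner ℝ (o 2) n| := by
    rw [em, en, norm_smul, norm_smul, o.orthonormal.1] at hmn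
    simpa using hmn
  rw [abs_eq_abs] at this
  rcases this with e | e
  · left; rw [em, en, e]
  · right; rw [em, e, neg_smul, ← en]

theorem mem_span (h : IsIsoscelesPair ℓ c a b) {n x : E3} (hn : n ≠ 0) (hna : inner ℝ n a = 0)
    (hnb : inner ℝ n b = 0) (hnx : inner ℝ n x = 0) : ∃ s t : ℝ, x = s • a + t • b := by
  obtain ⟨o, ha, hb⟩ := h.exists_basis
  have en := h.perp_iff ha hb hna hnb
  have h2 : inner ℝ (o 2) x = 0 := by
    rw [en, inner_smul_left, conj_trivial] at hnx
    refine (mul_eq_zero.1 hnx).resolve_left fun e => hn ?_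
    rw [en, e, zero_smul]
  have hpos := h.pos
  have hspos := h.sin_pos
  set s := √(1 - c ^ 2)
  set x0 := inner ℝ (o 0) x with hx0
  set x1 := inner ℝ (o 1) x with hx1
  refine ⟨(x0 - x1 / s * c) / ℓ, x1 / s / ℓ, ?_⟩
  have e : ((x0 - x1 / s * c) / ℓ) • a + (x1 / s / ℓ) • b = x0 • o 0 + x1 • o 1 := by
    rw [ha, hb]
    match_scalars <;> field_simp
    ring
  rw [e]
  conv_lhs => rw [o.eq_sum_three x, h2]
  simp [hx0, hx1]

theorem ext_map (h : IsIsoscelesPair ℓ c a b) {L M : E3 ≃ₗᵢ[ℝ] E3} (ha : L a = M a)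
    (hb : L b = M b) {n x : E3} (hn : n ≠ 0) (hna : inner ℝ n a = 0)
    (hnb : inner ℝ n b = 0) (hnx : inner ℝ n x = 0) : L x = M x := by
  obtain ⟨s, t, rfl⟩ := h.mem_span hn hna hnb hnx
  simp [ha, hb]

theorem ext_all (h : IsIsoscelesPair ℓ c a b) {L M : E3 ≃ₗᵢ[ℝ] E3} (ha : L a = M a)
    (hb : L b = M b) {n : E3} (hn : ‖n‖ = 1) (hna : inner ℝ n a = 0)
    (hnb : inner ℝ n b = 0) (hLM : L n = M n) : L = M := by
  have hn0 : n ≠ 0 := fun e => by simp [e] at hn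
  ext1 x
  have hx : x = (x - inner ℝ n x • n) + inner ℝ n x • n := by abel
  have hp : inner ℝ n (x - inner ℝ n x • n) = 0 := by
    rw [inner_sub_right, inner_smul_right, real_inner_self_eq_norm_sq, hn]; ring
  rw [hx, map_add, map_add, map_smul, map_smul, hLM, h.ext_map ha hb hn0 hna hnb hp]

end IsIsoscelesPair

theorem eq_of_inner_eq_norm_sq {a b : E3} {ℓ : ℝ} (ha : ‖a‖ = ℓ) (hb : ‖b‖ = ℓ)
    (h : inner ℝ a b = ℓ ^ 2) : a = b := by
  have : ‖a - b‖ ^ 2 = 0 := by rw [norm_sub_sq_real, ha, hb, h]; ring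
  exact sub_eq_zero.1 (norm_eq_zero.1 (pow_eq_zero_iff (two_ne_zero) |>.1 this))

theorem exists_isIsoscelesPair {a b : E3} {ℓ : ℝ} (hℓ : 0 < ℓ) (ha : ‖a‖ = ℓ) (hb : ‖b‖ = ℓ)
    (h1 : a ≠ b) (h2 : a ≠ -b) : ∃ c, IsIsoscelesPair ℓ c a b := by
  have hl : ℓ ^ 2 ≠ 0 := by positivity
  refine ⟨inner ℝ a b / ℓ ^ 2, hℓ, ?_, ha, hb, by rw [mul_div_cancel₀ _ hl]⟩
  have hle : |inner ℝ a b| ≤ ℓ ^ 2 := by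
    have := abs_real_inner_le_norm a b
    rw [ha, hb] at this; nlinarith
  have hlt : |inner ℝ a b| < ℓ ^ 2 := by
    refine lt_of_le_of_ne hle fun e => ?_
    rcases abs_eq (by positivity) |>.1 e with e | e
    · exact h1 (eq_of_inner_eq_norm_sq ha hb e)
    · refine h2 (eq_of_inner_eq_norm_sq ha (by rw [norm_neg, hb]) ?_)
      rw [inner_neg_right, e, neg_neg]
  rw [sq_lt_one_iff_abs_lt_one, abs_div, abs_of_nonneg (sq_nonneg ℓ), div_lt_one (by positivity)]
  exact hlt

namespace Complex2

variable {K : Complex2}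

/-- The faces of `K` turn by the same angle at each vertex, and never go straight on. -/
theorem exists_isIsoscelesPair (hK : K.IsPolygonalComplex) (hreg : K.IsRegular)
    {q₀ : ℤ → E3} (h₀ : K.IsFaceParam q₀) :
    ∃ ℓ c : ℝ, ∀ q, K.IsFaceParam q → IsIsoscelesPair ℓ c (q 1 - q 0) (q (-1) - q 0) := by
  have hnorm : ‖q₀ 1 - q₀ 0‖ = ‖q₀ (-1) - q₀ 0‖ := by
    obtain ⟨g, -, hg⟩ := hreg.exists_map_param hK h₀ h₀.neg
    have h1 := hg 1
    have h0 := hg 0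
    simp only [neg_zero] at h0 h1
    rw [← (linearPart g).norm_map, linearPart_sub, h0, h1]
  have hpos : 0 < ‖q₀ 1 - q₀ 0‖ := by
    rw [norm_pos_iff, sub_ne_zero]; simpa using h₀.succ_ne hK 0
  have hne : q₀ 1 - q₀ 0 ≠ q₀ (-1) - q₀ 0 := by
    intro e
    have := h₀.isParam.ne 0
    simp only [zero_sub, zero_add] at this
    exact this (sub_left_injective e).symm
  -- If one angle were straight, by regularity all angles of all faces would be. A face would be an
  -- arithmetic progression determined by any of its edges, so every edge would lie in a single
  -- face, against `2 ≤ r`.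
  have hstraight : q₀ 1 - q₀ 0 ≠ -(q₀ (-1) - q₀ 0) := by
    intro e
    have hall : ∀ q, K.IsFaceParam q → q 1 - q 0 = q 0 - q (-1) := by
      intro q hq
      obtain ⟨g, -, hg⟩ := hreg.exists_map_param hK h₀ hq
      rw [← hg, ← hg, ← hg, ← linearPart_sub, ← linearPart_sub, e, neg_sub]
    have hdet : ∀ q, K.IsFaceParam q → ∀ i : ℤ, q i = q 0 + (i : ℝ) • (q 1 - q 0) := by
      intro q hq
      have hstep : ∀ i : ℤ, q (i + 1) - q i = q 1 - q 0 := by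
        intro i
        induction i using Int.induction_on with
        | zero => simp
        | succ i ih =>
          have := hall _ (hq.shift (i + 1))
          simp only [zero_add, neg_add_cancel_comm_assoc] at this
          rw [← ih, add_comm _ (1 : ℤ), this]
        | pred i ih =>
          have := hall _ (hq.shift (-i))
          simp only [zero_add] at this
          rw [← ih, sub_add_cancel, add_comm _ (1 : ℤ), this]
          congr 2; ring
      intro i
      induction i using Int.induction_on with
      | zero => simp
      | succ i ih =>
        have := hstep i
        rw [sub_eq_iff_eq_add] at this
        rw [this, ih]; push_cast; module
      | pred i ih =>
        have := hstep (-i - 1)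
        rw [sub_add_cancel, sub_eq_iff_eq_add, ← sub_eq_iff_eq_add'] at this
        rw [← this, ih]; push_cast; module
    obtain ⟨r, hr, hcard⟩ := hK.faces_around_edge
    have he := h₀.mem_edges hK 0
    have hsub : {F ∈ K.faces | s(q₀ 0, q₀ (0 + 1)) ∈ F.edges} ⊆ {Figure.ofSeq q₀} := by
      rintro F ⟨hF, heF⟩
      obtain ⟨q, hq⟩ := (hK.face_polygon F hF).exists_isParam
      obtain ⟨q', hq', h0, h1⟩ := Figure.exists_param_of_incident hq heF (v := q₀ 0) (by simp)
      have h1' := Sym2.congr_right.1 h1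
      have : q' = q₀ := by
        funext i
        rw [hdet q' ⟨F, hF, hq'⟩, hdet q₀ h₀, h0, ← h1']; simp
      rw [Set.mem_singleton_iff, hq'.eq, this]
    have := Set.encard_le_encard hsub
    rw [hcard _ he, Set.encard_singleton] at this
    have : r ≤ 1 := by exact_mod_cast this
    omega
  obtain ⟨c, hc⟩ := _root_.exists_isIsoscelesPair hpos rfl hnorm.symm hne hstraight
  refine ⟨‖q₀ 1 - q₀ 0‖, c, fun q hq => ?_⟩
  obtain ⟨g, -, hg⟩ := hreg.exists_map_param hK h₀ hq
  rw [← hg, ← hg, ← hg, ← linearPart_sub, ← linearPart_sub]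
  exact hc.map _

/-- The face mirrors: the reflection in the plane of each face is a symmetry. -/
def HasMirrors (K : Complex2) : Prop := ∀ q, K.IsFaceParam q → ∃ g ∈ K.symmetryGroup,
  (∀ i, g (q i) = q i) ∧ ∀ n, inner ℝ n (q 1 - q 0) = 0 → inner ℝ n (q (-1) - q 0) = 0 →
    linearPart g n = -n

/-- The isometry is the identity on the face plane and `±1` on the normal line. With the sign `+1`
it would fix every point. -/
theorem linearPart_normal {ℓ c : ℝ} {q : ℤ → E3}
    (hpair : IsIsoscelesPair ℓ c (q 1 - q 0) (q (-1) - q 0)) {g : E3 ≃ᵢ E3}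
    (hg : ∀ i, g (q i) = q i) {x : E3} (hx : g x ≠ x) (n : E3)
    (hn1 : inner ℝ n (q 1 - q 0) = 0) (hn2 : inner ℝ n (q (-1) - q 0) = 0) :
    linearPart g n = -n := by
  have f1 : linearPart g (q 1 - q 0) = q 1 - q 0 := by rw [linearPart_sub, hg, hg]
  have f2 : linearPart g (q (-1) - q 0) = q (-1) - q 0 := by rw [linearPart_sub, hg, hg]
  have hLn1 : inner ℝ (linearPart g n) (q 1 - q 0) = 0 := by
    rw [← f1, (linearPart g).inner_map_map, hn1]
  have hLn2 : inner ℝ (linearPart g n) (q (-1) - q 0) = 0 := by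
    rw [← f2, (linearPart g).inner_map_map, hn2]
  rcases hpair.eq_or_eq_neg hLn1 hLn2 hn1 hn2 ((linearPart g).norm_map n) with e | e
  · by_cases hn : n = 0
    · simp [hn]
    exfalso
    apply hx
    have hnn : ‖n‖ ≠ 0 := norm_ne_zero_iff.2 hn
    have : linearPart g = 1 := by
      apply hpair.ext_all (n := ‖n‖⁻¹ • n) f1 f2
      · rw [norm_smul, norm_inv, norm_norm, inv_mul_cancel₀ hnn]
      · rw [inner_smul_left, hn1, mul_zero]
      · rw [inner_smul_left, hn2, mul_zero]
      · rw [map_smul, e]; rfl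
    rw [linearPart_eq (v := q 0) (g := g), this, hg]
    exact add_sub_cancel _ _
  · exact e

/-- The given symmetry fixes two consecutive vertices and the face, hence all vertices of the face,
and is its mirror by `linearPart_normal`. Conjugation by symmetries carries it to all other faces.
-/
theorem hasMirrors (hK : K.IsPolygonalComplex) (hreg : K.IsRegular) {v : E3} {e : Sym2 E3}
    {F : Figure} (hflag : K.IsFlag v e F) (hstab : K.FlagStabilizerNontrivial v e F) :
    K.HasMirrors := by
  obtain ⟨q₀, hq₀, rfl, rfl, rfl⟩ := exists_isFaceParam_of_flag hK hflag
  obtain ⟨ℓ, c, hpair⟩ := exists_isIsoscelesPair hK hreg hq₀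
  obtain ⟨g, hg, ⟨g0, g1, gF⟩, x, -, hx⟩ := hstab
  have hgq : ∀ i, g (q₀ i) = q₀ i := by
    refine comp_eq_of_flag hq₀ hq₀ g0 ?_ gF
    rw [Sym2.map_mk, g0] at g1
    exact Sym2.congr_right.1 g1
  intro q hq
  obtain ⟨h, hh, hhq⟩ := hreg.exists_map_param hK hq₀ hq
  have hfix : ∀ i, (h * g * h⁻¹) (q i) = q i := fun i => by
    rw [← hhq, isometryEquiv_mul_apply, isometryEquiv_mul_apply, isometryEquiv_inv_apply_self, hgq]
  refine ⟨h * g * h⁻¹, mul_mem (mul_mem hh hg) (inv_mem hh), hfix, ?_⟩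
  apply linearPart_normal (hpair q hq) hfix (x := h x)
  rw [isometryEquiv_mul_apply, isometryEquiv_mul_apply, isometryEquiv_inv_apply_self]
  exact fun e => hx (h.injective e)

/-- The faces are planar. -/
theorem IsFaceParam.inner_eq_zero (hmir : K.HasMirrors) {q : ℤ → E3} (hq : K.IsFaceParam q) {n : E3}
    (hn1 : inner ℝ n (q 1 - q 0) = 0) (hn2 : inner ℝ n (q (-1) - q 0) = 0) (i : ℤ) :
    inner ℝ n (q i - q 0) = 0 := by
  obtain ⟨g, -, hgq, hgn⟩ := hmir q hq
  have := (linearPart g).inner_map_map n (q i - q 0)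
  rw [hgn n hn1 hn2, linearPart_sub, hgq, hgq, inner_neg_left] at this
  linarith

end Complex2

end


/-! ### Arcs at a vertex, and the two kinds of symmetries that reverse a face. -/

noncomputable section

namespace Complex2

variable {K : Complex2}

theorem mem_carrier_of_edge {F : Figure} {v x : E3} (h : s(v, x) ∈ F.edges) : v ∈ F.carrier :=
  ⟨v, x, h, left_mem_segment ℝ v x⟩

/-- Every vertex lies on a face, only finitely many faces meet `C`, and each of these has only
finitely many vertices in `C`. -/
theorem finite_verts_inter (hK : K.IsPolygonalComplex) {C : Set E3} (hC : IsCompact C) :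
    (K.verts ∩ C).Finite := by
  have hF : ∀ F ∈ K.faces, (F.verts ∩ C).Finite := by
    intro F hF
    rcases hK.face_polygon F hF with ⟨n, hn, v, hv, rfl⟩ | ⟨v, hv, rfl, hfin⟩
    · have : NeZero n := ⟨by omega⟩
      exact (Set.finite_range v).inter_of_left C
    · refine ((hfin C hC).image v).subset ?_
      rintro _ ⟨⟨i, rfl⟩, hi⟩
      exact ⟨i, ⟨v i, left_mem_segment ℝ _ _, hi⟩, rfl⟩
  refine ((hK.discrete C hC).biUnion fun F hF' => hF F hF'.1).subset ?_
  rintro v ⟨hv, hvC⟩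
  obtain ⟨x, hx⟩ := exists_edge_of_vert hK hv
  obtain ⟨q, ⟨F, hFK, hq⟩, rfl, rfl⟩ := exists_isFaceParam_of_edge hK hx
  have he : s(q 0, q 1) ∈ F.edges := by simpa using hq.mem_edges 0
  exact Set.mem_biUnion (x := F) ⟨hFK, q 0, mem_carrier_of_edge he, hvC⟩ ⟨hq.mem_verts 0, hvC⟩

/-- `v + a`, `v`, `v + b` are consecutive vertices of a face. -/
def Arc (K : Complex2) (v a b : E3) : Prop :=
  ∃ q, K.IsFaceParam q ∧ q 0 = v ∧ q 1 = v + a ∧ q (-1) = v + b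

theorem Arc.symm {v a b : E3} (h : K.Arc v a b) : K.Arc v b a :=
  let ⟨q, hq, h0, h1, h2⟩ := h
  ⟨_, hq.neg, by simpa using h0, h2, by simpa using h1⟩

theorem Arc.map {v a b : E3} (h : K.Arc v a b) {g : E3 ≃ᵢ E3} (hg : g ∈ K.symmetryGroup) :
    K.Arc (g v) (linearPart g a) (linearPart g b) := by
  obtain ⟨q, hq, rfl, h1, h2⟩ := h
  refine ⟨_, hq.map hg, rfl, ?_, ?_⟩
  · rw [Function.comp, h1, linearPart_eq (v := q 0)]; simp
  · rw [Function.comp, h2, linearPart_eq (v := q 0)]; simp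

theorem IsFaceParam.arc {q : ℤ → E3} (hq : K.IsFaceParam q) :
    K.Arc (q 0) (q 1 - q 0) (q (-1) - q 0) :=
  ⟨q, hq, rfl, by simp, by simp⟩

theorem Arc.isIsoscelesPair {ℓ c : ℝ}
    (hpair : ∀ q, K.IsFaceParam q → IsIsoscelesPair ℓ c (q 1 - q 0) (q (-1) - q 0)) {v a b : E3}
    (h : K.Arc v a b) : IsIsoscelesPair ℓ c a b := by
  obtain ⟨q, hq, rfl, h1, h2⟩ := h
  have := hpair q hq
  rwa [h1, h2, add_sub_cancel_left, add_sub_cancel_left] at this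

theorem Arc.exists_map (hK : K.IsPolygonalComplex) (hreg : K.IsRegular) {v a b w a' b' : E3}
    (h : K.Arc v a b) (h' : K.Arc w a' b') :
    ∃ g ∈ K.symmetryGroup, g v = w ∧ linearPart g a = a' ∧ linearPart g b = b' := by
  obtain ⟨q, hq, rfl, h1, h2⟩ := h
  obtain ⟨q', hq', rfl, h1', h2'⟩ := h'
  obtain ⟨g, hg, hgq⟩ := hreg.exists_map_param hK hq hq'
  refine ⟨g, hg, hgq 0, ?_, ?_⟩
  · have : a = q 1 - q 0 := by rw [h1, add_sub_cancel_left]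
    rw [this, linearPart_sub, hgq, hgq, h1', add_sub_cancel_left]
  · have : b = q (-1) - q 0 := by rw [h2, add_sub_cancel_left]
    rw [this, linearPart_sub, hgq, hgq, h2', add_sub_cancel_left]

theorem exists_arc_of_edge (hK : K.IsPolygonalComplex) {v x : E3} (he : s(v, x) ∈ K.edges) :
    ∃ b, K.Arc v (x - v) b := by
  obtain ⟨q, hq, rfl, rfl⟩ := exists_isFaceParam_of_edge hK he
  exact ⟨_, hq.arc⟩

theorem Arc.mem_edges (hK : K.IsPolygonalComplex) {v a b : E3} (h : K.Arc v a b) :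
    s(v, v + a) ∈ K.edges := by
  obtain ⟨q, hq, rfl, h1, h2⟩ := h
  have := hq.mem_edges hK 0
  rwa [zero_add, h1] at this

/-- The special group of the stabilizer of a vertex. -/
def vertexGroup (K : Complex2) (v : E3) : Subgroup (E3 ≃ₗᵢ[ℝ] E3) where
  carrier := {L | ∃ g ∈ K.symmetryGroup, g v = v ∧ linearPart g = L}
  one_mem' := ⟨1, one_mem _, rfl, linearPart_one⟩
  mul_mem' := by
    rintro _ _ ⟨g, hg, hv, rfl⟩ ⟨h, hh, hv', rfl⟩
    exact ⟨g * h, mul_mem hg hh, by rw [isometryEquiv_mul_apply, hv', hv], linearPart_mul g h⟩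
  inv_mem' := by
    rintro _ ⟨g, hg, hv, rfl⟩
    refine ⟨g⁻¹, inv_mem hg, ?_, linearPart_inv g⟩
    conv_lhs => rw [← hv]
    exact isometryEquiv_inv_apply_self g v

theorem arc_of_vertexFigure_adj (hK : K.IsPolygonalComplex) {v x y : E3} {F : Figure}
    (hF : F ∈ K.faces) (hx : s(v, x) ∈ F.edges) (hy : s(v, y) ∈ F.edges) (hxy : x ≠ y) :
    K.Arc v (x - v) (y - v) := by
  obtain ⟨q, hq⟩ := (hK.face_polygon F hF).exists_isParam
  obtain ⟨q', hq', rfl, h1⟩ := Figure.exists_param_of_incident hq hx (v := v) (by simp)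
  have h1' := Sym2.congr_right.1 h1
  rcases (hq'.nbr 0 y).1 hy with e | e
  · exact ⟨q', ⟨F, hF, hq'⟩, rfl, by simp [h1'], by rw [e]; simp⟩
  · exact absurd (h1'.trans (by rw [e]; simp)) hxy

/-- An adjacency in the vertex-figure is an arc, so this is the connectedness of the vertex-figure.
-/
theorem arc_connected (hK : K.IsPolygonalComplex) {v a a' b b' : E3} (h : K.Arc v a a')
    (h' : K.Arc v b b') : Relation.ReflTransGen (K.Arc v) a b := by
  have ha := h.mem_edges hK
  have hb := h'.mem_edges hK
  have hv : v ∈ K.verts := hK.edge_verts _ ha v (by simp)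
  have hconn := (hK.vertexFigure_connected v hv).preconnected ⟨v + a, ha⟩ ⟨v + b, hb⟩
  rw [SimpleGraph.reachable_iff_reflTransGen] at hconn
  have key : ∀ x y : {u : E3 | s(v, u) ∈ K.edges},
      Relation.ReflTransGen (K.vertexFigure v).Adj x y →
        Relation.ReflTransGen (K.Arc v) (x.1 - v) (y.1 - v) := by
    intro x y hxy
    induction hxy with
    | refl => exact .refl
    | tail _ hyz ih =>
      obtain ⟨hne, F, hF, h1, h2⟩ := hyz
      exact ih.tail (arc_of_vertexFigure_adj hK hF h1 h2 fun e => hne (Subtype.ext e))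
  have := key _ _ hconn
  simpa using this

/-- Only finitely many faces pass through `v`, and each has two edges there. -/
theorem finite_arcs (hK : K.IsPolygonalComplex) (v : E3) : {a | ∃ b, K.Arc v a b}.Finite := by
  have hfin := hK.discrete {v} isCompact_singleton
  have h2 : ∀ F ∈ K.faces, {x | s(v, x) ∈ F.edges}.Finite := by
    intro F hF
    by_cases hne : ∃ x, s(v, x) ∈ F.edges
    · obtain ⟨x, hx⟩ := hne
      obtain ⟨q, hq⟩ := (hK.face_polygon F hF).exists_isParam
      obtain ⟨q', hq', rfl, h1⟩ := Figure.exists_param_of_incident hq hx (v := v) (by simp)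
      refine (Set.toFinite {q' (0 - 1), q' (0 + 1)}).subset fun y hy => ?_
      exact (hq'.nbr 0 y).1 hy
    · refine Set.finite_empty.subset fun y hy => hne ⟨y, hy⟩
  refine ((hfin.biUnion fun F hF => h2 F hF.1).image (· - v)).subset ?_
  rintro a ⟨b, q, ⟨F, hF, hq⟩, rfl, h1, h3⟩
  have he : s(q 0, q 1) ∈ F.edges := by simpa using hq.mem_edges 0
  exact ⟨q 1, Set.mem_biUnion (x := F) ⟨hF, q 0, mem_carrier_of_edge he, rfl⟩ he, by simp [h1]⟩

/-- Suppose the edge vectors at `v` are all perpendicular to `n`. A planar face through an edge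
carries this property to the other end of the edge, so the whole complex lies in the plane of the
base face. A symmetry fixing the flag is the identity on that plane, hence on the affine hull,
against `hstab`. -/
theorem arc_nonplanar (hK : K.IsPolygonalComplex) (hreg : K.IsRegular) (hmir : K.HasMirrors)
    {ℓ c : ℝ}
    (hpair : ∀ q, K.IsFaceParam q → IsIsoscelesPair ℓ c (q 1 - q 0) (q (-1) - q 0))
    {v : E3} {e : Sym2 E3} {F : Figure} (hflag : K.IsFlag v e F)
    (hstab : K.FlagStabilizerNontrivial v e F) {n : E3} (hn : n ≠ 0) :
    ∃ w w', K.Arc v w w' ∧ inner ℝ n w ≠ 0 := by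
  by_contra! hall
  obtain ⟨q₀, hq₀, rfl, rfl, rfl⟩ := exists_isFaceParam_of_flag hK hflag
  have step : ∀ y z : E3, (∀ a b, K.Arc y a b → inner ℝ n a = 0) → s(y, z) ∈ K.edges →
      inner ℝ n (z - y) = 0 ∧ ∀ a b, K.Arc z a b → inner ℝ n a = 0 := by
    intro y z hy he
    obtain ⟨q, hq, rfl, rfl⟩ := exists_isFaceParam_of_edge hK he
    have hn1 := hy _ _ hq.arc
    have hn2 := hy _ _ hq.arc.symm
    have hpl := fun i => hq.inner_eq_zero hmir hn1 hn2 i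
    refine ⟨hn1, ?_⟩
    have hsub : ∀ i, inner ℝ n (q i - q 1) = 0 := fun i => by
      have : q i - q 1 = (q i - q 0) - (q 1 - q 0) := by abel
      rw [this, inner_sub_right, hpl, hpl, sub_zero]
    have harc := (hq.shift 1).arc
    simp only [zero_add] at harc
    obtain ⟨g, hg, hg0, hg1, hg2⟩ := hq₀.arc.exists_map hK hreg harc
    have hm : ∀ a b, K.Arc (q 1) a b → inner ℝ (linearPart g n) a = 0 := by
      intro a b hab
      have := hab.map (inv_mem hg)
      rw [← hg0, isometryEquiv_inv_apply_self, linearPart_inv] at this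
      have h1 := hall _ _ this
      rw [← (linearPart g).inner_map_map, ← linearIsometryEquiv_mul_apply, mul_inv_cancel] at h1
      exact h1
    have hp := harc.isIsoscelesPair hpair
    -- By regularity the arcs at `q 1` are perpendicular to the moved normal `linearPart g n`. The
    -- face through the edge has both `n` and the moved normal as normals of equal length, so they
    -- agree up to sign.
    rcases hp.eq_or_eq_neg (hm _ _ harc) (hm _ _ harc.symm) (hsub _) (hsub _)
      ((linearPart g).norm_map n) with e | e
    · intro a b hab; rw [← e]; exact hm a b hab
    · intro a b hab
      have := hm a b hab
      rw [e, inner_neg_left] at this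
      linarith
  have hverts : ∀ y : K.verts, inner ℝ n ((y : E3) - q₀ 0) = 0 ∧
      ∀ a b, K.Arc y a b → inner ℝ n a = 0 := by
    intro y
    have hconn := hK.edgeGraph_connected.preconnected ⟨q₀ 0, hq₀.mem_verts hK 0⟩ y
    rw [SimpleGraph.reachable_iff_reflTransGen] at hconn
    induction hconn with
    | refl => exact ⟨by simp, hall⟩
    | tail _ hyz ih =>
      obtain ⟨h1, h2⟩ := step _ _ ih.2 hyz.2
      refine ⟨?_, h2⟩
      rw [← sub_add_sub_cancel _ (_ : E3) (q₀ 0), inner_add_right, h1, ih.1, zero_add]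
  obtain ⟨g, hg, ⟨g0, g1, gF⟩, x, hx, hgx⟩ := hstab
  have hgq : ∀ i, g (q₀ i) = q₀ i := by
    refine comp_eq_of_flag hq₀ hq₀ g0 ?_ gF
    rw [Sym2.map_mk, g0] at g1
    exact Sym2.congr_right.1 g1
  apply hgx
  have hx0 : inner ℝ n (x - q₀ 0) = 0 := by
    have hle : affineSpan ℝ K.verts ≤ AffineSubspace.mk' (q₀ 0) (Submodule.span ℝ {n})ᗮ := by
      rw [affineSpan_le]
      intro y hy
      rw [SetLike.mem_coe, AffineSubspace.mem_mk', vsub_eq_sub,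
        Submodule.mem_orthogonal_singleton_iff_inner_right]
      exact (hverts ⟨y, hy⟩).1
    have := hle hx
    rwa [AffineSubspace.mem_mk', vsub_eq_sub,
        Submodule.mem_orthogonal_singleton_iff_inner_right] at this
  have := (hpair q₀ hq₀).ext_map (L := linearPart g) (M := 1) (x := x - q₀ 0) ?_ ?_ hn
    (hall _ _ hq₀.arc) (hall _ _ hq₀.arc.symm) hx0
  · rw [linearPart_eq (v := q₀ 0) (g := g), this, hgq]
    exact add_sub_cancel _ _
  · rw [linearPart_sub, hgq, hgq]; rfl
  · rw [linearPart_sub, hgq, hgq]; rfl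

theorem localData (hK : K.IsPolygonalComplex) (hreg : K.IsRegular) (hmir : K.HasMirrors)
    {ℓ c : ℝ}
    (hpair : ∀ q, K.IsFaceParam q → IsIsoscelesPair ℓ c (q 1 - q 0) (q (-1) - q 0))
    {v : E3} {e : Sym2 E3} {F : Figure} (hflag : K.IsFlag v e F)
    (hstab : K.FlagStabilizerNontrivial v e F) :
    LocalData (K.Arc v) (K.vertexGroup v) ℓ c := by
  have hex : ∃ u u', K.Arc v u u' := by
    obtain ⟨q₀, hq₀, -, rfl, -⟩ := exists_isFaceParam_of_flag hK hflag
    exact ⟨_, _, hq₀.arc⟩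
  obtain ⟨u, u', hu⟩ := hex
  have hp := hu.isIsoscelesPair hpair
  refine ⟨hp.pos, hp.lt, ⟨u, u', hu⟩, finite_arcs hK v, Arc.symm, ?_, ?_, ?_, ?_, ?_,
    arc_connected hK, fun hn => arc_nonplanar hK hreg hmir hpair hflag hstab hn⟩
  · rintro _ ⟨g, hg, hgv, rfl⟩ a b hab
    have := hab.map hg
    rwa [hgv] at this
  · intro a b a' b' h h'
    obtain ⟨g, hg, hgv, h1, h2⟩ := h.exists_map hK hreg h'
    exact ⟨_, ⟨g, hg, hgv, rfl⟩, h1, h2⟩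
  · rintro a b ⟨q, hq, rfl, h1, h2⟩
    obtain ⟨g, hg, hgq, hgn⟩ := hmir q hq
    have ea : a = q 1 - q 0 := by rw [h1, add_sub_cancel_left]
    have eb : b = q (-1) - q 0 := by rw [h2, add_sub_cancel_left]
    refine ⟨_, ⟨g, hg, hgq 0, rfl⟩, ?_, ?_, ?_⟩
    · rw [ea, linearPart_sub, hgq, hgq]
    · rw [eb, linearPart_sub, hgq, hgq]
    · rwa [ea, eb]
  · intro a b hab; exact (hab.isIsoscelesPair hpair).left
  · intro a b hab; exact (hab.isIsoscelesPair hpair).inner_eq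

/-- The half-turn symmetry of a face about the midpoint of its base edge extends to the point
reflection in this midpoint. -/
def HasPointReflection (K : Complex2) (q : ℤ → E3) : Prop :=
  ∃ g ∈ K.symmetryGroup, (∀ x, g x = q 0 + q 1 - x) ∧ ∀ i, g (q i) = q (1 - i)

/-- The reflection of a face in the perpendicular bisector of its base edge extends to the plane
reflection. -/
def HasBisectorReflection (K : Complex2) (ℓ : ℝ) (q : ℤ → E3) : Prop :=
  ∃ g ∈ K.symmetryGroup, (∀ i, g (q i) = q (1 - i)) ∧
    ∀ x, linearPart g x = x - (2 * inner ℝ (q 1 - q 0) x / ℓ ^ 2) • (q 1 - q 0)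

theorem HasPointReflection.map {q : ℤ → E3} (h : K.HasPointReflection q) {g : E3 ≃ᵢ E3}
    (hg : g ∈ K.symmetryGroup) : K.HasPointReflection (g ∘ q) := by
  obtain ⟨f, hf, hfx, hfq⟩ := h
  refine ⟨g * f * g⁻¹, mul_mem (mul_mem hg hf) (inv_mem hg), fun x => ?_, fun i => ?_⟩
  · obtain ⟨y, rfl⟩ := g.surjective x
    rw [isometryEquiv_mul_apply, isometryEquiv_mul_apply, isometryEquiv_inv_apply_self, hfx,
      linearPart_eq (v := q 0) (g := g)]
    have : q 0 + q 1 - y - q 0 = q 1 - y := by abel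
    rw [this, linearPart_sub]
    simp only [Function.comp]; abel
  · simp only [Function.comp]
    rw [isometryEquiv_mul_apply, isometryEquiv_mul_apply, isometryEquiv_inv_apply_self, hfq]

theorem HasBisectorReflection.map {ℓ : ℝ} {q : ℤ → E3} (h : K.HasBisectorReflection ℓ q)
    {g : E3 ≃ᵢ E3} (hg : g ∈ K.symmetryGroup) : K.HasBisectorReflection ℓ (g ∘ q) := by
  obtain ⟨f, hf, hfq, hfx⟩ := h
  refine ⟨g * f * g⁻¹, mul_mem (mul_mem hg hf) (inv_mem hg), fun i => ?_, fun x => ?_⟩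
  · simp only [Function.comp]
    rw [isometryEquiv_mul_apply, isometryEquiv_mul_apply, isometryEquiv_inv_apply_self, hfq]
  · obtain ⟨y, rfl⟩ := (linearPart g).surjective x
    rw [linearPart_mul, linearPart_mul, linearIsometryEquiv_mul_apply,
      linearIsometryEquiv_mul_apply, linearPart_inv, linearIsometryEquiv_inv_apply_self]
    simp only [Function.comp]
    rw [← linearPart_sub, (linearPart g).inner_map_map]
    rw [hfx, map_sub, map_smul]

/-- A symmetry that reverses the face acts as `-1` on the base edge direction, and by signs on the
perpendicular direction within the face plane and on the normal. The mirror makes the sign on the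
normal arbitrary. If the sign within the plane is `-1`, the normal sign `-1` gives a point
reflection; if it is `+1`, the normal sign `+1` gives the bisector reflection. -/
theorem pointReflection_or_bisectorReflection (hK : K.IsPolygonalComplex) (hreg : K.IsRegular)
    (hmir : K.HasMirrors) {ℓ c : ℝ} {q : ℤ → E3} (hq : K.IsFaceParam q)
    (hp : IsIsoscelesPair ℓ c (q 1 - q 0) (q (-1) - q 0)) :
    K.HasPointReflection q ∨ K.HasBisectorReflection ℓ q := by
  have hrev : K.IsFaceParam fun i => q (1 - i) := by
    have := (hq.shift 1).neg
    simpa [neg_add_eq_sub] using this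
  obtain ⟨g, hg, hgq⟩ := hreg.exists_map_param hK hq hrev
  obtain ⟨m, hm, hmq, hmn⟩ := hmir q hq
  obtain ⟨o, ha, hb⟩ := hp.exists_basis
  have hspos := hp.sin_pos
  have hpos := hp.pos
  have hl2 : ℓ ^ 2 ≠ 0 := by positivity
  set s := √(1 - c ^ 2) with hs
  obtain ⟨p1, p2⟩ := IsIsoscelesPair.basis_two_perp ha hb
  have hpl := fun i => hq.inner_eq_zero hmir p1 p2 i
  -- every symmetry that reverses the face has one of four linear parts
  have key : ∀ f : E3 ≃ᵢ E3, (∀ i, f (q i) = q (1 - i)) → linearPart f (o 0) = -o 0 ∧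
      (linearPart f (o 1) = o 1 ∨ linearPart f (o 1) = -o 1) ∧
      (linearPart f (o 2) = o 2 ∨ linearPart f (o 2) = -o 2) := by
    intro f hf
    have e0 : linearPart f (o 0) = -o 0 := by
      have : linearPart f (q 1 - q 0) = -(q 1 - q 0) := by
        rw [linearPart_sub, hf, hf]; simp
      rw [ha, map_smul, ← smul_neg] at this
      exact smul_right_injective _ hpos.ne' this
    have hin : ∀ i, inner ℝ (o 2) (linearPart f (q i - q 0)) = 0 := by
      intro i
      rw [linearPart_sub, hf, hf]
      have : q (1 - i) - q (1 - 0) = (q (1 - i) - q 0) - (q 1 - q 0) := by simp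
      rw [this, inner_sub_right, hpl, hpl, sub_zero]
    have h21 : inner ℝ (o 2) (linearPart f (o 1)) = 0 := by
      have h3 := hin (-1)
      rw [hb, map_smul, map_add, map_smul, map_smul, e0, inner_smul_right, inner_add_right,
        inner_smul_right, inner_smul_right, inner_neg_right, o.inner_zero (by decide)] at h3
      simpa [hpos.ne', hspos.ne'] using h3
    have h01 : inner ℝ (o 0) (linearPart f (o 1)) = 0 := by
      have : inner ℝ (linearPart f (o 0)) (linearPart f (o 1)) = 0 := by
        rw [(linearPart f).inner_map_map]; exact o.inner_zero (by decide)
      rw [e0, inner_neg_left] at this; linarith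
    have e1 : linearPart f (o 1) = inner ℝ (o 1) (linearPart f (o 1)) • o 1 := by
      conv_lhs => rw [o.eq_sum_three (linearPart f (o 1)), h01, h21]
      simp
    have sq : ∀ (i : Fin 3) (t : ℝ), linearPart f (o i) = t • o i →
        linearPart f (o i) = o i ∨ linearPart f (o i) = -o i := by
      intro i t ht
      have := (linearPart f).norm_map (o i)
      rw [ht, norm_smul, o.orthonormal.1, mul_one, Real.norm_eq_abs,
        abs_eq (zero_le_one)] at this
      rcases this with rfl | rfl
      · left; rw [ht, one_smul]
      · right; rw [ht, neg_one_smul]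
    refine ⟨e0, sq 1 _ e1, ?_⟩
    have h02 : inner ℝ (o 0) (linearPart f (o 2)) = 0 := by
      have : inner ℝ (linearPart f (o 0)) (linearPart f (o 2)) = 0 := by
        rw [(linearPart f).inner_map_map]; exact o.inner_zero (by decide)
      rw [e0, inner_neg_left] at this; linarith
    have h12 : inner ℝ (o 1) (linearPart f (o 2)) = 0 := by
      have : inner ℝ (linearPart f (o 1)) (linearPart f (o 2)) = 0 := by
        rw [(linearPart f).inner_map_map]; exact o.inner_zero (by decide)
      rcases sq 1 _ e1 with e | e
      · rwa [e] at this
      · rw [e, inner_neg_left] at this; linarith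
    refine sq 2 (inner ℝ (o 2) (linearPart f (o 2))) ?_
    conv_lhs => rw [o.eq_sum_three (linearPart f (o 2)), h02, h12]
    simp
  have hmul : ∀ i, (g * m) (q i) = q (1 - i) := fun i => by
    rw [isometryEquiv_mul_apply, hmq, hgq]
  have hm2 : linearPart m (o 2) = -o 2 := hmn _ p1 p2
  have hm1 : linearPart m (o 1) = o 1 := by
    have f1 : linearPart m (q 1 - q 0) = q 1 - q 0 := by rw [linearPart_sub, hmq, hmq]
    have f2 : linearPart m (q (-1) - q 0) = q (-1) - q 0 := by rw [linearPart_sub, hmq, hmq]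
    exact hp.ext_map (L := linearPart m) (M := 1) f1 f2 (n := o 2)
      (fun e => by simpa [e] using o.orthonormal.1 2) p1 p2 (o.inner_zero (by decide))
  have hgm : ∀ x, linearPart (g * m) x = linearPart g (linearPart m x) := fun x => by
    rw [linearPart_mul, linearIsometryEquiv_mul_apply]
  -- Composition with the mirror `m` changes the sign on the normal and nothing else.
  have choose : ∀ σ : ℝ, (σ = 1 ∨ σ = -1) → ∃ f ∈ K.symmetryGroup, (∀ i, f (q i) = q (1 - i)) ∧
      linearPart f (o 1) = linearPart g (o 1) ∧ linearPart f (o 2) = σ • o 2 := by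
    obtain ⟨-, -, h2⟩ := key g hgq
    have hg2 : ∃ τ : ℝ, (τ = 1 ∨ τ = -1) ∧ linearPart g (o 2) = τ • o 2 := by
      rcases h2 with e | e
      · exact ⟨1, Or.inl rfl, by rw [e, one_smul]⟩
      · exact ⟨-1, Or.inr rfl, by rw [e, neg_one_smul]⟩
    obtain ⟨τ, hτ, hg2⟩ := hg2
    intro σ hσ
    by_cases hστ : σ = τ
    · exact ⟨g, hg, hgq, rfl, by rw [hg2, hστ]⟩
    · refine ⟨g * m, mul_mem hg hm, hmul, by rw [hgm, hm1], ?_⟩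
      rw [hgm, hm2, map_neg, hg2, ← neg_smul]
      congr 1
      rcases hσ with rfl | rfl <;> rcases hτ with rfl | rfl <;> simp at hστ ⊢
  obtain ⟨-, h1, -⟩ := key g hgq
  rcases h1 with h1 | h1
  · right
    obtain ⟨f, hf, hfq, f1, f2⟩ := choose 1 (Or.inl rfl)
    obtain ⟨f0, -, -⟩ := key f hfq
    refine ⟨f, hf, hfq, fun x => ?_⟩
    rw [ha, inner_smul_left, conj_trivial]
    have : linearPart f x = inner ℝ (o 0) x • linearPart f (o 0) +
        inner ℝ (o 1) x • linearPart f (o 1) + inner ℝ (o 2) x • linearPart f (o 2) := by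
      conv_lhs => rw [o.eq_sum_three x]
      simp
    rw [this, f0, f1, h1, f2]
    conv_rhs => rw [o.eq_sum_three x]
    simp only [inner_add_right, inner_smul_right, o.inner_self_one,
      o.inner_zero (show (0 : Fin 3) ≠ 1 by decide), o.inner_zero (show (0 : Fin 3) ≠ 2 by decide)]
    match_scalars <;> field_simp
    ring
  · left
    obtain ⟨f, hf, hfq, f1, f2⟩ := choose (-1) (Or.inr rfl)
    obtain ⟨f0, -, -⟩ := key f hfq
    refine ⟨f, hf, fun x => ?_, hfq⟩
    have : ∀ y, linearPart f y = -y := by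
      intro y
      conv_lhs => rw [o.eq_sum_three y]
      conv_rhs => rw [o.eq_sum_three y]
      simp only [map_add, map_smul, f0, f1, h1, f2]
      module
    rw [linearPart_eq (v := q 0) (g := f), this, hfq, sub_zero]
    abel

end Complex2

end


/-! ### The translation lattice, and the closing up of bounded faces. -/

noncomputable section

open scoped ComplexConjugate

/-- A basis of the lattice is a real basis of the space, and the matrix of `L` in it is integral. -/
theorem exists_int_trace_of_lattice (Λ : Submodule ℤ E3) [DiscreteTopology Λ] [IsZLattice ℝ Λ]
    {L : E3 →ₗ[ℝ] E3} (hL : ∀ x ∈ Λ, L x ∈ Λ) : ∃ k : ℤ, LinearMap.trace ℝ E3 L = k := by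
  classical
  have : Module.Finite ℤ Λ := ZLattice.module_finite ℝ Λ
  have : Module.Free ℤ Λ := ZLattice.module_free ℝ Λ
  let b := Module.Free.chooseBasis ℤ Λ
  let B := b.ofZLatticeBasis ℝ Λ
  refine ⟨∑ i, b.repr ⟨L (b i), hL _ (b i).2⟩ i, ?_⟩
  rw [LinearMap.trace_eq_matrix_trace ℝ B, Matrix.trace]
  push_cast
  refine Finset.sum_congr rfl fun i _ => ?_
  rw [Matrix.diag_apply, LinearMap.toMatrix_apply]
  have h1 : B i = b i := b.ofZLatticeBasis_apply ℝ Λ i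
  rw [h1]
  have := b.ofZLatticeBasis_repr_apply ℝ Λ ⟨L (b i), hL _ (b i).2⟩ i
  exact this

namespace LocalData

variable {A : E3 → E3 → Prop} {Γ : Subgroup (E3 ≃ₗᵢ[ℝ] E3)} {ℓ c : ℝ}

/-- The differences of nodes span the space: differences of neighbours of `u` produce the normal of
an arc and the direction `u' - c u`, exchanging the ends produces `u - c u'`, and these two are
independent because `c ^ 2 < 1`. -/
theorem eq_zero_of_perp_differences (h : LocalData A Γ ℓ c) {n : E3}
    (hn : ∀ a a' b b', A a a' → A b b' → inner ℝ n (a - b) = 0) : n = 0 := by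
  obtain ⟨r, hr, hrule, u, u', hA, -⟩ := h.exists_order
  have hc := h.lt
  obtain ⟨o, hu, hu'⟩ := h.exists_basis hA
  have hpair : IsIsoscelesPair ℓ c u u' :=
    ⟨h.pos, h.lt, h.norm_eq hA, h.norm_eq (h.symm hA), h.inner_eq hA⟩
  obtain ⟨p1, p2⟩ := IsIsoscelesPair.basis_two_perp hu hu'
  have hls : 0 < ℓ * √(1 - c ^ 2) := mul_pos h.pos h.sin_pos
  obtain ⟨ω, hω, hnω, hre⟩ := exp_root r (by omega)
  have hr' : (3 : ℝ) ≤ r := by exact_mod_cast hr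
  have hπ := Real.pi_pos
  have hz1 : -1 < ω.re := by
    have : -1 / 2 ≤ ω.re := by
      rw [hre, ← cos_two_pi_div_three]
      apply Real.cos_le_cos_of_nonneg_of_le_pi
      · positivity
      · push_cast; linarith
      · push_cast; gcongr
    linarith
  have hz2 : ω.re < 1 := by
    rw [hre, ← Real.cos_zero]
    apply Real.cos_lt_cos_of_nonneg_of_le_pi le_rfl
    · rw [div_le_iff₀ (by positivity)]; nlinarith
    · positivity
  have him : ω.im ≠ 0 := by
    intro h0
    have := Complex.normSq_eq_norm_sq ω
    rw [Complex.normSq_apply, hnω, h0] at this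
    nlinarith
  -- The neighbours at `ω` and at its conjugate differ by a multiple of `m`, non-zero since `ω` is
  -- not real. The difference between the neighbour at `ω` and `b` then gives the direction `b - c
  -- a`.
  have hperp : ∀ {a b m : E3}, A a b → inner ℝ m a = 0 → inner ℝ m b = 0 →
      ‖m‖ ^ 2 = ℓ ^ 2 * (1 - c ^ 2) → inner ℝ n (b - c • a) = 0 ∧ inner ℝ n m = 0 := by
    intro a b m hab h1 h2 h3
    have x1 := (hrule a b m hab h1 h2 h3 _).2 ⟨ω, hω, rfl⟩
    have x2 := (hrule a b m hab h1 h2 h3 _).2 ⟨conj ω, by rw [← map_pow, hω, map_one], rfl⟩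
    have e1 := hn _ _ _ _ (h.symm x1) (h.symm x2)
    have e2 := hn _ _ _ _ (h.symm x1) (h.symm hab)
    simp only [Complex.conj_re, Complex.conj_im] at e1
    have d1 : c • a + (ω.re • (b - c • a) + ω.im • m) -
        (c • a + (ω.re • (b - c • a) + -ω.im • m)) = (2 * ω.im) • m := by module
    have d2 : c • a + (ω.re • (b - c • a) + ω.im • m) - b =
        (ω.re - 1) • (b - c • a) + ω.im • m := by module
    rw [d1, inner_smul_right] at e1
    have hm : inner ℝ n m = 0 := (mul_eq_zero.1 e1).resolve_left (mul_ne_zero two_ne_zero him)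
    rw [d2, inner_add_right, inner_smul_right, inner_smul_right, hm, mul_zero, add_zero] at e2
    exact ⟨(mul_eq_zero.1 e2).resolve_left (by linarith), hm⟩
  let m : E3 := (ℓ * √(1 - c ^ 2)) • o 2
  have m1 : inner ℝ m u = 0 := by rw [inner_smul_left, p1, mul_zero]
  have m2 : inner ℝ m u' = 0 := by rw [inner_smul_left, p2, mul_zero]
  have m3 : ‖m‖ ^ 2 = ℓ ^ 2 * (1 - c ^ 2) := by
    rw [norm_smul, o.orthonormal.1, mul_one, Real.norm_eq_abs, sq_abs, mul_pow, h.sin_sq]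
  obtain ⟨q1, q2⟩ := hperp hA m1 m2 m3
  obtain ⟨q3, -⟩ := hperp (h.symm hA) m2 m1 m3
  rw [inner_sub_right, inner_smul_right] at q1 q3
  have hnu : inner ℝ n u = 0 := by
    have : (1 - c ^ 2) * inner ℝ n u = 0 := by linear_combination q3 + c * q1
    exact (mul_eq_zero.1 this).resolve_left (by linarith)
  have hnu' : inner ℝ n u' = 0 := by rw [hnu] at q1; linarith
  have e := hpair.perp_iff hu hu' hnu hnu'
  rw [inner_smul_right, real_inner_comm] at q2
  have := (mul_eq_zero.1 q2).resolve_left hls.ne'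
  rw [e, this, zero_smul]

end LocalData

/-- The translation by `t`. -/
def translation (t : E3) : E3 ≃ᵢ E3 := IsometryEquiv.addRight t

@[simp] theorem translation_apply (t x : E3) : translation t x = x + t := rfl

namespace Complex2

variable {K : Complex2}

theorem HasPointReflection.of_arc (hK : K.IsPolygonalComplex) (hreg : K.IsRegular)
    {q₀ : ℤ → E3} (h₀ : K.IsFaceParam q₀) (hpt : K.HasPointReflection q₀) {q : ℤ → E3}
    (hq : K.IsFaceParam q) : K.HasPointReflection q := by
  obtain ⟨g, hg, hgq⟩ := hreg.exists_map_param hK h₀ hq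
  rw [show q = g ∘ q₀ from funext fun i => (hgq i).symm]
  exact hpt.map hg

theorem HasBisectorReflection.of_arc (hK : K.IsPolygonalComplex) (hreg : K.IsRegular) {ℓ : ℝ}
    {q₀ : ℤ → E3} (h₀ : K.IsFaceParam q₀) (hpt : K.HasBisectorReflection ℓ q₀) {q : ℤ → E3}
    (hq : K.IsFaceParam q) : K.HasBisectorReflection ℓ q := by
  obtain ⟨g, hg, hgq⟩ := hreg.exists_map_param hK h₀ hq
  rw [show q = g ∘ q₀ from funext fun i => (hgq i).symm]
  exact hpt.map hg

/-- The product of the reflections in the midpoints of two edges at `v` is the translation by the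
difference of the edge vectors. -/
theorem translation_mem (hpt : ∀ q, K.IsFaceParam q → K.HasPointReflection q) {v a a' b b' : E3}
    (ha : K.Arc v a a') (hb : K.Arc v b b') : translation (a - b) ∈ K.symmetryGroup := by
  obtain ⟨q, hq, rfl, h1, -⟩ := ha
  obtain ⟨q', hq', h0', h1', -⟩ := hb
  obtain ⟨g, hg, hgx, -⟩ := hpt q hq
  obtain ⟨g', hg', hgx', -⟩ := hpt q' hq'
  have : translation (a - b) = g * g' := by
    ext1 x
    rw [isometryEquiv_mul_apply, hgx', hgx, translation_apply, h1, h1', h0']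
    abel
  rw [this]
  exact mul_mem hg hg'

/-- The differences of edge vectors generate a group of translations. It is discrete, because it
moves `v` to vertices, which are locally finite; it has full rank, because the differences span; and
it is invariant under the special group, which permutes the edge vectors. -/
theorem exists_int_trace (hK : K.IsPolygonalComplex)
    (hpt : ∀ q, K.IsFaceParam q → K.HasPointReflection q) {v : E3} {ℓ c : ℝ}
    (hloc : LocalData (K.Arc v) (K.vertexGroup v) ℓ c) (hv : v ∈ K.verts) {L : E3 ≃ₗᵢ[ℝ] E3}
    (hL : L ∈ K.vertexGroup v) : ∃ k : ℤ, LinearMap.trace ℝ E3 (L : E3 →ₗ[ℝ] E3) = k := by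
  let D : Set E3 := {d | ∃ a a' b b', K.Arc v a a' ∧ K.Arc v b b' ∧ d = a - b}
  let Λ : Submodule ℤ E3 := Submodule.span ℤ D
  have htrans : ∀ x ∈ Λ, translation x ∈ K.symmetryGroup := by
    intro x hx
    induction hx using Submodule.span_induction with
    | mem x hx =>
      obtain ⟨a, a', b, b', ha, hb, rfl⟩ := hx
      exact translation_mem hpt ha hb
    | zero =>
      have : translation 0 = 1 := by ext1 x; simp
      rw [this]; exact one_mem _
    | add x y _ _ hx hy =>
      have : translation (x + y) = translation y * translation x := by
        ext1 z; rw [isometryEquiv_mul_apply]; simp [add_assoc]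
      rw [this]; exact mul_mem hy hx
    | smul k x _ hx =>
      have hz : ∀ k : ℤ, translation (k • x) = translation x ^ k := by
        have hadd : ∀ y, translation (y + x) = translation y * translation x := fun y => by
          ext1 z; rw [isometryEquiv_mul_apply]; simp only [translation_apply]; abel
        intro k
        induction k using Int.induction_on with
        | zero => rw [zero_smul, zpow_zero]; ext1 x; simp
        | succ k ih => rw [add_smul, one_smul, hadd, ih, zpow_add_one]
        | pred k ih =>
          have := hadd ((-k - 1 : ℤ) • x)
          rw [← add_one_zsmul, sub_add_cancel, ih] at this
          rw [zpow_sub_one, this, mul_inv_cancel_right]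
      rw [hz]; exact zpow_mem hx k
  have hfin : ∀ R : ℝ, ((Λ : Set E3) ∩ Metric.closedBall 0 R).Finite := by
    intro R
    have := finite_verts_inter hK (isCompact_closedBall v R)
    refine (this.image (· - v)).subset ?_
    rintro x ⟨hx, hxR⟩
    refine ⟨v + x, ⟨map_mem_verts (htrans x hx) hv, ?_⟩, by simp⟩
    simpa using hxR
  have hdisc : DiscreteTopology Λ := by
    rw [discreteTopology_iff_isOpen_singleton_zero]
    have h1 := hfin 1
    have hfin1 : ({x : Λ | ‖(x : E3)‖ ≤ 1}).Finite := by
      refine Set.Finite.of_finite_image (f := Subtype.val) (h1.subset ?_)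
        Subtype.val_injective.injOn
      rintro _ ⟨x, hx, rfl⟩
      exact ⟨x.2, by simpa using hx⟩
    have hopen : IsOpen {x : Λ | ‖(x : E3)‖ < 1} :=
      isOpen_lt (by fun_prop) continuous_const
    have hf : ({x : Λ | ‖(x : E3)‖ < 1} \ {0}).Finite :=
      hfin1.subset fun x hx => le_of_lt (show ‖(x : E3)‖ < 1 from hx.1)
    have : ({0} : Set Λ) = {x : Λ | ‖(x : E3)‖ < 1} \ ({x : Λ | ‖(x : E3)‖ < 1} \ {0}) := by
      ext x
      simp only [Set.mem_singleton_iff, Set.mem_sdiff, Set.mem_ofPred_eq]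
      constructor
      · rintro rfl; simp
      · rintro ⟨hx1, hx2⟩
        by_contra hne
        exact hx2 ⟨hx1, hne⟩
    rw [this]
    exact hopen.sdiff hf.isClosed
  have hlat : IsZLattice ℝ Λ := by
    refine ⟨?_⟩
    rw [← Submodule.orthogonal_eq_bot_iff, Submodule.eq_bot_iff]
    intro n hn
    apply hloc.eq_zero_of_perp_differences
    intro a a' b b' ha hb
    have hmem : a - b ∈ Λ := Submodule.subset_span ⟨a, a', b, b', ha, hb, rfl⟩
    exact Submodule.inner_left_of_mem_orthogonal (Submodule.subset_span hmem) hn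
  refine exists_int_trace_of_lattice Λ fun x hx => ?_
  induction hx using Submodule.span_induction with
  | mem x hx =>
    obtain ⟨a, a', b, b', ha, hb, rfl⟩ := hx
    refine Submodule.subset_span ⟨_, _, _, _, hloc.map hL ha, hloc.map hL hb, ?_⟩
    exact map_sub L a b
  | zero => simp
  | add x y _ _ hx hy => rw [map_add]; exact add_mem hx hy
  | smul k x _ hx => rw [map_zsmul]; exact zsmul_mem hx k

/-- The turning angle of a bounded planar face is a rational multiple of `π`. -/
theorem exists_root_of_unity (hK : K.IsPolygonalComplex) {ℓ c : ℝ}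
    (hpair : ∀ q, K.IsFaceParam q → IsIsoscelesPair ℓ c (q 1 - q 0) (q (-1) - q 0))
    (hbis : ∀ q, K.IsFaceParam q → K.HasBisectorReflection ℓ q) {q : ℤ → E3}
    (hq : K.IsFaceParam q) : ∃ (l : ℂ) (n : ℕ), 0 < n ∧ l ^ n = 1 ∧ l.re = -c := by
  have hp := hpair q hq
  have hpos := hp.pos
  have hl2 : ℓ ^ 2 ≠ 0 := by positivity
  obtain ⟨o, ha, hb⟩ := hp.exists_basis
  have hspos := hp.sin_pos
  have hs2 : √(1 - c ^ 2) ^ 2 = 1 - c ^ 2 := Real.sq_sqrt (by linarith [hp.lt])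
  set s := √(1 - c ^ 2) with hs
  -- The unit complex number whose argument is the exterior angle of the face. Its powers turn out
  -- to be the edge vectors.
  let l : ℂ := ⟨-c, s⟩
  have hl : l * l = -(2 * c) * l - 1 := by
    apply Complex.ext <;> simp [l]
    · linear_combination -hs2
    · ring
  have hl0 : l ≠ 0 := fun h => by
    have := congrArg Complex.im h
    simp [l] at this
    exact hspos.ne' this
  have hl1 : l - 1 ≠ 0 := fun h => by
    have := congrArg Complex.im h
    simp [l] at this
    exact hspos.ne' this
  have hlnorm : ‖l‖ = 1 := by
    have : ‖l‖ ^ 2 = 1 := by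
      rw [← Complex.normSq_eq_norm_sq, Complex.normSq_apply]
      simp only [l]; linear_combination hs2
    rcases sq_eq_one_iff.1 this with h | h
    · exact h
    · linarith [norm_nonneg l]
  -- The bisector reflection of the edge between `q i` and `q (i + 1)` exchanges the preceding and
  -- the following edge.
  have hrec : ∀ i : ℤ, q (i + 2) - q (i + 1) =
      -(2 * c) • (q (i + 1) - q i) - (q i - q (i - 1)) := by
    intro i
    have hqi := hq.shift i
    obtain ⟨g, -, hg1, hg2⟩ := hbis _ hqi
    have e1 := hg1 (-1)
    have e0 := hg1 0
    have e := hg2 (q (-1 + i) - q (0 + i))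
    have hin := (hpair _ hqi).inner_eq
    simp only at hin e1 e0 e
    rw [linearPart_sub, e1, e0, hin] at e
    rw [show 1 - -1 + i = i + 2 by ring, show 1 - 0 + i = i + 1 by ring,
      show 1 + i = i + 1 by ring, show -1 + i = i - 1 by ring, zero_add] at e
    rw [e, show 2 * (ℓ ^ 2 * c) / ℓ ^ 2 = 2 * c by field_simp]
    module
  -- This identifies the complex plane with the direction plane of the face, `1` being the base edge
  -- vector.
  let φ : ℂ → E3 := fun z => (ℓ * z.re) • o 0 + (ℓ * z.im) • o 1
  have hφadd : ∀ x y, φ (x + y) = φ x + φ y := fun x y => by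
    simp only [φ, Complex.add_re, Complex.add_im]; module
  have hφinj : ∀ x y, φ x = φ y → x = y := by
    intro x y hxy
    have e0 := congrArg (inner ℝ (o 0)) hxy
    have e1 := congrArg (inner ℝ (o 1)) hxy
    simp only [φ, inner_add_right, inner_smul_right, o.inner_self_one,
      o.inner_zero (show (0 : Fin 3) ≠ 1 by decide),
      o.inner_zero (show (1 : Fin 3) ≠ 0 by decide)] at e0 e1
    apply Complex.ext
    · exact mul_left_cancel₀ hpos.ne' (by linarith)
    · exact mul_left_cancel₀ hpos.ne' (by linarith)
  have hφrec : ∀ i : ℤ, φ (l ^ (i + 1)) = -(2 * c) • φ (l ^ i) - φ (l ^ (i - 1)) := by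
    intro i
    have : l ^ (i + 1) = -(2 * c) * l ^ i - l ^ (i - 1) := by
      have e1 : l ^ (i + 1) = l ^ (i - 1) * (l * l) := by
        rw [← mul_assoc, ← zpow_add_one₀ hl0, sub_add_cancel, ← zpow_add_one₀ hl0]
      have e2 : l ^ i = l ^ (i - 1) * l := by rw [← zpow_add_one₀ hl0, sub_add_cancel]
      rw [e1, hl, e2]; ring
    rw [this]
    have hre : (-(2 * (c : ℂ)) * l ^ i - l ^ (i - 1)).re =
        -(2 * c) * (l ^ i).re - (l ^ (i - 1)).re := by simp
    have him : (-(2 * (c : ℂ)) * l ^ i - l ^ (i - 1)).im =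
        -(2 * c) * (l ^ i).im - (l ^ (i - 1)).im := by simp
    simp only [φ, hre, him]; module
  have hD : ∀ i : ℤ, q (i + 1) - q i = φ (l ^ i) ∧ q i - q (i - 1) = φ (l ^ (i - 1)) := by
    have hlinv : l⁻¹ = ⟨-c, -s⟩ := by
      apply inv_eq_of_mul_eq_one_right
      apply Complex.ext <;> simp [l]
      · linear_combination hs2
      · ring
    intro i
    induction i using Int.induction_on with
    | zero =>
      simp only [zero_add, zero_sub, zpow_zero, zpow_neg_one]
      refine ⟨by rw [ha]; simp [φ], ?_⟩
      have : q 0 - q (-1) = -(q (-1) - q 0) := by abel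
      rw [this, hb, hlinv]
      simp only [φ]; module
    | succ i ih =>
      refine ⟨?_, by simpa using ih.1⟩
      rw [show (i : ℤ) + 1 + 1 = i + 2 by ring, hrec, ih.1, ih.2, hφrec]
    | pred i ih =>
      have h1 : q (-(i : ℤ) - 1 + 1) - q (-(i : ℤ) - 1) = φ (l ^ (-(i : ℤ) - 1)) := by
        simpa using ih.2
      refine ⟨h1, ?_⟩
      have h2 := hrec (-(i : ℤ) - 1)
      have h3 := hφrec (-(i : ℤ) - 1)
      rw [show -(i : ℤ) - 1 + 2 = -i + 1 by ring, show -(i : ℤ) - 1 + 1 = -i by ring] at h2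
      rw [show -(i : ℤ) - 1 + 1 = -i by ring] at h3 h1
      rw [ih.1, h1, h3] at h2
      exact (sub_right_injective h2).symm
  -- The edge vectors sum to a geometric series, bounded because `l` has modulus one and differs
  -- from `1`.
  have hpos' : ∀ i : ℕ, q i = q 0 + φ ((l ^ (i : ℤ) - 1) / (l - 1)) := by
    intro i
    induction i with
    | zero => simp [φ]
    | succ i ih =>
      have := (hD i).1
      rw [sub_eq_iff_eq_add] at this
      rw [Nat.cast_succ, this, ih, add_left_comm, ← hφadd, zpow_add_one₀ hl0]
      congr 2
      field_simp
      ring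
  have hbound : ∀ i : ℕ, q i ∈ Metric.closedBall (q 0) (ℓ * (2 * (2 / ‖l - 1‖))) := by
    intro i
    rw [hpos' i, mem_closedBall_iff_norm, add_sub_cancel_left]
    set z := (l ^ (i : ℤ) - 1) / (l - 1) with hz
    have hzn : ‖z‖ ≤ 2 / ‖l - 1‖ := by
      rw [hz, norm_div]
      gcongr
      calc ‖l ^ (i : ℤ) - 1‖ ≤ ‖l ^ (i : ℤ)‖ + ‖(1 : ℂ)‖ := norm_sub_le _ _
        _ = 2 := by rw [norm_zpow, hlnorm]; norm_num
    calc ‖φ z‖ ≤ ‖(ℓ * z.re) • o 0‖ + ‖(ℓ * z.im) • o 1‖ := norm_add_le _ _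
      _ = ℓ * (|z.re| + |z.im|) := by
        rw [norm_smul, norm_smul, o.orthonormal.1, o.orthonormal.1, Real.norm_eq_abs,
          Real.norm_eq_abs, abs_mul, abs_mul, abs_of_pos hpos]; ring
      _ ≤ ℓ * (2 * ‖z‖) := by
        have := Complex.abs_re_le_norm z
        have := Complex.abs_im_le_norm z
        gcongr; linarith
      _ ≤ _ := by gcongr
  have hfin := finite_verts_inter hK
    (isCompact_closedBall (q 0) (ℓ * (2 * (2 / ‖l - 1‖))))
  -- The bounded face has only finitely many vertices, so some directed edge recurs; equal edge
  -- vectors mean equal powers of `l`.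
  obtain ⟨i, j, hij, heq⟩ : ∃ i j : ℕ, i < j ∧ (q i, q (i + 1)) = (q j, q (j + 1)) := by
    by_contra! hne
    have hinj : Function.Injective fun i : ℕ => (q i, q (i + 1)) := by
      intro i j h
      rcases lt_trichotomy i j with hlt | rfl | hlt
      · exact absurd h (hne i j hlt)
      · rfl
      · exact absurd h.symm (hne j i hlt)
    apply Set.infinite_range_of_injective hinj
    refine (hfin.prod hfin).subset ?_
    rintro _ ⟨i, rfl⟩
    exact ⟨⟨hq.mem_verts hK _, hbound i⟩,
      ⟨hq.mem_verts hK _, by simpa using hbound (i + 1)⟩⟩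
  rw [Prod.mk.injEq] at heq
  have h1 := (hD i).1
  have h2 := (hD j).1
  rw [heq.1, heq.2, h2] at h1
  have h3 := hφinj _ _ h1
  refine ⟨l, j - i, by omega, ?_, rfl⟩
  rw [zpow_natCast, zpow_natCast] at h3
  have h4 : l ^ i * l ^ (j - i) = l ^ i * 1 := by
    rw [← pow_add, Nat.add_sub_cancel' hij.le, h3, mul_one]
  exact mul_left_cancel₀ (pow_ne_zero _ hl0) h4

end Complex2

end


/-! ### Integral coordinates and the three model polyhedra. -/

noncomputable section

/-- Points with integral coordinates. -/
abbrev Z3 : Type := Fin 3 → ℤ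

def idot (x y : Z3) : ℤ := x 0 * y 0 + x 1 * y 1 + x 2 * y 2

def icross (x y : Z3) : Z3 :=
  ![x 1 * y 2 - x 2 * y 1, x 2 * y 0 - x 0 * y 2, x 0 * y 1 - x 1 * y 0]

theorem idot_comm (x y : Z3) : idot x y = idot y x := by simp only [idot]; ring

theorem idot_add (x y z : Z3) : idot (x + y) z = idot x z + idot y z := by
  simp only [idot, Pi.add_apply]; ring

theorem idot_sub (x y z : Z3) : idot (x - y) z = idot x z - idot y z := by
  simp only [idot, Pi.sub_apply]; ring

theorem idot_neg (x z : Z3) : idot (-x) z = -idot x z := by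
  simp only [idot, Pi.neg_apply]; ring

theorem idot_zsmul (k : ℤ) (x z : Z3) : idot (k • x) z = k * idot x z := by
  simp only [idot, Pi.smul_apply, smul_eq_mul]; ring

/-- A permutation of the coordinates together with changes of sign. -/
structure SignedPerm where
  perm : Equiv.Perm (Fin 3)
  sign : Fin 3 → ℤˣ

namespace SignedPerm

def act (M : SignedPerm) (x : Z3) : Z3 := fun i => (M.sign i : ℤ) * x (M.perm i)

theorem act_add (M : SignedPerm) (x y : Z3) : M.act (x + y) = M.act x + M.act y := by
  funext i; simp [act, mul_add]

theorem act_sub (M : SignedPerm) (x y : Z3) : M.act (x - y) = M.act x - M.act y := by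
  funext i; simp [act, mul_sub]

theorem unit_mul_self (u : ℤˣ) : (u : ℤ) * u = 1 := by
  rw [← Units.val_mul, Int.units_mul_self, Units.val_one]

theorem idot_act (M : SignedPerm) (x y : Z3) : idot (M.act x) (M.act y) = idot x y := by
  have e : ∀ x y : Z3, idot x y = ∑ i, x i * y i := fun x y => by
    rw [Fin.sum_univ_three]; rfl
  rw [e, e, ← Equiv.sum_comp M.perm (fun i => x i * y i)]
  refine Finset.sum_congr rfl fun i _ => ?_
  simp only [act]
  linear_combination (x (M.perm i) * y (M.perm i)) * unit_mul_self (M.sign i)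

/-- The linear isometry that extends a signed permutation. -/
def toLinearIsometryEquiv (M : SignedPerm) : E3 ≃ₗᵢ[ℝ] E3 where
  toFun x := WithLp.toLp 2 fun i => ((M.sign i : ℤ) : ℝ) * x (M.perm i)
  invFun x := WithLp.toLp 2 fun i =>
    ((M.sign (M.perm.symm i) : ℤ) : ℝ) * x (M.perm.symm i)
  map_add' x y := by ext i; simp [mul_add]
  map_smul' c x := by ext i; simp; ring
  left_inv x := by
    ext i
    have : (((M.sign (M.perm.symm i) : ℤ) : ℝ)) * ((M.sign (M.perm.symm i) : ℤ) : ℝ) = 1 := by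
      exact_mod_cast unit_mul_self _
    simp [← mul_assoc, this]
  right_inv x := by
    ext i
    have : (((M.sign i : ℤ) : ℝ)) * ((M.sign i : ℤ) : ℝ) = 1 := by
      exact_mod_cast unit_mul_self _
    simp [← mul_assoc, this]
  norm_map' x := by
    rw [EuclideanSpace.norm_eq, EuclideanSpace.norm_eq]
    congr 1
    rw [← Equiv.sum_comp M.perm (fun i => ‖x i‖ ^ 2)]
    refine Finset.sum_congr rfl fun i _ => ?_
    have : ((M.sign i : ℤ) : ℝ) ^ 2 = 1 := by
      rw [sq]; exact_mod_cast unit_mul_self _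
    simp [mul_pow, this]

theorem toLinearIsometryEquiv_intPoint (M : SignedPerm) (x : Z3) :
    M.toLinearIsometryEquiv (intPoint x) = intPoint (M.act x) := by
  ext i
  simp [toLinearIsometryEquiv, intPoint, act]

end SignedPerm

theorem inner_intPoint (x y : Z3) : inner ℝ (intPoint x) (intPoint y) = (idot x y : ℝ) := by
  simp [intPoint, idot, PiLp.inner_apply, Fin.sum_univ_three]
  ring

theorem intPoint_add (x y : Z3) : intPoint (x + y) = intPoint x + intPoint y := by
  ext i; simp [intPoint]

theorem intPoint_sub (x y : Z3) : intPoint (x - y) = intPoint x - intPoint y := by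
  ext i; simp [intPoint]

theorem intPoint_neg (x : Z3) : intPoint (-x) = -intPoint x := by
  ext i; simp [intPoint]

theorem intPoint_zsmul (k : ℤ) (x : Z3) : intPoint (k • x) = (k : ℝ) • intPoint x := by
  ext i; simp [intPoint]

theorem intPoint_zero : intPoint 0 = 0 := by
  ext i; simp [intPoint]

theorem intPoint_injective : Function.Injective intPoint := by
  intro x y h
  funext i
  have := congrArg (fun z : E3 => z i) h
  simpa [intPoint] using this

/-- A regular polyhedron with integral vertices, centred at the origin. The faces are given by
normal vectors `ν`: the vertices `w` of the face are those with `⟨w, ν⟩ = 1`. Adjacent vertices have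
inner product `adj`. The signed permutations `gen i` map the base flag to the adjacent flags. -/
structure IntPolyhedron where
  nodes : List Z3
  normals : List Z3
  normSq : ℤ
  adj : ℤ
  node₀ : Z3
  node₁ : Z3
  normal₀ : Z3
  gen₁ : SignedPerm
  gen₂ : SignedPerm
  gen₃ : SignedPerm

namespace IntPolyhedron

def Adj (D : IntPolyhedron) (w w' : Z3) : Prop := w ∈ D.nodes ∧ w' ∈ D.nodes ∧ idot w w' = D.adj

instance (D : IntPolyhedron) (w w' : Z3) : Decidable (D.Adj w w') :=
  inferInstanceAs (Decidable (_ ∧ _ ∧ _))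

theorem Adj.symm {D : IntPolyhedron} {w w' : Z3} (h : D.Adj w w') : D.Adj w' w :=
  ⟨h.2.1, h.1, by rw [idot_comm]; exact h.2.2⟩

def gen (D : IntPolyhedron) : Fin 3 → SignedPerm := ![D.gen₁, D.gen₂, D.gen₃]

/-- Images under a word in the generators, given as a list of indices. -/
def word (D : IntPolyhedron) : List (Fin 3) → Z3 → Z3
  | [], x => x
  | i :: l, x => (D.gen i).act (D.word l x)

/-- The finitely many facts that make the data a regular polyhedron. -/
structure IsRegular (D : IntPolyhedron) : Prop where
  normSq_pos : 0 < D.normSq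
  adj_ne : D.adj ≠ D.normSq
  adj_ne_neg : D.adj ≠ -D.normSq
  normSq_eq : ∀ w ∈ D.nodes, idot w w = D.normSq
  sum_eq : D.nodes.sum = 0
  nodup : D.nodes.Nodup
  odd : ∀ w ∈ D.nodes, ∀ ν ∈ D.normals, idot w ν % 2 = 1
  two_normals : ∀ w ∈ D.nodes, ∀ w' ∈ D.nodes, D.Adj w w' → ∃ ν ∈ D.normals, ∃ ν' ∈ D.normals,
    ν ≠ ν' ∧ (idot w ν = 1 ∧ idot w' ν = 1) ∧ (idot w ν' = 1 ∧ idot w' ν' = 1) ∧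
      ∀ μ ∈ D.normals, idot w μ = 1 → idot w' μ = 1 → μ = ν ∨ μ = ν'
  separate : ∀ w ∈ D.nodes, ∀ ν ∈ D.normals, ∀ ν' ∈ D.normals, idot w ν = 1 → idot w ν' = 1 →
    ν ≠ ν' → ∃ x ∈ D.nodes, ∃ y ∈ D.nodes, D.Adj w x ∧ D.Adj w y ∧ x ≠ y ∧ idot x ν = 1 ∧
      idot y ν = 1 ∧ idot x ν' ≠ 1
  two_nodes : ∀ w ∈ D.nodes, ∀ ν ∈ D.normals, idot w ν = 1 → ∃ x ∈ D.nodes, ∃ y ∈ D.nodes, x ≠ y ∧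
    (D.Adj w x ∧ idot x ν = 1) ∧ (D.Adj w y ∧ idot y ν = 1) ∧
      ∀ z ∈ D.nodes, D.Adj w z → idot z ν = 1 → z = x ∨ z = y
  face_connected : ∀ ν ∈ D.normals, ∀ w ∈ D.nodes, ∀ w' ∈ D.nodes, idot w ν = 1 → idot w' ν = 1 →
    w = w' ∨ D.Adj w w' ∨ ∃ x ∈ D.nodes, idot x ν = 1 ∧ D.Adj w x ∧ D.Adj x w'
  node_connected : ∀ w ∈ D.nodes, ∀ x ∈ D.nodes, ∀ y ∈ D.nodes, D.Adj w x → D.Adj w y →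
    ∃ z ∈ D.nodes, D.Adj w z ∧ (∃ ν ∈ D.normals, idot w ν = 1 ∧ idot x ν = 1 ∧ idot z ν = 1) ∧
      ∃ ν ∈ D.normals, idot w ν = 1 ∧ idot y ν = 1 ∧ idot z ν = 1
  graph_connected : ∀ w ∈ D.nodes, ∀ w' ∈ D.nodes, ∃ x ∈ D.nodes, ∃ y ∈ D.nodes,
    (w = x ∨ D.Adj w x) ∧ (x = y ∨ D.Adj x y) ∧ (y = w' ∨ D.Adj y w')
  exists_adj : ∀ w ∈ D.nodes, ∃ w' ∈ D.nodes, D.Adj w w'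
  base_adj : D.Adj D.node₀ D.node₁
  normal_mem : D.normal₀ ∈ D.normals
  base_normal : idot D.node₀ D.normal₀ = 1 ∧ idot D.node₁ D.normal₀ = 1
  exists_node : ∀ ν ∈ D.normals, ∃ w ∈ D.nodes, idot w ν = 1
  gen_nodes : ∀ i, ∀ w ∈ D.nodes, D.word [i] w ∈ D.nodes
  gen_normals : ∀ i, ∀ ν ∈ D.normals, D.word [i] ν ∈ D.normals
  gen_invol : ∀ i j : Fin 3, (D.gen i).perm ((D.gen i).perm j) = j ∧
    (D.gen i).sign j * (D.gen i).sign ((D.gen i).perm j) = 1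
  gen₁_node₀ : D.gen₁.act D.node₀ = D.node₁
  gen₁_node₁ : D.gen₁.act D.node₁ = D.node₀
  gen₁_normal : D.gen₁.act D.normal₀ = D.normal₀
  gen₂_node₀ : D.gen₂.act D.node₀ = D.node₀
  gen₂_node₁ : D.gen₂.act D.node₁ ≠ D.node₁
  gen₂_normal : D.gen₂.act D.normal₀ = D.normal₀
  gen₃_node₀ : D.gen₃.act D.node₀ = D.node₀
  gen₃_node₁ : D.gen₃.act D.node₁ = D.node₁
  gen₃_normal : D.gen₃.act D.normal₀ ≠ D.normal₀
  node_transitive : ∀ w ∈ D.nodes, ∃ l ∈ [[], [0], [1, 0], [2, 1, 0], [0, 1, 0], [1, 2, 1, 0],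
    [0, 2, 1, 0], [0, 1, 2, 1, 0], [1, 0, 2, 1, 0], [0, 1, 0, 2, 1, 0], [2, 0, 1, 0],
    [1, 2, 0, 1, 0], [2, 1, 2, 0, 1, 0], [2, 1, 0, 2, 1, 0], [2, 0, 1, 0, 2, 1, 0]],
    D.word l D.node₀ = w
  face_transitive : ∀ w ∈ D.nodes, ∀ w' ∈ D.nodes, D.Adj w w' → idot w D.normal₀ = 1 →
    idot w' D.normal₀ = 1 → ∃ l ∈ ([[], [0], [1], [0, 1], [1, 0], [0, 1, 0], [1, 0, 1],
      [0, 1, 0, 1]] : List (List (Fin 3))), D.word l D.node₀ = w ∧ D.word l D.node₁ = w'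
  link_transitive : ∀ w' ∈ D.nodes, D.Adj D.node₀ w' →
    ∃ l ∈ ([[], [1], [2, 1], [1, 2, 1]] : List (List (Fin 3))), D.word l D.node₀ = D.node₀ ∧
      D.word l D.node₁ = w'

/-- Used twice: for the apeirotope over the octahedron, and as the vertex-figure of the cubical
tessellation. Its normals are the nodes of `hexa`, and conversely. -/
def octa : IntPolyhedron where
  nodes := [![1, 0, 0], ![-1, 0, 0], ![0, 1, 0], ![0, -1, 0], ![0, 0, 1], ![0, 0, -1]]
  normals := [![1, 1, 1], ![1, 1, -1], ![1, -1, 1], ![1, -1, -1], ![-1, 1, 1], ![-1, 1, -1],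
    ![-1, -1, 1], ![-1, -1, -1]]
  normSq := 1
  adj := 0
  node₀ := ![1, 0, 0]
  node₁ := ![0, 1, 0]
  normal₀ := ![1, 1, 1]
  gen₁ := ⟨Equiv.swap 0 1, ![1, 1, 1]⟩
  gen₂ := ⟨Equiv.swap 1 2, ![1, 1, 1]⟩
  gen₃ := ⟨1, ![1, 1, -1]⟩

/-- Alternate vertices of the cube; the normals are the negatives of the nodes. -/
def tetra : IntPolyhedron where
  nodes := [![1, 1, 1], ![1, -1, -1], ![-1, 1, -1], ![-1, -1, 1]]
  normals := [![-1, -1, -1], ![-1, 1, 1], ![1, -1, 1], ![1, 1, -1]]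
  normSq := 3
  adj := -1
  node₀ := ![1, 1, 1]
  node₁ := ![1, -1, -1]
  normal₀ := ![1, 1, -1]
  gen₁ := ⟨Equiv.swap 1 2, ![1, -1, -1]⟩
  gen₂ := ⟨Equiv.swap 0 1, ![1, 1, 1]⟩
  gen₃ := ⟨Equiv.swap 1 2, ![1, 1, 1]⟩

def hexa : IntPolyhedron where
  nodes := [![1, 1, 1], ![1, 1, -1], ![1, -1, 1], ![1, -1, -1], ![-1, 1, 1], ![-1, 1, -1],
    ![-1, -1, 1], ![-1, -1, -1]]
  normals := [![1, 0, 0], ![-1, 0, 0], ![0, 1, 0], ![0, -1, 0], ![0, 0, 1], ![0, 0, -1]]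
  normSq := 3
  adj := 1
  node₀ := ![1, 1, 1]
  node₁ := ![-1, 1, 1]
  normal₀ := ![0, 0, 1]
  gen₁ := ⟨1, ![-1, 1, 1]⟩
  gen₂ := ⟨Equiv.swap 0 1, ![1, 1, 1]⟩
  gen₃ := ⟨Equiv.swap 1 2, ![1, 1, 1]⟩

/-- All conditions are bounded statements over explicit lists of integral vectors, hence decidable.
The lists of words in the transitivity conditions are long enough to serve all three polyhedra. -/
theorem octa_isRegular : octa.IsRegular := by
  constructor <;> decide

theorem tetra_isRegular : tetra.IsRegular := by
  constructor <;> decide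

theorem hexa_isRegular : hexa.IsRegular := by
  constructor <;> decide

end IntPolyhedron

end


/-! ### Abstract polytopes from polyhedral vertex-figures: ranks, flags and diamonds. -/

noncomputable section

namespace Complex3

variable {P : Complex3}

namespace Face

/-- Shifted by one against the usual convention: the least face has rank `0`. -/
def rank : Face P → ℕ
  | .bot => 0
  | .vert _ => 1
  | .edge _ => 2
  | .face _ => 3
  | .facet _ => 4
  | .top => 5

@[simp] theorem rank_bot : (bot : Face P).rank = 0 := rfl
@[simp] theorem rank_vert (v : P.verts) : (vert v).rank = 1 := rfl
@[simp] theorem rank_edge (e : P.edges) : (edge e).rank = 2 := rfl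
@[simp] theorem rank_face (F : P.faces) : (face F).rank = 3 := rfl
@[simp] theorem rank_facet (C : P.facets) : (facet C).rank = 4 := rfl
@[simp] theorem rank_top : (top : Face P).rank = 5 := rfl

theorem le_def {a b : Face P} : a ≤ b ↔ Face.Le a b := Iff.rfl

theorem eq_of_le_of_rank_eq {a b : Face P} (h : a ≤ b) (hr : a.rank = b.rank) : a = b := by
  rw [le_def] at h
  cases a <;> cases b <;> simp_all [Face.Le]

theorem rank_le_of_le {a b : Face P} (h : a ≤ b) : a.rank ≤ b.rank := by
  rw [le_def] at h
  cases a <;> cases b <;> simp_all [Face.Le]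

theorem rank_lt_of_lt {a b : Face P} (h : a < b) : a.rank < b.rank :=
  lt_of_le_of_ne (rank_le_of_le h.le) fun e => h.ne (eq_of_le_of_rank_eq h.le e)

theorem lt_of_le_of_rank_ne {a b : Face P} (h : a ≤ b) (hr : a.rank ≠ b.rank) : a < b :=
  lt_of_le_of_ne h fun e => hr (by rw [e])

theorem rank_le_five (a : Face P) : a.rank ≤ 5 := by cases a <;> simp

/-- Flags have one face of each rank as soon as no section of rank at least one is empty. -/
theorem encard_flag (hdense : ∀ a b : Face P, a < b → a.rank + 1 < b.rank → ∃ z, a < z ∧ z < b)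
    (Φ : Flag (Face P)) : (Φ : Set (Face P)).encard = 6 := by
  have hinj : Set.InjOn (rank (P := P)) (Φ : Set (Face P)) := by
    intro a ha b hb hab
    rcases Φ.chain_le.total ha hb with h | h
    · exact eq_of_le_of_rank_eq h hab
    · exact (eq_of_le_of_rank_eq h hab.symm).symm
  have hbot : (⊥ : Face P) ∈ Φ := Φ.bot_mem
  have htop : (⊤ : Face P) ∈ Φ := Φ.top_mem
  have himg : rank '' (Φ : Set (Face P)) = (Finset.range 6 : Set ℕ) := by
    ext r
    simp only [Set.mem_image, SetLike.mem_coe, Finset.coe_range, Set.mem_Iio]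
    constructor
    · rintro ⟨a, -, rfl⟩
      have := rank_le_five a
      omega
    · intro hr
      by_contra hno
      push Not at hno
      have h0 : r ≠ 0 := fun h => hno _ hbot (by rw [h]; rfl)
      have h5 : r ≠ 5 := fun h => hno _ htop (by rw [h]; rfl)
      -- If rank `r` is missing, the members of `Φ` nearest to it from below and above are selected;
      -- minimizing `5 - rank` maximizes the rank.
      have e1 : ∃ m, ∃ a ∈ Φ, a.rank < r ∧ m = 5 - a.rank := ⟨5, ⊥, hbot, by
        change 0 < r; omega, rfl⟩
      have e2 : ∃ m, ∃ b ∈ Φ, r < b.rank ∧ m = b.rank := ⟨5, ⊤, htop, by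
        change r < 5; omega, rfl⟩
      classical
      obtain ⟨a, ha, har, hma⟩ := Nat.find_spec e1
      obtain ⟨b, hb, hbr, hmb⟩ := Nat.find_spec e2
      have amax : ∀ x ∈ Φ, x.rank < r → x.rank ≤ a.rank := by
        intro x hx hxr
        have := Nat.find_min' e1 ⟨x, hx, hxr, rfl⟩
        have := rank_le_five x
        have := rank_le_five a
        omega
      have bmin : ∀ x ∈ Φ, r < x.rank → b.rank ≤ x.rank := by
        intro x hx hxr
        have := Nat.find_min' e2 ⟨x, hx, hxr, rfl⟩
        omega
      have le_of : ∀ x ∈ Φ, ∀ y ∈ Φ, x.rank ≤ y.rank → x ≤ y := by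
        intro x hx y hy hxy
        rcases Φ.chain_le.total hx hy with h | h
        · exact h
        · exact (eq_of_le_of_rank_eq h (le_antisymm (rank_le_of_le h) hxy)).ge
      have hab : a < b := lt_of_le_of_rank_ne (le_of a ha b hb (by omega)) (by omega)
      obtain ⟨z, hz1, hz2⟩ := hdense a b hab (by omega)
      -- The face `z` is comparable with every member of `Φ`, so it belongs to the maximal chain,
      -- against the choice of `a` and `b`.
      have hz : z ∈ Φ := by
        have hle : ∀ x ∈ Φ, x ≤ a ∨ b ≤ x := by
          intro x hx
          rcases lt_or_gt_of_ne (hno x hx) with h | h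
          · exact Or.inl (le_of x hx a ha (amax x hx h))
          · exact Or.inr (le_of b hb x hx (bmin x hx h))
        have hchain : IsChain (· ≤ ·) (insert z (Φ : Set (Face P))) := by
          refine Φ.chain_le.insert fun x hx _ => ?_
          rcases hle x hx with h | h
          · exact Or.inr (h.trans hz1.le)
          · exact Or.inl (hz2.le.trans h)
        have : (Φ : Set (Face P)) = insert z (Φ : Set (Face P)) :=
          Φ.max_chain' hchain (Set.subset_insert _ _)
        have hm : z ∈ (Φ : Set (Face P)) := this ▸ Set.mem_insert _ _
        exact hm
      have k1 := rank_lt_of_lt hz1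
      have k2 := rank_lt_of_lt hz2
      rcases lt_or_gt_of_ne (hno z hz) with h | h
      · have := amax z hz h; omega
      · have := bmin z hz h; omega
  rw [← hinj.encard_image, himg, Set.encard_coe_eq_coe_finsetCard]
  simp

/-- Connectedness by incidences within a set of faces. -/
def Conn (S : Set (Face P)) : Face P → Face P → Prop :=
  Relation.ReflTransGen fun x y => (x ≤ y ∨ y ≤ x) ∧ y ∈ S

theorem Conn.of_le {S : Set (Face P)} {a b : Face P} (hb : b ∈ S) (h : a ≤ b) : Conn S a b :=
  .single ⟨Or.inl h, hb⟩

theorem Conn.of_ge {S : Set (Face P)} {a b : Face P} (hb : b ∈ S) (h : b ≤ a) : Conn S a b :=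
  .single ⟨Or.inr h, hb⟩

end Face

/-- The faces of `P` at a vertex `x` correspond to the faces of the polyhedron `D`. -/
structure IsStar (P : Complex3) (D : IntPolyhedron) (x : E3) (nb : Z3 → E3)
    (fc : Z3 → Z3 → Figure) (ct : Z3 → Set Figure) : Prop where
  edge_iff : ∀ y, s(x, y) ∈ P.edges ↔ ∃ w ∈ D.nodes, y = nb w
  nb_inj : ∀ w ∈ D.nodes, ∀ w' ∈ D.nodes, nb w = nb w' → w = w'
  fc_mem : ∀ w w', D.Adj w w' → fc w w' ∈ P.faces
  fc_edges : ∀ w w', D.Adj w w' → ∀ y, s(x, y) ∈ (fc w w').edges ↔ y = nb w ∨ y = nb w'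
  fc_comm : ∀ w w', D.Adj w w' → fc w w' = fc w' w
  face_eq : ∀ F ∈ P.faces, ∀ y, s(x, y) ∈ F.edges → ∃ w w', D.Adj w w' ∧ F = fc w w'
  ct_mem : ∀ ν ∈ D.normals, ct ν ∈ P.facets
  facet_eq : ∀ C ∈ P.facets, ∀ F ∈ C, ∀ y, s(x, y) ∈ F.edges → ∃ ν ∈ D.normals, C = ct ν
  fc_mem_ct : ∀ w w', D.Adj w w' → ∀ ν ∈ D.normals,
    (fc w w' ∈ ct ν ↔ idot w ν = 1 ∧ idot w' ν = 1)

namespace IsStar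

variable {D : IntPolyhedron} {x : E3} {nb : Z3 → E3} {fc : Z3 → Z3 → Figure}
  {ct : Z3 → Set Figure}

/-- Two facets at a vertex are told apart by a 2-face: `separate` provides an edge of `D` on one of
the two faces and not on the other. -/
theorem ct_inj (h : P.IsStar D x nb fc ct) (hD : D.IsRegular) {ν ν' : Z3} (hν : ν ∈ D.normals)
    (hν' : ν' ∈ D.normals) (e : ct ν = ct ν') : ν = ν' := by
  by_contra hne
  obtain ⟨w, hw, hwν⟩ := hD.exists_node ν hν
  obtain ⟨u, hu, -, -, -, ⟨hwu, huν⟩, -⟩ := hD.two_nodes w hw ν hν hwν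
  have h1 := (h.fc_mem_ct w u hwu ν hν).2 ⟨hwν, huν⟩
  rw [e, h.fc_mem_ct w u hwu ν' hν'] at h1
  obtain ⟨y, hy, -, -, hwy, -, -, hyν, -, hyν'⟩ := hD.separate w hw ν hν ν' hν' hwν h1.1 hne
  have h2 := (h.fc_mem_ct w y hwy ν hν).2 ⟨hwν, hyν⟩
  rw [e, h.fc_mem_ct w y hwy ν' hν'] at h2
  exact hyν' h2.2

theorem adj_ne (hD : D.IsRegular) {w w' : Z3} (h : D.Adj w w') : w ≠ w' := by
  rintro rfl
  exact hD.adj_ne (h.2.2.symm.trans (hD.normSq_eq w h.1))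

theorem face_at (h : P.IsStar D x nb fc ct) {F : Figure} (hF : F ∈ P.faces) {y : E3}
    (hy : s(x, y) ∈ F.edges) : ∃ w w', D.Adj w w' ∧ F = fc w w' ∧ y = nb w := by
  obtain ⟨w, w', hA, rfl⟩ := h.face_eq F hF y hy
  rcases (h.fc_edges w w' hA y).1 hy with e | e
  · exact ⟨w, w', hA, rfl, e⟩
  · exact ⟨w', w, hA.symm, h.fc_comm w w' hA, e⟩

end IsStar

/-- Structures of rank 4 all of whose vertex-figures are copies of the polyhedron `D`. -/
structure IsLocallyPolyhedral (P : Complex3) (D : IntPolyhedron) : Prop where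
  edge_nondegenerate : ∀ e ∈ P.edges, ¬ e.IsDiag
  edge_verts : ∀ e ∈ P.edges, ∀ v ∈ e, v ∈ P.verts
  face_edges : ∀ F ∈ P.faces, F.edges ⊆ P.edges
  facet_faces : ∀ C ∈ P.facets, C ⊆ P.faces
  facet_nonempty : ∀ C ∈ P.facets, C.Nonempty
  face_param : ∀ F ∈ P.faces, ∃ q, F.IsParam q
  star : ∀ x ∈ P.verts, ∃ nb fc ct, P.IsStar D x nb fc ct
  nonempty : P.verts.Nonempty
  connected : ∀ x ∈ P.verts, ∀ y ∈ P.verts,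
    Relation.ReflTransGen (fun a b => s(a, b) ∈ P.edges) x y
  facet_connected : ∀ C ∈ P.facets, ∀ x y, (∃ F ∈ C, ∃ z, s(x, z) ∈ F.edges) →
    (∃ F ∈ C, ∃ z, s(y, z) ∈ F.edges) →
    Relation.ReflTransGen (fun a b => ∃ F ∈ C, s(a, b) ∈ F.edges) x y

namespace IsLocallyPolyhedral

variable {D : IntPolyhedron}

theorem left_mem (h : P.IsLocallyPolyhedral D) {x y : E3} (he : s(x, y) ∈ P.edges) : x ∈ P.verts :=
  h.edge_verts _ he x (by simp)

theorem exists_edge (h : P.IsLocallyPolyhedral D) (hD : D.IsRegular) {x : E3} (hx : x ∈ P.verts) :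
    ∃ y, s(x, y) ∈ P.edges := by
  obtain ⟨nb, fc, ct, hs⟩ := h.star x hx
  exact ⟨_, (hs.edge_iff _).2 ⟨_, hD.base_adj.1, rfl⟩⟩

theorem exists_face (h : P.IsLocallyPolyhedral D) (hD : D.IsRegular) {e : Sym2 E3}
    (he : e ∈ P.edges) : ∃ F ∈ P.faces, e ∈ F.edges := by
  induction e using Sym2.ind with | _ x y
  obtain ⟨nb, fc, ct, hs⟩ := h.star x (h.left_mem he)
  obtain ⟨w, hw, rfl⟩ := (hs.edge_iff y).1 he
  obtain ⟨w', -, hA⟩ := hD.exists_adj w hw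
  exact ⟨fc w w', hs.fc_mem _ _ hA, (hs.fc_edges _ _ hA _).2 (Or.inl rfl)⟩

theorem exists_edge_of_face (h : P.IsLocallyPolyhedral D) {F : Figure} (hF : F ∈ P.faces) :
    ∃ x y, s(x, y) ∈ F.edges := by
  obtain ⟨q, hq⟩ := h.face_param F hF
  exact ⟨_, _, hq.mem_edges 0⟩

theorem exists_facet (h : P.IsLocallyPolyhedral D) (hD : D.IsRegular) {F : Figure}
    (hF : F ∈ P.faces) : ∃ C ∈ P.facets, F ∈ C := by
  obtain ⟨x, y, he⟩ := h.exists_edge_of_face hF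
  obtain ⟨nb, fc, ct, hs⟩ := h.star x (h.left_mem (h.face_edges F hF he))
  obtain ⟨w, w', hA, rfl⟩ := hs.face_eq F hF y he
  obtain ⟨ν, hν, -, -, -, h1, -⟩ := hD.two_normals w hA.1 w' hA.2.1 hA
  exact ⟨ct ν, hs.ct_mem ν hν, (hs.fc_mem_ct _ _ hA ν hν).2 h1⟩

open Face

/-- Between proper faces, the incidence relation itself supplies the intermediate ones. Next to an
improper face they come from the star of a vertex, from the boundary of a face, or from
non-emptiness. -/
theorem dense (h : P.IsLocallyPolyhedral D) (hD : D.IsRegular) (a b : Face P) (hab : a < b)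
    (hr : a.rank + 1 < b.rank) : ∃ z, a < z ∧ z < b := by
  suffices H : ∃ z, (a ≤ z ∧ z ≤ b) ∧ a.rank ≠ z.rank ∧ z.rank ≠ b.rank by
    obtain ⟨z, ⟨h1, h2⟩, h3, h4⟩ := H
    exact ⟨z, lt_of_le_of_rank_ne h1 h3, lt_of_le_of_rank_ne h2 h4⟩
  have hle := le_def.1 hab.le
  cases a with
  | bot =>
    cases b with
    | bot | vert => simp at hr
    | edge e =>
      obtain ⟨e, he⟩ := e
      induction e using Sym2.ind with | _ x y
      exact ⟨.vert ⟨x, h.left_mem he⟩, ⟨trivial, show x ∈ s(x, y) by simp⟩, by simp⟩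
    | face F =>
      obtain ⟨x, y, he⟩ := h.exists_edge_of_face F.2
      exact ⟨.edge ⟨_, h.face_edges _ F.2 he⟩, ⟨trivial, he⟩, by simp⟩
    | facet C =>
      obtain ⟨F, hF⟩ := h.facet_nonempty _ C.2
      exact ⟨.face ⟨F, h.facet_faces _ C.2 hF⟩, ⟨trivial, hF⟩, by simp⟩
    | top =>
      obtain ⟨x, hx⟩ := h.nonempty
      exact ⟨.vert ⟨x, hx⟩, ⟨trivial, trivial⟩, by simp⟩
  | vert v =>
    cases b with
    | bot | vert | edge => simp at hr
    | face F =>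
      obtain ⟨e, h1, h2⟩ := hle
      exact ⟨.edge e, ⟨h1, h2⟩, by simp⟩
    | facet C =>
      obtain ⟨e, F, h1, h2, h3⟩ := hle
      exact ⟨.edge e, ⟨h1, F, h2, h3⟩, by simp⟩
    | top =>
      obtain ⟨y, hy⟩ := h.exists_edge hD v.2
      exact ⟨.edge ⟨_, hy⟩, ⟨show v.1 ∈ s(v.1, y) by simp, trivial⟩, by simp⟩
  | edge e =>
    cases b with
    | bot | vert | edge | face => simp at hr
    | facet C =>
      obtain ⟨F, h1, h2⟩ := hle
      exact ⟨.face F, ⟨h1, h2⟩, by simp⟩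
    | top =>
      obtain ⟨F, hF, heF⟩ := h.exists_face hD e.2
      exact ⟨.face ⟨F, hF⟩, ⟨heF, trivial⟩, by simp⟩
  | face F =>
    cases b with
    | bot | vert | edge | face | facet => simp at hr
    | top =>
      obtain ⟨C, hC, hFC⟩ := h.exists_facet hD F.2
      exact ⟨.facet ⟨C, hC⟩, ⟨hFC, trivial⟩, by simp⟩
  | facet C => cases b <;> simp at hr
  | top => cases b <;> simp at hr

theorem rank_of_covBy (h : P.IsLocallyPolyhedral D) (hD : D.IsRegular) {a b : Face P}
    (hab : a ⋖ b) : b.rank = a.rank + 1 := by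
  have h1 := rank_lt_of_lt hab.1
  by_contra hne
  obtain ⟨z, h2, h3⟩ := h.dense hD a b hab.1 (by omega)
  exact hab.2 h2 h3

theorem mem_Ioo_of {a z b : Face P} (h1 : a ≤ z) (h2 : z ≤ b) (r1 : a.rank ≠ z.rank)
    (r2 : z.rank ≠ b.rank) : z ∈ Set.Ioo a b :=
  ⟨lt_of_le_of_rank_ne h1 r1, lt_of_le_of_rank_ne h2 r2⟩

theorem encard_Ioo_edge (h : P.IsLocallyPolyhedral D) (e : P.edges) :
    (Set.Ioo (.bot : Face P) (.edge e)).encard = 2 := by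
  obtain ⟨e, he⟩ := e
  induction e using Sym2.ind with | _ x y
  have hne : x ≠ y := fun h' => h.edge_nondegenerate _ he (by simp [h'])
  have hy : s(y, x) ∈ P.edges := by rwa [Sym2.eq_swap]
  rw [Set.encard_eq_two]
  refine ⟨.vert ⟨x, h.left_mem he⟩, .vert ⟨y, h.left_mem hy⟩, by simpa using hne, ?_⟩
  ext z
  simp only [Set.mem_insert_iff, Set.mem_singleton_iff]
  constructor
  · rintro ⟨h1, h2⟩
    have r1 := rank_lt_of_lt h1
    have r2 := rank_lt_of_lt h2
    cases z with
    | vert v =>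
      have : v.1 ∈ s(x, y) := le_def.1 h2.le
      simpa [Subtype.ext_iff] using this
    | bot | edge | face | facet | top => simp at r1 r2
  · rintro (rfl | rfl)
    · exact mem_Ioo_of trivial (show x ∈ s(x, y) by simp) (by simp) (by simp)
    · exact mem_Ioo_of trivial (show y ∈ s(x, y) by simp) (by simp) (by simp)

/-- In the star of the vertex the 2-face is an edge of `D`, and the two edges in question are its
two ends. -/
theorem encard_Ioo_vert_face (h : P.IsLocallyPolyhedral D) (hD : D.IsRegular) (v : P.verts)
    (F : P.faces) (hvF : (.vert v : Face P) ≤ .face F) :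
    (Set.Ioo (.vert v : Face P) (.face F)).encard = 2 := by
  obtain ⟨x, hx⟩ := v
  obtain ⟨F, hF⟩ := F
  obtain ⟨e, hve, heF⟩ := le_def.1 hvF
  obtain ⟨y, hy⟩ := Sym2.mem_iff_exists.1 hve
  obtain ⟨nb, fc, ct, hs⟩ := h.star x hx
  rw [hy] at heF
  obtain ⟨w, w', hA, rfl⟩ := hs.face_eq F hF y heF
  have e1 := (hs.edge_iff _).2 ⟨w, hA.1, rfl⟩
  have e2 := (hs.edge_iff _).2 ⟨w', hA.2.1, rfl⟩
  rw [Set.encard_eq_two]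
  refine ⟨.edge ⟨_, e1⟩, .edge ⟨_, e2⟩, ?_, ?_⟩
  · intro h'
    rw [Face.edge.injEq, Subtype.mk.injEq, Sym2.congr_right] at h'
    exact IsStar.adj_ne hD hA (hs.nb_inj _ hA.1 _ hA.2.1 h')
  · ext z
    simp only [Set.mem_insert_iff, Set.mem_singleton_iff]
    constructor
    · rintro ⟨h1, h2⟩
      have r1 := rank_lt_of_lt h1
      have r2 := rank_lt_of_lt h2
      cases z with
      | edge e' =>
        have h3 : x ∈ e'.1 := le_def.1 h1.le
        have h4 : e'.1 ∈ (fc w w').edges := le_def.1 h2.le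
        obtain ⟨y', hy'⟩ := Sym2.mem_iff_exists.1 h3
        rw [hy', hs.fc_edges _ _ hA] at h4
        rcases h4 with rfl | rfl
        · exact Or.inl (congrArg _ (Subtype.ext hy'))
        · exact Or.inr (congrArg _ (Subtype.ext hy'))
      | bot | vert | face | facet | top => simp at r1 r2
    · rintro (rfl | rfl)
      · exact mem_Ioo_of (show x ∈ s(x, _) by simp) ((hs.fc_edges _ _ hA _).2 (Or.inl rfl))
          (by simp) (by simp)
      · exact mem_Ioo_of (show x ∈ s(x, _) by simp) ((hs.fc_edges _ _ hA _).2 (Or.inr rfl))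
          (by simp) (by simp)

/-- In the star of an end point, the edge is a node of `D` and the facet a face of `D`; the 2-faces
in between are the two edges of that face at that node. -/
theorem encard_Ioo_edge_facet (h : P.IsLocallyPolyhedral D) (hD : D.IsRegular) (e : P.edges)
    (C : P.facets) (heC : (.edge e : Face P) ≤ .facet C) :
    (Set.Ioo (.edge e : Face P) (.facet C)).encard = 2 := by
  obtain ⟨e, he⟩ := e
  obtain ⟨C, hC⟩ := C
  obtain ⟨F, heF, hFC⟩ := le_def.1 heC
  induction e using Sym2.ind with | _ x y
  obtain ⟨nb, fc, ct, hs⟩ := h.star x (h.left_mem he)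
  obtain ⟨ν, hν, rfl⟩ := hs.facet_eq C hC F hFC y heF
  obtain ⟨w, w', hA, hFw, rfl⟩ := hs.face_at F.2 heF
  have hFC' : F.1 ∈ ct ν := hFC
  rw [hFw, hs.fc_mem_ct w w' hA ν hν] at hFC'
  obtain ⟨u, hu, u', hu', hne, ⟨hA1, h1⟩, ⟨hA2, h2⟩, hmax⟩ := hD.two_nodes w hA.1 ν hν hFC'.1
  rw [Set.encard_eq_two]
  refine ⟨.face ⟨_, hs.fc_mem w u hA1⟩, .face ⟨_, hs.fc_mem w u' hA2⟩, ?_, ?_⟩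
  · intro h'
    rw [Face.face.injEq, Subtype.mk.injEq] at h'
    have h3 := (hs.fc_edges w u hA1 (nb u)).2 (Or.inr rfl)
    rw [h', hs.fc_edges w u' hA2] at h3
    rcases h3 with h3 | h3
    · exact IsStar.adj_ne hD hA1 (hs.nb_inj _ hu _ hA.1 h3).symm
    · exact hne (hs.nb_inj _ hu _ hu' h3)
  · ext z
    simp only [Set.mem_insert_iff, Set.mem_singleton_iff]
    constructor
    · rintro ⟨h3, h4⟩
      have r1 := rank_lt_of_lt h3
      have r2 := rank_lt_of_lt h4
      cases z with
      | face G =>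
        have h5 : s(x, nb w) ∈ G.1.edges := le_def.1 h3.le
        have h6 : G.1 ∈ ct ν := le_def.1 h4.le
        obtain ⟨t, t', hB, hG, ht⟩ := hs.face_at G.2 h5
        obtain rfl := hs.nb_inj _ hA.1 _ hB.1 ht
        rw [hG, hs.fc_mem_ct _ _ hB ν hν] at h6
        rcases hmax t' hB.2.1 hB h6.2 with rfl | rfl
        · exact Or.inl (congrArg _ (Subtype.ext hG))
        · exact Or.inr (congrArg _ (Subtype.ext hG))
      | bot | vert | edge | facet | top => simp at r1 r2
    · rintro (rfl | rfl)
      · exact mem_Ioo_of ((hs.fc_edges _ _ hA1 _).2 (Or.inl rfl))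
          ((hs.fc_mem_ct _ _ hA1 ν hν).2 ⟨hFC'.1, h1⟩) (by simp) (by simp)
      · exact mem_Ioo_of ((hs.fc_edges _ _ hA2 _).2 (Or.inl rfl))
          ((hs.fc_mem_ct _ _ hA2 ν hν).2 ⟨hFC'.1, h2⟩) (by simp) (by simp)

/-- In the star of one of its vertices the 2-face is an edge of `D`, which lies on exactly two faces
of `D`. -/
theorem encard_Ioo_face_top (h : P.IsLocallyPolyhedral D) (hD : D.IsRegular) (F : P.faces) :
    (Set.Ioo (.face F : Face P) .top).encard = 2 := by
  obtain ⟨F, hF⟩ := F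
  obtain ⟨x, y, he⟩ := h.exists_edge_of_face hF
  obtain ⟨nb, fc, ct, hs⟩ := h.star x (h.left_mem (h.face_edges F hF he))
  obtain ⟨w, w', hA, rfl⟩ := hs.face_eq F hF y he
  obtain ⟨ν, hν, ν', hν', hne, h1, h2, hmax⟩ := hD.two_normals w hA.1 w' hA.2.1 hA
  rw [Set.encard_eq_two]
  refine ⟨.facet ⟨_, hs.ct_mem ν hν⟩, .facet ⟨_, hs.ct_mem ν' hν'⟩, ?_, ?_⟩
  · intro h'
    rw [Face.facet.injEq, Subtype.mk.injEq] at h'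
    exact hne (hs.ct_inj hD hν hν' h')
  · ext z
    simp only [Set.mem_insert_iff, Set.mem_singleton_iff]
    constructor
    · rintro ⟨h3, h4⟩
      have r1 := rank_lt_of_lt h3
      have r2 := rank_lt_of_lt h4
      cases z with
      | facet C =>
        have h5 : fc w w' ∈ C.1 := le_def.1 h3.le
        obtain ⟨μ, hμ, hC⟩ := hs.facet_eq C.1 C.2 _ h5 y he
        rw [hC, hs.fc_mem_ct _ _ hA μ hμ] at h5
        rcases hmax μ hμ h5.1 h5.2 with rfl | rfl
        · exact Or.inl (congrArg _ (Subtype.ext hC))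
        · exact Or.inr (congrArg _ (Subtype.ext hC))
      | bot | vert | edge | face | top => simp at r1 r2
    · rintro (rfl | rfl)
      · exact mem_Ioo_of ((hs.fc_mem_ct _ _ hA ν hν).2 h1) trivial (by simp) (by simp)
      · exact mem_Ioo_of ((hs.fc_mem_ct _ _ hA ν' hν').2 h2) trivial (by simp)
          (by simp)

theorem diamond (h : P.IsLocallyPolyhedral D) (hD : D.IsRegular) (A B : Face P)
    (hAB : ∃ x, A ⋖ x ∧ x ⋖ B) : (Set.Ioo A B).encard = 2 := by
  obtain ⟨x, h1, h2⟩ := hAB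
  have r1 := h.rank_of_covBy hD h1
  have r2 := h.rank_of_covBy hD h2
  have hle : A ≤ B := h1.le.trans h2.le
  have r : B.rank = A.rank + 2 := by omega
  clear r1 r2 h1 h2
  cases A with
  | bot =>
    cases B with
    | edge e => exact h.encard_Ioo_edge e
    | bot | vert | face | facet | top => simp at r
  | vert v =>
    cases B with
    | face F => exact h.encard_Ioo_vert_face hD v F hle
    | bot | vert | edge | facet | top => simp at r
  | edge e =>
    cases B with
    | facet C => exact h.encard_Ioo_edge_facet hD e C hle
    | bot | vert | edge | face | top => simp at r
  | face F =>
    cases B with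
    | top => exact h.encard_Ioo_face_top hD F
    | bot | vert | edge | face | facet => simp at r
  | facet C => cases B <;> simp at r
  | top => cases B <;> simp at r

end IsLocallyPolyhedral

end Complex3

end


/-! ### Connectedness of the sections. -/

noncomputable section

namespace Complex3.IsLocallyPolyhedral

variable {P : Complex3} {D : IntPolyhedron}

open Face

theorem exists_vert_le (h : P.IsLocallyPolyhedral D) {z : Face P} (hz : z ≠ .bot) :
    ∃ v : P.verts, (.vert v : Face P) ≤ z := by
  cases z with
  | bot => exact absurd rfl hz
  | vert v => exact ⟨v, le_refl _⟩
  | edge e =>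
    obtain ⟨e, he⟩ := e
    induction e using Sym2.ind with | _ x y
    exact ⟨⟨x, h.left_mem he⟩, show x ∈ s(x, y) by simp⟩
  | face F =>
    obtain ⟨x, y, he⟩ := h.exists_edge_of_face F.2
    have he' := h.face_edges _ F.2 he
    exact ⟨⟨x, h.left_mem he'⟩, ⟨_, he'⟩, show x ∈ s(x, y) by simp, he⟩
  | facet C =>
    obtain ⟨F, hF⟩ := h.facet_nonempty _ C.2
    have hF' := h.facet_faces _ C.2 hF
    obtain ⟨x, y, he⟩ := h.exists_edge_of_face hF'
    have he' := h.face_edges _ hF' he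
    exact ⟨⟨x, h.left_mem he'⟩, ⟨_, he'⟩, ⟨F, hF'⟩, show x ∈ s(x, y) by simp, he, hF⟩
  | top =>
    obtain ⟨x, hx⟩ := h.nonempty
    exact ⟨⟨x, hx⟩, trivial⟩

/-- Two vertices of a face are joined by a path of edges of that face. -/
theorem exists_walk (h : P.IsLocallyPolyhedral D) {B : Face P} (hB : 3 ≤ B.rank) {v w : P.verts}
    (hv : (.vert v : Face P) ≤ B) (hw : (.vert w : Face P) ≤ B) :
    Relation.ReflTransGen (fun a b : E3 => ∃ he : s(a, b) ∈ P.edges, (.edge ⟨_, he⟩ : Face P) ≤ B)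
      v w := by
  cases B with
  | bot | vert | edge => simp at hB
  | face F =>
    obtain ⟨q, hq⟩ := h.face_param F.1 F.2
    have key : ∀ x : P.verts, (.vert x : Face P) ≤ .face F → ∃ i, x.1 = q i := by
      rintro x ⟨e, hxe, heF⟩
      rw [hq.eq] at heF
      obtain ⟨i, hi⟩ := heF
      simp only at hi
      rw [← hi, Sym2.mem_iff] at hxe
      exact hxe.elim (fun e => ⟨_, e⟩) fun e => ⟨_, e⟩
    obtain ⟨i, hi⟩ := key v hv
    obtain ⟨j, hj⟩ := key w hw
    rw [hi, hj]
    have step : ∀ k, ∃ he : s(q k, q (k + 1)) ∈ P.edges, (.edge ⟨_, he⟩ : Face P) ≤ .face F :=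
      fun k => ⟨h.face_edges _ F.2 (hq.mem_edges k), hq.mem_edges k⟩
    have step' : ∀ k, ∃ he : s(q (k + 1), q k) ∈ P.edges,
        (.edge ⟨_, he⟩ : Face P) ≤ .face F := fun k => by
      rw [Sym2.eq_swap]; exact step k
    have all : ∀ k : ℤ, Relation.ReflTransGen (fun a b : E3 => ∃ he : s(a, b) ∈ P.edges,
        (.edge ⟨_, he⟩ : Face P) ≤ .face F) (q i) (q (i + k)) := by
      intro k
      induction k with
      | zero => rw [add_zero]
      | succ k ih => exact ih.tail (by rw [← add_assoc]; exact step _)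
      | pred k ih =>
        refine ih.tail ?_
        have := step' (i + (-(k : ℤ) - 1))
        rwa [show i + (-(k : ℤ) - 1) + 1 = i + -(k : ℤ) by ring] at this
    have := all (j - i)
    rwa [add_sub_cancel] at this
  | facet C =>
    obtain ⟨e, F, h1, h2, h3⟩ := hv
    obtain ⟨e', F', h1', h2', h3'⟩ := hw
    obtain ⟨y, hy⟩ := Sym2.mem_iff_exists.1 h1
    obtain ⟨y', hy'⟩ := Sym2.mem_iff_exists.1 h1'
    rw [hy] at h2
    rw [hy'] at h2'
    refine Relation.ReflTransGen.mono ?_ _ _ (h.facet_connected C.1 C.2 v w ⟨F, h3, y, h2⟩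
      ⟨F', h3', y', h2'⟩)
    rintro a b ⟨G, hG, he⟩
    have hG' := h.facet_faces _ C.2 hG
    exact ⟨h.face_edges _ hG' he, ⟨G, hG'⟩, he, hG⟩
  | top =>
    exact Relation.ReflTransGen.mono (fun a b he => ⟨he, trivial⟩) _ _ (h.connected v v.2 w w.2)

/-- Each face of the section lies above a vertex. Two such vertices are joined by a walk along edges
of `B`, every step of which passes from a vertex through an edge to the next vertex. -/
theorem conn_bot (h : P.IsLocallyPolyhedral D) {B : Face P} (hB : 3 ≤ B.rank) {a b : Face P}
    (ha : a ∈ Set.Ioo .bot B) (hb : b ∈ Set.Ioo .bot B) : Conn (Set.Ioo .bot B) a b := by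
  obtain ⟨v, hv⟩ := h.exists_vert_le ha.1.ne'
  obtain ⟨w, hw⟩ := h.exists_vert_le hb.1.ne'
  have hS : ∀ x : P.verts, (.vert x : Face P) ≤ B → (.vert x : Face P) ∈ Set.Ioo .bot B :=
    fun x hx => mem_Ioo_of trivial hx (by simp) (by simp; omega)
  have hwB := hw.trans hb.2.le
  have hvB := hv.trans ha.2.le
  have walk := h.exists_walk hB hvB hwB
  have conv : ∀ y : E3, Relation.ReflTransGen (fun a b : E3 => ∃ he : s(a, b) ∈ P.edges,
      (.edge ⟨_, he⟩ : Face P) ≤ B) v y → ∃ hy : y ∈ P.verts, (.vert ⟨y, hy⟩ : Face P) ≤ B ∧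
        Conn (Set.Ioo .bot B) (.vert v) (.vert ⟨y, hy⟩) := by
    intro y hy
    induction hy with
    | refl => exact ⟨v.2, hvB, .refl⟩
    | @tail b c _ hbc ih =>
      obtain ⟨hb, hbB, hconn⟩ := ih
      obtain ⟨he, heB⟩ := hbc
      have hc : c ∈ P.verts := h.edge_verts _ he c (by simp)
      have h1 : (.vert ⟨b, hb⟩ : Face P) ≤ .edge ⟨_, he⟩ := show b ∈ s(b, c) by simp
      have h2 : (.vert ⟨c, hc⟩ : Face P) ≤ .edge ⟨_, he⟩ := show c ∈ s(b, c) by simp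
      refine ⟨hc, h2.trans heB, hconn.trans ?_⟩
      exact (Conn.of_le (mem_Ioo_of (show (.bot : Face P) ≤ _ from trivial) heB (by simp) (by simp; omega)) h1).trans
        (Conn.of_ge (hS _ (h2.trans heB)) h2)
  obtain ⟨hw', -, hc⟩ := conv w walk
  exact ((Conn.of_ge (hS _ hvB) hv).trans hc).trans (Conn.of_le hb hw)

theorem exists_edge_between (h : P.IsLocallyPolyhedral D) (hD : D.IsRegular) {x : P.verts}
    {z : Face P} (hz : .vert x < z) :
    ∃ (y : E3) (he : s(x.1, y) ∈ P.edges), (.edge ⟨_, he⟩ : Face P) ≤ z := by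
  have r := rank_lt_of_lt hz
  have hle := le_def.1 hz.le
  have key : ∀ e : P.edges, x.1 ∈ e.1 → (.edge e : Face P) ≤ z →
      ∃ (y : E3) (he : s(x.1, y) ∈ P.edges), (.edge ⟨_, he⟩ : Face P) ≤ z := by
    rintro ⟨e, he⟩ hx hez
    obtain ⟨y, rfl⟩ := Sym2.mem_iff_exists.1 hx
    exact ⟨y, he, hez⟩
  cases z with
  | bot | vert => simp at r
  | edge e => exact key e hle (le_refl _)
  | face F => obtain ⟨e, h1, h2⟩ := hle; exact key e h1 h2
  | facet C => obtain ⟨e, F, h1, h2, h3⟩ := hle; exact key e h1 ⟨F, h2, h3⟩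
  | top => obtain ⟨y, hy⟩ := h.exists_edge hD x.2; exact ⟨y, hy, trivial⟩

/-- It suffices to connect edges at `x`, that is, nodes of `D`. For a facet this is the
connectedness of a face of `D`, for the greatest face that of the edge graph of `D`. -/
theorem conn_vert (h : P.IsLocallyPolyhedral D) (hD : D.IsRegular) (x : P.verts) {B : Face P}
    (hB : 4 ≤ B.rank) {a b : Face P} (ha : a ∈ Set.Ioo (.vert x) B) (hb : b ∈ Set.Ioo (.vert x) B) :
    Conn (Set.Ioo (.vert x) B) a b := by
  obtain ⟨nb, fc, ct, hs⟩ := h.star x.1 x.2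
  obtain ⟨y, hy, hya⟩ := h.exists_edge_between hD ha.1
  obtain ⟨y', hy', hyb⟩ := h.exists_edge_between hD hb.1
  have hle : ∀ {y} (he : s(x.1, y) ∈ P.edges), (.vert x : Face P) ≤ .edge ⟨_, he⟩ := fun {y} he =>
    show x.1 ∈ s(x.1, y) by simp
  have hS : ∀ {y} (he : s(x.1, y) ∈ P.edges), (.edge ⟨_, he⟩ : Face P) ≤ B →
      (.edge ⟨_, he⟩ : Face P) ∈ Set.Ioo (.vert x) B := fun he heB =>
    mem_Ioo_of (hle he) heB (by simp) (by simp; omega)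
  suffices H : Conn (Set.Ioo (.vert x) B) (.edge ⟨_, hy⟩) (.edge ⟨_, hy'⟩) from
    ((Conn.of_ge (hS hy (hya.trans ha.2.le)) hya).trans H).trans (Conn.of_le hb hyb)
  have hyB := hya.trans ha.2.le
  have hyB' := hyb.trans hb.2.le
  obtain ⟨w, hw, rfl⟩ := (hs.edge_iff y).1 hy
  obtain ⟨w', hw', rfl⟩ := (hs.edge_iff y').1 hy'
  have he : ∀ w ∈ D.nodes, s(x.1, nb w) ∈ P.edges := fun w hw => (hs.edge_iff _).2 ⟨w, hw, rfl⟩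
  have step : ∀ u u' (hA : D.Adj u u'), (.face ⟨_, hs.fc_mem u u' hA⟩ : Face P) ≤ B →
      Conn (Set.Ioo (.vert x) B) (.edge ⟨_, he u hA.1⟩) (.edge ⟨_, he u' hA.2.1⟩) := by
    intro u u' hA hfB
    have l1 : (.edge ⟨_, he u hA.1⟩ : Face P) ≤ .face ⟨_, hs.fc_mem u u' hA⟩ :=
      (hs.fc_edges u u' hA _).2 (Or.inl rfl)
    have l2 : (.edge ⟨_, he u' hA.2.1⟩ : Face P) ≤ .face ⟨_, hs.fc_mem u u' hA⟩ :=
      (hs.fc_edges u u' hA _).2 (Or.inr rfl)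
    exact (Conn.of_le (mem_Ioo_of ((hle _).trans l1) hfB (by simp)
      (by simp; omega)) l1).trans (Conn.of_ge (hS _ (l2.trans hfB)) l2)
  cases B with
  | bot | vert | edge | face => simp at hB
  | facet C =>
    obtain ⟨F, h1, h2⟩ := le_def.1 hyB
    obtain ⟨F', h1', h2'⟩ := le_def.1 hyB'
    obtain ⟨ν, hν, hC⟩ := hs.facet_eq C.1 C.2 F h2 _ h1
    have on_face : ∀ u ∈ D.nodes, ∀ F : P.faces, s(x.1, nb u) ∈ F.1.edges → F.1 ∈ C.1 →
        idot u ν = 1 := by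
      intro u hu F h1 h2
      obtain ⟨t, t', hA, hF, ht⟩ := hs.face_at F.2 h1
      obtain rfl := hs.nb_inj _ hu _ hA.1 ht
      rw [hF, hC, hs.fc_mem_ct _ _ hA ν hν] at h2
      exact h2.1
    have hwν := on_face w hw F h1 h2
    have hwν' := on_face w' hw' F' h1' h2'
    have inC : ∀ u u' (hA : D.Adj u u'), idot u ν = 1 → idot u' ν = 1 →
        (.face ⟨_, hs.fc_mem u u' hA⟩ : Face P) ≤ .facet C := by
      intro u u' hA e1 e2
      change fc u u' ∈ C.1
      rw [hC]
      exact (hs.fc_mem_ct _ _ hA ν hν).2 ⟨e1, e2⟩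
    rcases hD.face_connected ν hν w hw w' hw' hwν hwν' with rfl | hA | ⟨t, ht, htν, hA1, hA2⟩
    · exact .refl
    · exact step _ _ hA (inC _ _ hA hwν hwν')
    · exact (step _ _ hA1 (inC _ _ hA1 hwν htν)).trans (step _ _ hA2 (inC _ _ hA2 htν hwν'))
  | top =>
    have step' : ∀ u (hu : u ∈ D.nodes) u' (hu' : u' ∈ D.nodes), u = u' ∨ D.Adj u u' →
        Conn (Set.Ioo (.vert x) .top) (.edge ⟨_, he u hu⟩) (.edge ⟨_, he u' hu'⟩) := by
      rintro u hu u' hu' (rfl | hA)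
      · exact .refl
      · exact step u u' hA trivial
    obtain ⟨t, ht, t', ht', e1, e2, e3⟩ := hD.graph_connected w hw w' hw'
    exact ((step' _ hw _ ht e1).trans (step' _ ht _ ht' e2)).trans (step' _ ht' _ hw' e3)

/-- It suffices to connect 2-faces, which are the edges of `D` at one node. Two of them are linked
through a third edge that shares a face of `D` with each. -/
theorem conn_edge (h : P.IsLocallyPolyhedral D) (hD : D.IsRegular) (e : P.edges)
    {a b : Face P} (ha : a ∈ Set.Ioo (.edge e) .top) (hb : b ∈ Set.Ioo (.edge e) .top) :
    Conn (Set.Ioo (.edge e) .top) a b := by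
  have hface : ∀ a : Face P, a ∈ Set.Ioo (.edge e) .top → ∃ F : P.faces, e.1 ∈ F.1.edges ∧
      (.face F : Face P) ≤ a := by
    rintro a ⟨h1, h2⟩
    have r1 := rank_lt_of_lt h1
    have r2 := rank_lt_of_lt h2
    have hle := le_def.1 h1.le
    cases a with
    | bot | vert | edge | top => simp at r1 r2
    | face F => exact ⟨F, hle, le_refl _⟩
    | facet C => obtain ⟨F, h3, h4⟩ := hle; exact ⟨F, h3, h4⟩
  obtain ⟨F, heF, hFa⟩ := hface a ha
  obtain ⟨F', heF', hFb⟩ := hface b hb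
  have hS : ∀ F : P.faces, e.1 ∈ F.1.edges → (.face F : Face P) ∈ Set.Ioo (.edge e) .top :=
    fun F hF => mem_Ioo_of hF trivial (by simp) (by simp)
  suffices H : Conn (Set.Ioo (.edge e) .top) (.face F) (.face F') from
    ((Conn.of_ge (hS F heF) hFa).trans H).trans (Conn.of_le hb hFb)
  obtain ⟨e, he⟩ := e
  induction e using Sym2.ind with | _ x y
  obtain ⟨nb, fc, ct, hs⟩ := h.star x (h.left_mem he)
  obtain ⟨w, u, hA, hF, rfl⟩ := hs.face_at F.2 heF
  obtain ⟨w', u', hA', hF', hw'⟩ := hs.face_at F'.2 heF'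
  obtain rfl := hs.nb_inj _ hA.1 _ hA'.1 hw'
  have step : ∀ (G G' : P.faces) u u', D.Adj w u → D.Adj w u' → G.1 = fc w u → G'.1 = fc w u' →
      (∃ ν ∈ D.normals, idot w ν = 1 ∧ idot u ν = 1 ∧ idot u' ν = 1) →
      Conn (Set.Ioo (.edge ⟨_, he⟩) .top) (.face G : Face P) (.face G') := by
    rintro G G' u u' hu hu' hG hG' ⟨ν, hν, e1, e2, e3⟩
    have l1 : (.face G : Face P) ≤ .facet ⟨_, hs.ct_mem ν hν⟩ := by
      change G.1 ∈ ct ν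
      rw [hG]; exact (hs.fc_mem_ct _ _ hu ν hν).2 ⟨e1, e2⟩
    have l2 : (.face G' : Face P) ≤ .facet ⟨_, hs.ct_mem ν hν⟩ := by
      change G'.1 ∈ ct ν
      rw [hG']; exact (hs.fc_mem_ct _ _ hu' ν hν).2 ⟨e1, e3⟩
    have g1 : s(x, nb w) ∈ G.1.edges := by
      rw [hG]; exact (hs.fc_edges _ _ hu _).2 (Or.inl rfl)
    have g2 : s(x, nb w) ∈ G'.1.edges := by
      rw [hG']; exact (hs.fc_edges _ _ hu' _).2 (Or.inl rfl)
    have g3 : (.edge ⟨_, he⟩ : Face P) ≤ .face G := g1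
    exact (Conn.of_le (mem_Ioo_of (g3.trans l1) (show _ ≤ (.top : Face P) from trivial) (by simp) (by simp)) l1).trans
      (Conn.of_ge (hS G' g2) l2)
  obtain ⟨z, hz, hAz, ⟨ν, hν, e1, e2, e3⟩, ⟨ν', hν', e1', e2', e3'⟩⟩ :=
    hD.node_connected w hA.1 u hA.2.1 u' hA'.2.1 hA hA'
  exact (step F ⟨_, hs.fc_mem _ _ hAz⟩ u z hA hAz hF rfl ⟨ν, hν, e1, e2, e3⟩).trans
    (step _ F' z u' hAz hA' rfl hF' ⟨ν', hν', e1', e3', e2'⟩)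

/-- Structures with polyhedral vertex-figures are abstract polytopes. -/
theorem isAbstractPolytope (h : P.IsLocallyPolyhedral D) (hD : D.IsRegular) :
    IsAbstractPolytope 4 (Face P) where
  flag_card Φ := by
    rw [encard_flag (h.dense hD) Φ]
    norm_num
  section_connected A B := by
    rintro ⟨x, y, h1, h2, h3⟩ a ha b hb
    have r1 := rank_lt_of_lt h1
    have r2 := rank_lt_of_lt h2
    have r3 := rank_lt_of_lt h3
    have r4 := rank_le_five B
    cases A with
    | bot => exact h.conn_bot (by omega) ha hb
    | vert v =>
      exact h.conn_vert hD v (by simp at r1; omega) ha hb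
    | edge e =>
      cases B with
      | top => exact h.conn_edge hD e ha hb
      | bot | vert | edge | face | facet => 
        simp only [rank_edge, Face.rank_bot, rank_vert, rank_face, rank_facet] at r1 r3
        omega
    | face | facet | top => 
      simp only [rank_face, rank_facet, Face.rank_top] at r1
      omega
  diamond := h.diamond hD

end Complex3.IsLocallyPolyhedral

end


/-! ### From the neighbour rule to the model polyhedra. -/

noncomputable section

theorem idot_icross_left (a b : Z3) : idot (icross a b) a = 0 := by
  simp [idot, icross]; ring

theorem idot_icross_right (a b : Z3) : idot (icross a b) b = 0 := by
  simp [idot, icross]; ring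

theorem idot_icross_self (a b : Z3) :
    idot (icross a b) (icross a b) = idot a a * idot b b - idot a b ^ 2 := by
  simp [idot, icross]; ring

/-- Integral points after a similarity that fixes the origin. -/
def scaledPoint (κ : ℝ) (J : E3 ≃ₗᵢ[ℝ] E3) (n : Z3) : E3 := κ • J (intPoint n)

section scaledPoint

variable {κ : ℝ} {J : E3 ≃ₗᵢ[ℝ] E3}

theorem scaledPoint_add (m n : Z3) :
    scaledPoint κ J (m + n) = scaledPoint κ J m + scaledPoint κ J n := by
  simp [scaledPoint, intPoint_add]

theorem scaledPoint_sub (m n : Z3) :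
    scaledPoint κ J (m - n) = scaledPoint κ J m - scaledPoint κ J n := by
  simp [scaledPoint, intPoint_sub, smul_sub]

theorem scaledPoint_neg (n : Z3) : scaledPoint κ J (-n) = -scaledPoint κ J n := by
  simp [scaledPoint, intPoint_neg]

theorem scaledPoint_zsmul (k : ℤ) (n : Z3) :
    scaledPoint κ J (k • n) = (k : ℝ) • scaledPoint κ J n := by
  simp only [scaledPoint, intPoint_zsmul, map_smul]
  rw [smul_comm]

theorem inner_scaledPoint (m n : Z3) :
    inner ℝ (scaledPoint κ J m) (scaledPoint κ J n) = κ ^ 2 * (idot m n : ℝ) := by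
  simp [scaledPoint, inner_smul_left, inner_smul_right, inner_intPoint]
  ring

theorem scaledPoint_injective (hκ : κ ≠ 0) : Function.Injective (scaledPoint κ J) := fun _ _ h =>
  intPoint_injective (J.injective (smul_right_injective E3 hκ h))

end scaledPoint

theorem pow_four_eq_one_iff (ω : ℂ) : ω ^ 4 = 1 ↔ (ω.re = 1 ∧ ω.im = 0) ∨ (ω.re = -1 ∧ ω.im = 0) ∨
    (ω.re = 0 ∧ ω.im = 1) ∨ (ω.re = 0 ∧ ω.im = -1) := by
  have e : ω ^ 4 - 1 = (ω - 1) * (ω + 1) * ((ω - Complex.I) * (ω + Complex.I)) := by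
    linear_combination (ω ^ 2 - 1) * Complex.I_sq
  rw [← sub_eq_zero, e]
  simp only [mul_eq_zero, sub_eq_zero, add_eq_zero_iff_eq_neg, Complex.ext_iff]
  simp
  tauto

theorem pow_three_eq_one_iff (ω : ℂ) : ω ^ 3 = 1 ↔ (ω.re = 1 ∧ ω.im = 0) ∨
    (ω.re = -1 / 2 ∧ ω.im = √3 / 2) ∨ (ω.re = -1 / 2 ∧ ω.im = -(√3 / 2)) := by
  have h3 : (√3 : ℝ) ^ 2 = 3 := Real.sq_sqrt (by norm_num)
  let z : ℂ := ⟨-1 / 2, √3 / 2⟩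
  let z' : ℂ := ⟨-1 / 2, -(√3 / 2)⟩
  have hs : z + z' = -1 := by apply Complex.ext <;> norm_num [z, z']
  have hp : z * z' = 1 := by
    apply Complex.ext <;> simp [z, z']
    · linear_combination h3 / 4
    · ring
  have e : ω ^ 3 - 1 = (ω - 1) * ((ω - z) * (ω - z')) := by
    linear_combination (ω - 1) * (ω * hs - hp)
  rw [← sub_eq_zero, e]
  simp only [mul_eq_zero, sub_eq_zero, Complex.ext_iff]
  simp [z, z']

namespace IntPolyhedron

/-- The four neighbours of `a` are the images of one of them under quarter-turns about `a`, in the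
form that matches the fourth roots of unity. -/
theorem octa_neighbours : ∀ a ∈ octa.nodes, ∀ b ∈ octa.nodes, octa.Adj a b →
    (octa.Adj a (-b) ∧ octa.Adj a (icross a b) ∧ octa.Adj a (-icross a b)) ∧
      ∀ w ∈ octa.nodes, octa.Adj a w → w = b ∨ w = -b ∨ w = icross a b ∨ w = -icross a b := by
  decide

/-- The nodes `u` and `u'` are the images of `b` under the rotations by a third of a turn about `a`,
for nodes of squared length `3`. The formulas are doubled to remain integral. -/
def HasTriangularLinks (D : IntPolyhedron) : Prop := ∀ a ∈ D.nodes, ∀ b ∈ D.nodes, D.Adj a b →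
    ∃ u ∈ D.nodes, ∃ u' ∈ D.nodes, D.Adj a u ∧ D.Adj a u' ∧
      (2 : ℤ) • u = D.adj • a - b + icross a b ∧ (2 : ℤ) • u' = D.adj • a - b - icross a b ∧
      ∀ w ∈ D.nodes, D.Adj a w → w = b ∨ w = u ∨ w = u'

theorem tetra_hasTriangularLinks : tetra.HasTriangularLinks := by
  unfold HasTriangularLinks; decide

theorem hexa_hasTriangularLinks : hexa.HasTriangularLinks := by
  unfold HasTriangularLinks; decide

end IntPolyhedron

namespace LocalData

open IntPolyhedron

variable {A : E3 → E3 → Prop} {Γ : Subgroup (E3 ≃ₗᵢ[ℝ] E3)} {ℓ c κ : ℝ} {J : E3 ≃ₗᵢ[ℝ] E3}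

/-- Arcs at a node of `D` lead exactly to the adjacent nodes. -/
def FollowsLinks (A : E3 → E3 → Prop) (D : IntPolyhedron) (κ : ℝ) (J : E3 ≃ₗᵢ[ℝ] E3) : Prop :=
  ∀ a b, D.Adj a b → A (scaledPoint κ J a) (scaledPoint κ J b) →
    ∀ x, A (scaledPoint κ J a) x ↔ ∃ w, D.Adj a w ∧ x = scaledPoint κ J w

/-- By Lagrange's identity the cross product, divided by the length of the nodes, has the length
that the rule requires of the normal. -/
theorem NeighbourRule.apply_icross {r : ℕ} (h : NeighbourRule A ℓ c r) {D : IntPolyhedron}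
    (hD : D.IsRegular) (hℓ : ℓ ^ 2 = κ ^ 2 * D.normSq) (hc : c * D.normSq = D.adj) {a b : Z3}
    (hab : D.Adj a b) (hA : A (scaledPoint κ J a) (scaledPoint κ J b)) (x : E3) :
    A (scaledPoint κ J a) x ↔ ∃ ω : ℂ, ω ^ r = 1 ∧ x = c • scaledPoint κ J a +
      (ω.re • (scaledPoint κ J b - c • scaledPoint κ J a) +
        ω.im • ((√(D.normSq : ℝ))⁻¹ • scaledPoint κ J (icross a b))) := by
  have hm : (0 : ℝ) < D.normSq := by exact_mod_cast hD.normSq_pos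
  refine h _ _ _ hA ?_ ?_ ?_ x
  · rw [inner_smul_left, inner_scaledPoint, idot_icross_left]; simp
  · rw [inner_smul_left, inner_scaledPoint, idot_icross_right]; simp
  · rw [← real_inner_self_eq_norm_sq, inner_smul_left, inner_smul_right, inner_scaledPoint,
      idot_icross_self, hD.normSq_eq a hab.1, hD.normSq_eq b hab.2.1, hab.2.2, hℓ]
    push_cast
    rw [← hc, conj_trivial, ← mul_assoc, ← sq, inv_pow, Real.sq_sqrt hm.le]
    field_simp

theorem followsLinks_octa (h : NeighbourRule A ℓ c 4) (hℓ : ℓ ^ 2 = κ ^ 2) (hc : c = 0) :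
    FollowsLinks A octa κ J := by
  intro a b hab hA x
  have hm : octa.normSq = 1 := rfl
  have hk : octa.adj = 0 := rfl
  rw [h.apply_icross octa_isRegular (by rw [hℓ, hm]; simp) (by rw [hc, hk]; simp) hab hA x]
  obtain ⟨⟨h1, h2, h3⟩, hmax⟩ := octa_neighbours a hab.1 b hab.2.1 hab
  simp only [pow_four_eq_one_iff, hc, hm, zero_smul, sub_zero, zero_add, Int.cast_one,
    Real.sqrt_one, inv_one, one_smul]
  constructor
  · rintro ⟨ω, (⟨e1, e2⟩ | ⟨e1, e2⟩ | ⟨e1, e2⟩ | ⟨e1, e2⟩), rfl⟩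
    · exact ⟨b, hab, by simp [e1, e2]⟩
    · exact ⟨-b, h1, by simp [e1, e2, scaledPoint_neg]⟩
    · exact ⟨_, h2, by simp [e1, e2]⟩
    · exact ⟨_, h3, by simp [e1, e2, scaledPoint_neg]⟩
  · rintro ⟨w, hw, rfl⟩
    rcases hmax w hw.2.1 hw with rfl | rfl | rfl | rfl
    · exact ⟨⟨1, 0⟩, by simp⟩
    · exact ⟨⟨-1, 0⟩, by simp [scaledPoint_neg]⟩
    · exact ⟨⟨0, 1⟩, by simp⟩
    · exact ⟨⟨0, -1⟩, by simp [scaledPoint_neg]⟩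

theorem followsLinks_of_hasTriangularLinks {D : IntPolyhedron} (hD : D.IsRegular)
    (hm : D.normSq = 3) (hD3 : D.HasTriangularLinks) (h : NeighbourRule A ℓ c 3)
    (hℓ : ℓ ^ 2 = κ ^ 2 * 3) (hc : c * 3 = D.adj) : FollowsLinks A D κ J := by
  intro a b hab hA x
  rw [h.apply_icross hD (by rw [hℓ, hm]; simp) (by rw [← hc, hm]; simp) hab hA x]
  obtain ⟨u, hu, u', hu', hAu, hAu', e, e', hmax⟩ := hD3 a hab.1 b hab.2.1 hab
  have E := congrArg (scaledPoint κ J) e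
  have E' := congrArg (scaledPoint κ J) e'
  rw [scaledPoint_zsmul, scaledPoint_add, scaledPoint_sub, scaledPoint_zsmul, ← hc] at E
  rw [scaledPoint_zsmul, scaledPoint_sub, scaledPoint_sub, scaledPoint_zsmul, ← hc] at E'
  have h3 : (0 : ℝ) < √3 := by positivity
  have h3' : √3 / 2 * (√3)⁻¹ = (1 / 2 : ℝ) := by field_simp
  have T1 : scaledPoint κ J u = c • scaledPoint κ J a +
      ((-1 / 2 : ℝ) • (scaledPoint κ J b - c • scaledPoint κ J a) +
        (√3 / 2) • ((√3)⁻¹ • scaledPoint κ J (icross a b))) := by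
    rw [smul_smul, h3']
    have : scaledPoint κ J u = (1 / 2 : ℝ) • (((2 : ℤ) : ℝ) • scaledPoint κ J u) := by
      rw [smul_smul]; norm_num
    rw [this, E]
    module
  have T2 : scaledPoint κ J u' = c • scaledPoint κ J a +
      ((-1 / 2 : ℝ) • (scaledPoint κ J b - c • scaledPoint κ J a) +
        (-(√3 / 2)) • ((√3)⁻¹ • scaledPoint κ J (icross a b))) := by
    rw [smul_smul, neg_mul, h3']
    have : scaledPoint κ J u' = (1 / 2 : ℝ) • (((2 : ℤ) : ℝ) • scaledPoint κ J u') := by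
      rw [smul_smul]; norm_num
    rw [this, E']
    module
  simp only [pow_three_eq_one_iff, hm, Int.cast_ofNat]
  constructor
  · rintro ⟨ω, (⟨e1, e2⟩ | ⟨e1, e2⟩ | ⟨e1, e2⟩), rfl⟩
    · exact ⟨b, hab, by simp [e1, e2]⟩
    · exact ⟨u, hAu, by rw [T1, e1, e2]⟩
    · exact ⟨u', hAu', by rw [T2, e1, e2]⟩
  · rintro ⟨w, hw, rfl⟩
    rcases hmax w hw.2.1 hw with rfl | rfl | rfl
    · exact ⟨⟨1, 0⟩, by simp⟩
    · exact ⟨⟨-1 / 2, √3 / 2⟩, by simp, T1⟩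
    · exact ⟨⟨-1 / 2, -(√3 / 2)⟩, by simp, T2⟩

/-- The arcs are the images of the edges of `D` under a similarity. -/
theorem arc_iff_of_followsLinks {D : IntPolyhedron} (h : LocalData A Γ ℓ c) (hD : D.IsRegular)
    (hF : FollowsLinks A D κ J)
    (hbase : A (scaledPoint κ J D.node₀) (scaledPoint κ J D.node₁)) (a b : E3) :
    A a b ↔ ∃ w w', D.Adj w w' ∧ a = scaledPoint κ J w ∧ b = scaledPoint κ J w' := by
  -- Knowing the neighbours of `w` gives an arc from each of them back to `w`, so the existence of a
  -- model arc spreads over the connected graph of `D`. Conversely, connectedness of the arcs keeps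
  -- all of them inside the model.
  have step : ∀ w, (∃ w', D.Adj w w' ∧ A (scaledPoint κ J w) (scaledPoint κ J w')) → ∀ w',
      D.Adj w w' → ∃ w'', D.Adj w' w'' ∧ A (scaledPoint κ J w') (scaledPoint κ J w'') := by
    rintro w ⟨u, hu, hA⟩ w' hw'
    exact ⟨w, hw'.symm, h.symm ((hF w u hu hA _).2 ⟨w', hw', rfl⟩)⟩
  have all : ∀ w ∈ D.nodes, ∃ w', D.Adj w w' ∧ A (scaledPoint κ J w) (scaledPoint κ J w') := by
    intro w hw
    obtain ⟨x, -, y, -, h1, h2, h3⟩ := hD.graph_connected D.node₀ hD.base_adj.1 w hw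
    have step' : ∀ w w', w = w' ∨ D.Adj w w' →
        (∃ w', D.Adj w w' ∧ A (scaledPoint κ J w) (scaledPoint κ J w')) →
        ∃ w'', D.Adj w' w'' ∧ A (scaledPoint κ J w') (scaledPoint κ J w'') := by
      rintro w w' (rfl | hA) hw
      · exact hw
      · exact step w hw w' hA
    exact step' _ _ h3 (step' _ _ h2 (step' _ _ h1 ⟨_, hD.base_adj, hbase⟩))
  constructor
  · intro hab
    have node : ∃ w ∈ D.nodes, a = scaledPoint κ J w := by
      have := h.connected hbase hab
      clear hab
      induction this with
      | refl => exact ⟨_, hD.base_adj.1, rfl⟩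
      | tail _ hbc ih =>
        obtain ⟨w, hw, rfl⟩ := ih
        obtain ⟨w', hw', hA⟩ := all w hw
        obtain ⟨u, hu, rfl⟩ := (hF w w' hw' hA _).1 hbc
        exact ⟨u, hu.2.1, rfl⟩
    obtain ⟨w, hw, rfl⟩ := node
    obtain ⟨w', hw', hA⟩ := all w hw
    obtain ⟨u, hu, rfl⟩ := (hF w w' hw' hA _).1 hab
    exact ⟨w, u, hu, rfl, rfl⟩
  · rintro ⟨w, w', hw, rfl, rfl⟩
    obtain ⟨u, hu, hA⟩ := all w hw.1
    exact (hF w u hu hA _).2 ⟨w', hw, rfl⟩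

/-- Bases adapted to the base edge of `D` and to an arc are matched. The angles agree by `hc`, and
the lengths agree after scaling by `κ`. -/
theorem exists_base_map {D : IntPolyhedron} (h : LocalData A Γ ℓ c) (hD : D.IsRegular)
    (hc : c * D.normSq = D.adj) (hκ : 0 < κ) (hℓ : ℓ ^ 2 = κ ^ 2 * D.normSq) :
    ∃ J : E3 ≃ₗᵢ[ℝ] E3, A (scaledPoint κ J D.node₀) (scaledPoint κ J D.node₁) := by
  obtain ⟨a, b, hab⟩ := h.exists_arc
  obtain ⟨o, ha, hb⟩ := h.exists_basis hab
  have hm : (0 : ℝ) < D.normSq := by exact_mod_cast hD.normSq_pos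
  set m : ℝ := √(D.normSq : ℝ) with hmdef
  have hm2 : m ^ 2 = D.normSq := Real.sq_sqrt hm.le
  have hm0 : 0 < m := Real.sqrt_pos.2 hm
  have hnorm : ∀ w ∈ D.nodes, ‖intPoint w‖ = m := by
    intro w hw
    rw [hmdef, ← hD.normSq_eq w hw, ← inner_intPoint, real_inner_self_eq_norm_sq,
      Real.sqrt_sq (norm_nonneg _)]
  obtain ⟨o', ha', hb'⟩ := exists_adapted_basis hm0 h.lt (hnorm _ hD.base_adj.1)
    (hnorm _ hD.base_adj.2.1) (by rw [inner_intPoint, hD.base_adj.2.2, hm2, ← hc]; ring)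
  have hℓm : κ * m = ℓ := by
    have : (κ * m) ^ 2 = ℓ ^ 2 := by rw [mul_pow, hm2, hℓ]
    exact (pow_left_inj₀ (by positivity) h.pos.le (by norm_num)).1 this
  refine ⟨o'.equiv o (Equiv.refl _), ?_⟩
  convert hab using 1
  · rw [scaledPoint, ha', map_smul, OrthonormalBasis.equiv_apply_basis, ha, smul_smul, hℓm]
    rfl
  · rw [scaledPoint, hb', map_smul, map_add, map_smul, map_smul,
      OrthonormalBasis.equiv_apply_basis, OrthonormalBasis.equiv_apply_basis, hb, smul_smul, hℓm]
    rfl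

/-- Integral coordinates for the arcs at a vertex. -/
def HasModel (A : E3 → E3 → Prop) (D : IntPolyhedron) : Prop :=
  ∃ (κ : ℝ) (J : E3 ≃ₗᵢ[ℝ] E3), 0 < κ ∧
    ∀ a b, A a b ↔ ∃ w w', D.Adj w w' ∧ a = scaledPoint κ J w ∧ b = scaledPoint κ J w'

theorem hasModel_octa (h : LocalData A Γ ℓ c) (hr : NeighbourRule A ℓ c 4) (hc : c = 0) :
    HasModel A octa := by
  obtain ⟨J, hJ⟩ := h.exists_base_map (κ := ℓ) octa_isRegular
    (by rw [hc, show octa.adj = 0 from rfl]; simp) h.pos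
    (by rw [show octa.normSq = 1 from rfl]; simp)
  exact ⟨ℓ, J, h.pos, h.arc_iff_of_followsLinks octa_isRegular
    (followsLinks_octa hr rfl hc) hJ⟩

theorem hasModel_of_hasTriangularLinks {D : IntPolyhedron} (h : LocalData A Γ ℓ c)
    (hD : D.IsRegular) (hm : D.normSq = 3) (hD3 : D.HasTriangularLinks)
    (hr : NeighbourRule A ℓ c 3) (hc : c * 3 = D.adj) : HasModel A D := by
  have hℓ := h.pos
  -- The nodes have length `√3`, so this scale produces edges of length `ℓ`.
  have h3 : (ℓ / √3) ^ 2 * 3 = ℓ ^ 2 := by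
    rw [div_pow, Real.sq_sqrt (by norm_num)]; field_simp
  obtain ⟨J, hJ⟩ := h.exists_base_map (κ := ℓ / √3) hD (by rw [← hc, hm]; simp) (by positivity)
    (by rw [hm, ← h3]; simp)
  exact ⟨ℓ / √3, J, by positivity, h.arc_iff_of_followsLinks hD
    (followsLinks_of_hasTriangularLinks hD hm hD3 hr h3.symm hc) hJ⟩

end LocalData

end


/-! ### The apeirotope over a polyhedron: sites, zigzags, slabs and stars. -/

noncomputable section

namespace Figure

theorem ofSeq_comp_shift (q : ℤ → E3) (k : ℤ) : ofSeq (fun i => q (i + k)) = ofSeq q := by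
  ext x
  · simp only [ofSeq, Set.mem_range]
    constructor
    · rintro ⟨i, rfl⟩; exact ⟨_, rfl⟩
    · rintro ⟨i, rfl⟩; exact ⟨i - k, by simp⟩
  · simp only [ofSeq, Set.mem_range]
    constructor
    · rintro ⟨i, rfl⟩; exact ⟨i + k, by rw [add_right_comm]⟩
    · rintro ⟨i, rfl⟩; exact ⟨i - k, by rw [add_right_comm, sub_add_cancel]⟩

theorem ofSeq_comp_reflect {ι : Type} [AddCommGroup ι] [One ι] (q : ι → E3) (k : ι) :
    ofSeq (fun i => q (k - i)) = ofSeq q := by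
  ext x
  · simp only [ofSeq, Set.mem_range]
    constructor
    · rintro ⟨i, rfl⟩; exact ⟨_, rfl⟩
    · rintro ⟨i, rfl⟩; exact ⟨k - i, by simp⟩
  · simp only [ofSeq, Set.mem_range]
    constructor
    · rintro ⟨i, rfl⟩; exact ⟨k - (i + 1), by rw [Sym2.eq_swap]; congr 3; abel⟩
    · rintro ⟨i, rfl⟩; exact ⟨k - (i + 1), by rw [Sym2.eq_swap]; congr 3 <;> abel⟩

theorem map_ofSeq {ι : Type} [Add ι] [One ι] (g : E3 → E3) (q : ι → E3) :
    (ofSeq q).map g = ofSeq (g ∘ q) := by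
  ext x <;> simp [map, ofSeq]

end Figure

namespace IntPolyhedron

variable {D : IntPolyhedron}

/-- The lattice generated by the differences of the nodes. -/
def lattice (D : IntPolyhedron) : AddSubgroup Z3 :=
  AddSubgroup.closure {d | ∃ w ∈ D.nodes, ∃ w' ∈ D.nodes, d = w - w'}

theorem sub_mem_lattice {w w' : Z3} (hw : w ∈ D.nodes) (hw' : w' ∈ D.nodes) : w - w' ∈ D.lattice :=
  AddSubgroup.subset_closure ⟨w, hw, w', hw', rfl⟩

/-- The vertices of the apeirotope over `D`, with a sign: the neighbours of `n` are the points
`n + ε w` for the nodes `w`. -/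
def Site (D : IntPolyhedron) (n : Z3) (ε : ℤ) : Prop :=
  (ε = 1 ∧ n ∈ D.lattice) ∨ (ε = -1 ∧ n - D.node₀ ∈ D.lattice)

theorem site_zero : D.Site 0 1 := Or.inl ⟨rfl, zero_mem _⟩

theorem Site.sign {n : Z3} {ε : ℤ} (h : D.Site n ε) : ε = 1 ∨ ε = -1 :=
  h.imp And.left And.left

theorem Site.add {n l : Z3} {ε : ℤ} (h : D.Site n ε) (hl : l ∈ D.lattice) : D.Site (n + l) ε := by
  rcases h with ⟨rfl, h⟩ | ⟨rfl, h⟩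
  · exact Or.inl ⟨rfl, add_mem h hl⟩
  · exact Or.inr ⟨rfl, by rw [add_sub_right_comm]; exact add_mem h hl⟩

theorem Site.neighbour {n w : Z3} {ε : ℤ} (hD : D.IsRegular) (h : D.Site n ε) (hw : w ∈ D.nodes) :
    D.Site (n + ε • w) (-ε) := by
  rcases h with ⟨rfl, h⟩ | ⟨rfl, h⟩
  · refine Or.inr ⟨rfl, ?_⟩
    rw [one_smul, add_sub_assoc]
    exact add_mem h (sub_mem_lattice hw hD.base_adj.1)
  · refine Or.inl ⟨by norm_num, ?_⟩
    have := add_mem h (sub_mem_lattice hD.base_adj.1 hw)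
    rwa [sub_add_sub_cancel, sub_eq_add_neg, ← neg_one_smul ℤ w] at this

/-- All nodes have odd inner product with a normal, so their differences have even inner product. -/
theorem two_dvd_idot (hD : D.IsRegular) {l ν : Z3} (hl : l ∈ D.lattice) (hν : ν ∈ D.normals) :
    (2 : ℤ) ∣ idot l ν := by
  induction hl using AddSubgroup.closure_induction with
  | mem x hx =>
    obtain ⟨w, hw, w', hw', rfl⟩ := hx
    have := hD.odd w hw ν hν
    have := hD.odd w' hw' ν hν
    rw [idot_sub]
    omega
  | zero => simp [idot]
  | add x y _ _ hx hy => rw [idot_add]; exact dvd_add hx hy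
  | neg x _ hx => rw [idot_neg]; exact (dvd_neg).2 hx

theorem Site.parity (hD : D.IsRegular) {n ν : Z3} {ε : ℤ} (h : D.Site n ε) (hν : ν ∈ D.normals) :
    (ε = 1 ∧ idot n ν % 2 = 0) ∨ (ε = -1 ∧ idot n ν % 2 = 1) := by
  rcases h with ⟨rfl, h⟩ | ⟨rfl, h⟩
  · have := two_dvd_idot hD h hν
    exact Or.inl ⟨rfl, by omega⟩
  · have h1 := two_dvd_idot hD h hν
    have h2 := hD.odd _ hD.base_adj.1 ν hν
    rw [idot_sub] at h1
    exact Or.inr ⟨rfl, by omega⟩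

/-- The parity of the inner product with a normal tells the two classes apart: even on the lattice,
odd on its translate by a node. -/
theorem Site.unique (hD : D.IsRegular) {n : Z3} {ε ε' : ℤ} (h : D.Site n ε) (h' : D.Site n ε') :
    ε = ε' := by
  have h1 := h.parity hD hD.normal_mem
  have h2 := h'.parity hD hD.normal_mem
  omega

/-- The vertices of the zigzag through `n + ε w'`, `n`, `n + ε w`. -/
def zseq (n : Z3) (ε : ℤ) (w w' : Z3) (i : ℤ) : Z3 :=
  n + (i / 2) • (ε • (w - w')) + (i % 2) • (ε • w)

theorem zseq_even (n : Z3) (ε : ℤ) (w w' : Z3) (k : ℤ) :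
    zseq n ε w w' (2 * k) = n + k • (ε • (w - w')) := by
  simp [zseq]

theorem zseq_odd (n : Z3) (ε : ℤ) (w w' : Z3) (k : ℤ) :
    zseq n ε w w' (2 * k + 1) = n + k • (ε • (w - w')) + ε • w := by
  have h1 : (2 * k + 1) / 2 = k := by omega
  have h2 : (2 * k + 1) % 2 = 1 := by omega
  rw [zseq, h1, h2, one_smul]

theorem zseq_zero (n : Z3) (ε : ℤ) (w w' : Z3) : zseq n ε w w' 0 = n := by simp [zseq]

theorem zseq_one (n : Z3) (ε : ℤ) (w w' : Z3) : zseq n ε w w' 1 = n + ε • w := by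
  simp [zseq]

theorem zseq_neg_one (n : Z3) (ε : ℤ) (w w' : Z3) : zseq n ε w w' (-1) = n + ε • w' := by
  have := zseq_odd n ε w w' (-1)
  rw [show (2 : ℤ) * (-1) + 1 = -1 by norm_num] at this
  rw [this]; module

theorem zseq_add_two (n : Z3) (ε : ℤ) (w w' : Z3) (k i : ℤ) :
    zseq n ε w w' (i + 2 * k) = zseq (n + k • (ε • (w - w'))) ε w w' i := by
  have h1 : (i + 2 * k) / 2 = i / 2 + k := by omega
  have h2 : (i + 2 * k) % 2 = i % 2 := by omega
  rw [zseq, zseq, h1, h2, add_smul]; abel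

theorem zseq_neg (n : Z3) (ε : ℤ) (w w' : Z3) (i : ℤ) :
    zseq n ε w w' (-i) = zseq n ε w' w i := by
  obtain ⟨k, rfl | rfl⟩ := Int.even_or_odd' i
  · rw [show -(2 * k) = 2 * (-k) by ring, zseq_even, zseq_even]
    module
  · rw [show -(2 * k + 1) = 2 * (-k - 1) + 1 by ring, zseq_odd, zseq_odd, ← neg_sub w' w, sub_smul]
    simp only [smul_sub, smul_neg, neg_smul, one_smul]
    abel

/-- Traversing the zigzag backwards from the other end of its base edge changes the sign of the base
vertex and keeps the pair of nodes. -/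
theorem zseq_one_sub (n : Z3) (ε : ℤ) (w w' : Z3) (i : ℤ) :
    zseq n ε w w' (1 - i) = zseq (n + ε • w) (-ε) w w' i := by
  obtain ⟨k, rfl | rfl⟩ := Int.even_or_odd' i
  · rw [show 1 - 2 * k = 2 * (-k) + 1 by ring, zseq_even, zseq_odd]
    simp only [smul_sub, smul_neg, neg_smul]
    abel
  · rw [show 1 - (2 * k + 1) = 2 * (-k) by ring, zseq_even, zseq_odd]
    simp only [smul_sub, smul_neg, neg_smul]
    abel

theorem Site.zseq (hD : D.IsRegular) {n w w' : Z3} {ε : ℤ} (h : D.Site n ε) (hA : D.Adj w w')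
    (i : ℤ) : D.Site (zseq n ε w w' i) (if i % 2 = 0 then ε else -ε) := by
  have hl : ∀ k : ℤ, k • (ε • (w - w')) ∈ D.lattice := fun k =>
    zsmul_mem (zsmul_mem (sub_mem_lattice hA.1 hA.2.1) _) _
  obtain ⟨k, rfl | rfl⟩ := Int.even_or_odd' i
  · rw [zseq_even, if_pos (by omega)]
    exact h.add (hl k)
  · rw [zseq_odd, if_neg (by omega)]
    exact (h.add (hl k)).neighbour hD hA.1

theorem Adj.ne (hD : D.IsRegular) {w w' : Z3} (h : D.Adj w w') : w ≠ w' :=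
  Complex3.IsStar.adj_ne hD h

theorem Site.ne_zero {n : Z3} {ε : ℤ} (h : D.Site n ε) : ε ≠ 0 := by
  rcases h.sign with h | h <;> rw [h] <;> norm_num

/-- Signs alternate along the zigzag, so equal points have indices of the same parity; within a
parity class the points advance by a fixed non-zero vector. -/
theorem zseq_injective (hD : D.IsRegular) {n w w' : Z3} {ε : ℤ} (h : D.Site n ε)
    (hA : D.Adj w w') : Function.Injective (zseq n ε w w') := by
  intro i j hij
  have hi := h.zseq hD hA i
  have hj := h.zseq hD hA j
  rw [hij] at hi
  have e := hi.unique hD hj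
  have hε := h.ne_zero
  have e2 : i % 2 = j % 2 := by
    split_ifs at e <;> omega
  rw [IntPolyhedron.zseq, IntPolyhedron.zseq, e2, add_left_inj, add_right_inj] at hij
  have hne : ε • (w - w') ≠ 0 := smul_ne_zero hε (sub_ne_zero.2 (hA.ne hD))
  have := smul_left_injective ℤ hne hij
  omega

/-- The zigzag faces at the vertex `p n`. -/
def zigzag (p : Z3 → E3) (n : Z3) (ε : ℤ) (w w' : Z3) : Figure :=
  Figure.ofSeq fun i => p (zseq n ε w w' i)

theorem zigzag_isParam (hD : D.IsRegular) {p : Z3 → E3} (hp : Function.Injective p) {n w w' : Z3}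
    {ε : ℤ} (h : D.Site n ε) (hA : D.Adj w w') :
    (zigzag p n ε w w').IsParam fun i => p (zseq n ε w w' i) :=
  Figure.isParam_of_injective id Function.surjective_id (fun _ => rfl) (by norm_num)
    (hp.comp (zseq_injective hD h hA))

theorem zigzag_comm (p : Z3 → E3) (n : Z3) (ε : ℤ) (w w' : Z3) :
    zigzag p n ε w w' = zigzag p n ε w' w := by
  rw [zigzag, ← Figure.ofSeq_comp_reflect _ 0, zigzag]
  simp only [zero_sub, zseq_neg]

theorem zigzag_add (p : Z3 → E3) (n : Z3) (ε : ℤ) (w w' : Z3) (k : ℤ) :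
    zigzag p n ε w w' = zigzag p (n + k • (ε • (w - w'))) ε w w' := by
  rw [zigzag, ← Figure.ofSeq_comp_shift _ (2 * k), zigzag]
  simp only [zseq_add_two]

theorem zigzag_neighbour (p : Z3 → E3) (n : Z3) (ε : ℤ) (w w' : Z3) :
    zigzag p n ε w w' = zigzag p (n + ε • w) (-ε) w w' := by
  rw [zigzag, ← Figure.ofSeq_comp_reflect _ 1, zigzag]
  simp only [zseq_one_sub]

/-- The zigzag as seen from any of its vertices: the nodes are the same, only the sign follows the
class of the vertex. -/
theorem zigzag_at (p : Z3 → E3) (n : Z3) (ε : ℤ) (w w' : Z3) (i : ℤ) :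
    zigzag p n ε w w' = zigzag p (zseq n ε w w' i) (if i % 2 = 0 then ε else -ε) w w' := by
  obtain ⟨k, rfl | rfl⟩ := Int.even_or_odd' i
  · rw [zseq_even, if_pos (by omega)]
    exact zigzag_add p n ε w w' k
  · rw [zseq_odd, if_neg (by omega), zigzag_add p n ε w w' k]
    exact zigzag_neighbour p _ ε w w'

def zigzagFaces (D : IntPolyhedron) (p : Z3 → E3) : Set Figure :=
  {F | ∃ n ε w w', D.Site n ε ∧ D.Adj w w' ∧ F = zigzag p n ε w w'}

/-- The zigzags between two neighbouring planes perpendicular to `ν`. -/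
def slab (D : IntPolyhedron) (p : Z3 → E3) (ν : Z3) (h : ℤ) : Set Figure :=
  {F | F ∈ D.zigzagFaces p ∧ ∀ m, p m ∈ F.verts → idot m ν = h ∨ idot m ν = h + 1}

/-- The apeirotope over the polyhedron `D`, in the coordinates `p`. -/
def apeirotope (D : IntPolyhedron) (p : Z3 → E3) : Complex3 where
  verts := {x | ∃ n ε, D.Site n ε ∧ x = p n}
  edges := {e | ∃ n ε w, D.Site n ε ∧ w ∈ D.nodes ∧ e = s(p n, p (n + ε • w))}
  faces := D.zigzagFaces p
  facets := {C | ∃ ν ∈ D.normals, ∃ l ∈ D.lattice, C = D.slab p ν (idot l ν)}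

/-- Since `h` is even, parity puts the vertices of sign `1` on the plane at level `h` and the others
on the plane at level `h + 1`. Nodes have odd inner product with `ν`, so the steps at a vertex stay
in the slab only if these inner products are `1`. -/
theorem zigzag_mem_slab (hD : D.IsRegular) {p : Z3 → E3} (hp : Function.Injective p)
    {n w w' ν : Z3} {ε h : ℤ} (hn : D.Site n ε) (hA : D.Adj w w') (hν : ν ∈ D.normals)
    (hh : h % 2 = 0) : zigzag p n ε w w' ∈ D.slab p ν h ↔
      idot n ν = h + (if ε = 1 then 0 else 1) ∧ idot w ν = 1 ∧ idot w' ν = 1 := by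
  have hw := hD.odd w hA.1 ν hν
  have hw' := hD.odd w' hA.2.1 ν hν
  have par := hn.parity hD hν
  have hz : ∀ i, idot (zseq n ε w w' i) ν =
      idot n ν + (i / 2) * (ε * (idot w ν - idot w' ν)) + (i % 2) * (ε * idot w ν) := by
    intro i
    simp only [zseq, idot_add, idot_zsmul, idot_sub]
  constructor
  · rintro ⟨-, hm⟩
    have h0 := hm _ ⟨0, rfl⟩
    have h1 := hm _ ⟨1, rfl⟩
    have h2 := hm _ ⟨-1, rfl⟩
    rw [zseq_zero] at h0
    rw [zseq_one, idot_add, idot_zsmul] at h1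
    rw [zseq_neg_one, idot_add, idot_zsmul] at h2
    rcases par with ⟨rfl, par⟩ | ⟨rfl, par⟩
    · rw [if_pos rfl]; omega
    · rw [if_neg (by norm_num)]; omega
  · rintro ⟨h1, h2, h3⟩
    refine ⟨⟨n, ε, w, w', hn, hA, rfl⟩, ?_⟩
    rintro m ⟨i, hi⟩
    rw [← hp hi, hz, h1, h2, h3]
    rcases hn.sign with rfl | rfl
    · rw [if_pos rfl]; simp; omega
    · rw [if_neg (by norm_num)]; simp; omega

/-- The sign-corrected level of a facet at a vertex. -/
def level (n ν : Z3) (ε : ℤ) : ℤ := idot n ν - if ε = 1 then 0 else 1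

theorem level_even (hD : D.IsRegular) {n ν : Z3} {ε : ℤ} (hn : D.Site n ε) (hν : ν ∈ D.normals) :
    level n ν ε % 2 = 0 := by
  unfold level
  rcases hn.parity hD hν with ⟨rfl, par⟩ | ⟨rfl, par⟩
  · rw [if_pos rfl]; omega
  · rw [if_neg (by norm_num)]; omega

/-- A vertex of sign `-1` lies on the upper plane of the slab; a step back along a node of the face
`ν` leads to a lattice point on the lower plane. -/
theorem slab_level_mem (hD : D.IsRegular) (p : Z3 → E3) {n ν : Z3} {ε : ℤ} (hn : D.Site n ε)
    (hν : ν ∈ D.normals) : D.slab p ν (level n ν ε) ∈ (D.apeirotope p).facets := by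
  refine ⟨ν, hν, ?_⟩
  unfold level
  rcases hn.sign with rfl | rfl
  · refine ⟨n, ?_, by simp⟩
    rcases hn with ⟨-, h⟩ | ⟨h, -⟩
    · exact h
    · norm_num at h
  · obtain ⟨w, hw, hwν⟩ := hD.exists_node ν hν
    refine ⟨n - w, ?_, ?_⟩
    · rcases hn.neighbour hD hw with ⟨-, h⟩ | ⟨h, -⟩
      · rwa [neg_one_smul, ← sub_eq_add_neg] at h
      · norm_num at h
    · rw [if_neg (by norm_num), idot_sub, hwν]

theorem zigzagFaces_at (hD : D.IsRegular) {p : Z3 → E3} (hp : Function.Injective p) {F : Figure}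
    (hF : F ∈ D.zigzagFaces p) {n : Z3} {ε : ℤ} (hn : D.Site n ε) {y : E3}
    (hy : s(p n, y) ∈ F.edges) :
    ∃ w w', D.Adj w w' ∧ F = zigzag p n ε w w' ∧ y = p (n + ε • w) := by
  obtain ⟨m, ε', w, w', hm, hA, rfl⟩ := hF
  have hi : ∃ i, n = zseq m ε' w w' i := by
    obtain ⟨i, hi⟩ := hy
    simp only [Sym2.eq_iff] at hi
    rcases hi with ⟨h1, -⟩ | ⟨-, h1⟩
    · exact ⟨i, (hp h1).symm⟩
    · exact ⟨i + 1, (hp h1).symm⟩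
  obtain ⟨i, rfl⟩ := hi
  have hs := hm.zseq hD hA i
  rw [zigzag_at p m ε' w w' i] at hy ⊢
  rw [hs.unique hD hn] at hy ⊢
  have := ((zigzag_isParam hD hp hn hA).nbr 0 y).1 (by rw [zseq_zero]; exact hy)
  rw [zero_sub, zero_add, zseq_neg_one, zseq_one] at this
  rcases this with h | h
  · exact ⟨w', w, hA.symm, zigzag_comm _ _ _ _ _, h⟩
  · exact ⟨w, w', hA, rfl, h⟩

theorem mem_edges_zigzag (hD : D.IsRegular) {p : Z3 → E3} (hp : Function.Injective p)
    {n w w' : Z3} {ε : ℤ} (hn : D.Site n ε) (hA : D.Adj w w') (y : E3) :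
    s(p n, y) ∈ (zigzag p n ε w w').edges ↔ y = p (n + ε • w) ∨ y = p (n + ε • w') := by
  have := (zigzag_isParam hD hp hn hA).nbr 0 y
  rw [zero_sub, zero_add, zseq_neg_one, zseq_one, zseq_zero] at this
  rw [this, or_comm]

theorem isStar_apeirotope (hD : D.IsRegular) {p : Z3 → E3} (hp : Function.Injective p) {n : Z3}
    {ε : ℤ} (hn : D.Site n ε) : (D.apeirotope p).IsStar D (p n) (fun w => p (n + ε • w))
      (fun w w' => zigzag p n ε w w') (fun ν => D.slab p ν (level n ν ε)) where
  edge_iff y := by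
    constructor
    · rintro ⟨m, ε', w, hm, hw, he⟩
      rw [Sym2.eq_iff] at he
      rcases he with ⟨h1, h2⟩ | ⟨h1, h2⟩
      · obtain rfl := hp h1
        rw [hn.unique hD hm]
        exact ⟨w, hw, h2⟩
      · obtain rfl := hp h1
        have := hn.unique hD (hm.neighbour hD hw)
        refine ⟨w, hw, ?_⟩
        rw [h2, this]
        simp
    · rintro ⟨w, hw, rfl⟩
      exact ⟨n, ε, w, hn, hw, rfl⟩
  nb_inj w _ w' _ h := by
    have := add_left_cancel (hp h)
    exact smul_right_injective _ hn.ne_zero this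
  fc_mem w w' hA := ⟨n, ε, w, w', hn, hA, rfl⟩
  fc_edges w w' hA y := mem_edges_zigzag hD hp hn hA y
  fc_comm w w' _ := zigzag_comm _ _ _ _ _
  face_eq F hF y hy := by
    obtain ⟨w, w', hA, h, -⟩ := zigzagFaces_at hD hp hF hn hy
    exact ⟨w, w', hA, h⟩
  ct_mem ν hν := slab_level_mem hD p hn hν
  facet_eq C hC F hF y hy := by
    obtain ⟨ν, hν, l, hl, rfl⟩ := hC
    obtain ⟨w, w', hA, rfl, -⟩ := zigzagFaces_at hD hp hF.1 hn hy
    have := two_dvd_idot hD hl hν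
    rw [zigzag_mem_slab hD hp hn hA hν (by omega)] at hF
    refine ⟨ν, hν, ?_⟩
    rw [level, hF.1, add_sub_cancel_right]
  fc_mem_ct w w' hA ν hν := by
    rw [zigzag_mem_slab hD hp hn hA hν (level_even hD hn hν), level, sub_add_cancel]
    simp

end IntPolyhedron

end


/-! ### Connectedness of the apeirotope and of its facets. -/

noncomputable section

namespace IntPolyhedron

variable {D : IntPolyhedron} {p : Z3 → E3}

/-- A generator `w - w'` is realized by two steps, forward along `w` and back along `w'`; the
invariant `φ` guarantees that steps are available. The induction treats `l` and `-l` together in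
order to pass through negation. -/
theorem walk_of_mem_closure {N : Set Z3} {φ : Z3 → Prop} {r : E3 → E3 → Prop}
    (hr : ∀ {a b}, r a b → r b a)
    (hφ : ∀ m, φ m → ∀ w ∈ N, ∀ w' ∈ N, φ (m + (w - w')))
    (hs : ∀ m, φ m → ∀ w ∈ N, r (p m) (p (m + w))) {l : Z3}
    (hl : l ∈ AddSubgroup.closure {d | ∃ w ∈ N, ∃ w' ∈ N, d = w - w'}) {m : Z3} (hm : φ m) :
    Relation.ReflTransGen r (p m) (p (m + l)) := by
  have base : ∀ m, φ m → ∀ w ∈ N, ∀ w' ∈ N,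
      Relation.ReflTransGen r (p m) (p (m + (w - w'))) := by
    intro m hm w hw w' hw'
    refine .tail (.single (hs m hm w hw)) (hr ?_)
    have := hs _ (hφ m hm w hw w' hw') w' hw'
    rwa [add_assoc, sub_add_cancel] at this
  have key : ∀ m, φ m → (φ (m + l) ∧ Relation.ReflTransGen r (p m) (p (m + l))) ∧
      (φ (m - l) ∧ Relation.ReflTransGen r (p m) (p (m - l))) := by
    clear hm m
    induction hl using AddSubgroup.closure_induction with
    | mem x hx =>
      obtain ⟨w, hw, w', hw', rfl⟩ := hx
      intro m hm
      refine ⟨⟨hφ m hm w hw w' hw', base m hm w hw w' hw'⟩, ?_⟩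
      rw [sub_eq_add_neg m, neg_sub]
      exact ⟨hφ m hm w' hw' w hw, base m hm w' hw' w hw⟩
    | zero => intro m hm; simpa using ⟨hm, Relation.ReflTransGen.refl⟩
    | add x y _ _ hx hy =>
      intro m hm
      obtain ⟨⟨h1, h2⟩, ⟨h3, h4⟩⟩ := hx m hm
      obtain ⟨⟨h1', h2'⟩, -⟩ := hy _ h1
      obtain ⟨-, ⟨h3', h4'⟩⟩ := hy _ h3
      rw [← add_assoc, ← sub_sub]
      exact ⟨⟨h1', h2.trans h2'⟩, ⟨h3', h4.trans h4'⟩⟩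
    | neg x _ hx =>
      intro m hm
      rw [sub_neg_eq_add, ← sub_eq_add_neg]
      exact ⟨(hx m hm).2, (hx m hm).1⟩
  exact (key m hm).1.2

/-- The lattice points in a plane parallel to a face are generated by that face. -/
def HasFlatSlabs (D : IntPolyhedron) : Prop :=
  ∀ ν ∈ D.normals, ∀ l ∈ D.lattice, idot l ν = 0 →
    l ∈ AddSubgroup.closure {d | ∃ w ∈ {w | w ∈ D.nodes ∧ idot w ν = 1},
      ∃ w' ∈ {w | w ∈ D.nodes ∧ idot w ν = 1}, d = w - w'}

theorem apeirotope_connected (hD : D.IsRegular) {n : Z3} {ε : ℤ} (hn : D.Site n ε) :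
    Relation.ReflTransGen (fun a b => s(a, b) ∈ (D.apeirotope p).edges) (p 0) (p n) := by
  have even : ∀ n, D.Site n 1 →
      Relation.ReflTransGen (fun a b => s(a, b) ∈ (D.apeirotope p).edges) (p 0) (p n) := by
    intro n hn
    have hl : n ∈ D.lattice := hn.elim And.right fun h => by norm_num at h
    have := walk_of_mem_closure (p := p) (N := {w | w ∈ D.nodes}) (φ := fun m => D.Site m 1)
      (r := fun a b => s(a, b) ∈ (D.apeirotope p).edges)
      (fun h => by rwa [Sym2.eq_swap]) (fun m hm w hw w' hw' => hm.add (sub_mem_lattice hw hw'))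
      (fun m hm w hw => ⟨m, 1, w, hm, hw, by rw [one_smul]⟩) hl site_zero
    rwa [zero_add] at this
  rcases hn.sign with rfl | rfl
  · exact even n hn
  · have h1 := hn.neighbour hD hD.base_adj.1
    rw [neg_neg] at h1
    refine (even _ h1).tail ⟨_, 1, D.node₀, h1, hD.base_adj.1, ?_⟩
    simp

theorem exists_adj_on_normal (hD : D.IsRegular) {w ν : Z3} (hw : w ∈ D.nodes)
    (hν : ν ∈ D.normals) (h : idot w ν = 1) : ∃ w', D.Adj w w' ∧ idot w' ν = 1 := by
  obtain ⟨x, -, -, -, -, hx, -⟩ := hD.two_nodes w hw ν hν h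
  exact ⟨x, hx⟩

/-- The vertices on the lower plane are joined by two-step walks along nodes of the face `ν`, which
generate all lattice vectors in that plane by `hflat`. A vertex on the upper plane is one edge away
from the lower plane. -/
theorem slab_connected (hD : D.IsRegular) (hflat : D.HasFlatSlabs) (hp : Function.Injective p)
    {ν l : Z3} (hν : ν ∈ D.normals) (hl : l ∈ D.lattice) {x : E3}
    (hx : ∃ F ∈ D.slab p ν (idot l ν), ∃ z, s(x, z) ∈ F.edges) :
    Relation.ReflTransGen (fun a b => ∃ F ∈ D.slab p ν (idot l ν), s(a, b) ∈ F.edges) (p l) x := by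
  have hpar : idot l ν % 2 = 0 := by
    have := two_dvd_idot hD hl hν
    omega
  have mem_iff := fun {n w w' : Z3} {ε : ℤ} (hn : D.Site n ε) (hA : D.Adj w w') =>
    zigzag_mem_slab hD hp hn hA hν hpar
  have even : ∀ n, D.Site n 1 → idot n ν = idot l ν → Relation.ReflTransGen
      (fun a b => ∃ F ∈ D.slab p ν (idot l ν), s(a, b) ∈ F.edges) (p l) (p n) := by
    intro n hn hnl
    have hd : n - l ∈ D.lattice :=
      sub_mem (hn.elim And.right fun h => by norm_num at h) hl
    have := walk_of_mem_closure (p := p) (φ := fun m => D.Site m 1 ∧ idot m ν = idot l ν)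
      (r := fun a b => ∃ F ∈ D.slab p ν (idot l ν), s(a, b) ∈ F.edges)
      (fun h => by simpa only [Sym2.eq_swap] using h)
      (fun m hm w hw w' hw' => ⟨hm.1.add (sub_mem_lattice hw.1 hw'.1), by
        rw [idot_add, idot_sub, hw.2, hw'.2, hm.2]; ring⟩)
      (fun m hm w hw => ?_) (hflat ν hν _ hd (by rw [idot_sub, hnl, sub_self]))
      ⟨Or.inl ⟨rfl, hl⟩, rfl⟩
    · rwa [add_sub_cancel] at this
    · obtain ⟨w', hA, hw'⟩ := exists_adj_on_normal hD hw.1 hν hw.2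
      refine ⟨zigzag p m 1 w w', (mem_iff hm.1 hA).2 ⟨by simpa using hm.2, hw.2, hw'⟩, ?_⟩
      rw [mem_edges_zigzag hD hp hm.1 hA]
      exact Or.inl (by rw [one_smul])
  obtain ⟨F, hF, z, hz⟩ := hx
  have hx' : ∃ n ε, D.Site n ε ∧ x = p n := by
    obtain ⟨m, ε, w, w', hm, hA, rfl⟩ := hF.1
    obtain ⟨i, hi⟩ := hz
    simp only [Sym2.eq_iff] at hi
    rcases hi with ⟨h1, -⟩ | ⟨-, h1⟩
    · exact ⟨_, _, hm.zseq hD hA i, h1.symm⟩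
    · exact ⟨_, _, hm.zseq hD hA (i + 1), h1.symm⟩
  obtain ⟨n, ε, hn, rfl⟩ := hx'
  obtain ⟨w, w', hA, rfl, rfl⟩ := zigzagFaces_at hD hp hF.1 hn hz
  have h1 := (mem_iff hn hA).1 hF
  rcases hn.sign with rfl | rfl
  · exact even n hn (by simpa using h1.1)
  · have h2 := hn.neighbour hD hA.1
    rw [neg_neg] at h2
    refine (even _ h2 ?_).tail ⟨_, hF, by rw [Sym2.eq_swap]; exact hz⟩
    rw [idot_add, idot_zsmul, h1.2.1, h1.1, if_neg (by norm_num)]; ring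

theorem apeirotope_isLocallyPolyhedral (hD : D.IsRegular) (hflat : D.HasFlatSlabs)
    (hp : Function.Injective p) : (D.apeirotope p).IsLocallyPolyhedral D where
  edge_nondegenerate := by
    rintro _ ⟨n, ε, w, hn, hw, rfl⟩ h
    have h1 := hp (Sym2.mk_isDiag_iff.1 h)
    have h2 := hn.neighbour hD hw
    rw [← h1] at h2
    have h2 := hn.unique hD h2
    have := hn.ne_zero
    omega
  edge_verts := by
    rintro _ ⟨n, ε, w, hn, hw, rfl⟩ v hv
    rcases Sym2.mem_iff.1 hv with rfl | rfl
    · exact ⟨n, ε, hn, rfl⟩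
    · exact ⟨_, _, hn.neighbour hD hw, rfl⟩
  face_edges := by
    rintro F hF e he
    induction e using Sym2.ind with | _ x y
    obtain ⟨n, ε, w, w', hn, hA, rfl⟩ := id hF
    have hx : ∃ i, x = p (zseq n ε w w' i) := by
      obtain ⟨i, hi⟩ := he
      simp only [Sym2.eq_iff] at hi
      rcases hi with ⟨h1, -⟩ | ⟨-, h1⟩
      · exact ⟨_, h1.symm⟩
      · exact ⟨_, h1.symm⟩
    obtain ⟨i, rfl⟩ := hx
    have hs := hn.zseq hD hA i
    obtain ⟨u, u', hA', -, rfl⟩ := zigzagFaces_at hD hp hF hs he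
    exact ⟨_, _, u, hs, hA'.1, rfl⟩
  facet_faces := by
    rintro _ ⟨ν, -, l, -, rfl⟩ F hF
    exact hF.1
  facet_nonempty := by
    rintro _ ⟨ν, hν, l, hl, rfl⟩
    obtain ⟨w, hw, hwν⟩ := hD.exists_node ν hν
    obtain ⟨w', hA, hw'⟩ := exists_adj_on_normal hD hw hν hwν
    have := two_dvd_idot hD hl hν
    exact ⟨_, (zigzag_mem_slab hD hp (Or.inl ⟨rfl, hl⟩) hA hν (by omega)).2
      ⟨by simp, hwν, hw'⟩⟩
  face_param := by
    rintro _ ⟨n, ε, w, w', hn, hA, rfl⟩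
    exact ⟨_, zigzag_isParam hD hp hn hA⟩
  star := by
    rintro _ ⟨n, ε, hn, rfl⟩
    exact ⟨_, _, _, isStar_apeirotope hD hp hn⟩
  nonempty := ⟨p 0, 0, 1, site_zero, rfl⟩
  connected := by
    rintro _ ⟨n, ε, hn, rfl⟩ _ ⟨m, ε', hm, rfl⟩
    have symm : Std.Symm (fun a b => s(a, b) ∈ (D.apeirotope p).edges) :=
      ⟨fun a b h => by rwa [Sym2.eq_swap]⟩
    exact (Relation.ReflTransGen.stdSymm.symm _ _ (apeirotope_connected hD hn)).trans
      (apeirotope_connected hD hm)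
  facet_connected := by
    rintro _ ⟨ν, hν, l, hl, rfl⟩ x y hx hy
    have symm : Std.Symm (fun a b => ∃ F ∈ D.slab p ν (idot l ν), s(a, b) ∈ F.edges) :=
      ⟨fun a b h => by simpa only [Sym2.eq_swap] using h⟩
    exact (Relation.ReflTransGen.stdSymm.symm _ _ (slab_connected hD hflat hp hν hl hx)).trans
      (slab_connected hD hflat hp hν hl hy)

end IntPolyhedron

end


/-! ### Automorphisms and their affine action on integral points. -/

noncomputable section

namespace Figure

theorem map_inv_map (F : Figure) (g : E3 ≃ᵢ E3) : (F.map g).map ⇑g⁻¹ = F := by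
  rw [map_map]
  convert F.map_id using 2
  funext x
  exact isometryEquiv_inv_apply_self g x

theorem map_map_inv (F : Figure) (g : E3 ≃ᵢ E3) : (F.map ⇑g⁻¹).map g = F := by
  rw [map_map]
  convert F.map_id using 2
  funext x
  exact isometryEquiv_apply_inv_self g x

end Figure

theorem Complex3.map_one (P : Complex3) : P.map ⇑(1 : E3 ≃ᵢ E3) = P := by
  have h' : ⇑(1 : E3 ≃ᵢ E3) = id := rfl
  ext <;> simp [map, h', Figure.map_id]

theorem Complex3.map_mul (P : Complex3) (g h : E3 ≃ᵢ E3) : P.map ⇑(g * h) = (P.map h).map g := by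
  have e : ⇑(g * h) = g ∘ h := rfl
  have e' : Figure.map (g ∘ h) = Figure.map g ∘ Figure.map h :=
    funext fun F => (Figure.map_map g h F).symm
  rw [e]
  simp only [map]
  rw [Set.image_comp, e', Set.image_comp, Sym2.map_comp, Set.image_comp]
  congr 1
  rw [← Set.image_comp]
  congr 1
  funext C
  exact Set.image_comp _ _ _

/-- The isometries that preserve a structure of rank 4. -/
def Complex3.automorphisms (P : Complex3) : Subgroup (E3 ≃ᵢ E3) where
  carrier := {g | P.map g = P}
  one_mem' := P.map_one
  mul_mem' := by
    intro g h hg hh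
    change P.map _ = P
    rw [map_mul, hh, hg]
  inv_mem' := by
    intro g hg
    change P.map g = P at hg
    change P.map _ = P
    conv_lhs => rw [← hg]
    rw [← map_mul, inv_mul_cancel, map_one]

/-- Mapping the faces of each rank into themselves is only an inclusion; the same for the inverse
turns it into equality. -/
theorem Complex3.mem_automorphisms_of_mapsTo {P : Complex3} {g : E3 ≃ᵢ E3}
    (h : ∀ g' : E3 ≃ᵢ E3, g' = g ∨ g' = g⁻¹ → (∀ x ∈ P.verts, g' x ∈ P.verts) ∧
      (∀ e ∈ P.edges, Sym2.map g' e ∈ P.edges) ∧ (∀ F ∈ P.faces, F.map g' ∈ P.faces) ∧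
      ∀ C ∈ P.facets, Figure.map g' '' C ∈ P.facets) : g ∈ P.automorphisms := by
  obtain ⟨hv, he, hf, hc⟩ := h g (Or.inl rfl)
  obtain ⟨hv', he', hf', hc'⟩ := h g⁻¹ (Or.inr rfl)
  have hfig : ∀ F : Figure, (F.map ⇑g⁻¹).map g = F := fun F => Figure.map_map_inv F g
  change P.map g = P
  ext x
  · refine ⟨?_, fun hx => ⟨_, hv' x hx, isometryEquiv_apply_inv_self g x⟩⟩
    rintro ⟨y, hy, rfl⟩
    exact hv y hy
  · refine ⟨?_, fun hx => ⟨_, he' x hx, ?_⟩⟩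
    · rintro ⟨y, hy, rfl⟩
      exact he y hy
    · rw [Sym2.map_map]
      conv_rhs => rw [← id_eq x, ← Sym2.map_id]
      exact Sym2.map_congr fun y _ => isometryEquiv_apply_inv_self g y
  · refine ⟨?_, fun hx => ⟨_, hf' x hx, hfig x⟩⟩
    rintro ⟨y, hy, rfl⟩
    exact hf y hy
  · refine ⟨?_, fun hx => ⟨_, hc' x hx, ?_⟩⟩
    · rintro ⟨y, hy, rfl⟩
      exact hc y hy
    · rw [← Set.image_comp]
      conv_rhs => rw [← Set.image_id x]
      exact Set.image_congr fun F _ => hfig F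

/-- If every flag is the image of one fixed flag, then the flags are permuted transitively. -/
theorem Complex3.flag_transitive_of_base {P : Complex3} {v₀ : E3} {e₀ : Sym2 E3} {F₀ : Figure}
    {C₀ : Set Figure}
    (h : ∀ {v e F C}, P.IsFlag v e F C → ∃ g ∈ P.automorphisms,
      g v₀ = v ∧ Sym2.map g e₀ = e ∧ F₀.map g = F ∧ Figure.map g '' C₀ = C)
    {v v' : E3} {e e' : Sym2 E3} {F F' : Figure} {C C' : Set Figure}
    (hf : P.IsFlag v e F C) (hf' : P.IsFlag v' e' F' C') :
    ∃ g : E3 ≃ᵢ E3, P.map g = P ∧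
      g v = v' ∧ Sym2.map g e = e' ∧ F.map g = F' ∧ Figure.map g '' C = C' := by
  obtain ⟨g, hg, rfl, rfl, rfl, rfl⟩ := h hf
  obtain ⟨g', hg', rfl, rfl, rfl, rfl⟩ := h hf'
  refine ⟨g' * g⁻¹, mul_mem hg' (inv_mem hg), ?_, ?_, ?_, ?_⟩
  · rw [isometryEquiv_mul_apply, isometryEquiv_inv_apply_self]
  · rw [Sym2.map_map]
    refine Sym2.map_congr fun x _ => ?_
    rw [Function.comp_apply, isometryEquiv_mul_apply, isometryEquiv_inv_apply_self]
  · change Figure.map (g' ∘ ⇑g⁻¹) _ = _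
    rw [← Figure.map_map, Figure.map_inv_map]
  · rw [← Set.image_comp]
    refine Set.image_congr fun F _ => ?_
    change Figure.map (g' ∘ ⇑g⁻¹) _ = _
    rw [← Figure.map_map, Figure.map_inv_map]

/-- Some element of `H` acts on the integral points as `φ`. -/
def Acts (p : Z3 → E3) (H : Subgroup (E3 ≃ᵢ E3)) (φ : Z3 → Z3) : Prop :=
  ∃ g ∈ H, ∀ m, g (p m) = p (φ m)

namespace Acts

variable {p : Z3 → E3} {H : Subgroup (E3 ≃ᵢ E3)} {φ ψ : Z3 → Z3}

theorem id : Acts p H id := ⟨1, one_mem _, fun _ => rfl⟩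

theorem comp (h : Acts p H φ) (h' : Acts p H ψ) : Acts p H (φ ∘ ψ) := by
  obtain ⟨g, hg, e⟩ := h
  obtain ⟨g', hg', e'⟩ := h'
  exact ⟨g * g', mul_mem hg hg', fun m => by rw [isometryEquiv_mul_apply, e', e]; rfl⟩

theorem inv (h : Acts p H φ) (hφ : ∀ m, φ (ψ m) = m) : Acts p H ψ := by
  obtain ⟨g, hg, e⟩ := h
  refine ⟨g⁻¹, inv_mem hg, fun m => ?_⟩
  conv_lhs => rw [← hφ m, ← e]
  exact isometryEquiv_inv_apply_self _ _

end Acts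

theorem SignedPerm.act_act {M : SignedPerm}
    (h : ∀ j, M.perm (M.perm j) = j ∧ M.sign j * M.sign (M.perm j) = 1) (x : Z3) :
    M.act (M.act x) = x := by
  funext j
  have e := congrArg Units.val (h j).2
  rw [Units.val_mul, Units.val_one] at e
  simp only [SignedPerm.act, (h j).1]
  rw [← mul_assoc, e, one_mul]

namespace IntPolyhedron

variable {D : IntPolyhedron} {p : Z3 → E3}

theorem gen_gen (hD : D.IsRegular) (i : Fin 3) (x : Z3) : (D.gen i).act ((D.gen i).act x) = x :=
  SignedPerm.act_act (hD.gen_invol i) x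

theorem word_append (l l' : List (Fin 3)) (x : Z3) : D.word (l ++ l') x = D.word l (D.word l' x) := by
  induction l with
  | nil => rfl
  | cons i l ih => simp [word, ih]

theorem word_reverse (hD : D.IsRegular) (l : List (Fin 3)) (x : Z3) :
    D.word l (D.word l.reverse x) = x := by
  induction l generalizing x with
  | nil => rfl
  | cons i l ih =>
    rw [List.reverse_cons, word_append, word, ih, word, word, gen_gen hD]

theorem idot_word (l : List (Fin 3)) (x y : Z3) : idot (D.word l x) (D.word l y) = idot x y := by
  induction l with
  | nil => rfl
  | cons i l ih => rw [word, word, SignedPerm.idot_act, ih]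

theorem word_mem_nodes (hD : D.IsRegular) (l : List (Fin 3)) {w : Z3} (hw : w ∈ D.nodes) :
    D.word l w ∈ D.nodes := by
  induction l with
  | nil => exact hw
  | cons i l ih => exact hD.gen_nodes i _ ih

theorem word_mem_normals (hD : D.IsRegular) (l : List (Fin 3)) {ν : Z3} (hν : ν ∈ D.normals) :
    D.word l ν ∈ D.normals := by
  induction l with
  | nil => exact hν
  | cons i l ih => exact hD.gen_normals i _ ih

theorem word_adj (hD : D.IsRegular) (l : List (Fin 3)) {w w' : Z3} (h : D.Adj w w') :
    D.Adj (D.word l w) (D.word l w') :=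
  ⟨word_mem_nodes hD l h.1, word_mem_nodes hD l h.2.1, by rw [idot_word, h.2.2]⟩

theorem word_add (l : List (Fin 3)) (x y : Z3) : D.word l (x + y) = D.word l x + D.word l y := by
  induction l with
  | nil => rfl
  | cons i l ih => rw [word, word, word, ih, SignedPerm.act_add]

def wordHom (D : IntPolyhedron) (l : List (Fin 3)) : Z3 →+ Z3 :=
  AddMonoidHom.mk' (D.word l) (word_add l)

/-- The first node is moved to `node₀`, and the words fixing `node₀` permute its neighbours
transitively. -/
theorem exists_word_node (hD : D.IsRegular) {w w' : Z3} (h : D.Adj w w') :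
    ∃ l, D.word l D.node₀ = w ∧ D.word l D.node₁ = w' := by
  obtain ⟨l, -, hl⟩ := hD.node_transitive w h.1
  have h1 := word_adj hD l.reverse h
  have h2 : D.word l.reverse w = D.node₀ := by
    rw [← hl]
    conv_lhs => rw [← l.reverse_reverse, List.reverse_reverse l]
    have := word_reverse hD l.reverse D.node₀
    rwa [List.reverse_reverse] at this
  rw [h2] at h1
  obtain ⟨l', -, h3, h4⟩ := hD.link_transitive _ h1.2.1 h1
  exact ⟨l ++ l', by rw [word_append, h3, hl], by rw [word_append, h4, word_reverse hD]⟩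

/-- The words in the generators act transitively on the flags of `D`. -/
theorem exists_word_flag (hD : D.IsRegular) {w w' ν : Z3} (h : D.Adj w w') (hν : ν ∈ D.normals)
    (hw : idot w ν = 1) (hw' : idot w' ν = 1) :
    ∃ l, D.word l D.node₀ = w ∧ D.word l D.node₁ = w' ∧ D.word l D.normal₀ = ν := by
  obtain ⟨l, h1, h2⟩ := exists_word_node hD h
  set μ := D.word l.reverse ν with hμ
  have hμν : D.word l μ = ν := word_reverse hD l ν
  have hμm : μ ∈ D.normals := word_mem_normals hD _ hν
  have e1 : idot D.node₀ μ = 1 := by rw [← idot_word (D := D) l, h1, hμν, hw]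
  have e2 : idot D.node₁ μ = 1 := by rw [← idot_word (D := D) l, h2, hμν, hw']
  obtain ⟨a, -, b, -, -, -, -, hmax⟩ :=
    hD.two_normals _ hD.base_adj.1 _ hD.base_adj.2.1 hD.base_adj
  have g1 := hmax _ hD.normal_mem hD.base_normal.1 hD.base_normal.2
  have g2 := hmax (D.gen₃.act D.normal₀) (hD.gen_normals 2 _ hD.normal_mem)
    (by rw [← hD.base_normal.1]; conv_lhs => rw [← hD.gen₃_node₀]
        rw [SignedPerm.idot_act])
    (by rw [← hD.base_normal.2]; conv_lhs => rw [← hD.gen₃_node₁]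
        rw [SignedPerm.idot_act])
  have g3 := hmax μ hμm e1 e2
  have hne := hD.gen₃_normal
  -- The base edge lies on exactly two faces, and `gen₃` exchanges them. In the second case `gen₃`
  -- is appended to the word.
  have : μ = D.normal₀ ∨ μ = D.gen₃.act D.normal₀ := by
    rcases g1 with g1 | g1 <;> rcases g2 with g2 | g2 <;> rcases g3 with g3 | g3 <;> simp_all
  rcases this with e | e
  · exact ⟨l, h1, h2, by rw [← e, hμν]⟩
  · refine ⟨l ++ [2], ?_, ?_, ?_⟩
    · rw [word_append]; exact (congrArg _ hD.gen₃_node₀).trans h1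
    · rw [word_append]; exact (congrArg _ hD.gen₃_node₁).trans h2
    · rw [word_append, ← hμν, e]; rfl

theorem zseq_affine (M : Z3 →+ Z3) (t : Z3) (σ : ℤ) (n : Z3) (ε : ℤ) (w w' : Z3) (i : ℤ) :
    t + σ • M (zseq n ε w w' i) = zseq (t + σ • M n) (σ * ε) (M w) (M w') i := by
  simp only [zseq, map_add, map_zsmul, map_sub, mul_smul]
  module

/-- `g` acts on the integral points as an affine map with linear part `σ M`. -/
def ActsAs (p : Z3 → E3) (g : E3 ≃ᵢ E3) (t : Z3) (σ : ℤ) (M : Z3 →+ Z3) : Prop :=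
  ∀ m, g (p m) = p (t + σ • M m)

theorem ActsAs.map_zigzag {g : E3 ≃ᵢ E3} {t : Z3} {σ : ℤ} {M : Z3 →+ Z3} (h : ActsAs p g t σ M)
    (n : Z3) (ε : ℤ) (w w' : Z3) :
    (zigzag p n ε w w').map g = zigzag p (t + σ • M n) (σ * ε) (M w) (M w') := by
  rw [zigzag, Figure.map_ofSeq, zigzag]
  congr 1
  funext i
  rw [Function.comp_apply, h, zseq_affine]

/-- The two bounding planes go to planes perpendicular to `M ν`. For `σ = -1` they change places, so
the new lower level comes from the old upper level `k + 1`. -/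
theorem ActsAs.image_slab {g : E3 ≃ᵢ E3} {t : Z3} {σ : ℤ} {M : Z3 →+ Z3} (h : ActsAs p g t σ M)
    (hσ : σ = 1 ∨ σ = -1) (hM : ∀ x y, idot (M x) (M y) = idot x y) (hp : Function.Injective p)
    (hg : ∀ F ∈ D.zigzagFaces p, F.map g ∈ D.zigzagFaces p)
    (hg' : ∀ F ∈ D.zigzagFaces p, F.map ⇑g⁻¹ ∈ D.zigzagFaces p) (ν : Z3) (k : ℤ) :
    Figure.map g '' D.slab p ν k =
      D.slab p (M ν) (if σ = 1 then idot t (M ν) + k else idot t (M ν) - k - 1) := by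
  have key : ∀ m, (idot m ν = k ∨ idot m ν = k + 1) ↔
      (idot (t + σ • M m) (M ν) = (if σ = 1 then idot t (M ν) + k else idot t (M ν) - k - 1) ∨
        idot (t + σ • M m) (M ν) =
          (if σ = 1 then idot t (M ν) + k else idot t (M ν) - k - 1) + 1) := by
    intro m
    rw [idot_add, idot_zsmul, hM]
    rcases hσ with rfl | rfl
    · rw [if_pos rfl]; omega
    · rw [if_neg (by norm_num)]; omega
  have hverts : ∀ F ∈ D.zigzagFaces p, ∀ x ∈ F.verts, ∃ m, x = p m := by
    rintro _ ⟨n, ε, w, w', -, -, rfl⟩ _ ⟨i, rfl⟩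
    exact ⟨_, rfl⟩
  ext F
  constructor
  · rintro ⟨F, hF, rfl⟩
    refine ⟨hg F hF.1, ?_⟩
    rintro m ⟨x, hx, hxm⟩
    obtain ⟨m', rfl⟩ := hverts F hF.1 x hx
    rw [h] at hxm
    rw [← hp hxm]
    exact (key m').1 (hF.2 m' hx)
  · intro hF
    refine ⟨F.map ⇑g⁻¹, ⟨hg' F hF.1, ?_⟩, Figure.map_map_inv F g⟩
    rintro m ⟨x, hx, hxm⟩
    rw [key]
    refine hF.2 _ ?_
    rw [← h, ← hxm, isometryEquiv_apply_inv_self]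
    exact hx

end IntPolyhedron

end


/-! ### The group of the apeirotope and its transitivity on flags. -/

noncomputable section

namespace IntPolyhedron

variable {D : IntPolyhedron} {p : Z3 → E3}

theorem word_mem_lattice (hD : D.IsRegular) (l : List (Fin 3)) {x : Z3} (hx : x ∈ D.lattice) :
    D.word l x ∈ D.lattice := by
  change D.wordHom l x ∈ D.lattice
  induction hx using AddSubgroup.closure_induction with
  | mem x hx =>
    obtain ⟨w, hw, w', hw', rfl⟩ := hx
    rw [map_sub]
    exact sub_mem_lattice (word_mem_nodes hD l hw) (word_mem_nodes hD l hw')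
  | zero => rw [map_zero]; exact zero_mem _
  | add x y _ _ hx hy => rw [map_add]; exact add_mem hx hy
  | neg x _ hx => rw [map_neg]; exact neg_mem hx

/-- Words preserve the lattice and permute the nodes. A lattice vector leaves the class of `t`
unchanged, and a further step along `σ` times a node reverses it, so signs multiply. -/
theorem Site.affine (hD : D.IsRegular) {n t : Z3} {ε σ : ℤ} (hn : D.Site n ε) (ht : D.Site t σ)
    (l : List (Fin 3)) : D.Site (t + σ • D.wordHom l n) (σ * ε) := by
  have key : ∀ x ∈ D.lattice, σ • D.wordHom l x ∈ D.lattice := fun x hx =>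
    zsmul_mem (word_mem_lattice hD l hx) _
  rcases hn with ⟨rfl, hn⟩ | ⟨rfl, hn⟩
  · rw [mul_one]
    exact ht.add (key n hn)
  · have h1 := (ht.add (key _ hn)).neighbour hD (word_mem_nodes hD l hD.base_adj.1)
    rw [mul_neg_one]
    convert h1 using 1
    change _ = _ + σ • D.wordHom l D.node₀
    rw [map_sub, smul_sub]
    abel

theorem ActsAs.map_mem_zigzagFaces (hD : D.IsRegular) {g : E3 ≃ᵢ E3} {t : Z3} {σ : ℤ}
    {l : List (Fin 3)} (h : ActsAs p g t σ (D.wordHom l)) (ht : D.Site t σ) {F : Figure}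
    (hF : F ∈ D.zigzagFaces p) : F.map g ∈ D.zigzagFaces p := by
  obtain ⟨n, ε, w, w', hn, hA, rfl⟩ := hF
  rw [h.map_zigzag]
  exact ⟨_, _, _, _, hn.affine hD ht l, word_adj hD l hA, rfl⟩

/-- The affine maps of the lattice that come from symmetries of `D` preserve the apeirotope. -/
theorem ActsAs.mem_automorphisms (hD : D.IsRegular) (hp : Function.Injective p) {g : E3 ≃ᵢ E3}
    {t : Z3} {σ : ℤ} {l : List (Fin 3)} (h : ActsAs p g t σ (D.wordHom l)) (ht : D.Site t σ)
    (hinv : ActsAs p g⁻¹ t σ (D.wordHom l)) : g ∈ (D.apeirotope p).automorphisms := by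
  have hverts : ∀ g' : E3 ≃ᵢ E3, ActsAs p g' t σ (D.wordHom l) →
      g' '' (D.apeirotope p).verts ⊆ (D.apeirotope p).verts := by
    rintro g' h' _ ⟨_, ⟨n, ε, hn, rfl⟩, rfl⟩
    exact ⟨_, _, hn.affine hD ht l, h' n⟩
  have hedges : ∀ g' : E3 ≃ᵢ E3, ActsAs p g' t σ (D.wordHom l) →
      Sym2.map g' '' (D.apeirotope p).edges ⊆ (D.apeirotope p).edges := by
    rintro g' h' _ ⟨_, ⟨n, ε, w, hn, hw, rfl⟩, rfl⟩
    refine ⟨_, _, _, hn.affine hD ht l, word_mem_nodes hD l hw, ?_⟩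
    rw [Sym2.map_mk, h', h', map_add, map_zsmul]
    have : t + σ • (D.wordHom l n + ε • D.wordHom l w) =
        t + σ • D.wordHom l n + (σ * ε) • D.word l w := by
      rw [smul_add, ← add_assoc, smul_smul]; rfl
    rw [this]
  have hfaces : ∀ g' : E3 ≃ᵢ E3, ActsAs p g' t σ (D.wordHom l) → ∀ F ∈ D.zigzagFaces p,
      F.map g' ∈ D.zigzagFaces p := fun g' h' F hF => h'.map_mem_zigzagFaces hD ht hF
  have hfacets : ∀ g' : E3 ≃ᵢ E3, ActsAs p g' t σ (D.wordHom l) →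
      ActsAs p g'⁻¹ t σ (D.wordHom l) → ∀ C ∈ (D.apeirotope p).facets,
        Figure.map g' '' C ∈ (D.apeirotope p).facets := by
    rintro g' h' hi _ ⟨ν, hν, k, hk, rfl⟩
    rw [h'.image_slab ht.sign (idot_word l) hp (hfaces _ h') (hfaces _ hi)]
    have hs : D.Site (t + σ • D.wordHom l k) σ := by
      simpa using Site.affine hD (Or.inl ⟨rfl, hk⟩ : D.Site k 1) ht l
    have := slab_level_mem hD p hs (word_mem_normals hD l hν)
    suffices E : (if σ = 1 then idot t (D.wordHom l ν) + idot k ν else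
        idot t (D.wordHom l ν) - idot k ν - 1) = level (t + σ • D.wordHom l k) (D.wordHom l ν) σ by
      rw [E]; exact this
    have e : idot (D.wordHom l k) (D.wordHom l ν) = idot k ν := idot_word l k ν
    rw [level, idot_add, idot_zsmul, e]
    rcases ht.sign with rfl | rfl
    · simp
    · simp [sub_eq_add_neg]
  refine Complex3.mem_automorphisms_of_mapsTo fun g' hg' => ?_
  have h' : ActsAs p g' t σ (D.wordHom l) ∧ ActsAs p g'⁻¹ t σ (D.wordHom l) := by
    rcases hg' with rfl | rfl
    · exact ⟨h, hinv⟩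
    · exact ⟨hinv, by rwa [inv_inv]⟩
  exact ⟨fun x hx => hverts g' h'.1 ⟨x, hx, rfl⟩, fun e he => hedges g' h'.1 ⟨e, he, rfl⟩,
    hfaces g' h'.1, hfacets g' h'.1 h'.2⟩

/-- Isometries that act on the integral points as the generators of the group of the
apeirotope. -/
structure IsGenerating (D : IntPolyhedron) (p : Z3 → E3) (R₀ R₁ R₂ R₃ : E3 ≃ᵢ E3) : Prop where
  apply₀ : ∀ m, R₀ (p m) = p (D.node₀ - m)
  apply₁ : ∀ m, R₁ (p m) = p (D.gen₁.act m)
  apply₂ : ∀ m, R₂ (p m) = p (D.gen₂.act m)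
  apply₃ : ∀ m, R₃ (p m) = p (D.gen₃.act m)

variable {R₀ R₁ R₂ R₃ : E3 ≃ᵢ E3}

theorem inv_apply_of_involutive {φ : Z3 → Z3} (hφ : ∀ m, φ (φ m) = m) {g : E3 ≃ᵢ E3}
    (hg : ∀ m, g (p m) = p (φ m)) (m : Z3) : g⁻¹ (p m) = p (φ m) := by
  conv_lhs => rw [← hφ m, ← hg]
  exact isometryEquiv_inv_apply_self _ _

theorem mem_automorphisms_of_gen (hD : D.IsRegular) (hp : Function.Injective p) {g : E3 ≃ᵢ E3}
    (i : Fin 3) (hg : ∀ m, g (p m) = p ((D.gen i).act m)) :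
    g ∈ (D.apeirotope p).automorphisms := by
  have e : ∀ m, (D.gen i).act m = 0 + (1 : ℤ) • D.wordHom [i] m := fun m => by
    rw [zero_add, one_smul]; rfl
  refine ActsAs.mem_automorphisms hD hp (t := 0) (σ := 1) (l := [i]) (fun m => ?_) site_zero
    fun m => ?_
  · rw [hg, e]
  · rw [inv_apply_of_involutive (gen_gen hD i) hg, e]

theorem mem_automorphisms_of_reflection (hD : D.IsRegular) (hp : Function.Injective p)
    {g : E3 ≃ᵢ E3} (hg : ∀ m, g (p m) = p (D.node₀ - m)) :
    g ∈ (D.apeirotope p).automorphisms := by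
  have e : ∀ m, D.node₀ - m = D.node₀ + (-1 : ℤ) • D.wordHom [] m := fun m => by
    rw [neg_one_smul, ← sub_eq_add_neg]; rfl
  refine ActsAs.mem_automorphisms hD hp (t := D.node₀) (σ := -1) (l := []) (fun m => ?_)
    (Or.inr ⟨rfl, by rw [sub_self]; exact zero_mem _⟩) fun m => ?_
  · rw [hg, e]
  · rw [inv_apply_of_involutive (fun m => sub_sub_cancel _ m) hg, e]

theorem IsGenerating.closure_le (h : IsGenerating D p R₀ R₁ R₂ R₃) (hD : D.IsRegular)
    (hp : Function.Injective p) :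
    Subgroup.closure {R₀, R₁, R₂, R₃} ≤ (D.apeirotope p).automorphisms := by
  rw [Subgroup.closure_le]
  rintro g (rfl | rfl | rfl | rfl)
  · exact mem_automorphisms_of_reflection hD hp h.apply₀
  · exact mem_automorphisms_of_gen hD hp 0 h.apply₁
  · exact mem_automorphisms_of_gen hD hp 1 h.apply₂
  · exact mem_automorphisms_of_gen hD hp 2 h.apply₃

section Orbits

variable {H : Subgroup (E3 ≃ᵢ E3)} {S : Set (Fin 3)}

theorem acts_word (hS : ∀ i ∈ S, Acts p H (D.gen i).act) (l : List (Fin 3)) (hl : ∀ i ∈ l, i ∈ S) :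
    Acts p H (D.word l) := by
  induction l with
  | nil => exact Acts.id
  | cons i l ih =>
    exact (hS i (hl i (by simp))).comp (ih fun j hj => hl j (by simp [hj]))

/-- Conjugates of the reflection `m ↦ node₀ - m`: the reflections in the midpoints of other edges at
the origin. -/
theorem acts_word_sub (hD : D.IsRegular) (hS : ∀ i ∈ S, Acts p H (D.gen i).act)
    (h₀ : Acts p H fun m => D.node₀ - m) (l : List (Fin 3)) (hl : ∀ i ∈ l, i ∈ S) :
    Acts p H fun m => D.word l D.node₀ - m := by
  induction l with
  | nil => exact h₀
  | cons i l ih =>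
    have hi := hS i (hl i (by simp))
    convert hi.comp ((ih fun j hj => hl j (by simp [hj])).comp hi) using 1
    funext m
    simp only [Function.comp, word, SignedPerm.act_sub, gen_gen hD]

/-- Products of two of these point reflections are the translations by differences of nodes. -/
theorem acts_add {N : Set Z3} (hN : ∀ w ∈ N, Acts p H fun m => w - m) {l : Z3}
    (hl : l ∈ AddSubgroup.closure {d | ∃ w ∈ N, ∃ w' ∈ N, d = w - w'}) :
    Acts p H fun m => m + l := by
  induction hl using AddSubgroup.closure_induction with
  | mem x hx =>
    obtain ⟨w, hw, w', hw', rfl⟩ := hx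
    convert (hN w hw).comp (hN w' hw') using 1
    funext m
    simp only [Function.comp]
    abel
  | zero => simp only [add_zero]; exact Acts.id
  | add x y _ _ hx hy =>
    convert hy.comp hx using 1
    funext m
    simp only [Function.comp, add_assoc]
  | neg x _ hx => exact hx.inv fun m => by simp

/-- For sign `-1` the reflection `m ↦ node₀ - m` is applied after the word, followed by a
translation by `n - node₀`. -/
theorem acts_affine (h₀ : Acts p H fun m => D.node₀ - m) {n : Z3} {ε : ℤ}
    (hn : (ε = 1 ∧ Acts p H fun m => m + n) ∨ (ε = -1 ∧ Acts p H fun m => m + (n - D.node₀)))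
    {l : List (Fin 3)} (hl : Acts p H (D.word l)) :
    ∃ g ∈ H, ActsAs p g n ε (D.wordHom l) := by
  have key : Acts p H fun m => n + ε • D.wordHom l m := by
    rcases hn with ⟨rfl, hn⟩ | ⟨rfl, hn⟩
    · convert hn.comp hl using 1
      funext m
      rw [one_smul, add_comm]; rfl
    · convert hn.comp (h₀.comp hl) using 1
      funext m
      simp only [Function.comp]
      change _ = D.node₀ - D.wordHom l m + _
      rw [neg_one_smul]; abel
  exact key

end Orbits

theorem IsGenerating.exists_actsAs (h : IsGenerating D p R₀ R₁ R₂ R₃) (hD : D.IsRegular) {n : Z3}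
    {ε : ℤ} (hn : D.Site n ε) (l : List (Fin 3)) :
    ∃ g ∈ Subgroup.closure {R₀, R₁, R₂, R₃}, ActsAs p g n ε (D.wordHom l) := by
  have mem : ∀ g ∈ ({R₀, R₁, R₂, R₃} : Set (E3 ≃ᵢ E3)), g ∈ Subgroup.closure {R₀, R₁, R₂, R₃} :=
    fun g hg => Subgroup.subset_closure hg
  have h₀ : Acts p (Subgroup.closure {R₀, R₁, R₂, R₃}) fun m => D.node₀ - m :=
    ⟨R₀, mem _ (by simp), h.apply₀⟩
  have hS : ∀ i ∈ (Set.univ : Set (Fin 3)),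
      Acts p (Subgroup.closure {R₀, R₁, R₂, R₃}) (D.gen i).act := by
    intro i _
    fin_cases i
    · exact ⟨R₁, mem _ (by simp), h.apply₁⟩
    · exact ⟨R₂, mem _ (by simp), h.apply₂⟩
    · exact ⟨R₃, mem _ (by simp), h.apply₃⟩
  have htr : ∀ x ∈ D.lattice, Acts p (Subgroup.closure {R₀, R₁, R₂, R₃}) fun m => m + x := by
    intro x hx
    refine acts_add (N := {w | w ∈ D.nodes}) (fun w hw => ?_) hx
    obtain ⟨l, -, rfl⟩ := hD.node_transitive w hw
    exact acts_word_sub hD hS h₀ l fun _ _ => trivial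
  refine acts_affine h₀ ?_ (acts_word hS l fun _ _ => trivial)
  exact hn.imp (fun h => ⟨h.1, htr _ h.2⟩) fun h => ⟨h.1, htr _ h.2⟩

theorem slab_base_eq {n ν : Z3} {ε : ℤ} (hε : ε = 1 ∨ ε = -1) :
    (if ε = 1 then idot n ν + 0 else idot n ν - 0 - 1) = level n ν ε := by
  rcases hε with rfl | rfl <;> simp [level]

theorem map_mem_of_automorphism {g : E3 ≃ᵢ E3} (hg : g ∈ (D.apeirotope p).automorphisms)
    {F : Figure} (hF : F ∈ D.zigzagFaces p) : F.map g ∈ D.zigzagFaces p := by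
  have e : (D.apeirotope p).map g = D.apeirotope p := hg
  have : (D.apeirotope p).faces = ((D.apeirotope p).map g).faces := by rw [e]
  change F.map g ∈ (D.apeirotope p).faces
  rw [this]
  exact ⟨F, hF, rfl⟩

theorem ActsAs.image_base_slab (hp : Function.Injective p) {g : E3 ≃ᵢ E3}
    (hg : g ∈ (D.apeirotope p).automorphisms) {n : Z3} {ε : ℤ} (hn : D.Site n ε)
    {l : List (Fin 3)} (h : ActsAs p g n ε (D.wordHom l)) :
    Figure.map g '' D.slab p D.normal₀ 0 =
      D.slab p (D.word l D.normal₀) (level n (D.word l D.normal₀) ε) := by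
  rw [h.image_slab hn.sign (idot_word l) hp (fun F => map_mem_of_automorphism hg)
    (fun F => map_mem_of_automorphism (inv_mem hg)), ← slab_base_eq hn.sign]
  rfl

theorem ActsAs.map_base_zigzag {g : E3 ≃ᵢ E3} {n : Z3} {ε : ℤ}
    {l : List (Fin 3)} (h : ActsAs p g n ε (D.wordHom l)) :
    (zigzag p 0 1 D.node₀ D.node₁).map g =
      zigzag p n ε (D.word l D.node₀) (D.word l D.node₁) := by
  rw [h.map_zigzag, map_zero, smul_zero, add_zero, mul_one]
  rfl

theorem ActsAs.map_base_edge {g : E3 ≃ᵢ E3} {n : Z3} {ε : ℤ}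
    {l : List (Fin 3)} (h : ActsAs p g n ε (D.wordHom l)) :
    Sym2.map g s(p 0, p D.node₀) = s(p n, p (n + ε • D.word l D.node₀)) := by
  rw [Sym2.map_mk, h, h, map_zero, smul_zero, add_zero]
  rfl

theorem ActsAs.apply_zero {g : E3 ≃ᵢ E3} {n : Z3} {ε : ℤ}
    {l : List (Fin 3)} (h : ActsAs p g n ε (D.wordHom l)) : g (p 0) = p n := by
  rw [h, map_zero, smul_zero, add_zero]

/-- The flags are the images of the base flag. -/
theorem IsGenerating.exists_map_flag (h : IsGenerating D p R₀ R₁ R₂ R₃) (hD : D.IsRegular)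
    (hp : Function.Injective p) {v : E3} {e : Sym2 E3} {F : Figure} {C : Set Figure}
    (hf : (D.apeirotope p).IsFlag v e F C) :
    ∃ g ∈ (D.apeirotope p).automorphisms, g (p 0) = v ∧ Sym2.map g s(p 0, p D.node₀) = e ∧
      (zigzag p 0 1 D.node₀ D.node₁).map g = F ∧ Figure.map g '' D.slab p D.normal₀ 0 = C := by
  obtain ⟨⟨n, ε, hn, rfl⟩, -, hF, hC, hve, heF, hFC⟩ := hf
  obtain ⟨y, rfl⟩ := Sym2.mem_iff_exists.1 hve
  have hs := isStar_apeirotope hD hp hn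
  obtain ⟨ν, hν, rfl⟩ := hs.facet_eq C hC F hFC y heF
  obtain ⟨w, w', hA, rfl, rfl⟩ := hs.face_at hF heF
  obtain ⟨h1, h2⟩ := (hs.fc_mem_ct w w' hA ν hν).1 hFC
  obtain ⟨l, rfl, rfl, rfl⟩ := exists_word_flag hD hA hν h1 h2
  obtain ⟨g, hg, hact⟩ := h.exists_actsAs hD hn l
  have hg' := h.closure_le hD hp hg
  exact ⟨g, hg', hact.apply_zero, hact.map_base_edge, hact.map_base_zigzag,
    hact.image_base_slab hp hg' hn⟩

theorem IsGenerating.flag_transitive (h : IsGenerating D p R₀ R₁ R₂ R₃) (hD : D.IsRegular)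
    (hp : Function.Injective p) {v v' : E3} {e e' : Sym2 E3} {F F' : Figure} {C C' : Set Figure}
    (hf : (D.apeirotope p).IsFlag v e F C) (hf' : (D.apeirotope p).IsFlag v' e' F' C') :
    ∃ g : E3 ≃ᵢ E3, (D.apeirotope p).map g = D.apeirotope p ∧
      g v = v' ∧ Sym2.map g e = e' ∧ F.map g = F' ∧ Figure.map g '' C = C' :=
  Complex3.flag_transitive_of_base (h.exists_map_flag hD hp) hf hf'

end IntPolyhedron

end


/-! ### Identification with Wythoff's construction. -/

noncomputable section

namespace IntPolyhedron

variable {D : IntPolyhedron} {p : Z3 → E3} {R₀ R₁ R₂ R₃ : E3 ≃ᵢ E3}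

/-- The vertices of the base zigzag. -/
def baseSeq (D : IntPolyhedron) (i : ℤ) : Z3 := zseq 0 1 D.node₀ D.node₁ i

theorem IsGenerating.apply₀_baseSeq (h : IsGenerating D p R₀ R₁ R₂ R₃) (i : ℤ) :
    R₀ (p (D.baseSeq i)) = p (D.baseSeq (1 - i)) := by
  rw [h.apply₀, baseSeq, baseSeq, zseq_one_sub]
  have := zseq_affine (AddMonoidHom.id Z3) D.node₀ (-1) 0 1 D.node₀ D.node₁ i
  simp only [AddMonoidHom.id_apply, neg_one_smul, neg_zero, add_zero] at this
  rw [sub_eq_add_neg, this, one_smul, zero_add, mul_one]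

theorem IsGenerating.apply₁_baseSeq (h : IsGenerating D p R₀ R₁ R₂ R₃) (hD : D.IsRegular) (i : ℤ) :
    R₁ (p (D.baseSeq i)) = p (D.baseSeq (-i)) := by
  rw [h.apply₁, baseSeq, baseSeq, zseq_neg]
  have := zseq_affine (D.wordHom [0]) 0 1 0 1 D.node₀ D.node₁ i
  have e0 : D.wordHom [0] D.node₀ = D.node₁ := hD.gen₁_node₀
  have e1 : D.wordHom [0] D.node₁ = D.node₀ := hD.gen₁_node₁
  rw [e0, e1, map_zero, smul_zero, zero_add, one_smul, zero_add, mul_one] at this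
  rw [← this]
  rfl

/-- On the indices of the base zigzag, `R₀` and `R₁` act as `i ↦ 1 - i` and `i ↦ -i`. They generate
all maps `i ↦ ±i + k`, so the orbits of the base vertex and of the base edge are all vertices and
all edges of the zigzag. -/
theorem IsGenerating.baseFace_eq (h : IsGenerating D p R₀ R₁ R₂ R₃) (hD : D.IsRegular) :
    ({ verts := {x | ∃ g ∈ Subgroup.closure {R₀, R₁}, x = g (p 0)}
       edges := {e | ∃ g ∈ Subgroup.closure {R₀, R₁}, e = Sym2.map g s(p 0, R₀ (p 0))} } : Figure) =
      zigzag p 0 1 D.node₀ D.node₁ := by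
  have b0 : D.baseSeq 0 = 0 := zseq_zero _ _ _ _
  have b1 : D.baseSeq 1 = D.node₀ := by rw [baseSeq, zseq_one, zero_add, one_smul]
  have hedge : s(p 0, R₀ (p 0)) = s(p (D.baseSeq 0), p (D.baseSeq 1)) := by
    rw [b0, b1, h.apply₀, sub_zero]
  have mem : ∀ g ∈ ({R₀, R₁} : Set (E3 ≃ᵢ E3)), g ∈ Subgroup.closure {R₀, R₁} :=
    fun g hg => Subgroup.subset_closure hg
  have hact : ∀ g ∈ Subgroup.closure {R₀, R₁}, ∃ σ k : ℤ, (σ = 1 ∨ σ = -1) ∧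
      ∀ i, g (p (D.baseSeq i)) = p (D.baseSeq (σ * i + k)) := by
    intro g hg
    induction hg using Subgroup.closure_induction with
    | mem g hg =>
      rcases hg with rfl | rfl
      · exact ⟨-1, 1, by simp, fun i => by rw [h.apply₀_baseSeq]; congr 2; ring⟩
      · exact ⟨-1, 0, by simp, fun i => by rw [h.apply₁_baseSeq hD]; congr 2; ring⟩
    | one => exact ⟨1, 0, by simp, fun i => by simp⟩
    | mul g g' _ _ hg hg' =>
      obtain ⟨σ, k, hσ, e⟩ := hg
      obtain ⟨σ', k', hσ', e'⟩ := hg'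
      refine ⟨σ * σ', σ * k' + k, ?_, fun i => ?_⟩
      · rcases hσ with rfl | rfl <;> rcases hσ' with rfl | rfl <;> simp
      · rw [isometryEquiv_mul_apply, e', e]; congr 2; ring
    | inv g _ hg =>
      obtain ⟨σ, k, hσ, e⟩ := hg
      refine ⟨σ, -(σ * k), hσ, fun i => ?_⟩
      have : i = σ * (σ * i + -(σ * k)) + k := by rcases hσ with rfl | rfl <;> ring
      conv_lhs => rw [this, ← e]
      exact isometryEquiv_inv_apply_self _ _
  have hshift : ∀ k : ℤ, ∃ g ∈ Subgroup.closure {R₀, R₁},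
      ∀ i, g (p (D.baseSeq i)) = p (D.baseSeq (i + k)) := by
    have hs : ∀ i, (R₀ * R₁) (p (D.baseSeq i)) = p (D.baseSeq (i + 1)) := fun i => by
      rw [isometryEquiv_mul_apply, h.apply₁_baseSeq hD, h.apply₀_baseSeq]
      congr 2; ring
    have hm : R₀ * R₁ ∈ Subgroup.closure {R₀, R₁} :=
      mul_mem (mem _ (by simp)) (mem _ (by simp))
    intro k
    induction k with
    | zero => exact ⟨1, one_mem _, fun i => by simp⟩
    | succ k ih =>
      obtain ⟨g, hg, e⟩ := ih
      refine ⟨R₀ * R₁ * g, mul_mem hm hg, fun i => ?_⟩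
      rw [isometryEquiv_mul_apply, e, hs, add_assoc]
    | pred k ih =>
      obtain ⟨g, hg, e⟩ := ih
      refine ⟨(R₀ * R₁)⁻¹ * g, mul_mem (inv_mem hm) hg, fun i => ?_⟩
      rw [isometryEquiv_mul_apply, e, show i + -(k : ℤ) = i + (-k - 1) + 1 by ring, ← hs,
        isometryEquiv_inv_apply_self]
  rw [hedge]
  ext x
  · constructor
    · rintro ⟨g, hg, rfl⟩
      obtain ⟨σ, k, -, e⟩ := hact g hg
      have e0 := e 0
      rw [b0] at e0
      rw [e0]
      exact ⟨_, rfl⟩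
    · rintro ⟨i, rfl⟩
      obtain ⟨g, hg, e⟩ := hshift i
      exact ⟨g, hg, by have e0 := e 0; rw [b0, zero_add] at e0; rw [e0]; rfl⟩
  · constructor
    · rintro ⟨g, hg, rfl⟩
      obtain ⟨σ, k, hσ, e⟩ := hact g hg
      rw [Sym2.map_mk, e, e]
      rcases hσ with rfl | rfl
      · exact ⟨k, by simp only [one_mul, zero_add]; rw [add_comm]; rfl⟩
      · refine ⟨k - 1, ?_⟩
        rw [Sym2.eq_swap]
        simp only [sub_add_cancel, mul_zero, zero_add, mul_one]
        rw [sub_eq_add_neg, add_comm k]; rfl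
    · rintro ⟨i, rfl⟩
      obtain ⟨g, hg, e⟩ := hshift i
      exact ⟨g, hg, by rw [Sym2.map_mk, e, e, zero_add, add_comm 1]; rfl⟩

/-- The three generators preserve the slab at level `0`. Conversely their group is transitive on its
zigzags: words in the first two polyhedral generators reach all directed edges of the base face, and
by `hflat` the translations along the slab are products of point reflections. -/
theorem IsGenerating.baseFacet_eq (h : IsGenerating D p R₀ R₁ R₂ R₃) (hD : D.IsRegular)
    (hflat : D.HasFlatSlabs) (hp : Function.Injective p) :
    {F | ∃ g ∈ Subgroup.closure {R₀, R₁, R₂}, F = (zigzag p 0 1 D.node₀ D.node₁).map g} =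
      D.slab p D.normal₀ 0 := by
  have hle : Subgroup.closure {R₀, R₁, R₂} ≤ Subgroup.closure {R₀, R₁, R₂, R₃} :=
    Subgroup.closure_mono (by
      rintro g (rfl | rfl | rfl) <;> simp)
  have haut := fun g (hg : g ∈ Subgroup.closure {R₀, R₁, R₂}) => h.closure_le hD hp (hle hg)
  have mem : ∀ g ∈ ({R₀, R₁, R₂} : Set (E3 ≃ᵢ E3)), g ∈ Subgroup.closure {R₀, R₁, R₂} :=
    fun g hg => Subgroup.subset_closure hg
  have hbase : zigzag p 0 1 D.node₀ D.node₁ ∈ D.slab p D.normal₀ 0 :=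
    (zigzag_mem_slab hD hp site_zero hD.base_adj hD.normal_mem rfl).2
      ⟨by simp [idot], hD.base_normal⟩
  have img : ∀ g ∈ Subgroup.closure {R₀, R₁, R₂}, ∀ t σ l, D.Site t σ →
      ActsAs p g t σ (D.wordHom l) → D.word l D.normal₀ = D.normal₀ → level t D.normal₀ σ = 0 →
      Figure.map g '' D.slab p D.normal₀ 0 = D.slab p D.normal₀ 0 := by
    intro g hg t σ l ht hact hl hlev
    rw [hact.image_base_slab hp (haut g hg) ht, hl, hlev]
  have stab : ∀ g ∈ Subgroup.closure {R₀, R₁, R₂},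
      Figure.map g '' D.slab p D.normal₀ 0 = D.slab p D.normal₀ 0 := by
    intro g hg
    induction hg using Subgroup.closure_induction with
    | mem g hg =>
      have hg' := hg
      rcases hg with rfl | rfl | rfl
      -- The reflection `R₀` exchanges the two planes of the slab; `node₀` lies on the upper one, so
      -- the level is again `0`.
      · refine img _ (mem _ hg') D.node₀ (-1) [] (Or.inr ⟨rfl, by simp⟩) (fun m => ?_) rfl ?_
        · rw [h.apply₀, neg_one_smul, ← sub_eq_add_neg]; rfl
        · rw [level, hD.base_normal.1]; simp
      · refine img _ (mem _ hg') 0 1 [0] site_zero (fun m => ?_) hD.gen₁_normal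
          (by simp [level, idot])
        rw [h.apply₁, zero_add, one_smul]; rfl
      · refine img _ (mem _ hg') 0 1 [1] site_zero (fun m => ?_) hD.gen₂_normal
          (by simp [level, idot])
        rw [h.apply₂, zero_add, one_smul]; rfl
    | one =>
      conv_rhs => rw [← Set.image_id (D.slab p D.normal₀ 0)]
      exact Set.image_congr fun F _ => Figure.map_id F
    | mul g g' _ _ hg hg' =>
      conv_rhs => rw [← hg, ← hg', ← Set.image_comp]
      exact Set.image_congr fun F _ => (Figure.map_map g g' F).symm
    | inv g _ hg =>
      conv_lhs => rw [← hg, ← Set.image_comp]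
      conv_rhs => rw [← Set.image_id (D.slab p D.normal₀ 0)]
      exact Set.image_congr fun F _ => Figure.map_inv_map F g
  have h₀ : Acts p (Subgroup.closure {R₀, R₁, R₂}) fun m => D.node₀ - m :=
    ⟨R₀, mem _ (by simp), h.apply₀⟩
  have hS : ∀ i ∈ ({0, 1} : Set (Fin 3)), Acts p (Subgroup.closure {R₀, R₁, R₂}) (D.gen i).act := by
    rintro i (rfl | rfl)
    · exact ⟨R₁, mem _ (by simp), h.apply₁⟩
    · exact ⟨R₂, mem _ (by simp), h.apply₂⟩
  have letters : ∀ l ∈ ([[], [0], [1], [0, 1], [1, 0], [0, 1, 0], [1, 0, 1],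
      [0, 1, 0, 1]] : List (List (Fin 3))), ∀ i ∈ l, i ∈ ({0, 1} : Set (Fin 3)) := by
    have : ∀ l ∈ ([[], [0], [1], [0, 1], [1, 0], [0, 1, 0], [1, 0, 1],
      [0, 1, 0, 1]] : List (List (Fin 3))), ∀ i ∈ l, i = 0 ∨ i = 1 := by decide
    exact this
  have htr : ∀ x ∈ D.lattice, idot x D.normal₀ = 0 →
      Acts p (Subgroup.closure {R₀, R₁, R₂}) fun m => m + x := by
    intro x hx hx0
    refine acts_add (fun w hw => ?_) (hflat _ hD.normal_mem x hx hx0)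
    obtain ⟨w', hA, hw'⟩ := exists_adj_on_normal hD hw.1 hD.normal_mem hw.2
    obtain ⟨l, hl, rfl, -⟩ := hD.face_transitive w hw.1 w' hA.2.1 hA hw.2 hw'
    exact acts_word_sub hD hS h₀ l (letters l hl)
  ext F
  constructor
  · rintro ⟨g, hg, rfl⟩
    rw [← stab g hg]
    exact ⟨_, hbase, rfl⟩
  · intro hF
    obtain ⟨n, ε, w, w', hn, hA, rfl⟩ := hF.1
    obtain ⟨h1, h2, h3⟩ := (zigzag_mem_slab hD hp hn hA hD.normal_mem rfl).1 hF
    obtain ⟨l, hl, rfl, rfl⟩ := hD.face_transitive w hA.1 w' hA.2.1 hA h2 h3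
    obtain ⟨g, hg, hact⟩ := acts_affine (n := n) (ε := ε) h₀ (by
      rcases hn with ⟨rfl, hn⟩ | ⟨rfl, hn⟩
      · exact Or.inl ⟨rfl, htr n hn (by simpa using h1)⟩
      · refine Or.inr ⟨rfl, htr _ hn ?_⟩
        rw [idot_sub, h1, hD.base_normal.1]; norm_num) (acts_word hS l (letters l hl))
    exact ⟨g, hg, hact.map_base_zigzag.symm⟩

/-- The apeirotope arises by Wythoff's construction. -/
theorem IsGenerating.apeirotope_eq_wythoff (h : IsGenerating D p R₀ R₁ R₂ R₃) (hD : D.IsRegular)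
    (hflat : D.HasFlatSlabs) (hp : Function.Injective p) :
    D.apeirotope p = Complex3.wythoff R₀ R₁ R₂ R₃ (p 0) := by
  have haut := h.closure_le hD hp
  have hmap : ∀ g ∈ Subgroup.closure {R₀, R₁, R₂, R₃}, (D.apeirotope p).map g = D.apeirotope p :=
    fun g hg => haut hg
  have hedge : s(p 0, R₀ (p 0)) = s(p 0, p D.node₀) := by rw [h.apply₀, sub_zero]
  have w1 : ∀ w ∈ D.nodes, ∃ l, D.word l D.node₀ = w := fun w hw =>
    let ⟨l, _, hl⟩ := hD.node_transitive w hw; ⟨l, hl⟩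
  unfold Complex3.wythoff
  simp only [h.baseFace_eq hD]
  simp only [h.baseFacet_eq hD hflat hp, hedge]
  ext x
  · constructor
    · rintro ⟨n, ε, hn, rfl⟩
      obtain ⟨g, hg, hact⟩ := h.exists_actsAs hD hn []
      exact ⟨g, hg, hact.apply_zero.symm⟩
    · rintro ⟨g, hg, rfl⟩
      rw [← hmap g hg]
      exact ⟨p 0, ⟨0, 1, site_zero, rfl⟩, rfl⟩
  · constructor
    · rintro ⟨n, ε, w, hn, hw, rfl⟩
      obtain ⟨l, rfl⟩ := w1 w hw
      obtain ⟨g, hg, hact⟩ := h.exists_actsAs hD hn l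
      exact ⟨g, hg, hact.map_base_edge.symm⟩
    · rintro ⟨g, hg, rfl⟩
      rw [← hmap g hg]
      exact ⟨_, ⟨0, 1, D.node₀, site_zero, hD.base_adj.1, by rw [one_smul, zero_add]⟩, rfl⟩
  · constructor
    · rintro ⟨n, ε, w, w', hn, hA, rfl⟩
      obtain ⟨l, rfl, rfl⟩ := exists_word_node hD hA
      obtain ⟨g, hg, hact⟩ := h.exists_actsAs hD hn l
      exact ⟨g, hg, hact.map_base_zigzag.symm⟩
    · rintro ⟨g, hg, rfl⟩
      rw [← hmap g hg]
      exact ⟨_, ⟨0, 1, _, _, site_zero, hD.base_adj, rfl⟩, rfl⟩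
  · constructor
    · rintro ⟨ν, hν, k, hk, rfl⟩
      obtain ⟨w, hw, hwν⟩ := hD.exists_node ν hν
      obtain ⟨w', hA, hw'⟩ := exists_adj_on_normal hD hw hν hwν
      obtain ⟨l, -, -, rfl⟩ := exists_word_flag hD hA hν hwν hw'
      have hs : D.Site k 1 := Or.inl ⟨rfl, hk⟩
      obtain ⟨g, hg, hact⟩ := h.exists_actsAs hD hs l
      refine ⟨g, hg, ?_⟩
      rw [hact.image_base_slab hp (haut hg) hs]
      simp [level]
    · rintro ⟨g, hg, rfl⟩
      rw [← hmap g hg]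
      exact ⟨_, ⟨_, hD.normal_mem, 0, zero_mem _, by simp [idot]⟩, rfl⟩

end IntPolyhedron

end


/-! ### Reconstruction of a complex with point reflections. -/

noncomputable section

namespace Complex2

open IntPolyhedron

variable {K : Complex2}

theorem Arc.map_iff {v a b : E3} {g : E3 ≃ᵢ E3} (hg : g ∈ K.symmetryGroup) :
    K.Arc (g v) (linearPart g a) (linearPart g b) ↔ K.Arc v a b := by
  refine ⟨fun h => ?_, fun h => h.map hg⟩
  have := h.map (inv_mem hg)
  rw [isometryEquiv_inv_apply_self, linearPart_inv, linearIsometryEquiv_inv_apply_self,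
    linearIsometryEquiv_inv_apply_self] at this
  exact this

/-- The reflection in the midpoint of the edge between `q k` and `q (k + 1)` exchanges `q (k + 2)`
and `q (k - 1)`. Hence all displacements over two edges are equal. -/
theorem HasPointReflection.recurrence {q : ℤ → E3}
    (h : ∀ k, K.HasPointReflection fun i => q (i + k)) (k : ℤ) :
    q (k + 2) - q k = q 1 - q (-1) := by
  have step : ∀ k, q (k + 2) - q k = q (k + 1) - q (k - 1) := by
    intro k
    obtain ⟨g, -, h1, h2⟩ := h k
    have := h2 2
    rw [h1] at this
    beta_reduce at this
    rw [show (1 : ℤ) - 2 + k = k - 1 by ring, show 0 + k = k by ring, add_comm 1 k,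
      add_comm 2 k] at this
    rw [← this]
    abel
  induction k with
  | zero => simpa using step 0
  | succ k ih =>
    rw [step, ← ih]
    congr 2; ring
  | pred k ih =>
    rw [← ih, step (-k)]
    congr 2; ring

theorem HasPointReflection.formula {q : ℤ → E3}
    (h : ∀ k, K.HasPointReflection fun i => q (i + k)) (k : ℤ) :
    q (2 * k) = q 0 + (k : ℝ) • (q 1 - q (-1)) ∧
      q (2 * k + 1) = q 1 + (k : ℝ) • (q 1 - q (-1)) := by
  have hrec := HasPointReflection.recurrence h
  induction k with
  | zero => simp
  | succ k ih =>
    have r1 := hrec (2 * k)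
    have r2 := hrec (2 * k + 1)
    rw [ih.1, sub_eq_iff_eq_add] at r1
    rw [ih.2, sub_eq_iff_eq_add] at r2
    constructor
    · rw [show (2 : ℤ) * (k + 1) = 2 * k + 2 by ring, r1]
      push_cast
      module
    · rw [show (2 : ℤ) * (k + 1) + 1 = 2 * k + 1 + 2 by ring, r2]
      push_cast
      module
  | pred k ih =>
    have r1 := hrec (2 * (-k - 1))
    have r2 := hrec (2 * (-k - 1) + 1)
    rw [show (2 : ℤ) * (-k - 1) + 2 = 2 * -k by ring, ih.1] at r1
    rw [show (2 : ℤ) * (-k - 1) + 1 + 2 = 2 * -k + 1 by ring, ih.2] at r2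
    constructor
    · rw [eq_comm, ← sub_eq_zero, ← sub_eq_zero.2 r1]
      push_cast
      module
    · rw [eq_comm, ← sub_eq_zero, ← sub_eq_zero.2 r2]
      push_cast
      module

section Model

variable {v : E3} {D : IntPolyhedron} {κ : ℝ} {J : E3 ≃ₗᵢ[ℝ] E3}

theorem translation_scaledPoint_mem (hpt : ∀ q, K.IsFaceParam q → K.HasPointReflection q)
    (hD : D.IsRegular)
    (harc : ∀ a b, K.Arc v a b ↔ ∃ w w', D.Adj w w' ∧ a = scaledPoint κ J w ∧ b = scaledPoint κ J w')
    {l : Z3} (hl : l ∈ D.lattice) : translation (scaledPoint κ J l) ∈ K.symmetryGroup := by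
  have node : ∀ w ∈ D.nodes, ∃ b, K.Arc v (scaledPoint κ J w) b := fun w hw =>
    let ⟨w', _, hA⟩ := hD.exists_adj w hw
    ⟨_, (harc _ _).2 ⟨w, w', hA, rfl, rfl⟩⟩
  induction hl using AddSubgroup.closure_induction with
  | mem x hx =>
    obtain ⟨w, hw, w', hw', rfl⟩ := hx
    obtain ⟨b, hb⟩ := node w hw
    obtain ⟨b', hb'⟩ := node w' hw'
    rw [scaledPoint_sub]
    exact translation_mem hpt hb hb'
  | zero =>
    convert one_mem K.symmetryGroup
    ext1 x
    simp [scaledPoint, intPoint_zero]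
  | add x y _ _ hx hy =>
    convert mul_mem hx hy
    ext1 z
    rw [isometryEquiv_mul_apply, translation_apply, translation_apply, translation_apply,
      scaledPoint_add]
    abel
  | neg x _ hx =>
    convert inv_mem hx
    ext1 z
    rw [eq_comm, ← (translation (scaledPoint κ J x)).injective.eq_iff,
      isometryEquiv_apply_inv_self]
    simp [scaledPoint_neg]

/-- The integral points in the coordinates given by the arcs at `v`. -/
def latticePoint (v : E3) (κ : ℝ) (J : E3 ≃ₗᵢ[ℝ] E3) (n : Z3) : E3 := v + scaledPoint κ J n

theorem latticePoint_injective (hκ : κ ≠ 0) : Function.Injective (latticePoint v κ J) :=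
  fun _ _ h => scaledPoint_injective hκ (add_left_cancel h)

/-- For sign `1` a translation; for sign `-1` a translation after the reflection in the midpoint of
the base edge. -/
theorem exists_symmetry_of_site (hpt : ∀ q, K.IsFaceParam q → K.HasPointReflection q)
    (hD : D.IsRegular)
    (harc : ∀ a b, K.Arc v a b ↔ ∃ w w', D.Adj w w' ∧ a = scaledPoint κ J w ∧ b = scaledPoint κ J w')
    {n : Z3} {ε : ℤ} (hn : D.Site n ε) : ∃ g ∈ K.symmetryGroup, g v = latticePoint v κ J n ∧
      ∀ x, linearPart g x = (ε : ℝ) • x := by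
  have lin : ∀ (g : E3 ≃ᵢ E3) (c : E3), (∀ x, g x = c + (ε : ℝ) • x) →
      ∀ x, linearPart g x = (ε : ℝ) • x := by
    intro g c hg x
    have := linearPart_sub g x 0
    rw [sub_zero, hg, hg] at this
    rw [this]; simp
  rcases hn with ⟨rfl, hn⟩ | ⟨rfl, hn⟩
  · exact ⟨_, translation_scaledPoint_mem hpt hD harc hn, rfl,
      lin _ (scaledPoint κ J n) fun x => by simp [add_comm]⟩
  · obtain ⟨q, hq, h0, h1, -⟩ := (harc _ _).2 ⟨_, _, hD.base_adj, rfl, rfl⟩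
    obtain ⟨g, hg, hgx, -⟩ := hpt q hq
    have ht := translation_scaledPoint_mem hpt hD harc hn
    have key : ∀ x, (translation (scaledPoint κ J (n - D.node₀)) * g) x =
        (v + latticePoint v κ J n) + ((-1 : ℤ) : ℝ) • x := by
      intro x
      rw [isometryEquiv_mul_apply, translation_apply, hgx, h0, h1, scaledPoint_sub, latticePoint]
      push_cast
      rw [neg_one_smul]
      abel
    refine ⟨_, mul_mem ht hg, ?_, lin _ _ key⟩
    rw [key]
    push_cast
    rw [neg_one_smul]
    abel

/-- A symmetry with linear part `ε` takes `v` to the site, so the arcs there are `ε` times the arcs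
at `v`. -/
theorem arc_site (hpt : ∀ q, K.IsFaceParam q → K.HasPointReflection q)
    (hD : D.IsRegular)
    (harc : ∀ a b, K.Arc v a b ↔ ∃ w w', D.Adj w w' ∧ a = scaledPoint κ J w ∧ b = scaledPoint κ J w')
    {n : Z3} {ε : ℤ} (hn : D.Site n ε) (a b : E3) : K.Arc (latticePoint v κ J n) a b ↔
      ∃ w w', D.Adj w w' ∧ a = scaledPoint κ J (ε • w) ∧ b = scaledPoint κ J (ε • w') := by
  obtain ⟨g, hg, hv, hlin⟩ := exists_symmetry_of_site hpt hD harc hn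
  have hε : (ε : ℝ) * ε = 1 := by rcases hn.sign with rfl | rfl <;> simp
  have e : ∀ x : E3, x = linearPart g ((ε : ℝ) • x) := fun x => by
    rw [hlin, smul_smul, hε, one_smul]
  rw [← hv, e a, e b, Arc.map_iff hg, harc, ← e, ← e]
  refine exists_congr fun w => exists_congr fun w' => and_congr_right fun _ => ?_
  have : ∀ (x : E3) (w : Z3), (ε : ℝ) • x = scaledPoint κ J w ↔ x = scaledPoint κ J (ε • w) := by
    intro x w
    rw [scaledPoint_zsmul]
    constructor
    · intro h; rw [← h, smul_smul, hε, one_smul]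
    · rintro rfl; rw [smul_smul, hε, one_smul]
  rw [this, this]

theorem faceParam_eq_zseq (hpt : ∀ q, K.IsFaceParam q → K.HasPointReflection q) {q : ℤ → E3}
    (hq : K.IsFaceParam q) {n w w' : Z3} {ε : ℤ} (h0 : q 0 = latticePoint v κ J n)
    (h1 : q 1 = latticePoint v κ J (n + ε • w)) (h2 : q (-1) = latticePoint v κ J (n + ε • w')) :
    q = fun i => latticePoint v κ J (zseq n ε w w' i) := by
  have hf := HasPointReflection.formula fun k => hpt _ (hq.shift k)
  have hd : q 1 - q (-1) = scaledPoint κ J (ε • (w - w')) := by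
    rw [h1, h2, latticePoint, latticePoint, smul_sub, scaledPoint_add, scaledPoint_add,
      scaledPoint_sub]
    abel
  funext i
  obtain ⟨k, rfl | rfl⟩ := Int.even_or_odd' i
  · rw [(hf k).1, hd, h0, zseq_even, latticePoint, latticePoint, ← scaledPoint_zsmul,
      scaledPoint_add]
    abel
  · rw [(hf k).2, hd, h1, zseq_odd, latticePoint, latticePoint, ← scaledPoint_zsmul,
      scaledPoint_add, scaledPoint_add, scaledPoint_add]
    abel

/-- A complex whose faces have point reflections is determined by the arcs at one vertex. -/
theorem twoSkeleton_apeirotope_eq (hK : K.IsPolygonalComplex)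
    (hpt : ∀ q, K.IsFaceParam q → K.HasPointReflection q) (hv : v ∈ K.verts) (hD : D.IsRegular)
    (harc : ∀ a b, K.Arc v a b ↔ ∃ w w', D.Adj w w' ∧ a = scaledPoint κ J w ∧ b = scaledPoint κ J w') :
    (D.apeirotope (latticePoint v κ J)).twoSkeleton = K := by
  have padd : ∀ n m, latticePoint v κ J (n + m) = latticePoint v κ J n + scaledPoint κ J m :=
    fun n m => by rw [latticePoint, scaledPoint_add, ← add_assoc]; rfl
  have hsite := fun {n : Z3} {ε : ℤ} (hn : D.Site n ε) => arc_site hpt hD harc hn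
  have hedge : ∀ n ε, D.Site n ε → ∀ y, s(latticePoint v κ J n, y) ∈ K.edges →
      ∃ w ∈ D.nodes, y = latticePoint v κ J (n + ε • w) := by
    intro n ε hn y hy
    obtain ⟨b, hb⟩ := exists_arc_of_edge hK hy
    obtain ⟨w, w', hA, e, -⟩ := (hsite hn _ _).1 hb
    exact ⟨w, hA.1, by rw [padd, ← e]; abel⟩
  -- Every vertex is reached from `v` along edges, and every edge at a site leads to a neighbouring
  -- site.
  have hverts : ∀ x ∈ K.verts, ∃ n ε, D.Site n ε ∧ x = latticePoint v κ J n := by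
    intro x hx
    have hr := hK.edgeGraph_connected.preconnected ⟨v, hv⟩ ⟨x, hx⟩
    rw [SimpleGraph.reachable_iff_reflTransGen] at hr
    have key : ∀ y : K.verts, Relation.ReflTransGen K.edgeGraph.Adj ⟨v, hv⟩ y →
        ∃ n ε, D.Site n ε ∧ y.1 = latticePoint v κ J n := by
      intro y hy
      induction hy with
      | refl => exact ⟨0, 1, site_zero, by simp [latticePoint, scaledPoint, intPoint_zero]⟩
      | tail _ hbc ih =>
        obtain ⟨n, ε, hn, e⟩ := ih
        have he := hbc.2
        rw [e] at he
        obtain ⟨w, hw, e'⟩ := hedge n ε hn _ he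
        exact ⟨_, _, hn.neighbour hD hw, e'⟩
    exact key _ hr
  have hverts' : ∀ n ε, D.Site n ε → latticePoint v κ J n ∈ K.verts := by
    intro n ε hn
    obtain ⟨g, hg, hgv, -⟩ := exists_symmetry_of_site hpt hD harc hn
    rw [← hgv]
    exact map_mem_verts hg hv
  ext x
  · constructor
    · rintro ⟨n, ε, hn, rfl⟩
      exact hverts' n ε hn
    · exact hverts x
  · constructor
    · rintro ⟨n, ε, w, hn, hw, rfl⟩
      obtain ⟨w', -, hA⟩ := hD.exists_adj w hw
      have := ((hsite hn _ _).2 ⟨w, w', hA, rfl, rfl⟩).mem_edges hK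
      rwa [← padd] at this
    · intro hx
      induction x using Sym2.ind with | _ x y
      obtain ⟨n, ε, hn, rfl⟩ := hverts x (hK.edge_verts _ hx x (by simp))
      obtain ⟨w, hw, rfl⟩ := hedge n ε hn y hx
      exact ⟨n, ε, w, hn, hw, rfl⟩
  · constructor
    · rintro ⟨n, ε, w, w', hn, hA, rfl⟩
      obtain ⟨q, hq, h0, h1, h2⟩ := (hsite hn _ _).2 ⟨w, w', hA, rfl, rfl⟩
      rw [← padd] at h1 h2
      have := hq.mem_faces
      rwa [faceParam_eq_zseq hpt hq h0 h1 h2] at this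
    · intro hx
      obtain ⟨q, hq⟩ := (hK.face_polygon x hx).exists_isParam
      have hq' : K.IsFaceParam q := ⟨x, hx, hq⟩
      obtain ⟨n, ε, hn, h0⟩ := hverts _ (hq'.mem_verts hK 0)
      have ha := hq'.arc
      rw [h0] at ha
      obtain ⟨w, w', hA, h1, h2⟩ := (hsite hn _ _).1 ha
      rw [sub_eq_iff_eq_add', ← padd] at h1 h2
      refine ⟨n, ε, w, w', hn, hA, ?_⟩
      rw [hq.eq, faceParam_eq_zseq hpt hq' h0 h1 h2]
      rfl

/-- The axis passes through the midpoints of the edges, with direction `w - w'`, and the vertices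
are displaced along `w + w'`. These vectors are orthogonal since nodes have equal length, and
non-zero since `w ≠ ±w'`. -/
theorem isZigzag_zigzag (hD : D.IsRegular) (hκ : κ ≠ 0) {n w w' : Z3} {ε : ℤ} (hn : D.Site n ε)
    (hA : D.Adj w w') : (zigzag (latticePoint v κ J) n ε w w').IsZigzag := by
  have hε : (ε : ℝ) ≠ 0 := by exact_mod_cast hn.ne_zero
  have inj := scaledPoint_injective (J := J) hκ
  have hz : scaledPoint κ J 0 = 0 := by simp [scaledPoint, intPoint_zero]
  have e1 : scaledPoint κ J (w - w') ≠ 0 := fun h =>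
    sub_ne_zero.2 (hA.ne hD) (inj (h.trans hz.symm))
  have e2 : scaledPoint κ J (w + w') ≠ 0 := fun h => by
    have h' := inj (h.trans hz.symm)
    have := hA.2.2
    rw [eq_neg_of_add_eq_zero_right h', idot_comm, idot_neg, hD.normSq_eq w hA.1] at this
    exact hD.adj_ne_neg this.symm
  refine ⟨latticePoint v κ J n + ((ε : ℝ) / 4) • scaledPoint κ J (w + w'),
    ((ε : ℝ) / 2) • scaledPoint κ J (w - w'), (-((ε : ℝ) / 4)) • scaledPoint κ J (w + w'),
    smul_ne_zero (by positivity) e1, smul_ne_zero (neg_ne_zero.2 (by positivity)) e2, ?_, ?_⟩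
  · rw [inner_smul_left, inner_smul_right, inner_scaledPoint]
    have : idot (w - w') (w + w') = 0 := by
      have h1 := hD.normSq_eq w hA.1
      have h2 := hD.normSq_eq w' hA.2.1
      rw [idot_sub, idot_comm w, idot_comm w', idot_add, idot_add, h1, h2, idot_comm w']
      ring
    rw [this]; simp
  · rw [zigzag]
    congr 1
    funext i
    obtain ⟨k, rfl | rfl⟩ := Int.even_or_odd' i
    · rw [zseq_even, Even.neg_one_zpow (even_two_mul k), latticePoint, latticePoint,
        scaledPoint_add, scaledPoint_zsmul, scaledPoint_zsmul]
      push_cast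
      module
    · rw [zseq_odd, Odd.neg_one_zpow (odd_two_mul_add_one k), latticePoint, latticePoint,
        scaledPoint_add, scaledPoint_add, scaledPoint_zsmul, scaledPoint_zsmul, scaledPoint_zsmul,
        scaledPoint_sub, scaledPoint_add]
      push_cast
      module

end Model

end Complex2

/-- The conditions on vertices, edges and 2-faces, including discreteness, are inherited from the
2-skeleton, which is known to be a polygonal complex. -/
theorem IntPolyhedron.isRegularApeirotope {D : IntPolyhedron} (hD : D.IsRegular)
    (hflat : D.HasFlatSlabs) {p : Z3 → E3} (hp : Function.Injective p)
    (hK : (D.apeirotope p).twoSkeleton.IsPolygonalComplex) {R₀ R₁ R₂ R₃ : E3 ≃ᵢ E3}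
    (hR : D.IsGenerating p R₀ R₁ R₂ R₃) : (D.apeirotope p).IsRegularApeirotope where
  edge_nondegenerate := hK.edge_nondegenerate
  edge_verts := hK.edge_verts
  face_polygon := hK.face_polygon
  face_verts := hK.face_verts
  face_edges := hK.face_edges
  facet_faces := (apeirotope_isLocallyPolyhedral hD hflat hp).facet_faces
  polytope := (apeirotope_isLocallyPolyhedral hD hflat hp).isAbstractPolytope hD
  infinite := Set.infinite_of_injective_forall_mem
    (hp.comp (zseq_injective hD site_zero hD.base_adj))
    fun i => ⟨_, _, site_zero.zseq hD hD.base_adj i, rfl⟩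
  discrete := hK.discrete
  flag_transitive _ _ _ _ _ _ _ _ hf hf' := hR.flag_transitive hD hp hf hf'

end


/-! ### Flat slabs of the models, and comparison with `apeir`. -/

noncomputable section

namespace IntPolyhedron

variable {D : IntPolyhedron}

/-- Three nodes of a face already generate the lattice vectors in its direction plane; `x` and `y`
are the coordinates. -/
theorem mem_closure_of_triangle {ν l u₀ u₁ u₂ : Z3} (x y : ℤ)
    (h₀ : u₀ ∈ D.nodes ∧ idot u₀ ν = 1) (h₁ : u₁ ∈ D.nodes ∧ idot u₁ ν = 1)
    (h₂ : u₂ ∈ D.nodes ∧ idot u₂ ν = 1) (hl : l = x • (u₀ - u₂) + y • (u₁ - u₂)) :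
    l ∈ AddSubgroup.closure {d | ∃ w ∈ {w | w ∈ D.nodes ∧ idot w ν = 1},
      ∃ w' ∈ {w | w ∈ D.nodes ∧ idot w ν = 1}, d = w - w'} := by
  rw [hl]
  refine add_mem (zsmul_mem (AddSubgroup.subset_closure ?_) _)
    (zsmul_mem (AddSubgroup.subset_closure ?_) _)
  · exact ⟨_, h₀, _, h₂, rfl⟩
  · exact ⟨_, h₁, _, h₂, rfl⟩

theorem octa_hasFlatSlabs : octa.HasFlatSlabs := by
  intro ν hν l _ h
  have hs : ∀ ν ∈ octa.normals, (![ν 0, 0, 0] ∈ octa.nodes ∧ idot ![ν 0, 0, 0] ν = 1) ∧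
      (![0, ν 1, 0] ∈ octa.nodes ∧ idot ![0, ν 1, 0] ν = 1) ∧
      (![0, 0, ν 2] ∈ octa.nodes ∧ idot ![0, 0, ν 2] ν = 1) ∧
      ν 0 * ν 0 = 1 ∧ ν 1 * ν 1 = 1 ∧ ν 2 * ν 2 = 1 := by decide
  obtain ⟨h0, h1, h2, e0, e1, e2⟩ := hs ν hν
  refine mem_closure_of_triangle (l 0 * ν 0) (l 1 * ν 1) h0 h1 h2 ?_
  rw [idot] at h
  funext i
  fin_cases i
  · simp
    linear_combination (-(l 0)) * e0
  · simp
    linear_combination (-(l 1)) * e1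
  · simp
    linear_combination (ν 2) * h - (l 2) * e2

theorem even_of_mem_lattice (h : ∀ w ∈ D.nodes, ∀ w' ∈ D.nodes, ∀ i, (2 : ℤ) ∣ w i - w' i) {l : Z3}
    (hl : l ∈ D.lattice) (i : Fin 3) : (2 : ℤ) ∣ l i := by
  induction hl using AddSubgroup.closure_induction with
  | mem x hx =>
    obtain ⟨w, hw, w', hw', rfl⟩ := hx
    exact h w hw w' hw' i
  | zero => simp
  | add x y _ _ hx hy => exact dvd_add hx hy
  | neg x _ hx => exact (dvd_neg).2 hx

/-- Here, and for the tetrahedron, differences of nodes have even coordinates; halves of two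
coordinates of `l`, up to sign, serve as coefficients. -/
theorem hexa_hasFlatSlabs : hexa.HasFlatSlabs := by
  intro ν hν l hl h
  have he := even_of_mem_lattice (D := hexa) (by decide) hl
  obtain ⟨a, ha⟩ := he 0
  obtain ⟨b, hb⟩ := he 1
  obtain ⟨c, hc⟩ := he 2
  obtain rfl : l = ![2 * a, 2 * b, 2 * c] := by
    funext i; fin_cases i <;> simp [ha, hb, hc]
  simp only [hexa, List.mem_cons, List.not_mem_nil, or_false] at hν
  rcases hν with rfl | rfl | rfl | rfl | rfl | rfl <;> simp [idot] at h <;> subst h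
  · exact mem_closure_of_triangle (u₀ := ![1, 1, -1]) (u₁ := ![1, -1, 1]) (u₂ := ![1, -1, -1]) b c
      (by decide) (by decide) (by decide) (by funext i; fin_cases i <;> simp <;> ring)
  · exact mem_closure_of_triangle (u₀ := ![-1, 1, -1]) (u₁ := ![-1, -1, 1]) (u₂ := ![-1, -1, -1])
      b c (by decide) (by decide) (by decide) (by funext i; fin_cases i <;> simp <;> ring)
  · exact mem_closure_of_triangle (u₀ := ![1, 1, -1]) (u₁ := ![-1, 1, 1]) (u₂ := ![-1, 1, -1]) a c
      (by decide) (by decide) (by decide) (by funext i; fin_cases i <;> simp <;> ring)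
  · exact mem_closure_of_triangle (u₀ := ![1, -1, -1]) (u₁ := ![-1, -1, 1]) (u₂ := ![-1, -1, -1])
      a c (by decide) (by decide) (by decide) (by funext i; fin_cases i <;> simp <;> ring)
  · exact mem_closure_of_triangle (u₀ := ![1, -1, 1]) (u₁ := ![-1, 1, 1]) (u₂ := ![-1, -1, 1]) a b
      (by decide) (by decide) (by decide) (by funext i; fin_cases i <;> simp <;> ring)
  · exact mem_closure_of_triangle (u₀ := ![1, -1, -1]) (u₁ := ![-1, 1, -1]) (u₂ := ![-1, -1, -1])
      a b (by decide) (by decide) (by decide) (by funext i; fin_cases i <;> simp <;> ring)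

theorem tetra_hasFlatSlabs : tetra.HasFlatSlabs := by
  intro ν hν l hl h
  have he := even_of_mem_lattice (D := tetra) (by decide) hl
  obtain ⟨a, ha⟩ := he 0
  obtain ⟨b, hb⟩ := he 1
  obtain ⟨c, hc⟩ := he 2
  obtain rfl : l = ![2 * a, 2 * b, 2 * c] := by
    funext i; fin_cases i <;> simp [ha, hb, hc]
  simp only [tetra, List.mem_cons, List.not_mem_nil, or_false] at hν
  rcases hν with rfl | rfl | rfl | rfl <;> simp [idot] at h
  · exact mem_closure_of_triangle (u₀ := ![1, -1, -1]) (u₁ := ![-1, 1, -1]) (u₂ := ![-1, -1, 1]) a b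
      (by decide) (by decide) (by decide) (by funext i; fin_cases i <;> simp <;> lia)
  · exact mem_closure_of_triangle (u₀ := ![1, 1, 1]) (u₁ := ![-1, 1, -1]) (u₂ := ![-1, -1, 1]) a
      (-c) (by decide) (by decide) (by decide) (by funext i; fin_cases i <;> simp <;> lia)
  · exact mem_closure_of_triangle (u₀ := ![1, 1, 1]) (u₁ := ![1, -1, -1]) (u₂ := ![-1, -1, 1]) b
      (-c) (by decide) (by decide) (by decide) (by funext i; fin_cases i <;> simp <;> lia)
  · exact mem_closure_of_triangle (u₀ := ![1, 1, 1]) (u₁ := ![1, -1, -1]) (u₂ := ![-1, 1, -1]) c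
      (-b) (by decide) (by decide) (by decide) (by funext i; fin_cases i <;> simp <;> lia)

end IntPolyhedron

/-- The isometry obtained by conjugation with a similarity. -/
def DilationEquiv.conjIsometry (f : E3 ≃ᵈ E3) (g : E3 ≃ᵢ E3) : E3 ≃ᵢ E3 where
  toEquiv := f.toEquiv.symm.trans (g.toEquiv.trans f.toEquiv)
  isometry_toFun := by
    intro x y
    obtain ⟨x, rfl⟩ := f.surjective x
    obtain ⟨y, rfl⟩ := f.surjective y
    change edist (f (g (f.symm (f x)))) (f (g (f.symm (f y)))) = _
    rw [f.symm_apply_apply, f.symm_apply_apply, Dilation.edist_eq f, g.edist_eq, Dilation.edist_eq f]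

theorem DilationEquiv.conjIsometry_apply (f : E3 ≃ᵈ E3) (g : E3 ≃ᵢ E3) (x : E3) :
    f.conjIsometry g (f x) = f (g x) := by
  change f (g (f.symm (f x))) = _
  rw [f.symm_apply_apply]

/-- The similarity `x ↦ v + κ J x`. -/
def similarity (v : E3) {κ : ℝ} (hκ : κ ≠ 0) (J : E3 ≃ₗᵢ[ℝ] E3) : E3 ≃ᵈ E3 :=
  J.toIsometryEquiv.toDilationEquiv.trans (DilationEquiv.smulTorsor v hκ)

theorem similarity_apply (v : E3) {κ : ℝ} (hκ : κ ≠ 0) (J : E3 ≃ₗᵢ[ℝ] E3) (x : E3) :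
    similarity v hκ J x = v + κ • J x := add_comm _ _

theorem similarity_intPoint (v : E3) {κ : ℝ} (hκ : κ ≠ 0) (J : E3 ≃ₗᵢ[ℝ] E3) (n : Z3) :
    similarity v hκ J (intPoint n) = Complex2.latticePoint v κ J n := similarity_apply v hκ J _

/-- Edges and faces are defined by distances between vertices, so an isometry need only preserve the
vertex set. -/
theorem polyhedronOf_map (k : ℕ) {V : Set E3} (d : ℝ) (g : E3 ≃ᵢ E3) (hg : g '' V = V) :
    (polyhedronOf k V d).map g = polyhedronOf k V d := by
  have hV : ∀ x, g x ∈ V ↔ x ∈ V := fun x => by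
    conv_lhs => rw [← hg]
    exact g.injective.mem_set_image
  have hV' : ∀ x, g.symm x ∈ V ↔ x ∈ V := fun x => by rw [← hV, g.apply_symm_apply]
  ext x
  · exact Set.ext_iff.1 hg x
  · constructor
    · rintro ⟨_, ⟨a, ha, b, hb, hd, rfl⟩, rfl⟩
      exact ⟨g a, (hV a).2 ha, g b, (hV b).2 hb, by rw [g.dist_eq, hd], rfl⟩
    · rintro ⟨a, ha, b, hb, hd, rfl⟩
      refine ⟨s(g.symm a, g.symm b), ⟨_, (hV' a).2 ha, _, (hV' b).2 hb, by rw [g.symm.dist_eq, hd],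
        rfl⟩, by simp⟩
  · constructor
    · rintro ⟨_, ⟨u, hu, huV, hd, rfl⟩, rfl⟩
      exact ⟨g ∘ u, g.injective.comp hu, fun i => (hV _).2 (huV i), fun i => by
        simp only [Function.comp, g.dist_eq, hd], Figure.map_ofSeq _ _⟩
    · rintro ⟨u, hu, huV, hd, rfl⟩
      refine ⟨Figure.ofSeq (g.symm ∘ u), ⟨_, g.symm.injective.comp hu, fun i => (hV' _).2 (huV i),
        fun i => by simp only [Function.comp, g.symm.dist_eq, hd], rfl⟩, ?_⟩
      rw [Figure.map_ofSeq]
      congr 1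
      funext i
      simp

namespace IntPolyhedron

variable {D : IntPolyhedron}

/-- `u` runs through the vertices of the base face of `D`, and `k`, `d` are the number of edges of
a face and their length. -/
structure IsBaseCycle (D : IntPolyhedron) (k : ℕ) (d : ℝ) (u : ZMod k → Z3) : Prop where
  mem : ∀ i, u i ∈ D.nodes
  injective : Function.Injective u
  dist_eq : ∀ i, dist (intPoint (u i)) (intPoint (u (i + 1))) = d
  zero : u 0 = D.node₀
  one : u 1 = D.node₁
  gen₁ : ∀ i, D.gen₁.act (u i) = u (1 - i)
  gen₂ : ∀ i, D.gen₂.act (u i) = u (0 - i)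
  gen₃ : ∃ i, ∀ j, D.gen₃.act (u i) ≠ u j

/-- The nodes sum to zero, and a similarity is affine, so the centroid is the image of the origin.
-/
theorem centroid_map {Q : Complex2} (hD : D.IsRegular) (hV : Q.verts = intPoint '' {w | w ∈ D.nodes})
    (v : E3) {κ : ℝ} (hκ : κ ≠ 0) (J : E3 ≃ₗᵢ[ℝ] E3) :
    (Q.map (similarity v hκ J)).centroid = v := by
  classical
  have hinj : Function.Injective fun w => similarity v hκ J (intPoint w) :=
    (similarity v hκ J).injective.comp intPoint_injective
  have hverts : (Q.map (similarity v hκ J)).verts =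
      ((D.nodes.toFinset.image fun w => similarity v hκ J (intPoint w) : Finset E3) : Set E3) := by
    ext x
    simp [Complex2.map, hV]
  have hne : (D.nodes.toFinset.card : ℝ) ≠ 0 := by
    rw [Nat.cast_ne_zero, Finset.card_ne_zero]
    exact ⟨_, List.mem_toFinset.2 hD.base_adj.1⟩
  rw [Complex2.centroid, hverts, Set.ncard_coe_finset, finsum_mem_coe_finset,
    Finset.card_image_of_injective _ hinj, Finset.sum_image hinj.injOn]
  have hsum : ∑ w ∈ D.nodes.toFinset, intPoint w = 0 := by
    rw [List.sum_toFinset _ hD.nodup]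
    have := congrArg intPoint hD.sum_eq
    rw [intPoint_zero] at this
    rw [← this]
    let φ : Z3 →+ E3 := AddMonoidHom.mk' intPoint intPoint_add
    exact (map_list_sum φ D.nodes).symm
  simp only [similarity_apply]
  rw [Finset.sum_add_distrib, ← Finset.smul_sum, ← map_sum, hsum]
  simp only [map_zero, smul_zero, add_zero, Finset.sum_const]
  rw [← Nat.cast_smul_eq_nsmul ℝ, smul_smul, inv_mul_cancel₀ hne, one_smul]

theorem image_nodes (hD : D.IsRegular) (i : Fin 3) :
    (D.gen i).toLinearIsometryEquiv.toIsometryEquiv '' (intPoint '' {w | w ∈ D.nodes}) =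
      intPoint '' {w | w ∈ D.nodes} := by
  have e : ∀ w, (D.gen i).toLinearIsometryEquiv.toIsometryEquiv (intPoint w) =
      intPoint ((D.gen i).act w) := SignedPerm.toLinearIsometryEquiv_intPoint _
  ext x
  constructor
  · rintro ⟨_, ⟨w, hw, rfl⟩, rfl⟩
    exact ⟨_, hD.gen_nodes i w hw, (e w).symm⟩
  · rintro ⟨w, hw, rfl⟩
    refine ⟨_, ⟨_, hD.gen_nodes i w hw, rfl⟩, ?_⟩
    rw [e]
    exact congrArg _ (gen_gen hD i w)

/-- The apeirotope over `D` is the apeirotope of the corresponding polyhedron. -/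
theorem isApeirOfSimilar (hD : D.IsRegular) (hflat : D.HasFlatSlabs) {k : ℕ} {d : ℝ}
    {u : ZMod k → Z3} (hu : D.IsBaseCycle k d u) (v : E3) {κ : ℝ} (hκ : κ ≠ 0)
    (J : E3 ≃ₗᵢ[ℝ] E3) : ∃ R₀ R₁ R₂ R₃,
      D.IsGenerating (Complex2.latticePoint v κ J) R₀ R₁ R₂ R₃ ∧
      (D.apeirotope (Complex2.latticePoint v κ J)).IsApeirOfSimilar
        (polyhedronOf k (intPoint '' {w | w ∈ D.nodes}) d) := by
  set V := intPoint '' {w | w ∈ D.nodes} with hV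
  set f := similarity v hκ J with hf
  set Q := polyhedronOf k V d with hQ
  have hfp : ∀ n, f (intPoint n) = Complex2.latticePoint v κ J n := similarity_intPoint v hκ J
  have finj : Function.Injective fun n => f (intPoint n) := f.injective.comp intPoint_injective
  let M : Fin 3 → (E3 ≃ᵢ E3) := fun i => (D.gen i).toLinearIsometryEquiv.toIsometryEquiv
  have hM : ∀ i n, M i (intPoint n) = intPoint ((D.gen i).act n) := fun i =>
    SignedPerm.toLinearIsometryEquiv_intPoint _
  have hRf : ∀ i n, f.conjIsometry (M i) (f (intPoint n)) = f (intPoint ((D.gen i).act n)) :=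
    fun i n => by rw [f.conjIsometry_apply, hM]
  have hcent : (Q.map f).centroid = v := centroid_map hD rfl v hκ J
  set R₀ := (AffineIsometryEquiv.pointReflection ℝ
    (midpoint ℝ (Q.map f).centroid (f (intPoint D.node₀)))).toIsometryEquiv with hR₀
  have hgen : D.IsGenerating (Complex2.latticePoint v κ J) R₀ (f.conjIsometry (M 0))
      (f.conjIsometry (M 1)) (f.conjIsometry (M 2)) := by
    refine ⟨fun m => ?_, fun m => ?_, fun m => ?_, fun m => ?_⟩
    -- As the centroid is `v`, the midpoint reflection is `m ↦ node₀ - m` in integral coordinates.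
    · rw [hR₀, hcent, hfp]
      change Equiv.pointReflection _ _ = _
      rw [Equiv.pointReflection_apply, midpoint_eq_smul_add, Complex2.latticePoint,
        Complex2.latticePoint, Complex2.latticePoint, scaledPoint_sub, vsub_eq_sub, vadd_eq_add,
        invOf_eq_inv]
      module
    · rw [← hfp, ← hfp, hRf]; rfl
    · rw [← hfp, ← hfp, hRf]; rfl
    · rw [← hfp, ← hfp, hRf]; rfl
  have hsymm : ∀ i, f.conjIsometry (M i) ∈ (Q.map f).symmetryGroup := by
    intro i
    change (Q.map f).map _ = _
    have hMQ : Q.map (M i) = Q := polyhedronOf_map k d (M i) (image_nodes hD i)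
    conv_rhs => rw [← hMQ]
    rw [Complex2.map_map, Complex2.map_map]
    congr 1
    funext x
    exact f.conjIsometry_apply _ x
  have hface : ∀ i, (((Figure.ofSeq fun j => intPoint (u j)).map f).map (f.conjIsometry (M i))) =
      Figure.ofSeq fun j => f (intPoint ((D.gen i).act (u j))) := by
    intro i
    rw [Figure.map_map, Figure.map_ofSeq]
    congr 1
    funext j
    exact hRf i (u j)
  have hface' : (Figure.ofSeq fun j => intPoint (u j)).map f =
      Figure.ofSeq fun j => f (intPoint (u j)) := Figure.map_ofSeq _ _
  have a0 : ∀ n, f.conjIsometry (M 0) (f (intPoint n)) = f (intPoint (D.gen₁.act n)) := hRf 0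
  have a1 : ∀ n, f.conjIsometry (M 1) (f (intPoint n)) = f (intPoint (D.gen₂.act n)) := hRf 1
  have a2 : ∀ n, f.conjIsometry (M 2) (f (intPoint n)) = f (intPoint (D.gen₃.act n)) := hRf 2
  refine ⟨R₀, _, _, _, hgen, f, f (intPoint D.node₀),
    s(f (intPoint D.node₀), f (intPoint D.node₁)), (Figure.ofSeq fun j => intPoint (u j)).map f,
    f.conjIsometry (M 0), f.conjIsometry (M 1), f.conjIsometry (M 2), ?_, hsymm 0, hsymm 1, hsymm 2,
    ⟨?_, ?_, ?_⟩, ⟨?_, ?_, ?_⟩, ⟨?_, ?_, ?_⟩, ?_⟩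
  · refine ⟨⟨_, ⟨_, hD.base_adj.1, rfl⟩, rfl⟩, ?_, ?_, by simp, ?_, ?_⟩
    · refine ⟨s(intPoint D.node₀, intPoint D.node₁), ⟨_, ⟨_, hD.base_adj.1, rfl⟩, _,
        ⟨_, hD.base_adj.2.1, rfl⟩, ?_, rfl⟩, rfl⟩
      have := hu.dist_eq 0
      rwa [zero_add, hu.zero, hu.one] at this
    · exact ⟨_, ⟨_, intPoint_injective.comp hu.injective, fun i => ⟨_, hu.mem i, rfl⟩, hu.dist_eq,
        rfl⟩, rfl⟩
    · rw [hface']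
      exact ⟨0, by simp only [hu.zero]⟩
    · rw [hface']
      exact ⟨0, by simp only [hu.zero, zero_add, hu.one]⟩
  · rw [a0, hD.gen₁_node₀]
    exact fun h => hD.base_adj.ne hD (finj h).symm
  · rw [Sym2.map_mk, a0, a0, hD.gen₁_node₀, hD.gen₁_node₁, Sym2.eq_swap]
  · rw [hface, hface']
    conv_rhs => rw [← Figure.ofSeq_comp_reflect _ 1]
    congr 1
    funext j
    exact congrArg (fun n => f (intPoint n)) (hu.gen₁ j)
  · rw [a1, hD.gen₂_node₀]
  · rw [Sym2.map_mk, a1, a1, hD.gen₂_node₀]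
    exact fun h => hD.gen₂_node₁ (finj (Sym2.congr_right.1 h))
  · rw [hface, hface']
    conv_rhs => rw [← Figure.ofSeq_comp_reflect _ 0]
    congr 1
    funext j
    exact congrArg (fun n => f (intPoint n)) (hu.gen₂ j)
  · rw [a2, hD.gen₃_node₀]
  · rw [Sym2.map_mk, a2, a2, hD.gen₃_node₀, hD.gen₃_node₁]
  · rw [hface, hface']
    intro h
    obtain ⟨i, hi⟩ := hu.gen₃
    have h1 := congrArg Figure.verts h
    have h2 : f (intPoint (D.gen₃.act (u i))) ∈
        (Figure.ofSeq fun j => f (intPoint (u j))).verts := by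
      rw [← h1]; exact ⟨i, rfl⟩
    obtain ⟨j, hj⟩ := h2
    exact hi j (finj hj).symm
  · have hp := Complex2.latticePoint_injective (v := v) (J := J) hκ
    rw [hgen.apeirotope_eq_wythoff hD hflat hp, hcent, hR₀, hcent,
      show Complex2.latticePoint v κ J 0 = v by
        simp [Complex2.latticePoint, scaledPoint, intPoint_zero]]

end IntPolyhedron

end


/-! ### The models as the regular octahedron, tetrahedron and cube. -/

noncomputable section

theorem dist_intPoint (a b : Z3) :
    dist (intPoint a) (intPoint b) = √(idot (a - b) (a - b) : ℝ) := by
  rw [dist_eq_norm, ← intPoint_sub, ← inner_intPoint, real_inner_self_eq_norm_sq,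
    Real.sqrt_sq (norm_nonneg _)]

namespace IntPolyhedron

theorem octahedron_eq : octahedron = polyhedronOf 3 (intPoint '' {w | w ∈ octa.nodes}) (√2) := by
  rw [octahedron]
  congr 1
  ext x
  constructor
  · have h : ∀ i, (Pi.single i 1 : Z3) ∈ octa.nodes ∧ (Pi.single i (-1) : Z3) ∈ octa.nodes := by
      decide
    rintro ⟨i, rfl | rfl⟩
    · exact ⟨_, (h i).1, rfl⟩
    · exact ⟨_, (h i).2, rfl⟩
  · have h : ∀ w ∈ octa.nodes, ∃ i, w = Pi.single i 1 ∨ w = Pi.single i (-1) := by decide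
    rintro ⟨w, hw, rfl⟩
    obtain ⟨i, rfl | rfl⟩ := h w hw
    · exact ⟨i, Or.inl rfl⟩
    · exact ⟨i, Or.inr rfl⟩

def octaCycle : ZMod 3 → Z3 := ![![1, 0, 0], ![0, 1, 0], ![0, 0, 1]]

def tetraCycle : ZMod 3 → Z3 := ![![1, 1, 1], ![1, -1, -1], ![-1, 1, -1]]

def hexaCycle : ZMod 4 → Z3 := ![![1, 1, 1], ![-1, 1, 1], ![-1, -1, 1], ![1, -1, 1]]

theorem octaCycle_isBaseCycle : octa.IsBaseCycle 3 (√2) octaCycle where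
  mem := by decide
  injective := by decide
  dist_eq i := by
    have : ∀ i, idot (octaCycle i - octaCycle (i + 1)) (octaCycle i - octaCycle (i + 1)) = 2 := by
      decide
    rw [dist_intPoint, this]; simp
  zero := rfl
  one := rfl
  gen₁ := by decide
  gen₂ := by decide
  gen₃ := by decide

theorem tetraCycle_isBaseCycle : tetra.IsBaseCycle 3 (2 * √2) tetraCycle where
  mem := by decide
  injective := by decide
  dist_eq i := by
    have : ∀ i, idot (tetraCycle i - tetraCycle (i + 1)) (tetraCycle i - tetraCycle (i + 1)) = 8 := by
      decide
    rw [dist_intPoint, this, Real.sqrt_eq_iff_mul_self_eq_of_pos (by positivity)]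
    have := Real.mul_self_sqrt (show (0 : ℝ) ≤ 2 by norm_num)
    push_cast
    linear_combination 4 * this
  zero := rfl
  one := rfl
  gen₁ := by decide
  gen₂ := by decide
  gen₃ := by decide

theorem hexaCycle_isBaseCycle : hexa.IsBaseCycle 4 2 hexaCycle where
  mem := by decide
  injective := by decide
  dist_eq i := by
    have : ∀ i, idot (hexaCycle i - hexaCycle (i + 1)) (hexaCycle i - hexaCycle (i + 1)) = 4 := by
      decide
    rw [dist_intPoint, this, Real.sqrt_eq_iff_mul_self_eq_of_pos (by norm_num)]
    norm_num
  zero := rfl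
  one := rfl
  gen₁ := by decide
  gen₂ := by decide
  gen₃ := by decide

theorem tetrahedron_eq :
    tetrahedron = polyhedronOf 3 (intPoint '' {w | w ∈ tetra.nodes}) (2 * √2) := by
  rw [tetrahedron]
  congr 1
  ext x
  simp only [tetra, List.mem_cons, List.not_mem_nil, or_false, Set.mem_ofPred_eq, Set.mem_image,
    Set.mem_insert_iff, Set.mem_singleton_iff]
  constructor
  · rintro (rfl | rfl | rfl | rfl) <;> simp
  · rintro ⟨w, rfl | rfl | rfl | rfl, rfl⟩ <;> simp

theorem cube_eq : cube = polyhedronOf 4 (intPoint '' {w | w ∈ hexa.nodes}) 2 := by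
  rw [cube]
  congr 1
  ext x
  simp only [Set.mem_ofPred_eq, Set.mem_image]
  refine exists_congr fun c => ?_
  rw [eq_comm (a := x)]
  refine and_congr_left fun _ => ?_
  constructor
  · intro h
    have hc : c = ![c 0, c 1, c 2] := by funext i; fin_cases i <;> rfl
    rw [hc]
    rcases h 0 with h0 | h0 <;> rcases h 1 with h1 | h1 <;> rcases h 2 with h2 | h2 <;>
      rw [h0, h1, h2] <;> decide
  · have : ∀ w ∈ hexa.nodes, ∀ i, w i = 1 ∨ w i = -1 := by decide
    exact this c

end IntPolyhedron
end


/-! ### The cubical complex in integral coordinates. -/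

noncomputable section

namespace IntPolyhedron

variable {p : Z3 → E3}

theorem mem_octa_normals {ν : Z3} (h : ∀ i, ν i = 1 ∨ ν i = -1) : ν ∈ octa.normals := by
  have hν : ν = ![ν 0, ν 1, ν 2] := by funext i; fin_cases i <;> rfl
  rw [hν]
  rcases h 0 with h0 | h0 <;> rcases h 1 with h1 | h1 <;> rcases h 2 with h2 | h2 <;>
    rw [h0, h1, h2] <;> decide

theorem octa_normals_apply : ∀ ν ∈ octa.normals, ∀ i, ν i = 1 ∨ ν i = -1 := by decide

theorem octa_nodes_eq_single : ∀ w ∈ octa.nodes, ∃ i, w = Pi.single i 1 ∨ w = Pi.single i (-1) := by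
  decide

theorem single_mem_octa_nodes : ∀ i, (Pi.single i 1 : Z3) ∈ octa.nodes ∧
    (Pi.single i (-1) : Z3) ∈ octa.nodes := by
  decide

theorem octa_adj_neg : ∀ w ∈ octa.nodes, ∀ w' ∈ octa.nodes, octa.Adj w w' → octa.Adj (-w) w' := by
  decide

/-- Induction along the edges of the cubical lattice. -/
theorem lattice_induction {φ : Z3 → Prop} (h0 : φ 0)
    (hstep : ∀ n, φ n → ∀ w ∈ octa.nodes, φ (n + w)) (n : Z3) : φ n := by
  have line : ∀ (i : Fin 3) (k : ℤ) (n : Z3), φ n → φ (n + Pi.single i k) := by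
    intro i k n hn
    induction k with
    | zero => simpa using hn
    | succ k ih =>
      have := hstep _ ih _ (single_mem_octa_nodes i).1
      rwa [add_assoc, ← Pi.single_add] at this
    | pred k ih =>
      have := hstep _ ih _ (single_mem_octa_nodes i).2
      rwa [add_assoc, ← Pi.single_add, ← sub_eq_add_neg] at this
  have := line 2 (n 2) _ (line 1 (n 1) _ (line 0 (n 0) 0 h0))
  convert this using 1
  funext i
  fin_cases i <;> simp

/-- The corners of a lattice square. -/
def squareSeq (n w w' : Z3) : ZMod 4 → Z3 := ![n, n + w, n + w + w', n + w']

theorem squareSeq_neg (n w w' : Z3) (i : ZMod 4) :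
    squareSeq n w w' (0 - i) = squareSeq n w' w i := by
  fin_cases i
  · rfl
  · rfl
  · exact add_right_comm _ _ _
  · rfl

theorem squareSeq_one_sub (n w w' : Z3) (i : ZMod 4) :
    squareSeq n w w' (1 - i) = squareSeq (n + w) (-w) w' i := by
  fin_cases i
  · rfl
  · exact (add_neg_cancel_right _ _).symm
  · change n + w' = n + w + -w + w'
    rw [add_neg_cancel_right]
  · rfl

theorem squareSeq_injective {w w' : Z3} (hA : octa.Adj w w') (n : Z3) :
    Function.Injective (squareSeq n w w') := by
  have key : ∀ w ∈ octa.nodes, ∀ w' ∈ octa.nodes, octa.Adj w w' →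
      Function.Injective (squareSeq 0 w w') := by decide
  have e : ∀ i, squareSeq n w w' i = n + squareSeq 0 w w' i := by
    intro i
    fin_cases i <;> simp [squareSeq, add_assoc]
  intro i j h
  rw [e, e] at h
  exact key w hA.1 w' hA.2.1 hA (add_left_cancel h)

def square (p : Z3 → E3) (n w w' : Z3) : Figure :=
  Figure.ofSeq (ι := ZMod 4) fun i => p (squareSeq n w w' i)

theorem square_comm (p : Z3 → E3) (n w w' : Z3) : square p n w w' = square p n w' w := by
  rw [square, ← Figure.ofSeq_comp_reflect _ 0, square]
  simp only [squareSeq_neg]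

theorem square_neg (p : Z3 → E3) (n w w' : Z3) : square p n w w' = square p (n + w) (-w) w' := by
  rw [square, ← Figure.ofSeq_comp_reflect _ 1, square]
  simp only [squareSeq_one_sub]

theorem square_isParam (hp : Function.Injective p) {w w' : Z3} (hA : octa.Adj w w') (n : Z3) :
    (square p n w w').IsParam fun i : ℤ => p (squareSeq n w w' (i : ZMod 4)) :=
  Figure.isParam_of_injective (fun i : ℤ => (i : ZMod 4)) ZMod.intCast_surjective
    (fun i => by push_cast; rfl) (by decide) (hp.comp (squareSeq_injective hA n))

theorem mem_edges_square (hp : Function.Injective p) {w w' : Z3} (hA : octa.Adj w w') (n : Z3)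
    (y : E3) : s(p n, y) ∈ (square p n w w').edges ↔ y = p (n + w) ∨ y = p (n + w') := by
  have := (square_isParam hp hA n).nbr 0 y
  rw [or_comm]
  exact this

theorem square_isFinitePolygon (hp : Function.Injective p) {w w' : Z3} (hA : octa.Adj w w')
    (n : Z3) : (square p n w w').IsFinitePolygon :=
  ⟨4, by norm_num, _, hp.comp (squareSeq_injective hA n), rfl⟩

def squareFaces (p : Z3 → E3) : Set Figure := {F | ∃ n w w', octa.Adj w w' ∧ F = square p n w w'}

/-- Passing to another corner of the square reverses the edge vectors along which the corner has
moved. -/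
theorem square_at {n w w' : Z3} (hA : octa.Adj w w') (i : ZMod 4) :
    ∃ u u', octa.Adj u u' ∧ square p n w w' = square p (squareSeq n w w' i) u u' := by
  have h1 := octa_adj_neg w hA.1 w' hA.2.1 hA
  have h2 := (octa_adj_neg w' hA.2.1 w hA.1 hA.symm).symm
  have h3 := (octa_adj_neg w' h1.2.1 (-w) h1.1 h1.symm).symm
  fin_cases i
  · exact ⟨w, w', hA, rfl⟩
  · exact ⟨-w, w', h1, square_neg p n w w'⟩
  · refine ⟨-w', -w, h3.symm, ?_⟩
    rw [square_neg, square_comm, square_neg]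
    rfl
  · refine ⟨-w', w, h2.symm, ?_⟩
    rw [square_comm, square_neg]
    rfl

theorem exists_corner {F : Figure} (hF : F ∈ squareFaces p) {x : E3} (hx : x ∈ F.verts) :
    ∃ n w w', x = p n ∧ octa.Adj w w' ∧ F = square p n w w' := by
  obtain ⟨m, w, w', hA, rfl⟩ := hF
  obtain ⟨i, rfl⟩ := hx
  obtain ⟨u, u', hA', e⟩ := square_at (p := p) (n := m) hA i
  exact ⟨_, u, u', rfl, hA', e⟩

theorem left_mem_verts_of_ofSeq {ι : Type} [Add ι] [One ι] {q : ι → E3} {x y : E3}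
    (h : s(x, y) ∈ (Figure.ofSeq q).edges) : x ∈ (Figure.ofSeq q).verts := by
  obtain ⟨i, hi⟩ := h
  simp only [Sym2.eq_iff] at hi
  rcases hi with ⟨h1, -⟩ | ⟨-, h1⟩
  · exact ⟨_, h1⟩
  · exact ⟨_, h1⟩

theorem squareFaces_at (hp : Function.Injective p) {F : Figure} (hF : F ∈ squareFaces p) {n : Z3}
    {y : E3} (hy : s(p n, y) ∈ F.edges) :
    ∃ w w', octa.Adj w w' ∧ F = square p n w w' := by
  have hv : p n ∈ F.verts := by
    obtain ⟨m, w, w', hA, rfl⟩ := hF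
    exact left_mem_verts_of_ofSeq hy
  obtain ⟨m, w, w', e, hA, rfl⟩ := exists_corner hF hv
  obtain rfl := hp e
  exact ⟨w, w', hA, rfl⟩

/-- The corners of the unit cube at `n` in the octant of `ν`. -/
def InBox (n ν m : Z3) : Prop := ∀ i, m i = n i ∨ m i = n i + ν i

def cubeFaces (p : Z3 → E3) (n ν : Z3) : Set Figure :=
  {F | F ∈ squareFaces p ∧ ∀ m, p m ∈ F.verts → InBox n ν m}

/-- The cubical tessellation in the coordinates `p`. -/
def cubeComplex (p : Z3 → E3) : Complex3 where
  verts := Set.range p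
  edges := {e | ∃ n, ∃ w ∈ octa.nodes, e = s(p n, p (n + w))}
  faces := squareFaces p
  facets := {C | ∃ n, ∃ ν ∈ octa.normals, C = cubeFaces p n ν}

/-- A cube can be described from any of its corners. -/
theorem exists_cubeFaces_eq {n ν m : Z3} (hν : ν ∈ octa.normals) (hm : InBox n ν m) :
    ∃ ν' ∈ octa.normals, (∀ x, InBox n ν x ↔ InBox m ν' x) ∧
      ∀ p, cubeFaces p n ν = cubeFaces p m ν' := by
  have h1 := octa_normals_apply ν hν
  have key : ∀ x, InBox n ν x ↔ InBox m (fun i => if m i = n i then ν i else -ν i) x := by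
    intro x
    refine forall_congr' fun i => ?_
    have := hm i
    dsimp only
    split_ifs with h
    · rw [h]
    · omega
  refine ⟨_, mem_octa_normals fun i => ?_, key, fun p => ?_⟩
  · have := h1 i
    split_ifs <;> omega
  · ext F
    refine and_congr_right fun _ => forall_congr' fun x => ?_
    rw [key]

/-- The corners of the cube are `n` plus vectors with coordinates `0` or `ν i`. A node is such a
vector exactly if its inner product with `ν` is `1`. -/
theorem square_mem_cubeFaces (hp : Function.Injective p) {n w w' ν : Z3} (hA : octa.Adj w w')
    (hν : ν ∈ octa.normals) :
    square p n w w' ∈ cubeFaces p n ν ↔ idot w ν = 1 ∧ idot w' ν = 1 := by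
  have key : ∀ ν ∈ octa.normals, ∀ w ∈ octa.nodes, ((∀ i, w i = 0 ∨ w i = ν i) ↔ idot w ν = 1) := by
    decide
  have key2 : ∀ ν ∈ octa.normals, ∀ w ∈ octa.nodes, ∀ w' ∈ octa.nodes, octa.Adj w w' →
      idot w ν = 1 → idot w' ν = 1 → ∀ i, (w + w') i = 0 ∨ (w + w') i = ν i := by
    decide
  have box : ∀ x, InBox n ν (n + x) ↔ ∀ i, x i = 0 ∨ x i = ν i := by
    intro x
    refine forall_congr' fun i => ?_
    rw [Pi.add_apply]
    omega
  constructor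
  · rintro ⟨-, h⟩
    have h1 := h (n + w) ⟨1, rfl⟩
    have h2 := h (n + w') ⟨3, rfl⟩
    rw [box, key ν hν _ (by first | exact hA.1 | exact hA.2.1)] at h1 h2
    exact ⟨h1, h2⟩
  · rintro ⟨h1, h2⟩
    refine ⟨⟨n, w, w', hA, rfl⟩, ?_⟩
    rintro m ⟨i, hi⟩
    rw [← hp hi]
    fin_cases i
    · exact fun _ => Or.inl rfl
    · exact (box w).2 ((key ν hν w hA.1).2 h1)
    · change InBox n ν (n + w + w')
      rw [add_assoc, box]
      exact key2 ν hν w hA.1 w' hA.2.1 hA h1 h2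
    · exact (box w').2 ((key ν hν w' hA.2.1).2 h2)

/-- The cubes at a vertex fill the eight octants, which correspond to the faces of the octahedron.
-/
theorem isStar_cubeComplex (hp : Function.Injective p) (n : Z3) :
    (cubeComplex p).IsStar octa (p n) (fun w => p (n + w)) (fun w w' => square p n w w')
      (fun ν => cubeFaces p n ν) where
  edge_iff y := by
    constructor
    · rintro ⟨m, w, hw, he⟩
      rw [Sym2.eq_iff] at he
      rcases he with ⟨h1, h2⟩ | ⟨h1, h2⟩
      · obtain rfl := hp h1
        exact ⟨w, hw, h2⟩
      · obtain rfl := hp h1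
        have hneg : ∀ w ∈ octa.nodes, -w ∈ octa.nodes := by decide
        exact ⟨-w, hneg w hw, by rw [h2, add_neg_cancel_right]⟩
    · rintro ⟨w, hw, rfl⟩
      exact ⟨n, w, hw, rfl⟩
  nb_inj w _ w' _ h := add_left_cancel (hp h)
  fc_mem w w' hA := ⟨n, w, w', hA, rfl⟩
  fc_edges w w' hA y := mem_edges_square hp hA n y
  fc_comm w w' _ := square_comm _ _ _ _
  face_eq F hF y hy := squareFaces_at hp hF hy
  ct_mem ν hν := ⟨n, ν, hν, rfl⟩
  facet_eq C hC F hF y hy := by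
    obtain ⟨m, ν, hν, rfl⟩ := hC
    obtain ⟨w, w', hA, rfl⟩ := squareFaces_at hp hF.1 hy
    obtain ⟨ν', hν', -, e⟩ := exists_cubeFaces_eq hν (hF.2 n ⟨0, rfl⟩)
    exact ⟨ν', hν', e p⟩
  fc_mem_ct w w' hA ν hν := square_mem_cubeFaces hp hA hν

/-- Seen from the corner `m`, a corner that may differ from it only in coordinate `i` is either `m`
itself or the other end of an edge of the cube. -/
theorem cube_step (hp : Function.Injective p) {n ν m m' : Z3} (hν : ν ∈ octa.normals)
    (hm : InBox n ν m) (hm' : InBox n ν m') {i : Fin 3} (h : ∀ j, j ≠ i → m j = m' j) :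
    Relation.ReflTransGen (fun a b => ∃ F ∈ cubeFaces p n ν, s(a, b) ∈ F.edges) (p m) (p m') := by
  obtain ⟨μ, hμ, hbox, e⟩ := exists_cubeFaces_eq hν hm
  rw [hbox] at hm'
  rw [e p]
  have hμi := octa_normals_apply μ hμ i
  rcases hm' i with hi | hi
  · obtain rfl : m = m' := by
      funext j
      by_cases hj : j = i
      · rw [hj, hi]
      · exact h j hj
    exact .refl
  · have hw : ∀ μ ∈ octa.normals, ∀ i, (Pi.single i (μ i) : Z3) ∈ octa.nodes ∧
        idot (Pi.single i (μ i)) μ = 1 := by decide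
    obtain ⟨hw1, hw2⟩ := hw μ hμ i
    obtain ⟨w', hA, hw'⟩ := exists_adj_on_normal octa_isRegular hw1 hμ hw2
    refine .single ⟨_, (square_mem_cubeFaces hp hA hμ).2 ⟨hw2, hw'⟩, ?_⟩
    rw [mem_edges_square hp hA]
    left
    congr 1
    funext j
    by_cases hj : j = i
    · subst hj; simp [hi]
    · simp [hj, h j hj]

theorem cubeComplex_isLocallyPolyhedral (hp : Function.Injective p) :
    (cubeComplex p).IsLocallyPolyhedral octa where
  edge_nondegenerate := by
    rintro _ ⟨n, w, hw, rfl⟩ h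
    have h1 := hp (Sym2.mk_isDiag_iff.1 h)
    rw [left_eq_add] at h1
    have h0 : (0 : Z3) ∉ octa.nodes := by decide
    exact h0 (h1 ▸ hw)
  edge_verts := by
    rintro _ ⟨n, w, hw, rfl⟩ v hv
    rcases Sym2.mem_iff.1 hv with rfl | rfl <;> exact ⟨_, rfl⟩
  face_edges := by
    rintro F hF e he
    induction e using Sym2.ind with | _ x y
    have hv : x ∈ F.verts := by
      obtain ⟨m, w, w', hA, rfl⟩ := hF
      exact left_mem_verts_of_ofSeq he
    obtain ⟨n, w, w', rfl, hA, rfl⟩ := exists_corner hF hv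
    rw [mem_edges_square hp hA] at he
    rcases he with rfl | rfl
    · exact ⟨n, w, hA.1, rfl⟩
    · exact ⟨n, w', hA.2.1, rfl⟩
  facet_faces := by
    rintro _ ⟨n, ν, hν, rfl⟩ F hF
    exact hF.1
  facet_nonempty := by
    rintro _ ⟨n, ν, hν, rfl⟩
    obtain ⟨w, hw, hwν⟩ := octa_isRegular.exists_node ν hν
    obtain ⟨w', hA, hw'⟩ := exists_adj_on_normal octa_isRegular hw hν hwν
    exact ⟨_, (square_mem_cubeFaces hp hA hν).2 ⟨hwν, hw'⟩⟩
  face_param := by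
    rintro _ ⟨n, w, w', hA, rfl⟩
    exact ⟨_, square_isParam hp hA n⟩
  star := by
    rintro _ ⟨n, rfl⟩
    exact ⟨_, _, _, isStar_cubeComplex hp n⟩
  nonempty := ⟨p 0, 0, rfl⟩
  connected := by
    have symm : Std.Symm (fun a b => s(a, b) ∈ (cubeComplex p).edges) :=
      ⟨fun a b h => by rwa [Sym2.eq_swap]⟩
    have all : ∀ n, Relation.ReflTransGen (fun a b => s(a, b) ∈ (cubeComplex p).edges) (p 0) (p n) :=
      lattice_induction .refl fun n hn w hw => hn.tail ⟨n, w, hw, rfl⟩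
    rintro _ ⟨n, rfl⟩ _ ⟨m, rfl⟩
    exact (Relation.ReflTransGen.stdSymm.symm _ _ (all n)).trans (all m)
  facet_connected := by
    rintro _ ⟨n, ν, hν, rfl⟩ x y hx hy
    have symm : Std.Symm (fun a b => ∃ F ∈ cubeFaces p n ν, s(a, b) ∈ F.edges) :=
      ⟨fun a b h => by simpa only [Sym2.eq_swap] using h⟩
    have walk : ∀ x, (∃ F ∈ cubeFaces p n ν, ∃ z, s(x, z) ∈ F.edges) →
        Relation.ReflTransGen (fun a b => ∃ F ∈ cubeFaces p n ν, s(a, b) ∈ F.edges) (p n) x := by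
      rintro x ⟨F, hF, z, hz⟩
      have hv : x ∈ F.verts := by
        obtain ⟨m, w, w', hA, rfl⟩ := hF.1
        exact left_mem_verts_of_ofSeq hz
      obtain ⟨m, w, w', rfl, hA, rfl⟩ := exists_corner hF.1 hv
      have hm := hF.2 m hv
      have b0 : InBox n ν n := fun _ => Or.inl rfl
      -- From `n` to `m` the coordinates are changed one at a time.
      have b1 : InBox n ν ![m 0, n 1, n 2] := fun i => by
        fin_cases i
        · exact hm 0
        · exact Or.inl rfl
        · exact Or.inl rfl
      have b2 : InBox n ν ![m 0, m 1, n 2] := fun i => by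
        fin_cases i
        · exact hm 0
        · exact hm 1
        · exact Or.inl rfl
      refine ((cube_step hp hν b0 b1 (i := 0) fun j hj => ?_).trans
        (cube_step hp hν b1 b2 (i := 1) fun j hj => ?_)).trans
        (cube_step hp hν b2 hm (i := 2) fun j hj => ?_)
      all_goals fin_cases j <;> first | rfl | exact absurd rfl hj
    exact (Relation.ReflTransGen.stdSymm.symm _ _ (walk x hx)).trans (walk y hy)

end IntPolyhedron

end


/-! ### Symmetries of the cubical complex, and comparison with the standard tessellation. -/

noncomputable section

namespace IntPolyhedron

variable {p : Z3 → E3} {g : E3 ≃ᵢ E3} {t : Z3} {l : List (Fin 3)}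

theorem InBox.word {n ν m : Z3} (h : InBox n ν m) (l : List (Fin 3)) :
    InBox (octa.word l n) (octa.word l ν) (octa.word l m) := by
  induction l with
  | nil => exact h
  | cons i l ih =>
    intro j
    simp only [IntPolyhedron.word, SignedPerm.act]
    rcases ih ((octa.gen i).perm j) with e | e
    · exact Or.inl (by rw [e])
    · exact Or.inr (by rw [e, mul_add])

theorem InBox.add {n ν m : Z3} (h : InBox n ν m) (t : Z3) : InBox (t + n) ν (t + m) := by
  intro j
  simp only [Pi.add_apply]
  rcases h j with e | e
  · exact Or.inl (by rw [e])
  · exact Or.inr (by rw [e, add_assoc])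

theorem map_square (h : ∀ m, g (p m) = p (t + octa.word l m)) (n w w' : Z3) :
    (square p n w w').map g = square p (t + octa.word l n) (octa.word l w) (octa.word l w') := by
  rw [square, Figure.map_ofSeq, square]
  congr 1
  funext i
  rw [Function.comp_apply, h]
  congr 1
  fin_cases i <;> simp [squareSeq, word_add, add_assoc]

theorem map_mem_squareFaces (h : ∀ m, g (p m) = p (t + octa.word l m)) {F : Figure}
    (hF : F ∈ squareFaces p) : F.map g ∈ squareFaces p := by
  obtain ⟨n, w, w', hA, rfl⟩ := hF
  rw [map_square h]
  exact ⟨_, _, _, word_adj octa_isRegular l hA, rfl⟩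

theorem map_mem_cubeFaces (hp : Function.Injective p) (h : ∀ m, g (p m) = p (t + octa.word l m))
    {F : Figure} {n ν : Z3} (hF : F ∈ cubeFaces p n ν) :
    F.map g ∈ cubeFaces p (t + octa.word l n) (octa.word l ν) := by
  refine ⟨map_mem_squareFaces h hF.1, ?_⟩
  rintro m ⟨x, hx, hm⟩
  obtain ⟨m', -, -, rfl, -⟩ := exists_corner hF.1 hx
  rw [h] at hm
  rw [← hp hm]
  exact ((hF.2 m' hx).word l).add t

theorem inv_apply_word (h : ∀ m, g (p m) = p (t + octa.word l m)) (m : Z3) :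
    g⁻¹ (p m) = p (-octa.word l.reverse t + octa.word l.reverse m) := by
  have e : t + octa.word l (-octa.word l.reverse t + octa.word l.reverse m) = m := by
    have := map_neg (octa.wordHom l) (octa.word l.reverse t)
    change octa.word l (-octa.word l.reverse t) = -octa.word l (octa.word l.reverse t) at this
    rw [word_add, this, word_reverse octa_isRegular, word_reverse octa_isRegular,
      add_neg_cancel_left]
  conv_lhs => rw [← e, ← h]
  exact isometryEquiv_inv_apply_self _ _

theorem image_cubeFaces (hp : Function.Injective p) (h : ∀ m, g (p m) = p (t + octa.word l m))
    (n ν : Z3) :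
    Figure.map g '' cubeFaces p n ν = cubeFaces p (t + octa.word l n) (octa.word l ν) := by
  ext F
  constructor
  · rintro ⟨F, hF, rfl⟩
    exact map_mem_cubeFaces hp h hF
  · intro hF
    refine ⟨F.map ⇑g⁻¹, ?_, Figure.map_map_inv F g⟩
    have rev : ∀ x, octa.word l.reverse (octa.word l x) = x := fun x => by
      have := word_reverse octa_isRegular l.reverse x
      rwa [List.reverse_reverse] at this
    have := map_mem_cubeFaces hp (inv_apply_word h) hF
    rwa [word_add, rev, rev, neg_add_cancel_left] at this

theorem mem_automorphisms_cubeComplex (hp : Function.Injective p)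
    (h : ∀ m, g (p m) = p (t + octa.word l m)) : g ∈ (cubeComplex p).automorphisms := by
  have key : ∀ (g : E3 ≃ᵢ E3) (t : Z3) (l : List (Fin 3)),
      (∀ m, g (p m) = p (t + octa.word l m)) → (∀ x ∈ (cubeComplex p).verts,
        g x ∈ (cubeComplex p).verts) ∧
      (∀ e ∈ (cubeComplex p).edges, Sym2.map g e ∈ (cubeComplex p).edges) ∧
      (∀ F ∈ (cubeComplex p).faces, F.map g ∈ (cubeComplex p).faces) ∧
      ∀ C ∈ (cubeComplex p).facets, Figure.map g '' C ∈ (cubeComplex p).facets := by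
    intro g t l h
    refine ⟨?_, ?_, fun F hF => map_mem_squareFaces h hF, ?_⟩
    · rintro _ ⟨n, rfl⟩
      exact ⟨_, (h n).symm⟩
    · rintro _ ⟨n, w, hw, rfl⟩
      refine ⟨t + octa.word l n, _, word_mem_nodes octa_isRegular l hw, ?_⟩
      rw [Sym2.map_mk, h, h, word_add, ← add_assoc]
    · rintro _ ⟨n, ν, hν, rfl⟩
      exact ⟨_, _, word_mem_normals octa_isRegular l hν, image_cubeFaces hp h n ν⟩
  refine Complex3.mem_automorphisms_of_mapsTo fun g' hg' => ?_
  rcases hg' with rfl | rfl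
  · exact key _ _ _ h
  · exact key _ _ _ (inv_apply_word h)

/-- A flag consists of a vertex and a flag of the octahedron; translations move the vertex and words
in the generators move the octahedral flag. -/
theorem exists_map_flag_cubeComplex (hp : Function.Injective p)
    (hg : ∀ t l, ∃ g : E3 ≃ᵢ E3, ∀ m, g (p m) = p (t + octa.word l m))
    {v : E3} {e : Sym2 E3} {F : Figure} {C : Set Figure} (hf : (cubeComplex p).IsFlag v e F C) :
    ∃ g ∈ (cubeComplex p).automorphisms, g (p 0) = v ∧ Sym2.map g s(p 0, p octa.node₀) = e ∧
      (square p 0 octa.node₀ octa.node₁).map g = F ∧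
      Figure.map g '' cubeFaces p 0 octa.normal₀ = C := by
  obtain ⟨⟨n, rfl⟩, -, hF, hC, hve, heF, hFC⟩ := hf
  obtain ⟨y, rfl⟩ := Sym2.mem_iff_exists.1 hve
  have hs := isStar_cubeComplex hp n
  obtain ⟨ν, hν, rfl⟩ := hs.facet_eq C hC F hFC y heF
  obtain ⟨w, w', hA, rfl, rfl⟩ := hs.face_at hF heF
  obtain ⟨h1, h2⟩ := (hs.fc_mem_ct w w' hA ν hν).1 hFC
  obtain ⟨l, rfl, rfl, rfl⟩ := exists_word_flag octa_isRegular hA hν h1 h2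
  obtain ⟨g, hg⟩ := hg n l
  have h0 : octa.word l 0 = 0 := map_zero (octa.wordHom l)
  refine ⟨g, mem_automorphisms_cubeComplex hp hg, ?_, ?_, ?_, ?_⟩
  · rw [hg, h0, add_zero]
  · rw [Sym2.map_mk, hg, hg, h0, add_zero]
  · rw [map_square hg, h0, add_zero]
  · rw [image_cubeFaces hp hg, h0, add_zero]

theorem exists_isometry_word (l : List (Fin 3)) :
    ∃ g : E3 ≃ᵢ E3, ∀ m, g (intPoint m) = intPoint (octa.word l m) := by
  induction l with
  | nil => exact ⟨1, fun _ => rfl⟩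
  | cons i l ih =>
    obtain ⟨g, hg⟩ := ih
    refine ⟨(octa.gen i).toLinearIsometryEquiv.toIsometryEquiv * g, fun m => ?_⟩
    rw [isometryEquiv_mul_apply, hg]
    exact SignedPerm.toLinearIsometryEquiv_intPoint _ _

theorem exists_isometry_affine_word {f : E3 ≃ᵈ E3} (hf : ∀ n, f (intPoint n) = p n) (t : Z3)
    (l : List (Fin 3)) : ∃ g : E3 ≃ᵢ E3, ∀ m, g (p m) = p (t + octa.word l m) := by
  obtain ⟨g, hg⟩ := exists_isometry_word l
  refine ⟨f.conjIsometry (translation (intPoint t) * g), fun m => ?_⟩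
  rw [← hf, f.conjIsometry_apply, isometryEquiv_mul_apply, hg, translation_apply, ← intPoint_add,
    hf, add_comm]

theorem cubeComplex_isRegularApeirotope {f : E3 ≃ᵈ E3} (hf : ∀ n, f (intPoint n) = p n)
    (hK : (cubeComplex p).twoSkeleton.IsPolygonalComplex) :
    (cubeComplex p).IsRegularApeirotope := by
  have hp : Function.Injective p := by
    rw [show p = fun n => f (intPoint n) from funext fun n => (hf n).symm]
    exact f.injective.comp intPoint_injective
  exact
    { edge_nondegenerate := hK.edge_nondegenerate
      edge_verts := hK.edge_verts
      face_polygon := hK.face_polygon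
      face_verts := hK.face_verts
      face_edges := hK.face_edges
      facet_faces := (cubeComplex_isLocallyPolyhedral hp).facet_faces
      polytope := (cubeComplex_isLocallyPolyhedral hp).isAbstractPolytope octa_isRegular
      infinite := Set.infinite_range_of_injective hp
      discrete := hK.discrete
      flag_transitive := fun _ _ _ _ _ _ _ _ h h' =>
        Complex3.flag_transitive_of_base
          (exists_map_flag_cubeComplex hp (exists_isometry_affine_word hf)) h h' }

theorem octa_adj_single : ∀ i j : Fin 3, octa.Adj (Pi.single i 1) (Pi.single j 1) ↔ i ≠ j := by
  decide

/-- A negative edge vector becomes positive when the square is described from the other end of that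
edge. -/
theorem square_eq_single {n w w' : Z3} (hA : octa.Adj w w') : ∃ c i j, i ≠ j ∧
    ∀ p, square p n w w' = square p c (Pi.single i 1) (Pi.single j 1) := by
  have left : ∀ {n w w'}, octa.Adj w w' → ∃ c i, octa.Adj (Pi.single i 1) w' ∧
      ∀ p, square p n w w' = square p c (Pi.single i 1) w' := by
    intro n w w' hA
    obtain ⟨i, rfl | rfl⟩ := octa_nodes_eq_single w hA.1
    · exact ⟨n, i, hA, fun _ => rfl⟩
    · have e : -(Pi.single i (-1) : Z3) = Pi.single i 1 := by rw [← Pi.single_neg, neg_neg]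
      refine ⟨n + Pi.single i (-1), i, ?_, fun p => ?_⟩
      · rw [← e]
        exact octa_adj_neg _ hA.1 _ hA.2.1 hA
      · rw [← e]
        exact square_neg _ _ _ _
  obtain ⟨c, i, h1, e1⟩ := left (n := n) hA
  obtain ⟨c', j, h2, e2⟩ := left (n := c) h1.symm
  refine ⟨c', i, j, (octa_adj_single i j).1 h2.symm, fun p => ?_⟩
  rw [e1, square_comm, e2, square_comm]

theorem map_unitSquare {f : E3 → E3} (hf : ∀ n, f (intPoint n) = p n) (c : Z3) (i j : Fin 3) :
    (unitSquare c i j).map f = square p c (Pi.single i 1) (Pi.single j 1) := by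
  rw [unitSquare, Figure.map_ofSeq, square]
  have : (f ∘ ![intPoint c, intPoint (c + Pi.single i 1),
      intPoint (c + Pi.single i 1 + Pi.single j 1), intPoint (c + Pi.single j 1)] : Fin 4 → E3) =
      fun k : Fin 4 => p (squareSeq c (Pi.single i 1) (Pi.single j 1) k) := by
    funext k
    fin_cases k <;> exact hf _
  rw [this]
  rfl

theorem mem_squareFaces_iff {f : E3 → E3} (hf : ∀ n, f (intPoint n) = p n) {F : Figure} :
    F ∈ squareFaces p ↔ ∃ c i j, i ≠ j ∧ F = (unitSquare c i j).map f := by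
  constructor
  · rintro ⟨n, w, w', hA, rfl⟩
    obtain ⟨c, i, j, hij, e⟩ := square_eq_single (n := n) hA
    exact ⟨c, i, j, hij, by rw [e, map_unitSquare hf]⟩
  · rintro ⟨c, i, j, hij, rfl⟩
    exact ⟨c, _, _, (octa_adj_single i j).2 hij, map_unitSquare hf c i j⟩

theorem exists_intPoint_of_mem_unitSquare {c : Z3} {i j : Fin 3} {x : E3}
    (hx : x ∈ (unitSquare c i j).verts) : ∃ b, x = intPoint b := by
  obtain ⟨k, rfl⟩ := hx
  fin_cases k <;> exact ⟨_, rfl⟩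

theorem image_unitCubeFaces {f : E3 → E3} (hf : ∀ n, f (intPoint n) = p n)
    (hp : Function.Injective p) (c : Z3) :
    Figure.map f '' unitCubeFaces c = cubeFaces p c ![1, 1, 1] := by
  have h1 : ∀ k, (![1, 1, 1] : Z3) k = 1 := by decide
  ext F
  constructor
  · rintro ⟨_, ⟨⟨a, i, j, hij, rfl⟩, h⟩, rfl⟩
    refine ⟨(mem_squareFaces_iff hf).2 ⟨a, i, j, hij, rfl⟩, ?_⟩
    rintro m ⟨x, hx, hm⟩
    obtain ⟨b, hb, rfl⟩ := h hx
    rw [hf] at hm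
    rw [← hp hm]
    intro k
    rw [h1]
    exact hb k
  · rintro ⟨hF, h⟩
    obtain ⟨a, i, j, hij, rfl⟩ := (mem_squareFaces_iff hf).1 hF
    refine ⟨_, ⟨⟨a, i, j, hij, rfl⟩, fun x hx => ?_⟩, rfl⟩
    obtain ⟨b, rfl⟩ := exists_intPoint_of_mem_unitSquare hx
    refine ⟨b, fun k => ?_, rfl⟩
    have := h b ⟨_, hx, hf b⟩ k
    rwa [h1] at this

/-- The cube is described from its smallest corner. -/
theorem exists_cubeFaces_eq_one {n ν : Z3} (hν : ν ∈ octa.normals) :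
    ∃ c, ∀ p, cubeFaces p n ν = cubeFaces p c ![1, 1, 1] := by
  have h1 : ∀ k, (![1, 1, 1] : Z3) k = 1 := by decide
  refine ⟨fun i => if ν i = 1 then n i else n i - 1, fun p => ?_⟩
  ext F
  refine and_congr_right fun _ => forall_congr' fun x => imp_congr_right fun _ =>
    forall_congr' fun i => ?_
  rw [h1]
  dsimp only
  rcases octa_normals_apply ν hν i with e | e
  · rw [if_pos e, e]
  · rw [if_neg (by omega)]
    omega

theorem cubeComplex_eq_map {f : E3 ≃ᵈ E3} (hf : ∀ n, f (intPoint n) = p n) :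
    cubeComplex p = cubicalTessellation.map f := by
  have hp : Function.Injective p := by
    rw [show p = fun n => f (intPoint n) from funext fun n => (hf n).symm]
    exact f.injective.comp intPoint_injective
  ext x
  · constructor
    · rintro ⟨n, rfl⟩
      exact ⟨_, ⟨n, rfl⟩, hf n⟩
    · rintro ⟨_, ⟨n, rfl⟩, rfl⟩
      exact ⟨n, (hf n).symm⟩
  · constructor
    · rintro ⟨n, w, hw, rfl⟩
      obtain ⟨i, rfl | rfl⟩ := octa_nodes_eq_single w hw
      · exact ⟨_, ⟨n, i, rfl⟩, by rw [Sym2.map_mk, hf, hf]⟩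
      · refine ⟨_, ⟨n + Pi.single i (-1), i, rfl⟩, ?_⟩
        rw [Sym2.map_mk, hf, hf, add_assoc, ← Pi.single_add, neg_add_cancel, Pi.single_zero,
          add_zero, Sym2.eq_swap]
    · rintro ⟨_, ⟨c, i, rfl⟩, rfl⟩
      exact ⟨c, _, (single_mem_octa_nodes i).1, by rw [Sym2.map_mk, hf, hf]⟩
  · constructor
    · intro hx
      obtain ⟨c, i, j, hij, rfl⟩ := (mem_squareFaces_iff hf).1 hx
      exact ⟨_, ⟨c, i, j, hij, rfl⟩, rfl⟩
    · rintro ⟨_, ⟨c, i, j, hij, rfl⟩, rfl⟩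
      exact (mem_squareFaces_iff hf).2 ⟨c, i, j, hij, rfl⟩
  · constructor
    · rintro ⟨n, ν, hν, rfl⟩
      obtain ⟨c, e⟩ := exists_cubeFaces_eq_one (n := n) hν
      exact ⟨_, ⟨c, rfl⟩, by rw [image_unitCubeFaces hf hp, e]⟩
    · rintro ⟨_, ⟨c, rfl⟩, rfl⟩
      exact ⟨c, _, mem_octa_normals (by decide), image_unitCubeFaces hf hp c⟩

end IntPolyhedron

end


/-! ### Reconstruction of a complex with square faces. -/

noncomputable section

namespace Complex2

open IntPolyhedron

variable {K : Complex2} {v : E3} {κ ℓ : ℝ} {J : E3 ≃ₗᵢ[ℝ] E3}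

/-- At right angles, the edges before and after a given edge are perpendicular to it. The bisector
reflection exchanges them without changing their direction, so opposite edges are parallel and the
face closes up after four steps. -/
theorem HasBisectorReflection.recurrence (hbis : ∀ q, K.IsFaceParam q → K.HasBisectorReflection ℓ q)
    (hpair : ∀ q, K.IsFaceParam q → IsIsoscelesPair ℓ 0 (q 1 - q 0) (q (-1) - q 0)) {q : ℤ → E3}
    (hq : K.IsFaceParam q) (k : ℤ) : q (k + 2) = q (k + 1) + q (k - 1) - q k := by
  obtain ⟨g, -, h1, h2⟩ := hbis _ (hq.shift k)
  have hin := (hpair _ (hq.shift k)).inner_eq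
  have h3 := h2 (q (-1 + k) - q (0 + k))
  have h4 := h1 (-1)
  have h5 := h1 0
  beta_reduce at h3 h4 h5 hin
  rw [mul_zero] at hin
  rw [linearPart_sub, hin, mul_zero, zero_div, zero_smul, sub_zero, h4, h5] at h3
  rw [show (1 : ℤ) - -1 + k = k + 2 by ring, show (1 : ℤ) - 0 + k = k + 1 by ring,
    show -1 + k = k - 1 by ring, zero_add, sub_eq_iff_eq_add] at h3
  rw [h3]
  abel

theorem HasBisectorReflection.periodic (hbis : ∀ q, K.IsFaceParam q → K.HasBisectorReflection ℓ q)
    (hpair : ∀ q, K.IsFaceParam q → IsIsoscelesPair ℓ 0 (q 1 - q 0) (q (-1) - q 0)) {q : ℤ → E3}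
    (hq : K.IsFaceParam q) : Function.Periodic q 4 := by
  intro k
  have h1 := HasBisectorReflection.recurrence hbis hpair hq (k + 1)
  have h2 := HasBisectorReflection.recurrence hbis hpair hq (k + 2)
  rw [show k + 1 + 2 = k + 3 by ring, show k + 1 + 1 = k + 2 by ring, add_sub_cancel_right] at h1
  rw [show k + 2 + 2 = k + 4 by ring, show k + 2 + 1 = k + 3 by ring,
    show k + 2 - 1 = k + 1 by ring, h1] at h2
  rw [h2]
  abel

theorem latticePoint_add (n m : Z3) :
    latticePoint v κ J (n + m) = latticePoint v κ J n + scaledPoint κ J m := by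
  rw [latticePoint, scaledPoint_add, ← add_assoc]; rfl

theorem faceParam_eq_squareSeq (hbis : ∀ q, K.IsFaceParam q → K.HasBisectorReflection ℓ q)
    (hpair : ∀ q, K.IsFaceParam q → IsIsoscelesPair ℓ 0 (q 1 - q 0) (q (-1) - q 0)) {q : ℤ → E3}
    (hq : K.IsFaceParam q) {n w w' : Z3} (h0 : q 0 = latticePoint v κ J n)
    (h1 : q 1 = latticePoint v κ J (n + w)) (h2 : q (-1) = latticePoint v κ J (n + w')) :
    q = fun i : ℤ => latticePoint v κ J (squareSeq n w w' (i : ZMod 4)) := by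
  have hper := HasBisectorReflection.periodic hbis hpair hq
  have h4 : (4 : ZMod 4) = 0 := by decide
  funext i
  have e : i = i % 4 + i / 4 * 4 := by omega
  have e1 : q i = q (i % 4) := by
    conv_lhs => rw [e]
    exact hper.int_mul (i / 4) (i % 4)
  have e2 : (i : ZMod 4) = ((i % 4 : ℤ) : ZMod 4) := by
    conv_lhs => rw [e]
    push_cast
    rw [h4, mul_zero, add_zero]
  rw [e1, e2]
  have hlt : i % 4 < 4 := Int.emod_lt_of_pos _ (by norm_num)
  have hge : 0 ≤ i % 4 := Int.emod_nonneg _ (by norm_num)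
  generalize i % 4 = r at hlt hge
  interval_cases r
  · exact h0
  · exact h1
  · have := HasBisectorReflection.recurrence hbis hpair hq 0
    rw [zero_add, zero_add, zero_sub, h0, h1, h2, latticePoint_add, latticePoint_add] at this
    change q 2 = latticePoint v κ J (n + w + w')
    rw [this, latticePoint_add, latticePoint_add]
    abel
  · have := hper (-1)
    rw [h2] at this
    exact this

/-- The linear part of the bisector reflection of an edge with direction `w`; no denominator is
needed since the nodes of `octa` are unit vectors. -/
def bisectorMap (w x : Z3) : Z3 := x - (2 * idot w x) • w

theorem octa_bisectorMap_adj : ∀ w ∈ octa.nodes, ∀ x ∈ octa.nodes, ∀ y ∈ octa.nodes,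
    octa.Adj x y → octa.Adj (bisectorMap w x) (bisectorMap w y) := by
  decide

theorem octa_bisectorMap_bisectorMap : ∀ w ∈ octa.nodes, ∀ x ∈ octa.nodes,
    bisectorMap w (bisectorMap w x) = x := by
  decide

/-- Induction along the edges: the bisector reflection of an edge carries the arcs at one end to
those at the other, and its linear part preserves the octahedron. -/
theorem arc_latticePoint (hbis : ∀ q, K.IsFaceParam q → K.HasBisectorReflection ℓ q)
    (hκ : κ ≠ 0) (hℓ : ℓ ^ 2 = κ ^ 2)
    (harc : ∀ a b, K.Arc v a b ↔
      ∃ w w', octa.Adj w w' ∧ a = scaledPoint κ J w ∧ b = scaledPoint κ J w') (n : Z3) :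
    ∀ a b, K.Arc (latticePoint v κ J n) a b ↔
      ∃ w w', octa.Adj w w' ∧ a = scaledPoint κ J w ∧ b = scaledPoint κ J w' := by
  refine lattice_induction (φ := fun n => ∀ a b, K.Arc (latticePoint v κ J n) a b ↔
      ∃ w w', octa.Adj w w' ∧ a = scaledPoint κ J w ∧ b = scaledPoint κ J w') ?_ ?_ n
  · rwa [show latticePoint v κ J 0 = v by simp [latticePoint, scaledPoint, intPoint_zero]]
  · intro n ih w hw a b
    obtain ⟨w', -, hA⟩ := octa_isRegular.exists_adj w hw
    obtain ⟨q, hq, h0, h1, -⟩ := (ih _ _).2 ⟨w, w', hA, rfl, rfl⟩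
    obtain ⟨g, hg, hgq, hlin⟩ := hbis q hq
    have hgn : g (latticePoint v κ J n) = latticePoint v κ J (n + w) := by
      have := hgq 0
      rwa [h0, sub_zero, h1, ← latticePoint_add] at this
    have hgx : ∀ x, linearPart g (scaledPoint κ J x) = scaledPoint κ J (bisectorMap w x) := by
      intro x
      rw [hlin, h1, h0, add_sub_cancel_left, inner_scaledPoint, hℓ, bisectorMap, scaledPoint_sub,
        scaledPoint_zsmul]
      congr 2
      push_cast
      field_simp
    rw [← hgn]
    constructor
    · intro h
      obtain ⟨a, rfl⟩ := (linearPart g).surjective a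
      obtain ⟨b, rfl⟩ := (linearPart g).surjective b
      obtain ⟨x, y, hxy, rfl, rfl⟩ := (ih a b).1 ((Arc.map_iff hg).1 h)
      exact ⟨_, _, octa_bisectorMap_adj w hw x hxy.1 y hxy.2.1 hxy, hgx x, hgx y⟩
    · rintro ⟨x, y, hxy, rfl, rfl⟩
      rw [← octa_bisectorMap_bisectorMap w hw x hxy.1,
        ← octa_bisectorMap_bisectorMap w hw y hxy.2.1, ← hgx (bisectorMap w x),
        ← hgx (bisectorMap w y), Arc.map_iff hg, ih]
      exact ⟨_, _, octa_bisectorMap_adj w hw x hxy.1 y hxy.2.1 hxy, rfl, rfl⟩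

/-- A complex whose faces are squares is determined by the arcs at one vertex. -/
theorem twoSkeleton_cubeComplex_eq (hK : K.IsPolygonalComplex)
    (hbis : ∀ q, K.IsFaceParam q → K.HasBisectorReflection ℓ q)
    (hpair : ∀ q, K.IsFaceParam q → IsIsoscelesPair ℓ 0 (q 1 - q 0) (q (-1) - q 0))
    (hv : v ∈ K.verts) (hκ : κ ≠ 0)
    (harc : ∀ a b, K.Arc v a b ↔
      ∃ w w', octa.Adj w w' ∧ a = scaledPoint κ J w ∧ b = scaledPoint κ J w') :
    (cubeComplex (latticePoint v κ J)).twoSkeleton = K := by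
  have hp := latticePoint_injective (v := v) (J := J) hκ
  have hℓ : ℓ ^ 2 = κ ^ 2 := by
    have h1 := (((harc _ _).2 ⟨_, _, octa_isRegular.base_adj, rfl, rfl⟩).isIsoscelesPair hpair).left
    rw [← h1, ← real_inner_self_eq_norm_sq, inner_scaledPoint]
    simp [octa, idot]
  have hat := arc_latticePoint hbis hκ hℓ harc
  have hedge : ∀ n y, s(latticePoint v κ J n, y) ∈ K.edges →
      ∃ w ∈ octa.nodes, y = latticePoint v κ J (n + w) := by
    intro n y hy
    obtain ⟨b, hb⟩ := exists_arc_of_edge hK hy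
    obtain ⟨w, w', hA, e, -⟩ := (hat n _ _).1 hb
    exact ⟨w, hA.1, by rw [latticePoint_add, ← e]; abel⟩
  have hedge' : ∀ n, ∀ w ∈ octa.nodes,
      s(latticePoint v κ J n, latticePoint v κ J (n + w)) ∈ K.edges := by
    intro n w hw
    obtain ⟨w', -, hA⟩ := octa_isRegular.exists_adj w hw
    have := ((hat n _ _).2 ⟨w, w', hA, rfl, rfl⟩).mem_edges hK
    rwa [← latticePoint_add] at this
  have hverts : ∀ x ∈ K.verts, ∃ n, x = latticePoint v κ J n := by
    intro x hx
    have hr := hK.edgeGraph_connected.preconnected ⟨v, hv⟩ ⟨x, hx⟩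
    rw [SimpleGraph.reachable_iff_reflTransGen] at hr
    have key : ∀ y : K.verts, Relation.ReflTransGen K.edgeGraph.Adj ⟨v, hv⟩ y →
        ∃ n, y.1 = latticePoint v κ J n := by
      intro y hy
      induction hy with
      | refl => exact ⟨0, by simp [latticePoint, scaledPoint, intPoint_zero]⟩
      | tail _ hbc ih =>
        obtain ⟨n, e⟩ := ih
        have he := hbc.2
        rw [e] at he
        obtain ⟨w, hw, e'⟩ := hedge n _ he
        exact ⟨_, e'⟩
    exact key _ hr
  ext x
  · constructor
    · rintro ⟨n, rfl⟩
      exact hK.edge_verts _ (hedge' n _ octa_isRegular.base_adj.1) _ (by simp)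
    · intro hx
      obtain ⟨n, rfl⟩ := hverts x hx
      exact ⟨n, rfl⟩
  · constructor
    · rintro ⟨n, w, hw, rfl⟩
      exact hedge' n w hw
    · intro hx
      induction x using Sym2.ind with | _ x y
      obtain ⟨n, rfl⟩ := hverts x (hK.edge_verts _ hx x (by simp))
      obtain ⟨w, hw, rfl⟩ := hedge n y hx
      exact ⟨n, w, hw, rfl⟩
  · constructor
    · rintro ⟨n, w, w', hA, rfl⟩
      obtain ⟨q, hq, h0, h1, h2⟩ := (hat n _ _).2 ⟨w, w', hA, rfl, rfl⟩
      rw [← latticePoint_add] at h1 h2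
      have := hq.mem_faces
      rwa [faceParam_eq_squareSeq hbis hpair hq h0 h1 h2, ← (square_isParam hp hA n).eq] at this
    · intro hx
      obtain ⟨q, hq⟩ := (hK.face_polygon x hx).exists_isParam
      have hq' : K.IsFaceParam q := ⟨x, hx, hq⟩
      obtain ⟨n, h0⟩ := hverts _ (hq'.mem_verts hK 0)
      have ha := hq'.arc
      rw [h0] at ha
      obtain ⟨w, w', hA, h1, h2⟩ := (hat n _ _).1 ha
      rw [sub_eq_iff_eq_add', ← latticePoint_add] at h1 h2
      refine ⟨n, w, w', hA, ?_⟩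
      rw [hq.eq, faceParam_eq_squareSeq hbis hpair hq' h0 h1 h2, ← (square_isParam hp hA n).eq]

end Complex2

end


/-! ### The classification. -/

noncomputable section

namespace Complex2

open IntPolyhedron

variable {K : Complex2} {v : E3}

/-- A complex with point reflections and the local structure of `D` is the `2`-skeleton of an
apeirotope over `D`. -/
theorem exists_apeirotope (hK : K.IsPolygonalComplex)
    (hpt : ∀ q, K.IsFaceParam q → K.HasPointReflection q) (hv : v ∈ K.verts) {D : IntPolyhedron}
    (hD : D.IsRegular) (hflat : D.HasFlatSlabs) {k : ℕ} {d : ℝ} {u : ZMod k → Z3}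
    (hu : D.IsBaseCycle k d u) (hm : LocalData.HasModel (K.Arc v) D) :
    ∃ P : Complex3, P.IsRegularApeirotope ∧ P.twoSkeleton = K ∧ (∀ F ∈ K.faces, F.IsZigzag) ∧
      P.IsApeirOfSimilar (polyhedronOf k (intPoint '' {w | w ∈ D.nodes}) d) := by
  obtain ⟨κ, J, hκ, harc⟩ := hm
  have hK' := twoSkeleton_apeirotope_eq hK hpt hv hD harc
  obtain ⟨R₀, R₁, R₂, R₃, hR, hsim⟩ := isApeirOfSimilar hD hflat hu v hκ.ne' J
  refine ⟨_, isRegularApeirotope hD hflat (latticePoint_injective hκ.ne') (by rwa [hK']) hR, hK',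
    fun F hF => ?_, hsim⟩
  rw [← hK'] at hF
  obtain ⟨n, ε, w, w', hn, hA, rfl⟩ := hF
  exact isZigzag_zigzag hD hκ.ne' hn hA

/-- A complex with bisector reflections and the local structure of the octahedron is the
`2`-skeleton of a cubical tessellation. -/
theorem exists_cubicalTessellation (hK : K.IsPolygonalComplex) {ℓ : ℝ}
    (hbis : ∀ q, K.IsFaceParam q → K.HasBisectorReflection ℓ q)
    (hpair : ∀ q, K.IsFaceParam q → IsIsoscelesPair ℓ 0 (q 1 - q 0) (q (-1) - q 0))
    (hv : v ∈ K.verts) (hm : LocalData.HasModel (K.Arc v) octa) :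
    ∃ P : Complex3, P.IsRegularApeirotope ∧ P.twoSkeleton = K ∧
      (∀ F ∈ K.faces, F.IsFinitePolygon) ∧ P.IsCubicalTessellation := by
  obtain ⟨κ, J, hκ, harc⟩ := hm
  have hK' := twoSkeleton_cubeComplex_eq hK hbis hpair hv hκ.ne' harc
  have hf := similarity_intPoint v hκ.ne' J
  refine ⟨_, cubeComplex_isRegularApeirotope hf (by rwa [hK']), hK', fun F hF => ?_,
    _, cubeComplex_eq_map hf⟩
  rw [← hK'] at hF
  obtain ⟨n, w, w', hA, rfl⟩ := hF
  exact square_isFinitePolygon (latticePoint_injective hκ.ne') hA n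

end Complex2

open Complex2 IntPolyhedron LocalData in
theorem mainTheorem2 (K : Complex2) (hK : K.IsPolygonalComplex) (hreg : K.IsRegular)
    (v : E3) (e : Sym2 E3) (F : Figure) (hflag : K.IsFlag v e F)
    (hstab : K.FlagStabilizerNontrivial v e F) :
    ∃ P : Complex3, P.IsRegularApeirotope ∧ P.twoSkeleton = K ∧
      (((∀ F' ∈ K.faces, F'.IsFinitePolygon) ∧ P.IsCubicalTessellation) ∨
        ((∀ F' ∈ K.faces, F'.IsZigzag) ∧
          (P.IsApeirOfSimilar tetrahedron ∨ P.IsApeirOfSimilar octahedron ∨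
            P.IsApeirOfSimilar cube))) := by
  obtain ⟨q₀, hq₀, -, -, -⟩ := exists_isFaceParam_of_flag hK hflag
  obtain ⟨ℓ, c, hpair⟩ := exists_isIsoscelesPair hK hreg hq₀
  have hmir := hasMirrors hK hreg hflag hstab
  have hloc := localData hK hreg hmir hpair hflag hstab
  have hv := hflag.1
  rcases pointReflection_or_bisectorReflection hK hreg hmir hq₀ (hpair q₀ hq₀) with h | h
  -- Point reflections: integral traces leave the octahedron, the cube and the tetrahedron for the
  -- edge vectors.
  · have hpt : ∀ q, K.IsFaceParam q → K.HasPointReflection q := fun q hq =>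
      h.of_arc hK hreg hq₀ hq
    rcases hloc.neighbourRule_of_int fun L hL => exists_int_trace hK hpt hloc hv hL with
      ⟨hr, hc⟩ | ⟨hr, hc | hc⟩
    · obtain ⟨P, h1, h2, h3, h4⟩ := exists_apeirotope hK hpt hv octa_isRegular octa_hasFlatSlabs
        octaCycle_isBaseCycle (hasModel_octa hloc hr hc)
      rw [← octahedron_eq] at h4
      exact ⟨P, h1, h2, Or.inr ⟨h3, Or.inr (Or.inl h4)⟩⟩
    · obtain ⟨P, h1, h2, h3, h4⟩ := exists_apeirotope hK hpt hv hexa_isRegular hexa_hasFlatSlabs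
        hexaCycle_isBaseCycle (hasModel_of_hasTriangularLinks hloc hexa_isRegular rfl
          hexa_hasTriangularLinks hr (by rw [hc, show hexa.adj = 1 from rfl]; norm_num))
      rw [← cube_eq] at h4
      exact ⟨P, h1, h2, Or.inr ⟨h3, Or.inr (Or.inr h4)⟩⟩
    · obtain ⟨P, h1, h2, h3, h4⟩ := exists_apeirotope hK hpt hv tetra_isRegular tetra_hasFlatSlabs
        tetraCycle_isBaseCycle (hasModel_of_hasTriangularLinks hloc tetra_isRegular rfl
          tetra_hasTriangularLinks hr (by rw [hc, show tetra.adj = -1 from rfl]; norm_num))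
      rw [← tetrahedron_eq] at h4
      exact ⟨P, h1, h2, Or.inr ⟨h3, Or.inl h4⟩⟩
  -- Bisector reflections: the bounded faces close up, and integrality leaves right angles and four
  -- neighbours.
  · have hbis : ∀ q, K.IsFaceParam q → K.HasBisectorReflection ℓ q := fun q hq =>
      h.of_arc hK hreg hq₀ hq
    obtain ⟨l, n, hn, hl, hre⟩ := exists_root_of_unity hK hpair hbis hq₀
    obtain ⟨hr, rfl⟩ := hloc.neighbourRule_of_isIntegral (fun L hL => hloc.isIntegral_trace hL)
      hn hl hre
    obtain ⟨P, h1, h2, h3, h4⟩ := exists_cubicalTessellation hK hbis hpair hv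
      (hasModel_octa hloc hr rfl)
    exact ⟨P, h1, h2, Or.inl ⟨h3, h4⟩⟩

end
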